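/- **Setting.** Let $N\ge 0$ and $\lambda_1,\dots,\lambda_N\in\mathbb Z_{\ge 0}$. Let $V_{\lambda}$ be the irreducible $\mathfrak{sl}_2$-module of highest weight $\lambda$ with highest weight vector $v_\lambda$, and $|0\rangle=v_{\lambda_1}\otimes\dots\otimes v_{\lambda_N}\in V:=\bigotimes_{i=1}^N V_{\lambda_i}$. For pairwise distinct $z_1,\dots,z_N\in\mathbb C$ the Gaudin Hamiltonians on $V$ are $$H_i=\sum_{j\ne i}\frac{e^{(i)}f^{(j)}+f^{(i)}e^{(j)}+\frac12h^{(i)}h^{(j)}}{z_i-z_j},$$ where $a^{(i)}$ is $a\in\mathfrak{sl}_2$ acting on the $i$-th factor. Put $f(w)=\sum_i f^{(i)}/(w-z_i)$. For $\mu\in\mathbb C^N$ let $$q_\mu(t)=\sum_{i=1}^N\frac{\lambda_i(\lambda_i+2)/4}{(t-z_i)^2}+\sum_{i=1}^N\frac{\mu_i}{t-z_i}.$$ Call $w=(w_1,\dots,w_m)\in\mathbb C^m$ ($m\ge 0$) *admissible* if the $w_j$ are pairwise distinct and different from all $z_i$; the *Bethe equations* for $w$ are $$\sum_{i=1}^N\frac{\lambda_i}{w_j-z_i}-\sum_{s\ne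 j}\frac{2}{w_j-w_s}=0,\qquad j=1,\dots,m,$$ and we put $$\chi_w(t)=\sum_i\frac{\lambda_i}{t-z_i}-\sum_j\frac{2}{t-w_j},\qquad \phi_w(t)=\prod_i(t-z_i)^{-\lambda_i/2}\prod_j(t-w_j).$$ **Theorem.** (I) Let $z_1,\dots,z_N$ be any pairwise distinct complex numbers. 1. If $\sum_i\mu_i=0$, the following are equivalent: (a) the monodromy representation $\pi_1(\mathbb P^1\setminus\{z_1,\dots,z_N,\infty\})\to PGL_2$ of the oper $\partial_t^2-q_\mu(t)$ is trivial; (b) analytic continuation along each loop multiplies all solutions of $\phi''=q_\mu\phi$ by $1$, or all of them by $-1$; (c) for some $m$ there is an admissible $w=(w_1,\dots,w_m)$ that satisfies the Bethe equations and $q_\mu=\frac14\chi_w^2-\frac12\chi_w'$; (d) for some $m$ there are $w_1,\dots,w_m\in\mathbb C\setminus\{z_1,\dots,z_N\}$ such that every branch of $\phi_w$ is a solution of $\phi''=q_\mu\phi$. 2. Let $w$ be admissible. Then $w$ satisfies the Bethe equations if and only if $\frac14\chi_w^2-\frac12\chi_w'=q_\mu$ for some $\mu$ with $\sum_i\mu_i=0$;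 and, for every $\mu$, $q_\mu=\frac14\chi_w^2-\frac12\chi_w'$ if and only if $\phi_w$ is a solution of $\phi''=q_\mu\phi$. If the Bethe equations and $q_\mu=\frac14\chi_w^2-\frac12\chi_w'$ hold, then $\Psi=f(w_1)\cdots f(w_m)|0\rangle$ (which may be zero) satisfies $H_i\Psi=\mu_i\Psi$ for all $i$, $e\Psi=0$ and $h\Psi=(\sum_i\lambda_i-2m)\Psi$. 3. If there is a nonzero $v\in V$ with $H_iv=\mu_iv$ for all $i$, then $\sum_i\mu_i=0$ and the monodromy representation of $\partial_t^2-q_\mu(t)$ in $PGL_2$ is trivial (so (a)–(d) hold). (II) (Completeness for generic $z$.) There is a nonzero polynomial $P\in\mathbb C[x_1,\dots,x_N]$, depending only on $\lambda_1,\dots,\lambda_N$, such that for all pairwise distinct $z_1,\dots,z_N$ with $P(z_1,\dots,z_N)\ne 0$: 1. every highest weight vector $v\in V$, of weight $\kappa$, that is a joint eigenvector of the $H_i$ with eigenvalues $\mu_i$ is a nonzero multiple of a Bethe vector $f(w_1)\cdots f(w_m)|0\rangle$, where $2m\le\sum_i\lambda_i$, $\kappa=\sum_i\lambda_i-2m$,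 and $w$ is admissible, satisfies the Bethe equations and has $q_\mu=\frac14\chi_w^2-\frac12\chi_w'$; 2. the Bethe vectors of admissible solutions $w$ of the Bethe equations with $2m\le\sum_i\lambda_i$, one for each unordered solution $\{w_1,\dots,w_m\}$, are linearly independent; 3. these Bethe vectors span the space $\{v\in V: ev=0\}$. -/

import Mathlib

open scoped TensorProduct Topology BigOperators

noncomputable section

namespace Gaudin

/-! ### The space of states and the Gaudin Hamiltonians -/

/-- The irreducible `sl₂`-module `V_n` of highest weight `n`, with basis `v_0, …, v_n`
(`v_b` is the `b`-th standard basis vector). -/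
abbrev V (n : ℕ) : Type := Fin (n + 1) → ℂ

/-- `e v_b = b (n - b + 1) v_{b-1}`. -/
def repE (n : ℕ) : Module.End ℂ (V n) :=
  Matrix.toLin' (Matrix.of fun a b : Fin (n + 1) =>
    if (a : ℕ) + 1 = (b : ℕ) then ((b : ℕ) : ℂ) * ((n : ℂ) - ((b : ℕ) : ℂ) + 1) else 0)

/-- `f v_b = v_{b+1}`, and `f v_n = 0`. -/
def repF (n : ℕ) : Module.End ℂ (V n) :=
  Matrix.toLin' (Matrix.of fun a b : Fin (n + 1) => if (a : ℕ) = (b : ℕ) + 1 then 1 else 0)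

/-- `h v_b = (n - 2 b) v_b`. -/
def repH (n : ℕ) : Module.End ℂ (V n) :=
  Matrix.toLin' (Matrix.diagonal fun b : Fin (n + 1) => (n : ℂ) - 2 * ((b : ℕ) : ℂ))

variable {N : ℕ}

/-- The space of states `V_{λ_1} ⊗ … ⊗ V_{λ_N}`. -/
abbrev States (lam : Fin N → ℕ) : Type := ⨂[ℂ] i, V (lam i)

/-- The operator `a^{(i)} = 1 ⊗ … ⊗ a ⊗ … ⊗ 1`, with `a` in the `i`-th place. -/
def site (lam : Fin N → ℕ) (a : (n : ℕ) → Module.End ℂ (V n)) (i : Fin N) :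
    Module.End ℂ (States lam) :=
  PiTensorProduct.map (Function.update (fun _ => LinearMap.id) i (a (lam i)))

/-- The diagonal action of an element of `sl₂` on the space of states. -/
def diagonalAction (lam : Fin N → ℕ) (a : (n : ℕ) → Module.End ℂ (V n)) :
    Module.End ℂ (States lam) :=
  ∑ i, site lam a i

/-- The Gaudin Hamiltonian
`H_i = ∑_{j ≠ i} (e^{(i)} f^{(j)} + f^{(i)} e^{(j)} + ½ h^{(i)} h^{(j)}) / (z_i - z_j)`. -/
def hamiltonian (lam : Fin N → ℕ) (z : Fin N → ℂ) (i : Fin N) : Module.End ℂ (States lam) :=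
  ∑ j ∈ Finset.univ.erase i, (z i - z j)⁻¹ •
    (site lam repE i * site lam repF j + site lam repF i * site lam repE j
      + (1 / 2 : ℂ) • (site lam repH i * site lam repH j))

/-- `v` is a simultaneous eigenvector of the Gaudin Hamiltonians, `H_i v = μ_i v`. -/
def IsGaudinEigenvector (lam : Fin N → ℕ) (z μ : Fin N → ℂ) (v : States lam) : Prop :=
  v ≠ 0 ∧ ∀ i, hamiltonian lam z i v = μ i • v

/-- `v` is a highest weight vector of weight `κ` for the diagonal action of `sl₂`. -/
def IsHighestWeightVector (lam : Fin N → ℕ) (κ : ℂ) (v : States lam) : Prop :=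
  v ≠ 0 ∧ diagonalAction lam repE v = 0 ∧ diagonalAction lam repH v = κ • v

/-! ### Bethe vectors and the Bethe ansatz equations -/

/-- The vector `|0⟩ = v_{λ_1} ⊗ … ⊗ v_{λ_N}`. -/
def vacuum (lam : Fin N → ℕ) : States lam :=
  PiTensorProduct.tprod ℂ fun i => (Pi.single 0 1 : V (lam i))

/-- `f(w) = ∑_i f^{(i)} / (w - z_i)`. -/
def fOp (lam : Fin N → ℕ) (z : Fin N → ℂ) (w : ℂ) : Module.End ℂ (States lam) :=
  ∑ i, (w - z i)⁻¹ • site lam repF i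

/-- The Bethe vector `f(w_1) ⋯ f(w_m) |0⟩`. -/
def betheVector (lam : Fin N → ℕ) (z : Fin N → ℂ) {m : ℕ} (w : Fin m → ℂ) : States lam :=
  (List.ofFn fun j => fOp lam z (w j)).prod (vacuum lam)

/-- The points `w_j` are pairwise distinct and different from all `z_i`. -/
def IsAdmissible (z : Fin N → ℂ) {m : ℕ} (w : Fin m → ℂ) : Prop :=
  Function.Injective w ∧ ∀ j i, w j ≠ z i

/-- The Bethe ansatz equations. -/
def BetheEquations (lam : Fin N → ℕ) (z : Fin N → ℂ) {m : ℕ} (w : Fin m → ℂ) : Prop :=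
  ∀ j, ∑ i, (lam i : ℂ) / (w j - z i) - ∑ s ∈ Finset.univ.erase j, 2 / (w j - w s) = 0

/-! ### The oper, its Miura form and its monodromy -/

/-- `q(t) = ∑_i (λ_i (λ_i + 2) / 4) / (t - z_i)² + ∑_i μ_i / (t - z_i)`. -/
def potential (lam : Fin N → ℕ) (z μ : Fin N → ℂ) (t : ℂ) : ℂ :=
  ∑ i, ((lam i : ℂ) * ((lam i : ℂ) + 2) / 4) / (t - z i) ^ 2 + ∑ i, μ i / (t - z i)

/-- `χ(t) = ∑_i λ_i / (t - z_i) - ∑_j 2 / (t - w_j)`. -/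
def chi (lam : Fin N → ℕ) (z : Fin N → ℂ) {m : ℕ} (w : Fin m → ℂ) (t : ℂ) : ℂ :=
  ∑ i, (lam i : ℂ) / (t - z i) - ∑ j, 2 / (t - w j)

/-- `q = χ² / 4 - χ' / 2` away from the points `z_i` and `w_j`. -/
def MiuraForm (lam : Fin N → ℕ) (z μ : Fin N → ℂ) {m : ℕ} (w : Fin m → ℂ) : Prop :=
  ∀ t : ℂ, (∀ i, t ≠ z i) → (∀ j, t ≠ w j) →
    potential lam z μ t = chi lam z w t ^ 2 / 4 - deriv (chi lam z w) t / 2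

/-- `φ` is a holomorphic solution of `φ'' = q φ` in a neighbourhood of `t₀`. -/
def IsSolutionAt (q φ : ℂ → ℂ) (t₀ : ℂ) : Prop :=
  AnalyticAt ℂ φ t₀ ∧ ∀ᶠ t in 𝓝 t₀, deriv (deriv φ) t = q t * φ t

/-- The multivalued function `∏_i (t - z_i)^{-λ_i/2} ∏_j (t - w_j)` solves `φ'' = q φ` on
`ℂ ∖ {z_1, …, z_N}`: each of its local holomorphic branches, which are
`∏_j (t - w_j) / r(t)` with `r` a holomorphic square root of `∏_i (t - z_i)^{λ_i}`, does. -/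
def BetheFunctionSolves (lam : Fin N → ℕ) (z μ : Fin N → ℂ) {m : ℕ} (w : Fin m → ℂ) : Prop :=
  ∀ t₀ : ℂ, (∀ i, t₀ ≠ z i) → ∀ r : ℂ → ℂ, AnalyticAt ℂ r t₀ →
    (∀ᶠ t in 𝓝 t₀, r t ^ 2 = ∏ i, (t - z i) ^ lam i) →
      IsSolutionAt (potential lam z μ) (fun t => (∏ j, (t - w j)) / r t) t₀

/-- `F` is an analytic continuation along `γ` of the germ `F 0` at `x` through solutions of
`φ'' = q φ`: each `F s` is a solution near `γ s`, and for `s'` near `s` the germ of `F s'`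
at `γ s'` is the germ of `F s`. -/
structure IsContinuation (q : ℂ → ℂ) {x y : ℂ} (γ : Path x y) (F : unitInterval → ℂ → ℂ) :
    Prop where
  solution : ∀ s, IsSolutionAt q (F s) (γ s)
  coherent : ∀ s, ∀ᶠ s' in 𝓝 s, F s' =ᶠ[𝓝 (γ s')] F s

/-- Analytic continuation along the loop `γ` multiplies every solution of `φ'' = q φ` near
the base point by the scalar `c`. -/
def HasScalarMonodromy (q : ℂ → ℂ) {x : ℂ} (γ : Path x x) (c : ℂ) : Prop :=
  ∀ F : unitInterval → ℂ → ℂ, IsContinuation q γ F → F 1 =ᶠ[𝓝 x] fun t => c * F 0 t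

/-- The monodromy representation `π₁(ℙ¹ ∖ {z_1, …, z_N, ∞}) → PGL₂` of `∂_t² - q(t)` is
trivial: every loop acts on the local solutions by a nonzero scalar. -/
def TrivialPGL2Monodromy (z : Fin N → ℂ) (q : ℂ → ℂ) : Prop :=
  ∀ (x : ℂ) (γ : Path x x), (∀ s i, γ s ≠ z i) → ∃ c : ℂ, c ≠ 0 ∧ HasScalarMonodromy q γ c

/-- All solutions of `φ'' = q φ` have monodromy `1` or all have monodromy `-1` along each loop in
`ℙ¹ ∖ {z_1, …, z_N, ∞}`. -/
def PlusMinusOneMonodromy (z : Fin N → ℂ) (q : ℂ → ℂ) : Prop :=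
  ∀ (x : ℂ) (γ : Path x x), (∀ s i, γ s ≠ z i) →
    HasScalarMonodromy q γ 1 ∨ HasScalarMonodromy q γ (-1)

end Gaudin

end

/-! The proof rests on one polynomial model and one ordinary differential operator. The tensor
product of Verma modules is realised on ℂ[x_1, …, x_N] with f_i = x_i, e_i = λ_i ∂_i − x_i ∂_i², h_i
= λ_i − 2 x_i ∂_i, and the space of states is its quotient by the ideal generated by the x_i^(λ_i+1)
(`toStates`). Conjugating ∂² − q_μ by ∏ (t − z_i)^(λ_i/2) and clearing denominators gives an
operator D_μ on polynomials in t (`operD`). Separation of variables (`operD_lineHom`) links the two: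
if ∑ b_i = 0 and p is restricted to the line t ↦ (b_i (t − z_i)), then D_μ of the restriction is a
combination of the restrictions of H_i p − μ_i p.

Monodromy. The exponents of D_μ at z_i are 0 and λ_i + 1, so only logarithms can obstruct trivial
monodromy. A logarithm is incompatible with scalar monodromy, since a solution containing log (t −
z_i) changes by a non-logarithmic solution along a small circle
(`noLogarithm_of_trivialPGL2Monodromy`). Without logarithms, a dimension count modulo ∏ (t −
z_i)^(λ_i+1) produces two independent polynomial solutions (`exists_two_polynomial_solutions`).
Every solution of φ'' = q_μ φ is then a polynomial divided by a square root of ∏ (t − z_i)^λ_i,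
whence monodromy ±1, and a general combination of the two polynomials has simple roots away from the
z_i, which form an admissible w. The Bethe equations say that the residues of the Miura transform at
the w_j vanish (`miura_eq`), and the Miura form says that D_μ annihilates ∏ (t − w_j).

Eigenvectors. An eigenvector of the H_i lifts to a polynomial eigenvector modulo the multiples of
x_i^(λ_i+1); after raising it is also singular modulo these multiples, hence not divisible by x_i. A
line through a suitable point of the hyperplane x_i = 0 then shows that z_i carries no logarithm. In
the polynomial model a Bethe vector is a product of linear forms, and the eigenvalue and highest
weight equations are partial fraction computations in which the unwanted terms cancel by the Bethe
equations.

Independence. Put Λ = ∑ λ_i. The exponents of D_μ at infinity add up to Λ + 1, so a polynomial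
solution of degree at most Λ/2 is unique up to a scalar. Hence different solutions w with 2m ≤ Λ
have different eigenvalues. Were a Bethe vector zero, some polynomial eigenvector divisible by
x_i^(λ_i+1) would have the same eigenvalues; its restrictions to lines would be multiples of ∏ (t −
w_j) that vanish at z_i, hence zero.

Completeness. Call z generic if the H_i and h have simple joint spectrum on highest weight vectors,
disjoint from their spectrum on the multiples of each x_i^(λ_i+1) (`IsGeneric`). Then a highest
weight eigenvector lifts to a singular polynomial eigenvector not divisible by any x_i; its
restrictions to lines give a polynomial solution whose roots w satisfy the Bethe equations, and
simplicity identifies the Bethe vector with the eigenvector up to a scalar. Genericity is detected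
by resultants of characteristic polynomials, so it suffices to find one generic point. This is done
by induction on N, sending one point to infinity (`isGeneric_limitMatrix`, `exists_isGeneric`). -/

open scoped TensorProduct Topology BigOperators

noncomputable section

namespace Gaudin

section

/-! ### Pairwise commuting copies of `sl₂` -/

section Sites

variable {ι R : Type*} [Ring R] [Algebra ℂ R]

/-- Pairwise commuting `sl₂`-triples `(e i, f i, h i)`, whose Casimir elements are the scalars
`c i`. -/
structure Sl2Sites (c : ι → ℂ) (e f h : ι → R) : Prop where
  comm_ee : ∀ i j, i ≠ j → e i * e j = e j * e i
  comm_ef : ∀ i j, i ≠ j → e i * f j = f j * e i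
  comm_eh : ∀ i j, i ≠ j → e i * h j = h j * e i
  comm_ff : ∀ i j, i ≠ j → f i * f j = f j * f i
  comm_fh : ∀ i j, i ≠ j → f i * h j = h j * f i
  comm_hh : ∀ i j, i ≠ j → h i * h j = h j * h i
  rel_he : ∀ i, h i * e i = e i * h i + 2 * e i
  rel_hf : ∀ i, h i * f i = f i * h i - 2 * f i
  rel_ef : ∀ i, e i * f i = f i * e i + h i
  casimir : ∀ i, f i * e i + (1 / 4 : ℂ) • (h i * h i) + (1 / 2 : ℂ) • h i = algebraMap ℂ R (c i)

/-- The split Casimir element of two sites. -/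
def omega (e f h : ι → R) (i j : ι) : R :=
  e i * f j + f i * e j + (1 / 2 : ℂ) • (h i * h j)

/-- Clears the factor 1/2 of Ω, so that the identities below have integer coefficients. -/
lemma commute_of_two_mul {a b : R} (h : Commute (2 * a) b) : Commute a b := by
  have : a = (1 / 2 : ℂ) • (2 * a) := by
    rw [two_mul, ← two_smul ℂ, smul_smul]; norm_num
  rw [this]
  exact h.smul_left _

lemma two_mul_omega (e f h : ι → R) (i j : ι) :
    2 * omega e f h i j = 2 * (e i * f j) + 2 * (f i * e j) + h i * h j := by
  have : (2 : R) * ((1 / 2 : ℂ) • (h i * h j)) = h i * h j := by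
    rw [two_mul, ← two_smul ℂ, smul_smul]; norm_num
  rw [omega, mul_add, mul_add, this]

namespace Sl2Sites

variable {c : ι → ℂ} {e f h : ι → R}

/-- The Chevalley involution: it halves the work by deducing facts about f from facts about e. -/
lemma swap (S : Sl2Sites c e f h) : Sl2Sites c f e (fun i => -h i) where
  comm_ee := S.comm_ff
  comm_ef i j hij := (S.comm_ef j i hij.symm).symm
  comm_eh i j hij := by rw [mul_neg, neg_mul, S.comm_fh i j hij]
  comm_ff := S.comm_ee
  comm_fh i j hij := by rw [mul_neg, neg_mul, S.comm_eh i j hij]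
  comm_hh i j hij := by rw [neg_mul_neg, neg_mul_neg, S.comm_hh i j hij]
  rel_he i := by rw [neg_mul, S.rel_hf]; noncomm_ring
  rel_hf i := by rw [neg_mul, S.rel_he]; noncomm_ring
  rel_ef i := by rw [S.rel_ef]; abel
  casimir i := by
    rw [← S.casimir i, S.rel_ef, neg_mul_neg]
    module

lemma omega_swap (e f h : ι → R) (i j : ι) :
    omega f e (fun i => -h i) i j = omega e f h i j := by
  rw [omega, omega, neg_mul_neg, add_comm (f i * e j)]

lemma omega_symm (S : Sl2Sites c e f h) {i j : ι} (hij : i ≠ j) :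
    omega e f h i j = omega e f h j i := by
  rw [omega, omega, S.comm_ef i j hij, S.comm_ef j i hij.symm, S.comm_hh i j hij,
    add_comm (f j * e i)]

lemma omega_commute_e (S : Sl2Sites c e f h) {i j : ι} (hij : i ≠ j) :
    Commute (omega e f h i j) (e i + e j) := by
  apply commute_of_two_mul
  rw [two_mul_omega]
  have h1 := sub_eq_zero.mpr (S.comm_ee i j hij)
  have h2 := sub_eq_zero.mpr (S.comm_ef i j hij)
  have h3 := sub_eq_zero.mpr (S.comm_ef j i hij.symm)
  have h4 := sub_eq_zero.mpr (S.comm_eh i j hij)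
  have h5 := sub_eq_zero.mpr (S.comm_eh j i hij.symm)
  have h6 := sub_eq_zero.mpr (S.rel_he i)
  have h7 := sub_eq_zero.mpr (S.rel_he j)
  have h8 := sub_eq_zero.mpr (S.rel_ef i)
  have h9 := sub_eq_zero.mpr (S.rel_ef j)
  refine sub_eq_zero.mp ?_
  -- The commutator written in the ideal of the defining relations: each bracket on the right is one
  -- of the vanishing expressions `h1` to `h9`.
  have key : (2 * (e i * f j) + 2 * (f i * e j) + h i * h j) * (e i + e j)
      - (e i + e j) * (2 * (e i * f j) + 2 * (f i * e j) + h i * h j)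
      = -2 * e i * (e i * f j - f j * e i) - 2 * e i * (e j * f j - (f j * e j + h j))
        + 2 * (e i * e j - e j * e i) * f j - 2 * f i * (e i * e j - e j * e i)
        - 2 * (e i * f i - (f i * e i + h i)) * e j - 2 * (e j * f i - f i * e j) * e j
        - h i * (e i * h j - h j * e i) + (h i * e i - (e i * h i + 2 * e i)) * h j
        + h i * (h j * e j - (e j * h j + 2 * e j)) - (e j * h i - h i * e j) * h j := by
    noncomm_ring
  rw [key, h1, h2, h3, h4, h5, h6, h7, h8, h9]
  simp

lemma omega_commute_f (S : Sl2Sites c e f h) {i j : ι} (hij : i ≠ j) :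
    Commute (omega e f h i j) (f i + f j) := by
  rw [← omega_swap]
  exact S.swap.omega_commute_e hij

lemma omega_commute_h (S : Sl2Sites c e f h) {i j : ι} (hij : i ≠ j) :
    Commute (omega e f h i j) (h i + h j) := by
  have : h i + h j = (e i + e j) * (f i + f j) - (f i + f j) * (e i + e j) := by
    have h2 := S.comm_ef i j hij
    have h3 := S.comm_ef j i hij.symm
    have h8 := S.rel_ef i
    have h9 := S.rel_ef j
    simp only [add_mul, mul_add, h2, h3, h8, h9]
    abel
  rw [this]
  have h1 := S.omega_commute_e hij
  have h2 := S.omega_commute_f hij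
  exact (h1.mul_right h2).sub_right (h2.mul_right h1)

lemma omega_commute_of_ne (S : Sl2Sites c e f h) {i j k : ι} (hik : i ≠ k) (hjk : j ≠ k) :
    Commute (omega e f h i j) (e k) ∧ Commute (omega e f h i j) (f k) ∧
      Commute (omega e f h i j) (h k) := by
  have key : ∀ x : R, Commute (e i) x → Commute (f i) x → Commute (h i) x →
      Commute (e j) x → Commute (f j) x → Commute (h j) x → Commute (omega e f h i j) x :=
    fun x a b c a' b' c' =>
      ((a.mul_left b').add_left (b.mul_left a')).add_left ((c.mul_left c').smul_left _)
  refine ⟨key _ (S.comm_ee i k hik) (S.comm_ef k i hik.symm).symm (S.comm_eh k i hik.symm).symm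
      (S.comm_ee j k hjk) (S.comm_ef k j hjk.symm).symm (S.comm_eh k j hjk.symm).symm,
    key _ (S.comm_ef i k hik) (S.comm_ff i k hik) (S.comm_fh k i hik.symm).symm
      (S.comm_ef j k hjk) (S.comm_ff j k hjk) (S.comm_fh k j hjk.symm).symm,
    key _ (S.comm_eh i k hik) (S.comm_fh i k hik) (S.comm_hh i k hik)
      (S.comm_eh j k hjk) (S.comm_fh j k hjk) (S.comm_hh j k hjk)⟩

/-- The infinitesimal braid relation: the sum is the split Casimir element of the diagonal sl₂ at i,
j with the site k, and Ω_ij is invariant under that diagonal action. -/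
lemma omega_commute_omega_add (S : Sl2Sites c e f h) {i j k : ι} (hij : i ≠ j) (hik : i ≠ k)
    (hjk : j ≠ k) : Commute (omega e f h i j) (omega e f h i k + omega e f h j k) := by
  have : omega e f h i k + omega e f h j k =
      (e i + e j) * f k + (f i + f j) * e k + (1 / 2 : ℂ) • ((h i + h j) * h k) := by
    simp only [omega, add_mul, smul_add]
    abel
  rw [this]
  obtain ⟨h1, h2, h3⟩ := S.omega_commute_of_ne hik hjk
  exact (((S.omega_commute_e hij).mul_right h2).add_right
    ((S.omega_commute_f hij).mul_right h1)).add_right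
      (((S.omega_commute_h hij).mul_right h3).smul_right _)

lemma omega_commute_omega (S : Sl2Sites c e f h) {i j k l : ι} (hik : i ≠ k) (hjk : j ≠ k)
    (hil : i ≠ l) (hjl : j ≠ l) : Commute (omega e f h i j) (omega e f h k l) := by
  obtain ⟨h1, h2, h3⟩ := S.omega_commute_of_ne hik hjk
  obtain ⟨h1', h2', h3'⟩ := S.omega_commute_of_ne hil hjl
  exact ((h1.mul_right h2').add_right (h2.mul_right h1')).add_right ((h3.mul_right h3').smul_right _)

variable [Fintype ι]

lemma omega_commute_sum (S : Sl2Sites c e f h) {i j : ι} (hij : i ≠ j) :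
    Commute (omega e f h i j) (∑ k, e k) ∧ Commute (omega e f h i j) (∑ k, f k) ∧
      Commute (omega e f h i j) (∑ k, h k) := by
  classical
  have key : ∀ x : ι → R, Commute (omega e f h i j) (x i + x j) →
      (∀ k, i ≠ k → j ≠ k → Commute (omega e f h i j) (x k)) →
      Commute (omega e f h i j) (∑ k, x k) := by
    intro x h1 h2
    rw [← Finset.add_sum_erase _ _ (Finset.mem_univ i),
      ← Finset.add_sum_erase _ _ (Finset.mem_erase.mpr ⟨hij.symm, Finset.mem_univ j⟩), ← add_assoc]
    refine h1.add_right (Commute.sum_right _ _ _ fun k hk => h2 k ?_ ?_)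
    · rintro rfl; simp at hk
    · rintro rfl; simp at hk
  exact ⟨key e (S.omega_commute_e hij) fun k hi hj => (S.omega_commute_of_ne hi hj).1,
    key f (S.omega_commute_f hij) fun k hi hj => (S.omega_commute_of_ne hi hj).2.1,
    key h (S.omega_commute_h hij) fun k hi hj => (S.omega_commute_of_ne hi hj).2.2⟩

end Sl2Sites

/-- Skew-symmetric solutions of the scalar classical Yang–Baxter equation. -/
structure IsRMatrix (r : ι → ι → ℂ) : Prop where
  skew : ∀ i j, r j i = -r i j
  yang_baxter : ∀ i j k, i ≠ j → i ≠ k → j ≠ k →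
    r i j * r j k = r i k * r i j + r i k * r j k

/-- The Arnold relation. General r are admitted because the Hamiltonians also have to be considered
for the limit `limitMatrix` in which one point goes to infinity. -/
lemma isRMatrix_inv_sub {z : ι → ℂ} (hz : Function.Injective z) :
    IsRMatrix fun i j => (z i - z j)⁻¹ where
  skew i j := by rw [← inv_neg, neg_sub]
  yang_baxter i j k hij hik hjk := by
    have h1 := sub_ne_zero.mpr (hz.ne hij)
    have h2 := sub_ne_zero.mpr (hz.ne hik)
    have h3 := sub_ne_zero.mpr (hz.ne hjk)
    field_simp
    ring

variable [Fintype ι] [DecidableEq ι]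

/-- The Hamiltonian `∑_{j ≠ i} r_{ij} Ω_{ij}`. -/
def ham (e f h : ι → R) (r : ι → ι → ℂ) (i : ι) : R :=
  ∑ j ∈ Finset.univ.erase i, r i j • omega e f h i j

namespace Sl2Sites

variable {c : ι → ℂ} {e f h : ι → R}

lemma ham_commute_sum (S : Sl2Sites c e f h) (r : ι → ι → ℂ) (i : ι) :
    Commute (ham e f h r i) (∑ k, e k) ∧ Commute (ham e f h r i) (∑ k, f k) ∧
      Commute (ham e f h r i) (∑ k, h k) := by
  refine ⟨?_, ?_, ?_⟩ <;> refine Commute.sum_left _ _ _ fun j hj => Commute.smul_left ?_ _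
  · exact (S.omega_commute_sum (Finset.ne_of_mem_erase hj).symm).1
  · exact (S.omega_commute_sum (Finset.ne_of_mem_erase hj).symm).2.1
  · exact (S.omega_commute_sum (Finset.ne_of_mem_erase hj).symm).2.2

lemma sum_ham (S : Sl2Sites c e f h) {r : ι → ι → ℂ} (hr : ∀ i j, r j i = -r i j) :
    ∑ i, ham e f h r i = 0 := by
  have h1 : ∑ i, ham e f h r i = ∑ i, ∑ j, if i = j then 0 else r i j • omega e f h i j := by
    refine Finset.sum_congr rfl fun i _ => ?_
    rw [ham, ← Finset.filter_ne, Finset.sum_filter]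
    exact Finset.sum_congr rfl fun j _ => by rw [ite_not]
  have h2 : ∑ i, ham e f h r i = -∑ i, ham e f h r i := by
    nth_rewrite 1 [h1]
    rw [Finset.sum_comm, h1, ← Finset.sum_neg_distrib]
    refine Finset.sum_congr rfl fun i _ => ?_
    rw [← Finset.sum_neg_distrib]
    refine Finset.sum_congr rfl fun j _ => ?_
    by_cases hij : i = j
    · simp [hij]
    · rw [if_neg hij, if_neg (Ne.symm hij), hr i j, S.omega_symm hij, neg_smul]
  have h3 : (2 : ℂ) • ∑ i, ham e f h r i = 0 := by
    rw [two_smul]; nth_rewrite 1 [h2]; simp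
  exact (smul_eq_zero.mp h3).resolve_left two_ne_zero

/-- Brackets of Ω's without a common site vanish. For each third site k, the braid relations make
the three remaining brackets multiples of [Ω_ij, Ω_jk], and the total coefficient is zero by the
Yang–Baxter equation. -/
lemma ham_commute (S : Sl2Sites c e f h) {r : ι → ι → ℂ} (hr : IsRMatrix r) (i j : ι) :
    Commute (ham e f h r i) (ham e f h r j) := by
  let : LieRing R := LieRing.ofAssociativeRing
  by_cases hij : i = j
  · rw [hij]
  have hi : ham e f h r i = r i j • omega e f h i j +
      ∑ k ∈ (Finset.univ.erase i).erase j, r i k • omega e f h i k :=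
    (Finset.add_sum_erase _ _ (Finset.mem_erase.mpr ⟨Ne.symm hij, Finset.mem_univ j⟩)).symm
  have hj : ham e f h r j = -r i j • omega e f h i j +
      ∑ k ∈ (Finset.univ.erase i).erase j, r j k • omega e f h j k := by
    rw [Finset.erase_right_comm, ← hr.skew, S.omega_symm hij]
    exact (Finset.add_sum_erase _ (fun k => r j k • omega e f h j k)
      (Finset.mem_erase.mpr ⟨hij, Finset.mem_univ i⟩)).symm
  rw [commute_iff_lie_eq, hi, hj]
  have hk : ∀ k ∈ (Finset.univ.erase i).erase j, i ≠ k ∧ j ≠ k := by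
    intro k hk
    simp only [Finset.mem_erase, Finset.mem_univ, and_true] at hk
    exact ⟨Ne.symm hk.2, Ne.symm hk.1⟩
  have hAB : ⁅∑ k ∈ (Finset.univ.erase i).erase j, r i k • omega e f h i k,
      ∑ k ∈ (Finset.univ.erase i).erase j, r j k • omega e f h j k⁆ =
      ∑ k ∈ (Finset.univ.erase i).erase j,
        (r i k * r j k) • ⁅omega e f h i k, omega e f h j k⁆ := by
    rw [sum_lie]
    refine Finset.sum_congr rfl fun k hk' => ?_
    rw [lie_sum, Finset.sum_eq_single k]
    · rw [smul_lie, lie_smul, smul_smul]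
    · intro l hl hlk
      rw [smul_lie, lie_smul, (S.omega_commute_omega hij (hk k hk').2.symm (hk l hl).1
        (Ne.symm hlk)).lie_eq, smul_zero, smul_zero]
    · exact fun h => absurd hk' h
  rw [add_lie, lie_add, lie_add, hAB, smul_lie, lie_smul, lie_self, smul_zero, smul_zero, zero_add,
    lie_smul, smul_lie, lie_sum, sum_lie, Finset.smul_sum, Finset.smul_sum, ← add_assoc,
    ← Finset.sum_add_distrib, ← Finset.sum_add_distrib]
  refine Finset.sum_eq_zero fun k hk' => ?_
  obtain ⟨hik, hjk⟩ := hk k hk'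
  have h1 := (S.omega_commute_omega_add hij hik hjk).lie_eq
  have h2 := (S.omega_commute_omega_add hik hij (Ne.symm hjk)).lie_eq
  rw [lie_add] at h1 h2
  rw [S.omega_symm (Ne.symm hjk)] at h2
  have h3 : ⁅omega e f h i k, omega e f h i j⁆ = ⁅omega e f h i j, omega e f h j k⁆ := by
    rw [← lie_skew, neg_eq_iff_add_eq_zero.mpr h1]
  have h4 : ⁅omega e f h i k, omega e f h j k⁆ = -⁅omega e f h i j, omega e f h j k⁆ := by
    rw [← h3]; exact eq_neg_of_add_eq_zero_right h2
  rw [lie_smul, smul_lie, h3, h4]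
  have := hr.yang_baxter i j k hij hik hjk
  rw [smul_smul, smul_smul, smul_neg, ← neg_smul, ← add_smul, ← add_smul]
  convert zero_smul ℂ _ using 2
  linear_combination this

lemma casimir_total (S : Sl2Sites c e f h) :
    (∑ i, f i) * ∑ i, e i + (1 / 4 : ℂ) • ((∑ i, h i) * ∑ i, h i) + (1 / 2 : ℂ) • ∑ i, h i =
      algebraMap ℂ R (∑ i, c i) +
        (1 / 2 : ℂ) • ∑ i, ∑ j ∈ Finset.univ.erase i, omega e f h i j := by
  have hfe : ∀ i, ∑ j, f i * e j = f i * e i + ∑ j ∈ Finset.univ.erase i, f i * e j :=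
    fun i => (Finset.add_sum_erase _ _ (Finset.mem_univ i)).symm
  have hhh : ∀ i, ∑ j, h i * h j = h i * h i + ∑ j ∈ Finset.univ.erase i, h i * h j :=
    fun i => (Finset.add_sum_erase _ _ (Finset.mem_univ i)).symm
  have hef : ∑ i, ∑ j ∈ Finset.univ.erase i, e i * f j =
      ∑ i, ∑ j ∈ Finset.univ.erase i, f i * e j := by
    have h0 : ∀ x : ι → ι → R, ∑ i, ∑ j ∈ Finset.univ.erase i, x i j =
        ∑ i, ∑ j, if i = j then 0 else x i j := fun x => by
      refine Finset.sum_congr rfl fun i _ => ?_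
      rw [← Finset.filter_ne, Finset.sum_filter]
      exact Finset.sum_congr rfl fun j _ => by rw [ite_not]
    rw [h0, h0, Finset.sum_comm]
    refine Finset.sum_congr rfl fun i _ => Finset.sum_congr rfl fun j _ => ?_
    by_cases hij : i = j
    · simp [hij]
    · rw [if_neg hij, if_neg (Ne.symm hij), S.comm_ef j i (Ne.symm hij)]
  simp only [omega, Finset.sum_add_distrib]
  rw [hef, map_sum, ← Finset.sum_congr rfl fun i _ => S.casimir i, Finset.sum_mul_sum,
    Finset.sum_mul_sum, Finset.sum_congr rfl fun i _ => hfe i, Finset.sum_congr rfl fun i _ => hhh i]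
  simp only [Finset.sum_add_distrib, ← Finset.smul_sum]
  module

/-- Symmetrise and use z_i / (z_i − z_j) + z_j / (z_j − z_i) = 1. With `casimir_total`, this makes
the total Casimir element a function of the Hamiltonians, so that the eigenvalues of the H_i
determine the isotypic component. -/
lemma sum_smul_ham (S : Sl2Sites c e f h) {z : ι → ℂ} (hz : Function.Injective z) :
    ∑ i, z i • ham e f h (fun i j => (z i - z j)⁻¹) i =
      (1 / 2 : ℂ) • ∑ i, ∑ j ∈ Finset.univ.erase i, omega e f h i j := by
  have h0 : ∀ x : ι → ι → R, ∑ i, ∑ j ∈ Finset.univ.erase i, x i j =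
      ∑ i, ∑ j, if i = j then 0 else x i j := fun x => by
    refine Finset.sum_congr rfl fun i _ => ?_
    rw [← Finset.filter_ne, Finset.sum_filter]
    exact Finset.sum_congr rfl fun j _ => by rw [ite_not]
  simp only [ham, Finset.smul_sum]
  rw [h0, h0]
  set A := ∑ i, ∑ j, if i = j then 0 else z i • (z i - z j)⁻¹ • omega e f h i j with hA
  have h1 : A = ∑ i, ∑ j, if i = j then 0 else z j • (z j - z i)⁻¹ • omega e f h i j := by
    rw [hA, Finset.sum_comm]
    refine Finset.sum_congr rfl fun i _ => Finset.sum_congr rfl fun j _ => ?_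
    by_cases hij : i = j
    · simp [hij]
    · rw [if_neg hij, if_neg (Ne.symm hij), S.omega_symm hij]
  have h2 : A + A = ∑ i, ∑ j, if i = j then 0 else omega e f h i j := by
    nth_rewrite 1 [hA]
    rw [h1, ← Finset.sum_add_distrib]
    refine Finset.sum_congr rfl fun i _ => ?_
    rw [← Finset.sum_add_distrib]
    refine Finset.sum_congr rfl fun j _ => ?_
    by_cases hij : i = j
    · simp [hij]
    · simp only [if_neg hij]
      have h3 : z i - z j ≠ 0 := sub_ne_zero.mpr (hz.ne hij)
      have h4 : z j - z i ≠ 0 := sub_ne_zero.mpr (hz.ne (Ne.symm hij))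
      rw [smul_smul, smul_smul, ← add_smul]
      convert one_smul ℂ _ using 2
      rw [← neg_sub (z i) (z j)] at h4 ⊢
      field_simp
      ring
  have h3 : ∀ i j, (if i = j then 0 else (1 / 2 : ℂ) • omega e f h i j) =
      (1 / 2 : ℂ) • (if i = j then 0 else omega e f h i j) := fun i j => by
    split_ifs <;> simp
  simp only [h3, ← Finset.smul_sum]
  rw [← h2, ← two_smul ℂ, smul_smul]
  norm_num

end Sl2Sites
end Sites
end

section

/-! ### The irreducible modules -/

lemma end_two_apply {M : Type*} [AddCommGroup M] [Module ℂ M] (x : M) :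
    (2 : Module.End ℂ M) x = (2 : ℂ) • x := by
  rw [← one_add_one_eq_two, LinearMap.add_apply, Module.End.one_apply, two_smul]

/-- The vector `f^k v` of `V n`, which is zero for `k > n`. -/
def vb (n k : ℕ) : V n := if h : k < n + 1 then Pi.single ⟨k, h⟩ 1 else 0

lemma vb_apply (n k : ℕ) (a : Fin (n + 1)) : vb n k a = if (a : ℕ) = k then 1 else 0 := by
  unfold vb
  split_ifs with h h1 h1
  · rw [Pi.single_apply, if_pos (Fin.ext h1)]
  · rw [Pi.single_apply, if_neg (fun h2 => h1 (congrArg Fin.val h2))]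
  · exact absurd (h1 ▸ a.isLt) h
  · rfl

lemma repF_vb (n k : ℕ) : repF n (vb n k) = vb n (k + 1) := by
  ext a
  simp only [repF, Matrix.toLin'_apply, Matrix.mulVec, dotProduct, Matrix.of_apply, vb_apply,
    mul_ite, mul_one, mul_zero]
  by_cases hk : k < n + 1
  · rw [Finset.sum_eq_single ⟨k, hk⟩]
    · simp
    · intro b _ hb
      rw [if_neg (fun h => hb (Fin.ext h))]
    · simp
  · rw [if_neg (by omega)]
    exact Finset.sum_eq_zero fun b _ => if_neg (by omega)

lemma repE_vb (n k : ℕ) : repE n (vb n k) = ((k : ℂ) * (n - k + 1)) • vb n (k - 1) := by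
  ext a
  simp only [repE, Matrix.toLin'_apply, Matrix.mulVec, dotProduct, Matrix.of_apply, vb_apply,
    mul_ite, mul_one, mul_zero, Pi.smul_apply, smul_eq_mul]
  by_cases hk : k < n + 1
  · rw [Finset.sum_eq_single ⟨k, hk⟩]
    · rcases Nat.eq_zero_or_pos k with rfl | h0
      · simp
      · simp only [if_true]
        exact if_congr (by omega) rfl rfl
    · intro b _ hb
      rw [if_neg (fun h => hb (Fin.ext h))]
    · simp
  · rw [Finset.sum_eq_zero fun b _ => if_neg (by omega)]
    -- For k > n the vector v_{k−1} is nonzero only if k = n + 1, where the factor n − k + 1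
    -- vanishes.
    split_ifs with h
    · have : k = n + 1 := by omega
      rw [this]; push_cast; ring
    · rfl

lemma repH_vb (n k : ℕ) : repH n (vb n k) = ((n : ℂ) - 2 * k) • vb n k := by
  ext a
  simp only [repH, Matrix.toLin'_apply, Matrix.mulVec_diagonal, vb_apply, Pi.smul_apply,
    smul_eq_mul]
  split_ifs with h
  · rw [h]
  · simp

lemma rep_ext {n : ℕ} {M : Type*} [AddCommMonoid M] [Module ℂ M] {S T : V n →ₗ[ℂ] M}
    (h : ∀ k, S (vb n k) = T (vb n k)) : S = T := by
  refine (Pi.basisFun ℂ (Fin (n + 1))).ext fun i => ?_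
  have : vb n i = Pi.basisFun ℂ (Fin (n + 1)) i := by
    ext a; simp [vb_apply, Pi.single_apply, Fin.ext_iff]
  rw [← this]; exact h i

lemma rep_he (n : ℕ) : repH n * repE n = repE n * repH n + 2 * repE n := by
  refine rep_ext fun k => ?_
  simp only [Module.End.mul_apply, LinearMap.add_apply, repE_vb, repH_vb, map_smul, end_two_apply, smul_smul,
    ← add_smul]
  rcases Nat.eq_zero_or_pos k with rfl | h0
  · simp
  · rw [Nat.cast_sub h0]; congr 1; push_cast; ring

lemma rep_hf (n : ℕ) : repH n * repF n = repF n * repH n - 2 * repF n := by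
  refine rep_ext fun k => ?_
  simp only [Module.End.mul_apply, LinearMap.sub_apply, repF_vb, repH_vb, map_smul, end_two_apply,
    ← sub_smul]
  congr 1; push_cast; ring

lemma rep_ef (n : ℕ) : repE n * repF n = repF n * repE n + repH n := by
  refine rep_ext fun k => ?_
  simp only [Module.End.mul_apply, LinearMap.add_apply, repF_vb, repH_vb, repE_vb, map_smul]
  rcases Nat.eq_zero_or_pos k with rfl | h0
  · simp
  · rw [Nat.sub_add_cancel h0, ← add_smul, Nat.add_sub_cancel]; congr 1; push_cast; ring

lemma rep_casimir (n : ℕ) :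
    repF n * repE n + (1 / 4 : ℂ) • (repH n * repH n) + (1 / 2 : ℂ) • repH n =
      algebraMap ℂ (Module.End ℂ (V n)) ((n : ℂ) * (n + 2) / 4) := by
  refine rep_ext fun k => ?_
  simp only [Module.End.mul_apply, LinearMap.add_apply, LinearMap.smul_apply, repF_vb, repH_vb,
    repE_vb, map_smul, Module.algebraMap_end_apply, smul_smul]
  rcases Nat.eq_zero_or_pos k with rfl | h0
  · simp only [Nat.cast_zero, zero_mul, zero_smul, zero_add, ← add_smul]
    congr 1; ring
  · rw [Nat.sub_add_cancel h0, ← add_smul, ← add_smul]; congr 1; ring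

/-! ### The space of states -/

variable {N : ℕ}

lemma states_ext {lam : Fin N → ℕ} {M : Type*} [AddCommMonoid M] [Module ℂ M]
    {S T : States lam →ₗ[ℂ] M}
    (h : ∀ v, S (PiTensorProduct.tprod ℂ v) = T (PiTensorProduct.tprod ℂ v)) : S = T :=
  PiTensorProduct.ext (MultilinearMap.ext h)

/-- The action of an endomorphism of the `i`-th factor on the space of states. -/
def siteFun (lam : Fin N → ℕ) (i : Fin N) (a : Module.End ℂ (V (lam i))) :
    Module.End ℂ (States lam) :=
  PiTensorProduct.map (Function.update (fun _ => LinearMap.id) i a)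

lemma siteFun_tprod (lam : Fin N → ℕ) (i : Fin N) (a : Module.End ℂ (V (lam i)))
    (v : (i : Fin N) → V (lam i)) :
    siteFun lam i a (PiTensorProduct.tprod ℂ v) =
      PiTensorProduct.tprod ℂ (Function.update v i (a (v i))) := by
  rw [siteFun, PiTensorProduct.map_tprod]
  congr 1
  funext j
  by_cases h : j = i
  · subst h; simp
  · simp [Function.update_of_ne h]

/-- The linear action of the endomorphisms of the `i`-th factor on the space of states. -/
def siteLinear (lam : Fin N → ℕ) (i : Fin N) :
    Module.End ℂ (V (lam i)) →ₗ[ℂ] Module.End ℂ (States lam) where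
  toFun := siteFun lam i
  map_add' a b := states_ext fun v => by
    rw [LinearMap.add_apply, siteFun_tprod, siteFun_tprod, siteFun_tprod, LinearMap.add_apply,
      MultilinearMap.map_update_add]
  map_smul' c a := states_ext fun v => by
    rw [RingHom.id_apply, LinearMap.smul_apply, siteFun_tprod, siteFun_tprod, LinearMap.smul_apply,
      MultilinearMap.map_update_smul]

lemma siteLinear_tprod (lam : Fin N → ℕ) (i : Fin N) (a : Module.End ℂ (V (lam i)))
    (v : (i : Fin N) → V (lam i)) :
    siteLinear lam i a (PiTensorProduct.tprod ℂ v) =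
      PiTensorProduct.tprod ℂ (Function.update v i (a (v i))) :=
  siteFun_tprod lam i a v

/-- The action of the endomorphisms of the `i`-th factor on the space of states. -/
def siteHom (lam : Fin N → ℕ) (i : Fin N) :
    Module.End ℂ (V (lam i)) →ₐ[ℂ] Module.End ℂ (States lam) :=
  AlgHom.ofLinearMap (siteLinear lam i)
    (states_ext fun v => by
      rw [siteLinear_tprod, Module.End.one_apply, Module.End.one_apply, Function.update_eq_self])
    (fun a b => states_ext fun v => by
      rw [Module.End.mul_apply, siteLinear_tprod, siteLinear_tprod, siteLinear_tprod,
        Function.update_idem, Function.update_self, Module.End.mul_apply])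

lemma site_eq (lam : Fin N → ℕ) (a : (n : ℕ) → Module.End ℂ (V n)) (i : Fin N) :
    site lam a i = siteHom lam i (a (lam i)) := rfl

lemma siteHom_tprod (lam : Fin N → ℕ) (i : Fin N) (a : Module.End ℂ (V (lam i)))
    (v : (i : Fin N) → V (lam i)) :
    siteHom lam i a (PiTensorProduct.tprod ℂ v) =
      PiTensorProduct.tprod ℂ (Function.update v i (a (v i))) :=
  siteLinear_tprod lam i a v

lemma siteHom_comm (lam : Fin N → ℕ) {i j : Fin N} (hij : i ≠ j) (a : Module.End ℂ (V (lam i)))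
    (b : Module.End ℂ (V (lam j))) :
    siteHom lam i a * siteHom lam j b = siteHom lam j b * siteHom lam i a := by
  refine states_ext fun v => ?_
  simp only [Module.End.mul_apply, siteHom_tprod]
  rw [Function.update_of_ne hij, Function.update_of_ne hij.symm, Function.update_comm hij]

/-- The eigenvalue of the Casimir element on `V n`. -/
abbrev casimirValue (n : ℕ) : ℂ := (n : ℂ) * (n + 2) / 4

lemma states_sites (lam : Fin N → ℕ) :
    Sl2Sites (fun i => casimirValue (lam i)) (site lam repE) (site lam repF) (site lam repH) where
  comm_ee _ _ hij := siteHom_comm lam hij _ _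
  comm_ef _ _ hij := siteHom_comm lam hij _ _
  comm_eh _ _ hij := siteHom_comm lam hij _ _
  comm_ff _ _ hij := siteHom_comm lam hij _ _
  comm_fh _ _ hij := siteHom_comm lam hij _ _
  comm_hh _ _ hij := siteHom_comm lam hij _ _
  rel_he i := by
    simp only [site_eq, ← map_mul, rep_he, map_add]
    rw [map_mul (siteHom lam i) 2, map_ofNat]
  rel_hf i := by
    simp only [site_eq, ← map_mul, rep_hf, map_sub]
    rw [map_mul (siteHom lam i) 2, map_ofNat]
  rel_ef i := by simp only [site_eq, ← map_mul, rep_ef, map_add]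
  casimir i := by
    simp only [site_eq, ← map_mul, ← map_smul, ← map_add, rep_casimir, AlgHom.commutes]

lemma hamiltonian_eq (lam : Fin N → ℕ) (z : Fin N → ℂ) (i : Fin N) :
    hamiltonian lam z i =
      ham (site lam repE) (site lam repF) (site lam repH) (fun i j => (z i - z j)⁻¹) i := rfl

/-! ### Polynomials as a tensor product of Verma modules -/

open MvPolynomial

lemma pderiv_comm {σ : Type*} (i j : σ) (p : MvPolynomial σ ℂ) :
    pderiv i (pderiv j p) = pderiv j (pderiv i p) := by
  classical
  induction p using MvPolynomial.induction_on with
  | C a => simp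
  | add p q hp hq => simp only [map_add, hp, hq]
  | mul_X p k hp =>
    simp only [pderiv_mul, map_add, hp, pderiv_X, Pi.single_apply]
    split_ifs <;> simp <;> ring

lemma pderiv_two {σ : Type*} (i : σ) : pderiv i (2 : MvPolynomial σ ℂ) = 0 := by
  rw [← map_ofNat C, pderiv_C]

/-- `f = x` on the Verma module `ℂ[x]`. -/
def polyF (i : Fin N) : Module.End ℂ (MvPolynomial (Fin N) ℂ) := LinearMap.mulLeft ℂ (X i)

/-- `e = λ ∂ - x ∂²` on the Verma module `ℂ[x]`. -/
def polyE (lam : Fin N → ℕ) (i : Fin N) : Module.End ℂ (MvPolynomial (Fin N) ℂ) :=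
  (lam i : ℂ) • (pderiv i : Derivation ℂ _ _).toLinearMap
    - LinearMap.mulLeft ℂ (X i) ∘ₗ (pderiv i : Derivation ℂ _ _).toLinearMap ∘ₗ
      (pderiv i : Derivation ℂ _ _).toLinearMap

/-- `h = λ - 2 x ∂` on the Verma module `ℂ[x]`. -/
def polyH (lam : Fin N → ℕ) (i : Fin N) : Module.End ℂ (MvPolynomial (Fin N) ℂ) :=
  (lam i : ℂ) • 1 - (2 : ℂ) • LinearMap.mulLeft ℂ (X i) ∘ₗ (pderiv i : Derivation ℂ _ _).toLinearMap

lemma polyF_apply (i : Fin N) (p : MvPolynomial (Fin N) ℂ) : polyF i p = X i * p := rfl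

lemma polyE_apply (lam : Fin N → ℕ) (i : Fin N) (p : MvPolynomial (Fin N) ℂ) :
    polyE lam i p = C (lam i : ℂ) * pderiv i p - X i * pderiv i (pderiv i p) := by
  rw [← smul_eq_C_mul]; rfl

lemma polyH_apply (lam : Fin N → ℕ) (i : Fin N) (p : MvPolynomial (Fin N) ℂ) :
    polyH lam i p = C (lam i : ℂ) * p - 2 * (X i * pderiv i p) := by
  have : (2 : MvPolynomial (Fin N) ℂ) * (X i * pderiv i p) = (2 : ℂ) • (X i * pderiv i p) := by
    rw [two_smul, two_mul]
  rw [this, ← smul_eq_C_mul]; rfl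

lemma poly_sites (lam : Fin N → ℕ) :
    Sl2Sites (fun i => casimirValue (lam i)) (polyE lam) polyF (polyH lam) where
  comm_ee i j hij := by
    refine LinearMap.ext fun p => ?_
    simp only [Module.End.mul_apply, polyE_apply, map_sub, pderiv_mul, pderiv_C, pderiv_X_of_ne hij,
      pderiv_X_of_ne hij.symm, pderiv_comm i j, zero_mul, zero_add]
    ring
  comm_ef i j hij := by
    refine LinearMap.ext fun p => ?_
    simp only [Module.End.mul_apply, polyE_apply, polyF_apply, map_sub, pderiv_mul,
      pderiv_X_of_ne hij.symm, zero_mul, zero_add]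
    ring
  comm_eh i j hij := by
    refine LinearMap.ext fun p => ?_
    simp only [Module.End.mul_apply, polyE_apply, polyH_apply, map_sub, pderiv_mul,
      pderiv_X_of_ne hij.symm, pderiv_X_of_ne hij, zero_mul, zero_add, pderiv_C, pderiv_comm i j,
      pderiv_two]
    ring
  comm_ff i j hij := by
    refine LinearMap.ext fun p => ?_
    simp only [Module.End.mul_apply, polyF_apply]
    ring
  comm_fh i j hij := by
    refine LinearMap.ext fun p => ?_
    simp only [Module.End.mul_apply, polyF_apply, polyH_apply, pderiv_mul, pderiv_X_of_ne hij]
    ring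
  comm_hh i j hij := by
    refine LinearMap.ext fun p => ?_
    simp only [Module.End.mul_apply, polyH_apply, map_sub, pderiv_mul,
      pderiv_X_of_ne hij.symm, pderiv_X_of_ne hij, pderiv_C, pderiv_comm i j, pderiv_two]
    ring
  rel_he i := by
    refine LinearMap.ext fun p => ?_
    simp only [Module.End.mul_apply, LinearMap.add_apply, end_two_apply, two_smul, polyE_apply, polyH_apply, map_sub,
      map_add, pderiv_mul, pderiv_X_self, pderiv_C, pderiv_two, pderiv_one, zero_mul, zero_add]
    ring
  rel_hf i := by
    refine LinearMap.ext fun p => ?_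
    simp only [Module.End.mul_apply, LinearMap.sub_apply, end_two_apply, two_smul, polyF_apply, polyH_apply,
      pderiv_mul, pderiv_X_self]
    ring
  rel_ef i := by
    refine LinearMap.ext fun p => ?_
    simp only [Module.End.mul_apply, LinearMap.add_apply, polyF_apply, polyH_apply, polyE_apply,
      map_add, pderiv_mul, pderiv_X_self, pderiv_one]
    ring
  casimir i := by
    refine LinearMap.ext fun p => ?_
    simp only [Module.End.mul_apply, LinearMap.add_apply, LinearMap.smul_apply, polyF_apply,
      polyH_apply, polyE_apply, map_sub, pderiv_mul, pderiv_X_self, pderiv_C, pderiv_two,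
      Module.algebraMap_end_apply, smul_eq_C_mul, casimirValue]
    have h1 : (C (1 / 4 : ℂ) : MvPolynomial (Fin N) ℂ) * 4 = 1 := by
      rw [← map_ofNat C, ← C_mul]; norm_num
    have h2 : (C (1 / 2 : ℂ) : MvPolynomial (Fin N) ℂ) = 2 * C (1 / 4 : ℂ) := by
      rw [← map_ofNat C, ← C_mul]; norm_num
    have h3 : (C ((lam i : ℂ) * (lam i + 2) / 4) : MvPolynomial (Fin N) ℂ) =
        C (1 / 4) * (C (lam i : ℂ) * (C (lam i : ℂ) + 2)) := by
      rw [← map_ofNat C, ← C_add, ← C_mul, ← C_mul]; congr 1; ring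
    rw [h3, h2]
    linear_combination -(X i * (C (lam i : ℂ) * pderiv i p - X i * pderiv i (pderiv i p))) * h1
end

/-! ### Intertwining maps and the Hamiltonians. -/

section
open MvPolynomial
variable {N : ℕ}

lemma omega_intertwine {ι M M' : Type*} [AddCommGroup M] [Module ℂ M] [AddCommGroup M']
    [Module ℂ M'] {e f h : ι → Module.End ℂ M} {e' f' h' : ι → Module.End ℂ M'} {T : M →ₗ[ℂ] M'}
    (he : ∀ i p, T (e i p) = e' i (T p)) (hf : ∀ i p, T (f i p) = f' i (T p))
    (hh : ∀ i p, T (h i p) = h' i (T p)) (i j : ι) (p : M) :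
    T (omega e f h i j p) = omega e' f' h' i j (T p) := by
  simp only [omega, LinearMap.add_apply, LinearMap.smul_apply, Module.End.mul_apply, map_add,
    map_smul, he, hf, hh]

lemma ham_intertwine {ι M M' : Type*} [Fintype ι] [DecidableEq ι] [AddCommGroup M] [Module ℂ M]
    [AddCommGroup M'] [Module ℂ M'] {e f h : ι → Module.End ℂ M} {e' f' h' : ι → Module.End ℂ M'}
    {T : M →ₗ[ℂ] M'}
    (he : ∀ i p, T (e i p) = e' i (T p)) (hf : ∀ i p, T (f i p) = f' i (T p))
    (hh : ∀ i p, T (h i p) = h' i (T p)) (r : ι → ι → ℂ) (i : ι) (p : M) :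
    T (ham e f h r i p) = ham e' f' h' r i (T p) := by
  simp only [ham, LinearMap.sum_apply, LinearMap.smul_apply, map_sum, map_smul,
    omega_intertwine he hf hh]

/-! ### From polynomials to states -/

/-- The projection of the tensor product of Verma modules onto the space of states. -/
def toStates (lam : Fin N → ℕ) : MvPolynomial (Fin N) ℂ →ₗ[ℂ] States lam :=
  (basisMonomials (Fin N) ℂ).constr ℂ fun a => PiTensorProduct.tprod ℂ fun i => vb (lam i) (a i)

lemma toStates_monomial (lam : Fin N → ℕ) (a : Fin N →₀ ℕ) (c : ℂ) :
    toStates lam (monomial a c) = c • PiTensorProduct.tprod ℂ fun i => vb (lam i) (a i) := by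
  have h : monomial a c = c • basisMonomials (Fin N) ℂ a := by
    rw [coe_basisMonomials, smul_monomial, smul_eq_mul, mul_one]
  rw [h, map_smul, toStates, Module.Basis.constr_basis]

lemma toStates_polyF (lam : Fin N → ℕ) (i : Fin N) (p : MvPolynomial (Fin N) ℂ) :
    toStates lam (polyF i p) = site lam repF i (toStates lam p) := by
  suffices h : toStates lam ∘ₗ polyF i = site lam repF i ∘ₗ toStates lam from
    LinearMap.congr_fun h p
  refine (basisMonomials (Fin N) ℂ).ext fun a => ?_
  rw [coe_basisMonomials, LinearMap.comp_apply, LinearMap.comp_apply, polyF_apply, X,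
    monomial_mul, one_mul, toStates_monomial, toStates_monomial, one_smul, one_smul, site_eq,
    siteHom_tprod, repF_vb]
  congr 1
  funext j
  by_cases h : j = i
  · subst h; simp [add_comm]
  · rw [Function.update_of_ne h, Finsupp.add_apply, Finsupp.single_eq_of_ne h, zero_add]

lemma toStates_polyH (lam : Fin N → ℕ) (i : Fin N) (p : MvPolynomial (Fin N) ℂ) :
    toStates lam (polyH lam i p) = site lam repH i (toStates lam p) := by
  suffices h : toStates lam ∘ₗ polyH lam i = site lam repH i ∘ₗ toStates lam from
    LinearMap.congr_fun h p
  refine (basisMonomials (Fin N) ℂ).ext fun a => ?_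
  have h1 : polyH lam i (monomial a 1) = ((lam i : ℂ) - 2 * a i) • monomial a 1 := by
    rw [polyH_apply, X_mul_pderiv_monomial, sub_smul, ← smul_eq_C_mul, mul_smul, two_smul, two_mul]
    simp only [Nat.cast_smul_eq_nsmul]
  rw [coe_basisMonomials, LinearMap.comp_apply, LinearMap.comp_apply, h1, map_smul,
    toStates_monomial, one_smul, site_eq, siteHom_tprod, repH_vb, MultilinearMap.map_update_smul,
    Function.update_eq_self]

lemma polyE_monomial (lam : Fin N → ℕ) (i : Fin N) (a : Fin N →₀ ℕ) :
    polyE lam i (monomial a 1) =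
      ((a i : ℂ) * (lam i - a i + 1)) • monomial (a - Finsupp.single i 1) 1 := by
  have h2 : X i * pderiv i (pderiv i (monomial a (1 : ℂ))) =
      ((a i : ℂ) * (a i - 1)) • monomial (a - Finsupp.single i 1) 1 := by
    rw [pderiv_monomial, X_mul_pderiv_monomial]
    rcases Nat.eq_zero_or_pos (a i) with h | h
    · simp [h]
    · rw [← Nat.cast_smul_eq_nsmul ℂ, smul_monomial, smul_monomial, Finsupp.tsub_apply,
        Finsupp.single_eq_same, Nat.cast_sub h]
      congr 1
      simp only [smul_eq_mul]; push_cast; ring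
  rw [polyE_apply, h2, pderiv_monomial, C_mul_monomial, smul_monomial, smul_monomial, ← map_sub]
  congr 1
  simp only [smul_eq_mul]; ring

lemma toStates_polyE (lam : Fin N → ℕ) (i : Fin N) (p : MvPolynomial (Fin N) ℂ) :
    toStates lam (polyE lam i p) = site lam repE i (toStates lam p) := by
  suffices h : toStates lam ∘ₗ polyE lam i = site lam repE i ∘ₗ toStates lam from
    LinearMap.congr_fun h p
  refine (basisMonomials (Fin N) ℂ).ext fun a => ?_
  rw [coe_basisMonomials, LinearMap.comp_apply, LinearMap.comp_apply, polyE_monomial, map_smul,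
    toStates_monomial, toStates_monomial, one_smul, one_smul, site_eq, siteHom_tprod, repE_vb,
    MultilinearMap.map_update_smul]
  congr 2
  funext j
  by_cases h : j = i
  · subst h; simp
  · rw [Function.update_of_ne h, Finsupp.tsub_apply, Finsupp.single_eq_of_ne h, tsub_zero]

lemma toStates_ham (lam : Fin N → ℕ) (r : Fin N → Fin N → ℂ) (i : Fin N)
    (p : MvPolynomial (Fin N) ℂ) :
    toStates lam (ham (polyE lam) polyF (polyH lam) r i p) =
      ham (site lam repE) (site lam repF) (site lam repH) r i (toStates lam p) :=
  ham_intertwine (toStates_polyE lam) (toStates_polyF lam) (toStates_polyH lam) r i p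

lemma toStates_sum_polyE (lam : Fin N → ℕ) (p : MvPolynomial (Fin N) ℂ) :
    toStates lam ((∑ i, polyE lam i) p) = diagonalAction lam repE (toStates lam p) := by
  simp only [diagonalAction, LinearMap.sum_apply, map_sum, toStates_polyE]

lemma toStates_sum_polyH (lam : Fin N → ℕ) (p : MvPolynomial (Fin N) ℂ) :
    toStates lam ((∑ i, polyH lam i) p) = diagonalAction lam repH (toStates lam p) := by
  simp only [diagonalAction, LinearMap.sum_apply, map_sum, toStates_polyH]

lemma toStates_one (lam : Fin N → ℕ) : toStates lam 1 = vacuum lam := by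
  rw [← C_1, C_apply, toStates_monomial, one_smul, vacuum]
  congr 1

/-- The basis of the space of states formed by the vectors `⊗ v_{a_i}`. -/
def statesBasis (lam : Fin N → ℕ) :
    Module.Basis ((i : Fin N) → Fin (lam i + 1)) ℂ (States lam) :=
  Basis.piTensorProduct fun i => Pi.basisFun ℂ (Fin (lam i + 1))

lemma statesBasis_apply (lam : Fin N → ℕ) (a : (i : Fin N) → Fin (lam i + 1)) :
    statesBasis lam a = toStates lam (monomial (Finsupp.equivFunOnFinite.symm fun i => a i) 1) := by
  rw [toStates_monomial, one_smul, statesBasis, Basis.piTensorProduct_apply]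
  congr 1
  funext i
  ext b
  simp [vb_apply, Pi.single_apply, Fin.ext_iff]

lemma statesBasis_repr_toStates (lam : Fin N → ℕ) (p : MvPolynomial (Fin N) ℂ)
    (a : (i : Fin N) → Fin (lam i + 1)) :
    (statesBasis lam).repr (toStates lam p) a =
      coeff (Finsupp.equivFunOnFinite.symm fun i => (a i : ℕ)) p := by
  suffices h : (Finsupp.lapply a ∘ₗ (statesBasis lam).repr.toLinearMap) ∘ₗ toStates lam =
      lcoeff ℂ (Finsupp.equivFunOnFinite.symm fun i => (a i : ℕ)) from
    LinearMap.congr_fun h p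
  refine (basisMonomials (Fin N) ℂ).ext fun b => ?_
  rw [coe_basisMonomials, LinearMap.comp_apply, toStates_monomial, one_smul, statesBasis]
  simp only [LinearMap.comp_apply, LinearEquiv.coe_coe, Finsupp.lapply_apply,
    Basis.piTensorProduct_repr_tprod_apply, Pi.basisFun_repr, vb_apply, lcoeff_apply, coeff_monomial]
  rw [Finset.prod_ite_zero]
  simp only [Finset.mem_univ, true_implies, Finset.prod_const_one]
  refine if_congr ?_ rfl rfl
  rw [Finsupp.ext_iff]
  exact forall_congr' fun i => by simp [eq_comm]

/-- The coordinates of the image are the coefficients of the monomials with exponents at most λ_i,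
so the kernel is the monomial ideal generated by the x_i^(λ_i+1). -/
lemma toStates_eq_zero_iff (lam : Fin N → ℕ) (p : MvPolynomial (Fin N) ℂ) :
    toStates lam p = 0 ↔ ∀ a : Fin N →₀ ℕ, (∀ i, a i ≤ lam i) → coeff a p = 0 := by
  constructor
  · intro h a ha
    have := statesBasis_repr_toStates lam p fun i => ⟨a i, Nat.lt_succ_of_le (ha i)⟩
    rw [h, map_zero, Finsupp.zero_apply] at this
    rw [this]; congr 1; ext i; simp
  · intro h
    refine (statesBasis lam).ext_elem fun a => ?_
    rw [statesBasis_repr_toStates, map_zero, Finsupp.zero_apply]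
    exact h _ fun i => by simpa using Nat.le_of_lt_succ (a i).isLt

/-- The degree bound puts the lift in a finite-dimensional space stable under the Hamiltonians,
where eigenvectors can be found. -/
lemma exists_toStates_eq (lam : Fin N → ℕ) (v : States lam) :
    ∃ p ∈ restrictTotalDegree (Fin N) ℂ (∑ i, lam i), toStates lam p = v := by
  have h : v ∈ Submodule.map (toStates lam) (restrictTotalDegree (Fin N) ℂ (∑ i, lam i)) := by
    rw [← (statesBasis lam).sum_repr v]
    refine Submodule.sum_mem _ fun a _ => Submodule.smul_mem _ _ ?_
    rw [statesBasis_apply]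
    refine Submodule.mem_map_of_mem ?_
    rw [mem_restrictTotalDegree]
    refine (totalDegree_monomial_le _ _).trans ?_
    rw [Finsupp.sum_fintype _ _ fun _ => rfl]
    exact Finset.sum_le_sum fun i _ => by simpa using Nat.le_of_lt_succ (a i).isLt
  obtain ⟨p, hp, rfl⟩ := h
  exact ⟨p, hp, rfl⟩

instance (lam : Fin N → ℕ) : FiniteDimensional ℂ (States lam) :=
  (statesBasis lam).finiteDimensional_of_finite

end

section

/-! ### Joint eigenvectors of commuting operators -/

section Joint

variable {ι U V' : Type*} [AddCommGroup U] [Module ℂ U] [AddCommGroup V'] [Module ℂ V']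

/-- `u` is a joint eigenvector of the operators `X i` with eigenvalues `μ i`. -/
def IsJointEigenvector (X : ι → Module.End ℂ U) (μ : ι → ℂ) (u : U) : Prop :=
  u ≠ 0 ∧ ∀ i, X i u = μ i • u

/-- One operator at a time: the last nonzero vector (X_j − μ_j)^k u' is an eigenvector of X_j, and
by commutativity it keeps the eigenvector equations already obtained. -/
lemma exists_joint_eigenvector_of_pow [Finite ι] {X : ι → Module.End ℂ U}
    (hX : ∀ i j, Commute (X i) (X j)) (μ : ι → ℂ) {u : U} (hu : u ≠ 0)
    (h : ∀ i, ∃ k : ℕ, ((X i - algebraMap ℂ _ (μ i)) ^ k) u = 0) :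
    ∃ u', IsJointEigenvector X μ u' := by
  classical
  have := Fintype.ofFinite ι
  have hcomm : ∀ i j, Commute (X i - algebraMap ℂ _ (μ i)) (X j - algebraMap ℂ _ (μ j)) :=
    fun i j => ((hX i j).sub_left (Algebra.commutes _ _)).sub_right
      (Algebra.commutes (μ j) _).symm
  suffices key : ∀ S : Finset ι, ∃ u' ≠ 0,
      (∀ i, ∃ k : ℕ, ((X i - algebraMap ℂ _ (μ i)) ^ k) u' = 0) ∧
        ∀ i ∈ S, (X i - algebraMap ℂ _ (μ i)) u' = 0 by
    obtain ⟨u', h0, -, h1⟩ := key Finset.univ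
    refine ⟨u', h0, fun i => ?_⟩
    have := h1 i (Finset.mem_univ i)
    rwa [LinearMap.sub_apply, Module.algebraMap_end_apply, sub_eq_zero] at this
  intro S
  induction S using Finset.induction_on with
  | empty => exact ⟨u, hu, h, by simp⟩
  | insert j S _ ih =>
    obtain ⟨u', h0, h1, h2⟩ := ih
    set Y := X j - algebraMap ℂ _ (μ j) with hY
    have hex : ∃ k : ℕ, (Y ^ k) u' = 0 := h1 j
    obtain ⟨k, hk⟩ : ∃ k, Nat.find hex = k + 1 := by
      refine Nat.exists_eq_succ_of_ne_zero fun h3 => ?_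
      have := Nat.find_spec hex
      rw [h3, pow_zero, Module.End.one_apply] at this
      exact h0 this
    refine ⟨(Y ^ k) u', Nat.find_min hex (by omega), fun i => ?_, fun i hi => ?_⟩
    · obtain ⟨l, hl⟩ := h1 i
      refine ⟨l, ?_⟩
      rw [← Module.End.mul_apply, ((hcomm i j).pow_pow l k).eq, Module.End.mul_apply, hl, map_zero]
    · rcases Finset.mem_insert.mp hi with rfl | hi
      · rw [← Module.End.mul_apply, ← pow_succ', ← hk]
        exact Nat.find_spec hex
      · rw [← Module.End.mul_apply, ((hcomm i j).pow_right k).eq, Module.End.mul_apply, h2 i hi,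
          map_zero]

/-- Write the minimal polynomial of X_j as (X − μ_j)^k q with q(μ_j) ≠ 0. Then q(X_j) moves u into
the generalized eigenspace of μ_j, while it only multiplies π u by the nonzero scalar q(μ_j). -/
lemma exists_joint_eigenvector [Finite ι] [FiniteDimensional ℂ U] {X : ι → Module.End ℂ U}
    (hX : ∀ i j, Commute (X i) (X j)) {Y : ι → Module.End ℂ V'} {π : U →ₗ[ℂ] V'}
    (hπ : ∀ i u, π (X i u) = Y i (π u)) {μ : ι → ℂ} {u : U}
    (h : IsJointEigenvector Y μ (π u)) : ∃ u', IsJointEigenvector X μ u' := by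
  classical
  have := Fintype.ofFinite ι
  suffices key : ∀ S : Finset ι, ∃ u, IsJointEigenvector Y μ (π u) ∧
      ∀ i ∈ S, ∃ k : ℕ, ((X i - algebraMap ℂ _ (μ i)) ^ k) u = 0 by
    obtain ⟨u', h0, h1⟩ := key Finset.univ
    exact exists_joint_eigenvector_of_pow hX μ (u := u') (fun h => h0.1 (by rw [h, map_zero]))
      fun i => h1 i (Finset.mem_univ i)
  intro S
  induction S using Finset.induction_on with
  | empty => exact ⟨u, h, by simp⟩
  | insert j S _ ih =>
    obtain ⟨u', h0, h1⟩ := ih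
    have hm : minpoly ℂ (X j) ≠ 0 := minpoly.ne_zero (Algebra.IsIntegral.isIntegral _)
    obtain ⟨q, hq, hq'⟩ := Polynomial.exists_eq_pow_rootMultiplicity_mul_and_not_dvd _ hm (μ j)
    rw [Polynomial.dvd_iff_isRoot, Polynomial.IsRoot] at hq'
    have hπq : π (Polynomial.aeval (X j) q u') = q.eval (μ j) • π u' := by
      rw [← Module.End.aeval_apply_of_hasEigenvector
        (⟨Module.End.mem_eigenspace_iff.mpr (h0.2 j), h0.1⟩ : (Y j).HasEigenvector (μ j) (π u'))]
      generalize q = q'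
      induction q' using Polynomial.induction_on' with
      | add a b ha hb => simp only [map_add, LinearMap.add_apply, ha, hb]
      | monomial n a =>
        simp only [Polynomial.aeval_monomial, Module.End.mul_apply, Module.algebraMap_end_apply,
          map_smul]
        congr 1
        induction n with
        | zero => simp
        | succ n ih => rw [pow_succ', pow_succ', Module.End.mul_apply, Module.End.mul_apply, hπ, ih]
    refine ⟨Polynomial.aeval (X j) q u', ⟨?_, fun i => ?_⟩, fun i hi => ?_⟩
    · rw [hπq]; exact smul_ne_zero hq' h0.1
    · rw [hπq, map_smul, h0.2 i, smul_comm]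
    · rcases Finset.mem_insert.mp hi with rfl | hi
      · refine ⟨(minpoly ℂ (X i)).rootMultiplicity (μ i), ?_⟩
        have := minpoly.aeval ℂ (X i)
        rw [hq, map_mul, map_pow, map_sub, Polynomial.aeval_X, Polynomial.aeval_C] at this
        rw [← Module.End.mul_apply, this, LinearMap.zero_apply]
      · obtain ⟨k, hk⟩ := h1 i hi
        refine ⟨k, ?_⟩
        have hc : Commute ((X i - algebraMap ℂ _ (μ i)) ^ k) (Polynomial.aeval (X j) q) := by
          refine Commute.pow_left ?_ k
          refine Commute.sub_left ?_ (Algebra.commutes _ _)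
          refine Polynomial.induction_on' (motive := fun q => Commute (X i) (Polynomial.aeval (X j) q))
            q ?_ ?_
          · intro a b ha hb; rw [map_add]; exact ha.add_right hb
          · intro n a
            rw [Polynomial.aeval_monomial]
            exact (Algebra.commute_algebraMap_right a (X i)).mul_right ((hX i j).pow_right n)
        rw [← Module.End.mul_apply, hc.eq, Module.End.mul_apply, hk, map_zero]

/-- The previous lemma for R / (R ∩ K), through which π factors on R. The kernel of π may be larger
than K: the aim is an eigenvector modulo the smaller subspace. -/
lemma exists_joint_eigenvector_mod [Finite ι] {R K : Submodule ℂ U} [FiniteDimensional ℂ R]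
    {X : ι → Module.End ℂ U} (hX : ∀ i j, Commute (X i) (X j)) (hR : ∀ i, ∀ u ∈ R, X i u ∈ R)
    (hK : ∀ i, ∀ u ∈ K, X i u ∈ K) {Y : ι → Module.End ℂ V'} {π : U →ₗ[ℂ] V'}
    (hπ : ∀ i u, π (X i u) = Y i (π u)) (hKπ : ∀ u ∈ K, π u = 0) {μ : ι → ℂ} {u : U} (hu : u ∈ R)
    (h : IsJointEigenvector Y μ (π u)) :
    ∃ u' ∈ R, u' ∉ K ∧ ∀ i, X i u' - μ i • u' ∈ K := by
  let K' : Submodule ℂ R := K.comap R.subtype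
  let H : ι → Module.End ℂ R := fun i => (X i).restrict (hR i)
  let XQ : ι → Module.End ℂ (R ⧸ K') := fun i => K'.mapQ K' (H i) fun p hp => hK i p hp
  let π' : (R ⧸ K') →ₗ[ℂ] V' := K'.liftQ (π ∘ₗ R.subtype) fun p hp => hKπ p hp
  have hXQ : ∀ i p, XQ i (K'.mkQ p) = K'.mkQ (H i p) := fun i p => rfl
  have hcomm : ∀ i j, Commute (XQ i) (XQ j) := by
    intro i j
    refine LinearMap.ext fun p => ?_
    obtain ⟨p, rfl⟩ := K'.mkQ_surjective p
    rw [Module.End.mul_apply, Module.End.mul_apply, hXQ, hXQ, hXQ, hXQ]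
    exact congrArg _ (Subtype.ext (LinearMap.congr_fun (hX i j).eq p.1))
  have hπ' : ∀ i u, π' (XQ i u) = Y i (π' u) := by
    intro i p
    obtain ⟨p, rfl⟩ := K'.mkQ_surjective p
    rw [hXQ]
    exact hπ i p.1
  obtain ⟨u', hu0, hu'⟩ := exists_joint_eigenvector hcomm hπ' (u := K'.mkQ ⟨u, hu⟩) (μ := μ) h
  obtain ⟨u', rfl⟩ := K'.mkQ_surjective u'
  refine ⟨u', u'.2, fun h => hu0 ((Submodule.Quotient.mk_eq_zero K').mpr h), fun i => ?_⟩
  have h1 := hu' i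
  rw [hXQ, ← map_smul, ← sub_eq_zero, ← map_sub] at h1
  exact (Submodule.Quotient.mk_eq_zero K').mp h1

lemma exists_pow_apply_mem_of_not_mem {K : Submodule ℂ U} {E : Module.End ℂ U} {u : U} (hu : u ∉ K)
    (h : ∃ k, (E ^ k) u ∈ K) : ∃ k, (E ^ k) u ∉ K ∧ E ((E ^ k) u) ∈ K := by
  classical
  obtain ⟨k, hk⟩ : ∃ k, Nat.find h = k + 1 := by
    refine Nat.exists_eq_succ_of_ne_zero fun h3 => ?_
    have := Nat.find_spec h
    rw [h3] at this
    exact hu this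
  refine ⟨k, Nat.find_min h (by omega), ?_⟩
  rw [← Module.End.mul_apply, ← pow_succ', ← hk]
  exact Nat.find_spec h

end Joint
end

section
variable {N : ℕ}

/-! ### The oper as an operator on polynomials -/

section Oper

open Polynomial

/-- `∑_{j ≠ i} λ_i λ_j / (2 (z_i - z_j))`, the eigenvalue of `H_i` on the vacuum. -/
def vacuumValue (lam : Fin N → ℕ) (z : Fin N → ℂ) (i : Fin N) : ℂ :=
  ∑ j ∈ Finset.univ.erase i, (z i - z j)⁻¹ * ((lam i : ℂ) * lam j / 2)

/-- `∏_i (t - z_i)` -/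
def nodal (z : Fin N → ℂ) : ℂ[X] := ∏ i, (X - C (z i))

/-- `∏_{j ≠ i} (t - z_j)` -/
def nodalErase (z : Fin N → ℂ) (i : Fin N) : ℂ[X] := ∏ j ∈ Finset.univ.erase i, (X - C (z j))

lemma nodal_eq (z : Fin N → ℂ) (i : Fin N) : nodal z = (X - C (z i)) * nodalErase z i :=
  (Finset.mul_prod_erase _ _ (Finset.mem_univ i)).symm

lemma eval_nodal_ne_zero {z : Fin N → ℂ} {t : ℂ} (ht : ∀ i, t ≠ z i) : (nodal z).eval t ≠ 0 := by
  rw [nodal, eval_prod, Finset.prod_ne_zero_iff]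
  intro i _
  rw [eval_sub, eval_X, eval_C]
  exact sub_ne_zero.mpr (ht i)

lemma eval_nodalErase {z : Fin N → ℂ} {t : ℂ} (ht : ∀ i, t ≠ z i) (i : Fin N) :
    (nodalErase z i).eval t = (nodal z).eval t / (t - z i) := by
  rw [nodal_eq z i, eval_mul, eval_sub, eval_X, eval_C,
    mul_div_cancel_left₀ _ (sub_ne_zero.mpr (ht i))]

lemma eval_nodalErase_self_ne_zero {z : Fin N → ℂ} (hz : Function.Injective z) (i : Fin N) :
    (nodalErase z i).eval (z i) ≠ 0 := by
  rw [nodalErase, eval_prod, Finset.prod_ne_zero_iff]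
  intro j hj
  rw [eval_sub, eval_X, eval_C]
  exact sub_ne_zero.mpr (hz.ne (Finset.ne_of_mem_erase hj).symm)

lemma eval_nodalErase_of_ne (z : Fin N → ℂ) {i j : Fin N} (hij : i ≠ j) :
    (nodalErase z i).eval (z j) = 0 := by
  rw [nodalErase, eval_prod]
  exact Finset.prod_eq_zero (Finset.mem_erase.mpr ⟨hij.symm, Finset.mem_univ j⟩) (by simp)

lemma infinite_compl_range (z : Fin N → ℂ) : {t : ℂ | ∀ i, t ≠ z i}.Infinite := by
  have h : {t : ℂ | ∀ i, t ≠ z i} = (Set.range z)ᶜ := by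
    ext t; simp [eq_comm]
  rw [h]
  exact (Set.finite_range z).infinite_compl

lemma polynomial_ext_of_forall_ne {z : Fin N → ℂ} {p q : ℂ[X]}
    (h : ∀ t : ℂ, (∀ i, t ≠ z i) → p.eval t = q.eval t) : p = q :=
  eq_of_infinite_eval_eq p q ((infinite_compl_range z).mono fun t ht => h t ht)

/-- The first order coefficient `∑_i λ_i ∏_{j ≠ i} (t - z_j)`. -/
def operB (lam : Fin N → ℕ) (z : Fin N → ℂ) : ℂ[X] := ∑ i, C (lam i : ℂ) * nodalErase z i

/-- The potential term `∑_i ν_i ∏_{j ≠ i} (t - z_j)`. -/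
def operC (z ν : Fin N → ℂ) : ℂ[X] := ∑ i, C (ν i) * nodalErase z i

/-- The operator `∏ (t - z_i) (∂² - ∑ λ_i / (t - z_i) ∂ + ∑ ν_i / (t - z_i))` on polynomials, with
`ν_i` the difference of the vacuum value and `μ_i`. It is the conjugate of `∂² - q_μ` by
`∏ (t - z_i)^{λ_i / 2}`, up to the leading coefficient. -/
def operD (lam : Fin N → ℕ) (z μ : Fin N → ℂ) : ℂ[X] →ₗ[ℂ] ℂ[X] :=
  LinearMap.mulLeft ℂ (nodal z) ∘ₗ derivative ∘ₗ derivative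
    - LinearMap.mulLeft ℂ (operB lam z) ∘ₗ derivative
    + LinearMap.mulLeft ℂ (operC z fun i => vacuumValue lam z i - μ i)

lemma operD_apply (lam : Fin N → ℕ) (z μ : Fin N → ℂ) (y : ℂ[X]) :
    operD lam z μ y = nodal z * derivative (derivative y) - operB lam z * derivative y
      + operC z (fun i => vacuumValue lam z i - μ i) * y := rfl

lemma eval_operC {z : Fin N → ℂ} {t : ℂ} (ht : ∀ i, t ≠ z i) (ν : Fin N → ℂ) :
    (operC z ν).eval t = (nodal z).eval t * ∑ i, ν i / (t - z i) := by
  rw [operC, eval_finsetSum, Finset.mul_sum]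
  refine Finset.sum_congr rfl fun i _ => ?_
  rw [eval_mul, eval_C, eval_nodalErase ht]
  ring

lemma eval_operD {lam : Fin N → ℕ} {z : Fin N → ℂ} {t : ℂ} (ht : ∀ i, t ≠ z i) (μ : Fin N → ℂ)
    (y : ℂ[X]) :
    (operD lam z μ y).eval t = (nodal z).eval t * ((derivative (derivative y)).eval t
      - (∑ i, (lam i : ℂ) / (t - z i)) * (derivative y).eval t
      + (∑ i, (vacuumValue lam z i - μ i) / (t - z i)) * y.eval t) := by
  have : operB lam z = operC z fun i => (lam i : ℂ) := rfl
  rw [operD_apply, this, eval_add, eval_sub, eval_mul, eval_mul, eval_mul, eval_operC ht,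
    eval_operC ht]
  ring

end Oper

/-! ### Restriction of polynomials to lines -/

section Lines

open MvPolynomial

/-- Restriction of a polynomial to the line `t ↦ (b_i (t - z_i))_i`. -/
def lineHom (z b : Fin N → ℂ) : MvPolynomial (Fin N) ℂ →ₐ[ℂ] Polynomial ℂ :=
  aeval fun i => Polynomial.C (b i) * (Polynomial.X - Polynomial.C (z i))

lemma lineHom_X (z b : Fin N → ℂ) (i : Fin N) :
    lineHom z b (X i) = Polynomial.C (b i) * (Polynomial.X - Polynomial.C (z i)) := aeval_X _ _

lemma lineHom_C (z b : Fin N → ℂ) (c : ℂ) : lineHom z b (C c) = Polynomial.C c :=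
  aeval_C _ _

lemma eval_lineHom (z b : Fin N → ℂ) (p : MvPolynomial (Fin N) ℂ) (t : ℂ) :
    (lineHom z b p).eval t = eval (fun i => b i * (t - z i)) p := by
  induction p using MvPolynomial.induction_on with
  | C a => simp
  | add p q hp hq => simp [hp, hq]
  | mul_X p i hp => simp [hp, lineHom_X]

lemma derivative_lineHom (z b : Fin N → ℂ) (p : MvPolynomial (Fin N) ℂ) :
    Polynomial.derivative (lineHom z b p) = ∑ i, Polynomial.C (b i) * lineHom z b (pderiv i p) := by
  classical
  induction p using MvPolynomial.induction_on with
  | C a => simp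
  | add p q hp hq => simp only [map_add, hp, hq, mul_add, Finset.sum_add_distrib]
  | mul_X p i hp =>
    simp only [map_mul, Polynomial.derivative_mul, hp, lineHom_X, Polynomial.derivative_C,
      Polynomial.derivative_sub, Polynomial.derivative_X, pderiv_mul, map_add, mul_add,
      Finset.sum_add_distrib, Finset.sum_mul]
    refine congrArg₂ (· + ·) (Finset.sum_congr rfl fun j _ => by ring) ?_
    · rw [Finset.sum_eq_single i]
      · simp; ring
      · intro j _ hj; simp [pderiv_X_of_ne hj.symm]
      · simp

lemma natDegree_lineHom_le (z b : Fin N → ℂ) (p : MvPolynomial (Fin N) ℂ) :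
    (lineHom z b p).natDegree ≤ p.totalDegree := by
  rw [p.as_sum, map_sum]
  refine Polynomial.natDegree_sum_le_of_forall_le _ _ fun a ha => ?_
  rw [monomial_eq, map_mul, lineHom_C, ← p.as_sum]
  refine (Polynomial.natDegree_C_mul_le _ _).trans ?_
  rw [Finsupp.prod, map_prod]
  refine (Polynomial.natDegree_prod_le _ _).trans (le_trans ?_ (le_totalDegree ha))
  refine Finset.sum_le_sum fun i _ => ?_
  rw [map_pow, lineHom_X]
  refine Polynomial.natDegree_pow_le.trans ?_
  have : (Polynomial.C (b i) * (Polynomial.X - Polynomial.C (z i))).natDegree ≤ 1 :=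
    (Polynomial.natDegree_C_mul_le _ _).trans (Polynomial.natDegree_X_sub_C_le _)
  simpa using Nat.mul_le_mul_left (a i) this

/-- The part of the split Casimir element that vanishes on the vacuum. -/
def polyW (lam : Fin N → ℕ) (i j : Fin N) (p : MvPolynomial (Fin N) ℂ) : MvPolynomial (Fin N) ℂ :=
  (C (lam i : ℂ) * X j - C (lam j : ℂ) * X i) * (pderiv i p - pderiv j p)
    - X i * X j * (pderiv i (pderiv i p) - 2 * pderiv i (pderiv j p) + pderiv j (pderiv j p))

lemma omega_poly (lam : Fin N → ℕ) {i j : Fin N} (hij : i ≠ j) (p : MvPolynomial (Fin N) ℂ) :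
    omega (polyE lam) polyF (polyH lam) i j p =
      C ((lam i : ℂ) * lam j / 2) * p + polyW lam i j p := by
  simp only [omega, LinearMap.add_apply, LinearMap.smul_apply, Module.End.mul_apply, polyE_apply,
    polyF_apply, polyH_apply, pderiv_mul, pderiv_X_of_ne hij.symm, map_sub, pderiv_C, pderiv_two,
    smul_eq_C_mul, polyW, map_add, map_zero]
  have h1 : (C (1 / 2 : ℂ) : MvPolynomial (Fin N) ℂ) * 2 = 1 := by
    rw [← map_ofNat C, ← C_mul]; norm_num
  have h2 : (C ((lam i : ℂ) * lam j / 2) : MvPolynomial (Fin N) ℂ) =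
      C (1 / 2) * (C (lam i : ℂ) * C (lam j : ℂ)) := by
    rw [← C_mul, ← C_mul]; congr 1; ring
  rw [h2]
  linear_combination (- C (lam i : ℂ) * X j * pderiv j p - C (lam j : ℂ) * X i * pderiv i p
    + 2 * X i * X j * pderiv i (pderiv j p)) * h1

lemma ham_poly (lam : Fin N → ℕ) (z : Fin N → ℂ) (i : Fin N) (p : MvPolynomial (Fin N) ℂ) :
    ham (polyE lam) polyF (polyH lam) (fun i j => (z i - z j)⁻¹) i p =
      C (vacuumValue lam z i) * p
        + ∑ j ∈ Finset.univ.erase i, C (z i - z j)⁻¹ * polyW lam i j p := by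
  simp only [ham, LinearMap.sum_apply, LinearMap.smul_apply, vacuumValue, map_sum, Finset.sum_mul]
  rw [← Finset.sum_add_distrib]
  refine Finset.sum_congr rfl fun j hj => ?_
  rw [omega_poly lam (Finset.ne_of_mem_erase hj).symm, smul_eq_C_mul, C_mul]
  ring

/-- The summand in the pair (i, j) is symmetric up to the prefactors, and (1/t_i − 1/t_j) / (z_i −
z_j) = 1 / (t_i t_j), so symmetrising removes all denominators z_i − z_j. The condition ∑ b_i = 0
then kills the terms with D_ii, D_jj and those in which l_i/t_i meets d_i. -/
lemma sum_pairs_on_line {b t z l : Fin N → ℂ} (hz : Function.Injective z) (ht : ∀ i, t i ≠ 0)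
    (hzt : ∀ i j, z i - z j = t j - t i) (hb : ∑ i, b i = 0) (d : Fin N → ℂ)
    {D : Fin N → Fin N → ℂ} (hD : ∀ i j, D i j = D j i) :
    ∑ i, (t i)⁻¹ * ∑ j ∈ Finset.univ.erase i, (z i - z j)⁻¹ *
        ((l i * (b j * t j) - l j * (b i * t i)) * (d i - d j)
          - (b i * t i) * (b j * t j) * (D i i - 2 * D i j + D j j)) =
      ∑ i, ∑ j, b i * b j * D i j - (∑ i, l i / t i) * ∑ j, b j * d j := by
  set w : Fin N → Fin N → ℂ := fun i j =>
    (l i * (b j * t j) - l j * (b i * t i)) * (d i - d j)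
          - (b i * t i) * (b j * t j) * (D i i - 2 * D i j + D j j) with hw
  set g : Fin N → Fin N → ℂ := fun i j => if i = j then 0 else (t i)⁻¹ * ((z i - z j)⁻¹ * w i j)
    with hg
  have hL : ∑ i, (t i)⁻¹ * ∑ j ∈ Finset.univ.erase i, (z i - z j)⁻¹ * w i j = ∑ i, ∑ j, g i j := by
    refine Finset.sum_congr rfl fun i _ => ?_
    rw [Finset.mul_sum, ← Finset.filter_ne, Finset.sum_filter]
    exact Finset.sum_congr rfl fun j _ => by rw [ite_not]
  have hsym : ∀ i j, g i j + g j i = (l i / t i * b j - l j / t j * b i) * (d i - d j)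
      - b i * b j * (D i i - 2 * D i j + D j j) := by
    intro i j
    by_cases hij : i = j
    · subst hij; simp only [hg, if_true]; ring
    · simp only [hg, if_neg hij, if_neg (Ne.symm hij), hw]
      have h1 := sub_ne_zero.mpr (hz.ne hij)
      have h2 : z j - z i = -(z i - z j) := by ring
      have h3 : t j = t i + (z i - z j) := by rw [hzt]; ring
      rw [h2, hD j i]
      have h4 := ht i
      have h5 := ht j
      have h6 : (t i)⁻¹ - (t j)⁻¹ = (z i - z j) / (t i * t j) := by
        rw [hzt]; field_simp
      have h7 : (t i)⁻¹ * ((z i - z j)⁻¹ * w i j) + (t j)⁻¹ * ((-(z i - z j))⁻¹ * w i j) =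
          w i j / (t i * t j) := by
        rw [inv_neg]
        calc _ = ((t i)⁻¹ - (t j)⁻¹) * (z i - z j)⁻¹ * w i j := by ring
          _ = _ := by rw [h6]; field_simp
      have h8 : (l j * (b i * t i) - l i * (b j * t j)) * (d j - d i)
          - (b j * t j) * (b i * t i) * (D j j - 2 * D i j + D i i) = w i j := by
        simp only [hw]; ring
      rw [h8]
      refine h7.trans ?_
      simp only [hw]
      field_simp
  have h2 : 2 * ∑ i, ∑ j, g i j = ∑ i, ∑ j, (g i j + g j i) := by
    rw [two_mul]
    nth_rewrite 2 [Finset.sum_comm]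
    rw [← Finset.sum_add_distrib]
    exact Finset.sum_congr rfl fun i _ => by rw [← Finset.sum_add_distrib]
  have e1 : ∑ i, ∑ j, l i / t i * b j * d i = 0 := by
    simp only [mul_right_comm _ _ (d _), ← Finset.mul_sum, hb, mul_zero, Finset.sum_const_zero]
  have e2 : ∑ i, ∑ j, l i / t i * b j * d j = (∑ i, l i / t i) * ∑ j, b j * d j := by
    rw [Finset.sum_mul_sum]
    exact Finset.sum_congr rfl fun i _ => Finset.sum_congr rfl fun j _ => by ring
  have e3 : ∑ i, ∑ j, l j / t j * b i * d i = (∑ i, l i / t i) * ∑ j, b j * d j := by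
    rw [Finset.sum_comm, e2]
  have e4 : ∑ i, ∑ j, l j / t j * b i * d j = 0 := by rw [Finset.sum_comm, e1]
  have e5 : ∑ i, ∑ j, b i * b j * D i i = 0 := by
    simp only [mul_right_comm _ (b _) (D _ _), ← Finset.mul_sum, hb, mul_zero,
      Finset.sum_const_zero]
  have e6 : ∑ i, ∑ j, b i * b j * D j j = 0 := by
    rw [Finset.sum_comm, ← e5]
    exact Finset.sum_congr rfl fun i _ => Finset.sum_congr rfl fun j _ => by ring
  have h3 : ∑ i, ∑ j, (g i j + g j i) = 2 * (∑ i, ∑ j, b i * b j * D i j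
      - (∑ i, l i / t i) * ∑ j, b j * d j) := by
    have : ∀ i j, g i j + g j i = l i / t i * b j * d i - l i / t i * b j * d j
        - l j / t j * b i * d i + l j / t j * b i * d j - b i * b j * D i i
        + 2 * (b i * b j * D i j) - b i * b j * D j j := fun i j => by rw [hsym]; ring
    simp only [this, Finset.sum_add_distrib, Finset.sum_sub_distrib, ← Finset.mul_sum]
    rw [e1, e2, e3, e4, e5, e6]
    ring
  rw [hL]
  linear_combination (h2 + h3) / 2

/-- Separation of variables: restriction to lines turns the Gaudin Hamiltonians into the oper. -/
lemma operD_lineHom (lam : Fin N → ℕ) {z : Fin N → ℂ} (hz : Function.Injective z) (μ : Fin N → ℂ)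
    {b : Fin N → ℂ} (hb : ∑ i, b i = 0) (p : MvPolynomial (Fin N) ℂ) :
    operD lam z μ (lineHom z b p) = ∑ i, nodalErase z i * lineHom z b
      (ham (polyE lam) polyF (polyH lam) (fun i j => (z i - z j)⁻¹) i p - C (μ i) * p) := by
  refine polynomial_ext_of_forall_ne (z := z) fun t ht => ?_
  rw [eval_operD ht, Polynomial.eval_finsetSum]
  have ht' : ∀ i, t - z i ≠ 0 := fun i => sub_ne_zero.mpr (ht i)
  have key := sum_pairs_on_line (t := fun i => t - z i) (l := fun i => (lam i : ℂ)) hz ht'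
    (fun i j => by ring) hb (fun i => (lineHom z b (pderiv i p)).eval t)
    (D := fun i j => (lineHom z b (pderiv i (pderiv j p))).eval t)
    (fun i j => by rw [pderiv_comm])
  have hd1 : (Polynomial.derivative (lineHom z b p)).eval t =
      ∑ j, b j * (lineHom z b (pderiv j p)).eval t := by
    rw [derivative_lineHom, Polynomial.eval_finsetSum]
    simp
  have hd2 : (Polynomial.derivative (Polynomial.derivative (lineHom z b p))).eval t =
      ∑ i, ∑ j, b i * b j * (lineHom z b (pderiv i (pderiv j p))).eval t := by
    rw [derivative_lineHom, Polynomial.derivative_sum, Polynomial.eval_finsetSum, Finset.sum_comm]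
    refine Finset.sum_congr rfl fun i _ => ?_
    rw [Polynomial.derivative_C_mul, derivative_lineHom, Polynomial.eval_mul, Polynomial.eval_C,
      Polynomial.eval_finsetSum, Finset.mul_sum]
    refine Finset.sum_congr rfl fun j _ => ?_
    rw [Polynomial.eval_mul, Polynomial.eval_C]
    ring
  have hR : ∀ i, (nodalErase z i * lineHom z b
      (ham (polyE lam) polyF (polyH lam) (fun i j => (z i - z j)⁻¹) i p - C (μ i) * p)).eval t =
      (nodal z).eval t * ((vacuumValue lam z i - μ i) / (t - z i) * (lineHom z b p).eval t +
        (t - z i)⁻¹ * ∑ j ∈ Finset.univ.erase i, (z i - z j)⁻¹ *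
        (((lam i : ℂ) * (b j * (t - z j)) - lam j * (b i * (t - z i)))
            * ((lineHom z b (pderiv i p)).eval t - (lineHom z b (pderiv j p)).eval t)
          - (b i * (t - z i)) * (b j * (t - z j)) * ((lineHom z b (pderiv i (pderiv i p))).eval t
            - 2 * (lineHom z b (pderiv i (pderiv j p))).eval t
            + (lineHom z b (pderiv j (pderiv j p))).eval t))) := by
    intro i
    rw [Polynomial.eval_mul, eval_nodalErase ht, ham_poly]
    simp only [polyW, map_sub, map_add, map_mul, map_sum, lineHom_C, lineHom_X, map_ofNat,
      Polynomial.eval_sub, Polynomial.eval_add, Polynomial.eval_mul, Polynomial.eval_finsetSum,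
      Polynomial.eval_C, Polynomial.eval_X, Polynomial.eval_ofNat]
    ring
  rw [Finset.sum_congr rfl fun i _ => hR i, ← Finset.mul_sum, Finset.sum_add_distrib, key, hd1, hd2,
    ← Finset.sum_mul]
  ring

end Lines
end

section
open MvPolynomial
variable {N : ℕ}

/-! ### Degrees and the submodules generated by singular vectors -/

lemma pderiv_mem_restrictTotalDegree {m : ℕ} {p : MvPolynomial (Fin N) ℂ}
    (hp : p ∈ restrictTotalDegree (Fin N) ℂ (m + 1)) (i : Fin N) :
    pderiv i p ∈ restrictTotalDegree (Fin N) ℂ m := by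
  rw [mem_restrictTotalDegree] at hp ⊢
  refine Finset.sup_le fun a ha => ?_
  rw [mem_support_iff, coeff_pderiv] at ha
  have h := le_totalDegree (mem_support_iff.mpr (left_ne_zero_of_mul ha))
  rw [Finsupp.sum_add_index' (fun _ => rfl) (fun _ _ _ => rfl), Finsupp.sum_single_index rfl] at h
  omega

lemma pderiv_eq_zero_of_mem {p : MvPolynomial (Fin N) ℂ}
    (hp : p ∈ restrictTotalDegree (Fin N) ℂ 0) (i : Fin N) : pderiv i p = 0 := by
  rw [mem_restrictTotalDegree, Nat.le_zero, totalDegree_eq_zero_iff_eq_C] at hp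
  rw [hp, pderiv_C]

lemma X_mul_mem_restrictTotalDegree {m : ℕ} {p : MvPolynomial (Fin N) ℂ}
    (hp : p ∈ restrictTotalDegree (Fin N) ℂ m) (i : Fin N) :
    X i * p ∈ restrictTotalDegree (Fin N) ℂ (m + 1) := by
  rw [mem_restrictTotalDegree] at hp ⊢
  refine (totalDegree_mul _ _).trans ?_
  rw [totalDegree_X]
  omega

lemma C_mul_mem_restrictTotalDegree {m : ℕ} {p : MvPolynomial (Fin N) ℂ}
    (hp : p ∈ restrictTotalDegree (Fin N) ℂ m) (c : ℂ) :
    C c * p ∈ restrictTotalDegree (Fin N) ℂ m := by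
  rw [← smul_eq_C_mul]; exact Submodule.smul_mem _ _ hp

lemma X_mul_pderiv_mem {m : ℕ} {p : MvPolynomial (Fin N) ℂ}
    (hp : p ∈ restrictTotalDegree (Fin N) ℂ m) (i j : Fin N) :
    X j * pderiv i p ∈ restrictTotalDegree (Fin N) ℂ m := by
  cases m with
  | zero => rw [pderiv_eq_zero_of_mem hp, mul_zero]; exact zero_mem _
  | succ m => exact X_mul_mem_restrictTotalDegree (pderiv_mem_restrictTotalDegree hp i) j

lemma X_mul_X_mul_pderiv_mem {m : ℕ} {p : MvPolynomial (Fin N) ℂ}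
    (hp : p ∈ restrictTotalDegree (Fin N) ℂ m) (i j k l : Fin N) :
    X i * X j * pderiv k (pderiv l p) ∈ restrictTotalDegree (Fin N) ℂ m := by
  cases m with
  | zero => rw [pderiv_eq_zero_of_mem hp, map_zero, mul_zero]; exact zero_mem _
  | succ m =>
    rw [mul_assoc]
    exact X_mul_mem_restrictTotalDegree
      (X_mul_pderiv_mem (pderiv_mem_restrictTotalDegree hp l) k j) i

lemma polyH_mem {m : ℕ} (lam : Fin N → ℕ) {p : MvPolynomial (Fin N) ℂ}
    (hp : p ∈ restrictTotalDegree (Fin N) ℂ m) (i : Fin N) :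
    polyH lam i p ∈ restrictTotalDegree (Fin N) ℂ m := by
  rw [polyH_apply, two_mul]
  exact sub_mem (C_mul_mem_restrictTotalDegree hp _)
    (add_mem (X_mul_pderiv_mem hp i i) (X_mul_pderiv_mem hp i i))

lemma polyE_mem {m : ℕ} (lam : Fin N → ℕ) {p : MvPolynomial (Fin N) ℂ}
    (hp : p ∈ restrictTotalDegree (Fin N) ℂ (m + 1)) (i : Fin N) :
    polyE lam i p ∈ restrictTotalDegree (Fin N) ℂ m := by
  rw [polyE_apply]
  have h := pderiv_mem_restrictTotalDegree hp i
  exact sub_mem (C_mul_mem_restrictTotalDegree h _) (X_mul_pderiv_mem h i i)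

lemma omega_mem {m : ℕ} (lam : Fin N → ℕ) {p : MvPolynomial (Fin N) ℂ}
    (hp : p ∈ restrictTotalDegree (Fin N) ℂ m) {i j : Fin N} (hij : i ≠ j) :
    omega (polyE lam) polyF (polyH lam) i j p ∈ restrictTotalDegree (Fin N) ℂ m := by
  rw [omega_poly lam hij, polyW]
  have h1 : (C (lam i : ℂ) * X j - C (lam j : ℂ) * X i) * (pderiv i p - pderiv j p) =
      C (lam i : ℂ) * (X j * pderiv i p) - C (lam i : ℂ) * (X j * pderiv j p)
        - (C (lam j : ℂ) * (X i * pderiv i p) - C (lam j : ℂ) * (X i * pderiv j p)) := by ring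
  have h2 : X i * X j * (pderiv i (pderiv i p) - 2 * pderiv i (pderiv j p)
      + pderiv j (pderiv j p)) = X i * X j * pderiv i (pderiv i p)
        - X i * X j * pderiv i (pderiv j p) - X i * X j * pderiv i (pderiv j p)
        + X i * X j * pderiv j (pderiv j p) := by ring
  rw [h1, h2]
  have h3 := fun a b c => C_mul_mem_restrictTotalDegree (X_mul_pderiv_mem hp a b) c
  have h4 := X_mul_X_mul_pderiv_mem hp i j
  exact add_mem (C_mul_mem_restrictTotalDegree hp _) (sub_mem (sub_mem (sub_mem (h3 _ _ _) (h3 _ _ _))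
    (sub_mem (h3 _ _ _) (h3 _ _ _))) (add_mem (sub_mem (sub_mem (h4 _ _) (h4 _ _)) (h4 _ _))
    (h4 _ _)))

lemma ham_mem {m : ℕ} (lam : Fin N → ℕ) {p : MvPolynomial (Fin N) ℂ}
    (hp : p ∈ restrictTotalDegree (Fin N) ℂ m) (r : Fin N → Fin N → ℂ) (i : Fin N) :
    ham (polyE lam) polyF (polyH lam) r i p ∈ restrictTotalDegree (Fin N) ℂ m := by
  rw [ham, LinearMap.sum_apply]
  exact Submodule.sum_mem _ fun j hj => Submodule.smul_mem _ _
    (omega_mem lam hp (Finset.ne_of_mem_erase hj).symm)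

/-- The raising operator lowers the degree, hence is locally nilpotent. -/
lemma sum_polyE_pow_eq_zero (lam : Fin N → ℕ) (m : ℕ) {p : MvPolynomial (Fin N) ℂ}
    (hp : p ∈ restrictTotalDegree (Fin N) ℂ m) : ((∑ i, polyE lam i) ^ (m + 1)) p = 0 := by
  induction m generalizing p with
  | zero =>
    rw [zero_add, pow_one, LinearMap.sum_apply]
    refine Finset.sum_eq_zero fun i _ => ?_
    rw [polyE_apply, pderiv_eq_zero_of_mem hp, map_zero, mul_zero, mul_zero, sub_zero]
  | succ m ih =>
    rw [pow_succ, Module.End.mul_apply]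
    refine ih ?_
    rw [LinearMap.sum_apply]
    exact Submodule.sum_mem _ fun i _ => polyE_mem lam hp i

/-- The multiples of the singular vector `x_i ^ (λ_i + 1)`. -/
def singularMultiples (lam : Fin N → ℕ) (i : Fin N) : Submodule ℂ (MvPolynomial (Fin N) ℂ) where
  carrier := {p | X i ^ (lam i + 1) ∣ p}
  add_mem' := dvd_add
  zero_mem' := dvd_zero _
  smul_mem' c p hp := by
    change _ ∣ c • p
    rw [smul_eq_C_mul]; exact hp.mul_left _

lemma mem_singularMultiples {lam : Fin N → ℕ} {i : Fin N} {p : MvPolynomial (Fin N) ℂ} :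
    p ∈ singularMultiples lam i ↔ X i ^ (lam i + 1) ∣ p := Iff.rfl

/-- The coefficient (k + 1)(λ_i − k) of the lowest power of x_i vanishes only for k = λ_i. This is
why x_i^(λ_i+1) generates a submodule, and why no lower positive power can divide a singular vector
exactly. -/
lemma polyE_X_pow_mul (lam : Fin N → ℕ) (i : Fin N) (k : ℕ) (q : MvPolynomial (Fin N) ℂ) :
    polyE lam i (X i ^ (k + 1) * q) = C (((k : ℂ) + 1) * (lam i - k)) * (X i ^ k * q)
      + X i ^ (k + 1) * (C (lam i - 2 * ((k : ℂ) + 1)) * pderiv i q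
        - X i * pderiv i (pderiv i q)) := by
  rw [polyE_apply]
  simp only [pderiv_mul, pderiv_pow, pderiv_X_self, map_add, map_sub, map_mul, map_natCast,
    map_one, map_ofNat, Nat.add_sub_cancel]
  cases k with
  | zero => simp; ring
  | succ k =>
    simp only [Nat.add_sub_cancel, Nat.cast_add, Nat.cast_one, map_add,
      Derivation.map_natCast, pderiv_one]
    ring

lemma polyE_X_pow_mul_of_ne (lam : Fin N → ℕ) {i j : Fin N} (hij : i ≠ j) (k : ℕ)
    (q : MvPolynomial (Fin N) ℂ) : polyE lam j (X i ^ k * q) = X i ^ k * polyE lam j q := by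
  simp only [polyE_apply, pderiv_mul, pderiv_pow, pderiv_X_of_ne hij, mul_zero, zero_mul, zero_add]
  ring

lemma polyE_mem_singularMultiples (lam : Fin N → ℕ) (i j : Fin N) {p : MvPolynomial (Fin N) ℂ}
    (hp : p ∈ singularMultiples lam i) : polyE lam j p ∈ singularMultiples lam i := by
  obtain ⟨q, rfl⟩ := hp
  by_cases hij : i = j
  · subst hij
    rw [polyE_X_pow_mul, sub_self, mul_zero, C_0, zero_mul, zero_add]
    exact dvd_mul_right _ _
  · rw [polyE_X_pow_mul_of_ne lam hij]
    exact dvd_mul_right _ _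

lemma polyF_mem_singularMultiples (lam : Fin N → ℕ) (i j : Fin N) {p : MvPolynomial (Fin N) ℂ}
    (hp : p ∈ singularMultiples lam i) : polyF j p ∈ singularMultiples lam i :=
  Dvd.dvd.mul_left hp _

lemma polyH_mem_singularMultiples (lam : Fin N → ℕ) (i j : Fin N) {p : MvPolynomial (Fin N) ℂ}
    (hp : p ∈ singularMultiples lam i) : polyH lam j p ∈ singularMultiples lam i := by
  obtain ⟨q, rfl⟩ := hp
  rw [polyH_apply, pderiv_mul, pderiv_pow]
  have h : X j * (((lam i + 1 : ℕ) : MvPolynomial (Fin N) ℂ) * X i ^ (lam i + 1 - 1) *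
      pderiv j (X i)) = X i ^ (lam i + 1) * (((lam i + 1 : ℕ) : MvPolynomial (Fin N) ℂ) *
        pderiv j (X i)) := by
    by_cases hij : i = j
    · subst hij; rw [Nat.add_sub_cancel]; ring
    · rw [pderiv_X_of_ne hij]; ring
  refine ⟨C (lam j : ℂ) * q - 2 * (((lam i + 1 : ℕ) : MvPolynomial (Fin N) ℂ) *
        pderiv j (X i) * q) - 2 * (X j * pderiv j q), ?_⟩
  linear_combination -2 * q * h

lemma omega_mem_singularMultiples (lam : Fin N → ℕ) (i j k : Fin N) {p : MvPolynomial (Fin N) ℂ}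
    (hp : p ∈ singularMultiples lam i) :
    omega (polyE lam) polyF (polyH lam) j k p ∈ singularMultiples lam i := by
  simp only [omega, LinearMap.add_apply, LinearMap.smul_apply, Module.End.mul_apply]
  exact add_mem (add_mem
    (polyE_mem_singularMultiples _ _ _ (polyF_mem_singularMultiples _ _ _ hp))
    (polyF_mem_singularMultiples _ _ _ (polyE_mem_singularMultiples _ _ _ hp)))
    (Submodule.smul_mem _ _
      (polyH_mem_singularMultiples _ _ _ (polyH_mem_singularMultiples _ _ _ hp)))

lemma ham_mem_singularMultiples (lam : Fin N → ℕ) (i j : Fin N) {p : MvPolynomial (Fin N) ℂ}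
    (hp : p ∈ singularMultiples lam i) (r : Fin N → Fin N → ℂ) :
    ham (polyE lam) polyF (polyH lam) r j p ∈ singularMultiples lam i := by
  rw [ham, LinearMap.sum_apply]
  exact Submodule.sum_mem _ fun k _ => Submodule.smul_mem _ _ (omega_mem_singularMultiples _ _ _ _ hp)

lemma sum_polyE_mem_singularMultiples (lam : Fin N → ℕ) (i : Fin N) {p : MvPolynomial (Fin N) ℂ}
    (hp : p ∈ singularMultiples lam i) : (∑ j, polyE lam j) p ∈ singularMultiples lam i := by
  rw [LinearMap.sum_apply]
  exact Submodule.sum_mem _ fun k _ => polyE_mem_singularMultiples _ _ _ hp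

lemma toStates_eq_zero_of_mem (lam : Fin N → ℕ) (i : Fin N) {p : MvPolynomial (Fin N) ℂ}
    (hp : p ∈ singularMultiples lam i) : toStates lam p = 0 := by
  obtain ⟨q, rfl⟩ := hp
  rw [toStates_eq_zero_iff]
  intro a ha
  rw [X_pow_eq_monomial, coeff_monomial_mul', if_neg]
  intro h
  have := h i
  rw [Finsupp.single_eq_same] at this
  have := ha i
  omega

/-- A vector that is singular modulo the multiples of `x_i ^ (λ_i + 1)` but not such a multiple is
not divisible by `x_i`. -/
lemma not_X_dvd_of_singular {lam : Fin N → ℕ} {i : Fin N} {u : MvPolynomial (Fin N) ℂ}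
    (hu : u ∉ singularMultiples lam i) (he : (∑ j, polyE lam j) u ∈ singularMultiples lam i) :
    ¬ X i ∣ u := by
  classical
  intro hX
  have hex : ∃ k, ¬ X i ^ k ∣ u := ⟨_, hu⟩
  -- Here x_i^(k+1) is the exact power of x_i dividing u, and 1 ≤ k + 1 ≤ λ_i.
  obtain ⟨k, hk⟩ : ∃ k, Nat.find hex = k + 2 := by
    have h1 : ∀ k, k < 2 → Nat.find hex ≠ k := by
      intro k hk h
      have := Nat.find_spec hex
      rw [h] at this
      interval_cases k
      · simp at this
      · rw [pow_one] at this; exact this hX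
    exact ⟨Nat.find hex - 2, by have := h1 0; have := h1 1; omega⟩
  have hle : k + 1 ≤ lam i := by
    have : Nat.find hex ≤ lam i + 1 := Nat.find_le hu
    omega
  obtain ⟨q, rfl⟩ : X i ^ (k + 1) ∣ u := not_not.mp (Nat.find_min hex (m := k + 1) (by omega))
  have hdvd : X i ^ (k + 1) ∣ (∑ j, polyE lam j) (X i ^ (k + 1) * q) :=
    (pow_dvd_pow _ (by omega)).trans he
  rw [LinearMap.sum_apply, ← Finset.add_sum_erase _ _ (Finset.mem_univ i), polyE_X_pow_mul,
    add_assoc] at hdvd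
  -- Every other term of e u is divisible by x_i^(k+1); since k < λ_i, the remaining term forces one
  -- more factor x_i in u, against exactness.
  have h2 : X i ^ (k + 1) ∣ C (((k : ℂ) + 1) * (lam i - k)) * (X i ^ k * q) := by
    refine (dvd_add_left (dvd_add (dvd_mul_right _ _) (Finset.dvd_sum fun j hj => ?_))).mp hdvd
    rw [polyE_X_pow_mul_of_ne lam (Finset.ne_of_mem_erase hj).symm]
    exact dvd_mul_right _ _
  have hc : ((k : ℂ) + 1) * (lam i - k) ≠ 0 := by
    refine mul_ne_zero (Nat.cast_add_one_ne_zero k) (sub_ne_zero.mpr ?_)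
    exact_mod_cast (show lam i ≠ k by omega)
  have h3 : X i ^ (k + 1) ∣ X i ^ k * q := by
    have := h2.mul_left (C (((k : ℂ) + 1) * (lam i - k))⁻¹)
    rwa [← mul_assoc, ← C_mul, inv_mul_cancel₀ hc, C_1, one_mul] at this
  have h4 : X i ∣ q := by
    rw [pow_succ] at h3
    exact (mul_dvd_mul_iff_left (pow_ne_zero _ (X_ne_zero i))).mp h3
  refine Nat.find_spec hex ?_
  rw [hk, pow_succ (X i) (k + 1)]
  exact mul_dvd_mul_left _ h4

/-- Modulo x_i the polynomial u agrees with its substitution x_i = 0 (the map `s`). If u vanished on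
the hyperplane, that substitution would be the zero polynomial. -/
lemma exists_eval_ne_zero_of_not_X_dvd {i : Fin N} {u : MvPolynomial (Fin N) ℂ} (hu : ¬ X i ∣ u) :
    ∃ x : Fin N → ℂ, x i = 0 ∧ eval x u ≠ 0 := by
  by_contra hcon
  push Not at hcon
  let s : MvPolynomial (Fin N) ℂ →ₐ[ℂ] MvPolynomial (Fin N) ℂ := aeval (Function.update X i 0)
  have h1 : ∀ p, X i ∣ p - s p := by
    intro p
    induction p using MvPolynomial.induction_on with
    | C a => simp [s]
    | add p q hp hq => rw [map_add, add_sub_add_comm]; exact dvd_add hp hq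
    | mul_X p j hp =>
      rw [map_mul]
      have : p * X j - s p * s (X j) = (p - s p) * X j + s p * (X j - s (X j)) := by ring
      rw [this]
      refine dvd_add (hp.mul_right _) (Dvd.dvd.mul_left ?_ _)
      by_cases hij : j = i
      · subst hij; simp [s]
      · simp [s, Function.update_of_ne hij]
  have h2 : s u = 0 := by
    refine MvPolynomial.funext fun x => ?_
    rw [map_zero]
    have : ∀ p, eval x (s p) = eval (Function.update x i 0) p := by
      intro p
      induction p using MvPolynomial.induction_on with
      | C a => simp [s]
      | add p q hp hq => rw [map_add, map_add, map_add, hp, hq]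
      | mul_X p j hp =>
        rw [map_mul, map_mul, map_mul, hp]
        by_cases hij : j = i
        · subst hij; simp [s]
        · simp [s, Function.update_of_ne hij]
    rw [this u]
    exact hcon _ (Function.update_self _ _ _)
  exact hu (by simpa [h2] using h1 u)

/-! ### Absence of logarithms -/

/-- The local solutions of `operD y = 0` at `z_i` contain no logarithms: there is a solution modulo
`(t - z_i) ^ (λ_i + 1)` that does not vanish at `z_i`. -/
def NoLogarithm (lam : Fin N → ℕ) (z μ : Fin N → ℂ) (i : Fin N) : Prop :=
  ∃ g : Polynomial ℂ, g.eval (z i) ≠ 0 ∧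
    (Polynomial.X - Polynomial.C (z i)) ^ (lam i + 1) ∣ operD lam z μ g

/-- At t = z_i the i-th coordinate of the line is 0 for any b_i, so b_i is free to be chosen with ∑
b_j = 0. -/
lemma exists_line_through (z : Fin N → ℂ) (hz : Function.Injective z) {i : Fin N} {x : Fin N → ℂ}
    (hx : x i = 0) : ∃ b : Fin N → ℂ, ∑ j, b j = 0 ∧ (fun j => b j * (z i - z j)) = x := by
  refine ⟨Function.update (fun j => x j / (z i - z j)) i
    (-∑ j ∈ Finset.univ.erase i, x j / (z i - z j)), ?_, ?_⟩
  · rw [← Finset.add_sum_erase _ _ (Finset.mem_univ i), Function.update_self,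
      Finset.sum_congr rfl fun j hj => Function.update_of_ne (Finset.ne_of_mem_erase hj) _ _]
    exact neg_add_cancel _
  · funext j
    by_cases hj : j = i
    · subst hj; rw [sub_self, mul_zero, hx]
    · rw [Function.update_of_ne hj, div_mul_cancel₀ _ (sub_ne_zero.mpr (hz.ne (Ne.symm hj)))]

lemma lineHom_dvd_of_mem {lam : Fin N → ℕ} {i : Fin N} {p : MvPolynomial (Fin N) ℂ}
    (hp : p ∈ singularMultiples lam i) (z b : Fin N → ℂ) :
    (Polynomial.X - Polynomial.C (z i)) ^ (lam i + 1) ∣ lineHom z b p := by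
  obtain ⟨q, rfl⟩ := hp
  rw [map_mul, map_pow, lineHom_X, mul_pow, mul_assoc, mul_left_comm]
  exact dvd_mul_right _ _

/-- Lift v to an eigenvector modulo the multiples of x_i^(λ_i+1) for the single index i, and apply
the last power of E = ∑ e_j that stays outside these multiples. The Hamiltonians commute with E, so
the eigenvalues do not change. -/
lemma exists_eigenvector_mod_singularMultiples {lam : Fin N → ℕ} {z μ : Fin N → ℂ}
    (hz : Function.Injective z) {v : States lam} (hv : IsGaudinEigenvector lam z μ v) (i : Fin N) :
    ∃ u : MvPolynomial (Fin N) ℂ, u ∉ singularMultiples lam i ∧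
      (∀ j, ham (polyE lam) polyF (polyH lam) (fun i j => (z i - z j)⁻¹) j u - C (μ j) * u ∈
        singularMultiples lam i) ∧ (∑ j, polyE lam j) u ∈ singularMultiples lam i := by
  set r : Fin N → Fin N → ℂ := fun i j => (z i - z j)⁻¹ with hr
  obtain ⟨p, hp, hpv⟩ := exists_toStates_eq lam v
  obtain ⟨u, huR, hu1, hu2⟩ := exists_joint_eigenvector_mod
    (X := ham (polyE lam) polyF (polyH lam) r) (K := singularMultiples lam i)
    ((poly_sites lam).ham_commute (isRMatrix_inv_sub hz)) (fun j p hp => ham_mem lam hp r j)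
    (fun j p hp => ham_mem_singularMultiples lam i j hp r) (toStates_ham lam r)
    (fun p hp => toStates_eq_zero_of_mem lam i hp) hp (μ := μ) (by rw [hpv]; exact hv)
  set E := ∑ j, polyE lam j with hE
  have hEm : ∀ (k : ℕ) {q}, q ∈ singularMultiples lam i → (E ^ k) q ∈ singularMultiples lam i := by
    intro k q hq
    induction k with
    | zero => exact hq
    | succ k ih =>
      rw [pow_succ', Module.End.mul_apply]
      exact sum_polyE_mem_singularMultiples lam i ih
  obtain ⟨k, hk1, hk2⟩ := exists_pow_apply_mem_of_not_mem hu1 ⟨_, by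
    rw [sum_polyE_pow_eq_zero lam _ huR]; exact zero_mem _⟩
  refine ⟨(E ^ k) u, hk1, fun j => ?_, hk2⟩
  · have hc := (((poly_sites lam).ham_commute_sum r j).1.pow_right k).eq
    have : ham (polyE lam) polyF (polyH lam) r j ((E ^ k) u) - C (μ j) * (E ^ k) u =
        (E ^ k) (ham (polyE lam) polyF (polyH lam) r j u - μ j • u) := by
      rw [map_sub, ← smul_eq_C_mul, map_smul]
      congr 1
      exact LinearMap.congr_fun hc _
    rw [this]
    exact hEm k (hu2 j)

/-- The lift u is not divisible by x_i, so some line meets the hyperplane x_i = 0 at t = z_i in a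
point where u ≠ 0. On that line, the errors H_j u − μ_j u restrict to multiples of (t −
z_i)^(λ_i+1), and by separation of variables so does D_μ of the restriction of u. -/
theorem noLogarithm_of_eigenvector {lam : Fin N → ℕ} {z μ : Fin N → ℂ}
    (hz : Function.Injective z) {v : States lam} (hv : IsGaudinEigenvector lam z μ v) (i : Fin N) :
    NoLogarithm lam z μ i := by
  obtain ⟨u, hu, hH, he⟩ := exists_eigenvector_mod_singularMultiples hz hv i
  obtain ⟨x, hx, hxu⟩ := exists_eval_ne_zero_of_not_X_dvd (not_X_dvd_of_singular hu he)
  obtain ⟨b, hb, rfl⟩ := exists_line_through z hz hx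
  refine ⟨lineHom z b u, by rwa [eval_lineHom], ?_⟩
  rw [operD_lineHom lam hz μ hb]
  exact Finset.dvd_sum fun j _ => (lineHom_dvd_of_mem (hH j) z b).mul_left _

theorem sum_eq_zero_of_eigenvector {lam : Fin N → ℕ} {z μ : Fin N → ℂ} {v : States lam}
    (hv : IsGaudinEigenvector lam z μ v) : ∑ i, μ i = 0 := by
  have h := LinearMap.congr_fun ((states_sites lam).sum_ham (r := fun i j => (z i - z j)⁻¹)
    fun i j => by rw [← inv_neg, neg_sub]) v
  rw [LinearMap.sum_apply, LinearMap.zero_apply] at h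
  simp only [← hamiltonian_eq, hv.2, ← Finset.sum_smul] at h
  exact (smul_eq_zero.mp h).resolve_right hv.1

end

section
open Polynomial
variable {N : ℕ}

/-! ### Polynomial solutions of the oper equation -/

lemma derivative_X_sub_C_pow_mul (a : ℂ) (k : ℕ) (g : ℂ[X]) :
    derivative ((X - C a) ^ (k + 1) * g) =
      (X - C a) ^ k * (C ((k : ℂ) + 1) * g + (X - C a) * derivative g) := by
  rw [derivative_mul, derivative_X_sub_C_pow, Nat.add_sub_cancel]
  push_cast
  rw [C_add, C_1, map_natCast]
  ring

lemma exists_operB_eq (lam : Fin N → ℕ) (z : Fin N → ℂ) (i : Fin N) :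
    ∃ B', operB lam z = C (lam i : ℂ) * nodalErase z i + (X - C (z i)) * B' := by
  have h : X - C (z i) ∣ ∑ j ∈ Finset.univ.erase i, C (lam j : ℂ) * nodalErase z j := by
    refine Finset.dvd_sum fun j hj => Dvd.dvd.mul_left ?_ _
    rw [dvd_iff_isRoot]
    exact eval_nodalErase_of_ne z (Finset.ne_of_mem_erase hj)
  obtain ⟨B', hB'⟩ := h
  exact ⟨B', by rw [operB, ← Finset.add_sum_erase _ _ (Finset.mem_univ i), hB']⟩

/-- The indicial equation of the oper at `z_i`. -/
lemma exists_operD_X_sub_C_pow_mul (lam : Fin N → ℕ) (z μ : Fin N → ℂ) (i : Fin N) (k : ℕ)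
    (g : ℂ[X]) : ∃ R, operD lam z μ ((X - C (z i)) ^ (k + 1) * g) =
      (X - C (z i)) ^ k * (C (((k : ℂ) + 1) * (k - lam i)) * nodalErase z i * g
        + (X - C (z i)) * R) := by
  obtain ⟨B', hB'⟩ := exists_operB_eq lam z i
  set s := X - C (z i) with hs
  rw [operD_apply, hB', nodal_eq z i, derivative_X_sub_C_pow_mul, ← hs]
  cases k with
  | zero =>
    have hd : derivative (s ^ 0 * (C (((0 : ℕ) : ℂ) + 1) * g + s * derivative g)) =
        2 * derivative g + s * derivative (derivative g) := by
      simp [hs]; ring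
    rw [hd]
    refine ⟨nodalErase z i * (2 * derivative g + s * derivative (derivative g))
      - C (lam i : ℂ) * nodalErase z i * derivative g - B' * (g + s * derivative g)
      + operC z (fun i => vacuumValue lam z i - μ i) * g, ?_⟩
    simp only [Nat.cast_zero, zero_add, zero_sub, one_mul, C_neg, C_1, pow_zero, pow_one]
    ring
  | succ k =>
    rw [derivative_X_sub_C_pow_mul, ← hs]
    have hd : derivative (C (((k + 1 : ℕ) : ℂ) + 1) * g + s * derivative g) =
        C ((k : ℂ) + 3) * derivative g + s * derivative (derivative g) := by
      have : (C ((k : ℂ) + 3) : ℂ[X]) = C (((k + 1 : ℕ) : ℂ) + 1) + 1 := by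
        rw [← C_1, ← C_add]; congr 1; push_cast; ring
      rw [this]
      simp [hs]; ring
    rw [hd]
    refine ⟨nodalErase z i * (C ((k : ℂ) + 1) * derivative g + (C ((k : ℂ) + 3) * derivative g
        + s * derivative (derivative g))) - C (lam i : ℂ) * nodalErase z i * derivative g
        - B' * (C ((k : ℂ) + 2) * g + s * derivative g)
        + operC z (fun i => vacuumValue lam z i - μ i) * g, ?_⟩
    have e1 : (C (((k + 1 : ℕ) : ℂ) + 1) : ℂ[X]) = C (k : ℂ) + 2 := by
      rw [← map_ofNat C, ← C_add]; congr 1; push_cast; ring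
    have e2 : (C ((((k + 1 : ℕ) : ℂ) + 1) * (((k + 1 : ℕ) : ℂ) - lam i)) : ℂ[X]) =
        (C (k : ℂ) + 2) * (C (k : ℂ) + 1 - C (lam i : ℂ)) := by
      rw [← map_ofNat C, ← C_1, ← C_add, ← C_add, ← C_sub, ← C_mul]; congr 1; push_cast; ring
    have e3 : (C ((k : ℂ) + 2) : ℂ[X]) = C (k : ℂ) + 2 := by
      rw [← map_ofNat C, ← C_add]
    have e4 : (C ((k : ℂ) + 1) : ℂ[X]) = C (k : ℂ) + 1 := by rw [C_add, C_1]
    rw [e1, e2, e3, e4]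
    ring

/-- The exponent λ_i + 1 is a root of the indicial equation, so the expected loss of one order at
z_i does not occur. -/
lemma operD_dvd_of_dvd (lam : Fin N → ℕ) (z μ : Fin N → ℂ) (i : Fin N) {y : ℂ[X]}
    (h : (X - C (z i)) ^ (lam i + 1) ∣ y) : (X - C (z i)) ^ (lam i + 1) ∣ operD lam z μ y := by
  obtain ⟨g, rfl⟩ := h
  obtain ⟨R, hR⟩ := exists_operD_X_sub_C_pow_mul lam z μ i (lam i) g
  rw [hR, sub_self, mul_zero, C_0, zero_mul, zero_mul, zero_add, ← mul_assoc, ← pow_succ]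
  exact dvd_mul_right _ _

/-- The positive root of the indicial equation is λ_i + 1. -/
lemma rootMultiplicity_eq_of_operD_eq_zero {lam : Fin N → ℕ} {z μ : Fin N → ℂ}
    (hz : Function.Injective z) {i : Fin N} {y : ℂ[X]} (hy : y ≠ 0) (hD : operD lam z μ y = 0)
    (hi : y.eval (z i) = 0) : y.rootMultiplicity (z i) = lam i + 1 := by
  obtain ⟨g, hg, hg'⟩ := exists_eq_pow_rootMultiplicity_mul_and_not_dvd y hy (z i)
  have hpos : 0 < y.rootMultiplicity (z i) := (rootMultiplicity_pos hy).mpr hi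
  obtain ⟨k, hk⟩ := Nat.exists_eq_succ_of_ne_zero hpos.ne'
  rw [hk] at hg ⊢
  rw [dvd_iff_isRoot, IsRoot] at hg'
  obtain ⟨R, hR⟩ := exists_operD_X_sub_C_pow_mul lam z μ i k g
  rw [hg] at hD
  change operD lam z μ ((X - C (z i)) ^ (k + 1) * g) = 0 at hD
  rw [hR] at hD
  have h1 := (mul_eq_zero.mp hD).resolve_left (pow_ne_zero _ (X_sub_C_ne_zero _))
  have h2 := congrArg (eval (z i)) h1
  simp only [eval_add, eval_mul, eval_C, eval_sub, eval_X, sub_self, zero_mul, add_zero,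
    eval_zero] at h2
  have h3 := (mul_eq_zero.mp ((mul_eq_zero.mp h2).resolve_right hg')).resolve_right
    (eval_nodalErase_self_ne_zero hz i)
  have h4 := (mul_eq_zero.mp h3).resolve_left (Nat.cast_add_one_ne_zero k)
  rw [sub_eq_zero, Nat.cast_inj] at h4
  rw [Nat.succ_eq_add_one, h4]

/-- Uniqueness at an ordinary point: a zero of order k + 2 ≥ 2 would leave the lowest order term (k
+ 1)(k + 2) ∏ (t − z_i) g(t) in D_μ y, with nothing to cancel it. -/
lemma eq_zero_of_operD_eq_zero_of_double_root {lam : Fin N → ℕ} {z μ : Fin N → ℂ} {t : ℂ}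
    (ht : ∀ i, t ≠ z i) {y : ℂ[X]} (hD : operD lam z μ y = 0) (h0 : y.eval t = 0)
    (h1 : (derivative y).eval t = 0) : y = 0 := by
  by_contra hy
  have h2 : 1 < y.rootMultiplicity t :=
    (one_lt_rootMultiplicity_iff_isRoot hy).mpr ⟨h0, h1⟩
  obtain ⟨g, hg, hg'⟩ := exists_eq_pow_rootMultiplicity_mul_and_not_dvd y hy t
  obtain ⟨k, hk⟩ : ∃ k, y.rootMultiplicity t = k + 2 := ⟨y.rootMultiplicity t - 2, by omega⟩
  rw [hk] at hg
  rw [dvd_iff_isRoot, IsRoot] at hg'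
  have hd1 : derivative y = (X - C t) ^ (k + 1) *
      (C (((k + 1 : ℕ) : ℂ) + 1) * g + (X - C t) * derivative g) := by
    rw [hg]; exact derivative_X_sub_C_pow_mul t (k + 1) g
  have hd2 := derivative_X_sub_C_pow_mul t k
    (C (((k + 1 : ℕ) : ℂ) + 1) * g + (X - C t) * derivative g)
  rw [← hd1] at hd2
  rw [operD_apply, hd2, hd1, hg] at hD
  have h3 : (X - C t) ^ k * (nodal z * (C ((k : ℂ) + 1) * (C (((k + 1 : ℕ) : ℂ) + 1) * g
      + (X - C t) * derivative g) + (X - C t) * derivative (C (((k + 1 : ℕ) : ℂ) + 1) * g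
      + (X - C t) * derivative g)) - operB lam z * ((X - C t) *
      (C (((k + 1 : ℕ) : ℂ) + 1) * g + (X - C t) * derivative g))
      + operC z (fun i => vacuumValue lam z i - μ i) * ((X - C t) ^ 2 * g)) = 0 := by
    rw [← hD]; ring
  have h4 := (mul_eq_zero.mp h3).resolve_left (pow_ne_zero _ (X_sub_C_ne_zero _))
  have h5 := congrArg (eval t) h4
  simp only [eval_add, eval_mul, eval_C, eval_sub, eval_X, sub_self, zero_mul, add_zero, mul_zero,
    sub_zero, eval_pow, ne_eq, OfNat.ofNat_ne_zero, not_false_eq_true, zero_pow, eval_zero] at h5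
  refine (mul_ne_zero (eval_nodal_ne_zero ht) (mul_ne_zero (Nat.cast_add_one_ne_zero k)
    (mul_ne_zero (Nat.cast_add_one_ne_zero (k + 1)) hg'))) h5

/-! The behaviour at infinity. -/

lemma natDegree_nodal (z : Fin N → ℂ) : (nodal z).natDegree = N := by
  rw [nodal, natDegree_finsetProd_X_sub_C_eq_card, Finset.card_univ, Fintype.card_fin]

lemma nodal_monic (z : Fin N → ℂ) : (nodal z).Monic := monic_prod_X_sub_C _ _

lemma natDegree_nodalErase_lt (z : Fin N → ℂ) (i : Fin N) : (nodalErase z i).natDegree < N := by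
  rw [nodalErase, natDegree_finsetProd_X_sub_C_eq_card, Finset.card_erase_of_mem
    (Finset.mem_univ i), Finset.card_univ, Fintype.card_fin]
  have := i.pos
  omega

lemma natDegree_operC_le (z ν : Fin N → ℂ) : (operC z ν).natDegree ≤ N :=
  natDegree_sum_le_of_forall_le _ _ fun i _ =>
    (natDegree_C_mul_le _ _).trans (natDegree_nodalErase_lt z i).le

lemma coeff_operC (z ν : Fin N → ℂ) : (operC z ν).coeff N = 0 := by
  rw [operC, finsetSum_coeff]
  refine Finset.sum_eq_zero fun i _ => ?_
  rw [coeff_C_mul, coeff_eq_zero_of_natDegree_lt (natDegree_nodalErase_lt z i), mul_zero]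

lemma X_mul_operC (z ν : Fin N → ℂ) :
    X * operC z ν = C (∑ i, ν i) * nodal z + operC z fun i => ν i * z i := by
  simp only [operC, map_sum, Finset.sum_mul, Finset.mul_sum]
  rw [← Finset.sum_add_distrib]
  refine Finset.sum_congr rfl fun i _ => ?_
  rw [nodal_eq z i, C_mul]
  ring

/-- Since ∑ ν_i = 0, the zeroth order term has degree at most N − 2 and X² D_μ has a leading part of
Euler type. In the last line the factors `operC` have degree less than N, so they do not contribute
to the indicial equation at infinity. -/
lemma X_sq_mul_operD {lam : Fin N → ℕ} {z μ : Fin N → ℂ}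
    (hμ : ∑ i, (vacuumValue lam z i - μ i) = 0) (y : ℂ[X]) :
    X ^ 2 * operD lam z μ y =
      nodal z * (X ^ 2 * derivative (derivative y) - C (∑ i, (lam i : ℂ)) * (X * derivative y)
        + C (∑ i, (vacuumValue lam z i - μ i) * z i) * y)
      + (operC z (fun i => (vacuumValue lam z i - μ i) * z i * z i) * y
        - operC z (fun i => (lam i : ℂ) * z i) * (X * derivative y)) := by
  have hB : X * operB lam z = C (∑ i, (lam i : ℂ)) * nodal z + operC z fun i => (lam i : ℂ) * z i :=
    X_mul_operC z fun i => (lam i : ℂ)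
  have h1 := X_mul_operC z fun i => vacuumValue lam z i - μ i
  have h2 := X_mul_operC z fun i => (vacuumValue lam z i - μ i) * z i
  rw [hμ, C_0, zero_mul, zero_add] at h1
  rw [operD_apply]
  linear_combination (-X * derivative y) * hB + X * y * h1 + y * h2

lemma natDegree_X_mul_derivative_le (y : ℂ[X]) : (X * derivative y).natDegree ≤ y.natDegree := by
  by_cases h : derivative y = 0
  · rw [h, mul_zero, natDegree_zero]; exact Nat.zero_le _
  · have h1 : y.natDegree ≠ 0 := fun h2 => h (by rw [eq_C_of_natDegree_eq_zero h2, derivative_C])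
    rw [natDegree_X_mul h]
    have := natDegree_derivative_lt h1
    omega

lemma natDegree_X_sq_mul_derivative_le (y : ℂ[X]) :
    (X ^ 2 * derivative (derivative y)).natDegree ≤ y.natDegree := by
  have h : X ^ 2 * derivative (derivative y) =
      X * derivative (X * derivative y) - X * derivative y := by
    rw [derivative_mul, derivative_X]; ring
  rw [h]
  have h1 := natDegree_X_mul_derivative_le y
  exact (natDegree_sub_le _ _).trans
    (max_le ((natDegree_X_mul_derivative_le _).trans h1) h1)

lemma natDegree_indicial_le (y : ℂ[X]) (a b : ℂ) :
    (X ^ 2 * derivative (derivative y) - C a * (X * derivative y) + C b * y).natDegree ≤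
      y.natDegree :=
  natDegree_add_le_of_degree_le ((natDegree_sub_le _ _).trans
    (max_le (natDegree_X_sq_mul_derivative_le y)
    ((natDegree_C_mul_le _ _).trans (natDegree_X_mul_derivative_le y)))) (natDegree_C_mul_le _ _)

lemma natDegree_X_sq_mul_operD_le {lam : Fin N → ℕ} {z μ : Fin N → ℂ}
    (hμ : ∑ i, (vacuumValue lam z i - μ i) = 0) (y : ℂ[X]) :
    (X ^ 2 * operD lam z μ y).natDegree ≤ N + y.natDegree := by
  rw [X_sq_mul_operD hμ]
  refine natDegree_add_le_of_degree_le ?_ ((natDegree_sub_le _ _).trans (max_le ?_ ?_))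
  · exact natDegree_mul_le_of_le (natDegree_nodal z).le (natDegree_indicial_le y _ _)
  · exact natDegree_mul_le_of_le (natDegree_operC_le _ _) le_rfl
  · exact natDegree_mul_le_of_le (natDegree_operC_le _ _) (natDegree_X_mul_derivative_le y)

lemma coeff_X_mul_derivative (y : ℂ[X]) (n : ℕ) :
    (X * derivative y).coeff n = n * y.coeff n := by
  cases n with
  | zero => simp
  | succ n => rw [coeff_X_mul, coeff_derivative]; push_cast; ring

/-- The indicial equation of the oper at infinity. -/
lemma natDegree_of_operD_eq_zero {lam : Fin N → ℕ} {z μ : Fin N → ℂ}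
    (hμ : ∑ i, (vacuumValue lam z i - μ i) = 0) {y : ℂ[X]} (hy : y ≠ 0)
    (hD : operD lam z μ y = 0) :
    (y.natDegree : ℂ) * (∑ i, (lam i : ℂ) + 1 - y.natDegree) =
      ∑ i, (vacuumValue lam z i - μ i) * z i := by
  have h := congrArg (fun p => coeff p (N + y.natDegree)) (X_sq_mul_operD (lam := lam) hμ y)
  simp only [hD, mul_zero, coeff_zero, coeff_add, coeff_sub] at h
  rw [coeff_mul_add_eq_of_natDegree_le (natDegree_nodal z).le (natDegree_indicial_le y _ _),
    coeff_mul_add_eq_of_natDegree_le (natDegree_operC_le _ _) le_rfl,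
    coeff_mul_add_eq_of_natDegree_le (natDegree_operC_le _ _) (natDegree_X_mul_derivative_le y),
    coeff_operC, coeff_operC, zero_mul, zero_mul, sub_zero, add_zero] at h
  have h1 : (nodal z).coeff N = 1 := by
    have := nodal_monic z
    rwa [Monic, leadingCoeff, natDegree_nodal] at this
  have h2 : X ^ 2 * derivative (derivative y) =
      X * derivative (X * derivative y) - X * derivative y := by
    rw [derivative_mul, derivative_X]; ring
  rw [h1, one_mul, coeff_add, coeff_sub, h2, coeff_sub, coeff_C_mul, coeff_C_mul,
    coeff_X_mul_derivative, coeff_X_mul_derivative] at h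
  have h3 : y.coeff y.natDegree ≠ 0 := leadingCoeff_ne_zero.mpr hy
  refine mul_right_cancel₀ h3 ?_
  linear_combination h
end

section
open Polynomial
variable {N : ℕ}

/-! ### Two independent polynomial solutions -/

lemma sum_vacuumValue (lam : Fin N → ℕ) (z : Fin N → ℂ) : ∑ i, vacuumValue lam z i = 0 := by
  have h : ∀ i, vacuumValue lam z i =
      ∑ j, if j = i then 0 else (z i - z j)⁻¹ * ((lam i : ℂ) * lam j / 2) := by
    intro i
    rw [vacuumValue, ← Finset.add_sum_erase _ _ (Finset.mem_univ i), if_pos rfl, zero_add]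
    refine Finset.sum_congr rfl fun j hj => ?_
    rw [if_neg (Finset.ne_of_mem_erase hj)]
  simp only [h]
  have h2 := Finset.sum_comm (s := Finset.univ) (t := Finset.univ)
    (f := fun i j : Fin N => if j = i then (0 : ℂ) else (z i - z j)⁻¹ * ((lam i : ℂ) * lam j / 2))
  have h3 : ∑ j : Fin N, ∑ i : Fin N,
      (if j = i then (0 : ℂ) else (z i - z j)⁻¹ * ((lam i : ℂ) * lam j / 2)) =
      -∑ i : Fin N, ∑ j : Fin N,
        (if j = i then (0 : ℂ) else (z i - z j)⁻¹ * ((lam i : ℂ) * lam j / 2)) := by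
    rw [← Finset.sum_neg_distrib]
    refine Finset.sum_congr rfl fun j _ => ?_
    rw [← Finset.sum_neg_distrib]
    refine Finset.sum_congr rfl fun i _ => ?_
    by_cases hij : j = i
    · simp [hij]
    · rw [if_neg hij, if_neg (Ne.symm hij), ← neg_sub (z j) (z i), inv_neg]
      ring
  have h4 := h2.trans h3
  linear_combination (1 / 2 : ℂ) * h4

lemma sum_vacuumValue_sub (lam : Fin N → ℕ) (z : Fin N → ℂ) {μ : Fin N → ℂ} (hμ : ∑ i, μ i = 0) :
    ∑ i, (vacuumValue lam z i - μ i) = 0 := by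
  rw [Finset.sum_sub_distrib, sum_vacuumValue, hμ, sub_zero]

lemma finrank_degreeLT (n : ℕ) : Module.finrank ℂ (degreeLT ℂ n) = n := by
  rw [(degreeLTEquiv ℂ n).finrank_eq, Module.finrank_fin_fun]

instance (n : ℕ) : FiniteDimensional ℂ (degreeLT ℂ n) :=
  Module.Finite.equiv (degreeLTEquiv ℂ n).symm

/-- `∏_i (X - z_i) ^ (λ_i + 1)`. -/
def exponentProd (lam : Fin N → ℕ) (z : Fin N → ℂ) : ℂ[X] := ∏ i, (X - C (z i)) ^ (lam i + 1)

lemma exponentProd_monic (lam : Fin N → ℕ) (z : Fin N → ℂ) : (exponentProd lam z).Monic :=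
  monic_prod_of_monic _ _ fun _ _ => (monic_X_sub_C _).pow _

lemma pairwise_coprime_factors {lam : Fin N → ℕ} {z : Fin N → ℂ} (hz : Function.Injective z) :
    Pairwise (Function.onFun IsCoprime fun i => (X - C (z i) : ℂ[X]) ^ (lam i + 1)) :=
  fun _ _ hij => (pairwise_coprime_X_sub_C hz hij).pow

lemma exponentProd_dvd {lam : Fin N → ℕ} {z : Fin N → ℂ} (hz : Function.Injective z) {p : ℂ[X]}
    (h : ∀ i, (X - C (z i)) ^ (lam i + 1) ∣ p) : exponentProd lam z ∣ p :=
  Finset.prod_dvd_of_coprime (fun _ _ _ _ hij => pairwise_coprime_factors hz hij) fun i _ => h i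

lemma factor_dvd_exponentProd (lam : Fin N → ℕ) (z : Fin N → ℂ) (i : Fin N) :
    (X - C (z i)) ^ (lam i + 1) ∣ exponentProd lam z :=
  Finset.dvd_prod_of_mem (fun i => (X - C (z i)) ^ (lam i + 1)) (Finset.mem_univ i)

lemma exponentProd_dvd_operD {lam : Fin N → ℕ} {z : Fin N → ℂ} (hz : Function.Injective z)
    (μ : Fin N → ℂ) {p : ℂ[X]} (h : exponentProd lam z ∣ p) :
    exponentProd lam z ∣ operD lam z μ p :=
  exponentProd_dvd hz fun i => operD_dvd_of_dvd lam z μ i ((factor_dvd_exponentProd lam z i).trans h)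

/-- Local solutions without logarithms glue to solutions modulo `exponentProd`. -/
lemma exists_glued_solution {lam : Fin N → ℕ} {z : Fin N → ℂ} (hz : Function.Injective z)
    {μ : Fin N → ℂ} {i : Fin N} (h : NoLogarithm lam z μ i) :
    ∃ G : ℂ[X], exponentProd lam z ∣ operD lam z μ G ∧ ∀ j, G.eval (z j) ≠ 0 ↔ j = i := by
  obtain ⟨g, hg, hd⟩ := h
  have hc : IsCoprime ((X - C (z i)) ^ (lam i + 1))
      (∏ j ∈ Finset.univ.erase i, (X - C (z j)) ^ (lam j + 1)) :=
    IsCoprime.prod_right fun j hj => pairwise_coprime_factors hz (Finset.ne_of_mem_erase hj).symm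
  obtain ⟨a, b, hab⟩ := hc
  -- Chinese remainders: by Bézout, the polynomial is g modulo the factor at z_i and 0 modulo the
  -- factors at the other points.
  have hG : b * g * ∏ j ∈ Finset.univ.erase i, (X - C (z j)) ^ (lam j + 1) =
      g - (X - C (z i)) ^ (lam i + 1) * (a * g) := by linear_combination g * hab
  have hj : ∀ j, j ≠ i → (X - C (z j)) ^ (lam j + 1) ∣
      b * g * ∏ j ∈ Finset.univ.erase i, (X - C (z j)) ^ (lam j + 1) := fun j hj =>
    (Finset.dvd_prod_of_mem (fun j => (X - C (z j)) ^ (lam j + 1))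
      (Finset.mem_erase.mpr ⟨hj, Finset.mem_univ j⟩)).mul_left _
  refine ⟨b * g * ∏ j ∈ Finset.univ.erase i, (X - C (z j)) ^ (lam j + 1),
    exponentProd_dvd hz fun j => ?_, fun j => ⟨fun h => ?_, ?_⟩⟩
  · by_cases hji : j = i
    · rw [hji, hG, map_sub]
      exact dvd_sub hd (operD_dvd_of_dvd lam z μ i (dvd_mul_right _ _))
    · exact operD_dvd_of_dvd lam z μ j (hj j hji)
  · by_contra hji
    refine h ?_
    have := (dvd_pow_self (X - C (z j)) (Nat.succ_ne_zero (lam j))).trans (hj j hji)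
    exact dvd_iff_isRoot.mp this
  · rintro rfl
    rw [hG]
    simpa using hg

lemma card_le_finrank_ker {V W : Type*} [AddCommGroup V] [Module ℂ V] [FiniteDimensional ℂ V]
    [AddCommGroup W] [Module ℂ W] {ι : Type*} [Fintype ι] (f : V →ₗ[ℂ] W) {v : ι → V}
    (hv : LinearIndependent ℂ v) (h : ∀ i, f (v i) = 0) :
    Fintype.card ι ≤ Module.finrank ℂ (LinearMap.ker f) :=
  LinearIndependent.fintype_card_le_finrank (b := fun i => (⟨v i, h i⟩ : LinearMap.ker f))
    (LinearIndependent.of_comp (LinearMap.ker f).subtype hv)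

lemma finrank_le_add_finrank_ker {V W : Type*} [AddCommGroup V] [Module ℂ V]
    [FiniteDimensional ℂ V] [AddCommGroup W] [Module ℂ W] [FiniteDimensional ℂ W]
    (f : V →ₗ[ℂ] W) :
    Module.finrank ℂ V ≤ Module.finrank ℂ W + Module.finrank ℂ (LinearMap.ker f) := by
  rw [← LinearMap.finrank_range_add_finrank_ker f]
  gcongr
  exact Submodule.finrank_le _

/-- The cokernel of an endomorphism bounds the kernel of a map through it. -/
lemma finrank_add_card_le {U V : Type*} [AddCommGroup U] [Module ℂ U] [FiniteDimensional ℂ U]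
    [AddCommGroup V] [Module ℂ V] [FiniteDimensional ℂ V] {ι : Type*} [Fintype ι]
    (E : V →ₗ[ℂ] V) {v : ι → V} (hv : LinearIndependent ℂ v) (h : ∀ i, E (v i) = 0)
    (Φ : U →ₗ[ℂ] V) (hΦ : LinearMap.range Φ ≤ LinearMap.range E) :
    Module.finrank ℂ U + Fintype.card ι ≤
      Module.finrank ℂ V + Module.finrank ℂ (LinearMap.ker Φ) := by
  have h1 := card_le_finrank_ker E hv h
  have h2 := LinearMap.finrank_range_add_finrank_ker E
  have h3 := LinearMap.finrank_range_add_finrank_ker Φ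
  have h4 := Submodule.finrank_mono hΦ
  omega

/-- If no local solution has a logarithm, the oper has two independent polynomial solutions. -/
theorem exists_two_polynomial_solutions {lam : Fin N → ℕ} {z : Fin N → ℂ}
    (hz : Function.Injective z) {μ : Fin N → ℂ} (hμ : ∑ i, μ i = 0)
    (h : ∀ i, NoLogarithm lam z μ i) :
    ∃ y : Fin 2 → ℂ[X], LinearIndependent ℂ y ∧ ∀ k, operD lam z μ (y k) = 0 := by
  set Q := exponentProd lam z with hQ
  set d := Q.natDegree with hd
  have hQm : Q.Monic := exponentProd_monic lam z
  have hdeg : Q.degree = d := degree_eq_natDegree hQm.ne_zero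
  obtain ⟨ρ, hρ, hρρ⟩ : ∃ ρ : ℂ[X] →ₗ[ℂ] degreeLT ℂ d, (∀ p, ρ p = 0 ↔ Q ∣ p) ∧
      ∀ p, Q ∣ p - (ρ p : ℂ[X]) := by
    refine ⟨(modByMonicHom Q).codRestrict _ fun p =>
      mem_degreeLT.mpr (hdeg ▸ degree_modByMonic_lt p hQm), fun p => ?_, fun p => ?_⟩
    · rw [← modByMonic_eq_zero_iff_dvd hQm, ← Subtype.coe_inj]; rfl
    · refine ⟨p /ₘ Q, ?_⟩
      have := modByMonic_add_div p Q
      change p - p %ₘ Q = _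
      linear_combination -this
  -- D_μ preserves the multiples of Q, so it induces an endomorphism E of the d-dimensional space of
  -- residues modulo Q. The glued local solutions are N independent vectors in its kernel.
  obtain ⟨E, hE⟩ : ∃ E : degreeLT ℂ d →ₗ[ℂ] degreeLT ℂ d,
      ∀ p, E (ρ p) = ρ (operD lam z μ p) := by
    refine ⟨ρ ∘ₗ operD lam z μ ∘ₗ (degreeLT ℂ d).subtype, fun p => ?_⟩
    change ρ (operD lam z μ (ρ p)) = _
    rw [← sub_eq_zero, ← map_sub, ← map_sub, hρ, ← neg_sub p, map_neg, dvd_neg]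
    exact exponentProd_dvd_operD hz μ (hρρ p)
  choose G hGD hGe using fun i => exists_glued_solution hz (h i)
  have hli : LinearIndependent ℂ (fun i => ρ (G i)) := by
    refine Fintype.linearIndependent_iff.mpr fun c hc i => ?_
    have h1 : Q ∣ ∑ j, c j • G j := by
      rw [← hρ, map_sum, ← hc]
      exact Finset.sum_congr rfl fun j _ => map_smul _ _ _
    have h2 : (∑ j, c j • G j).eval (z i) = 0 := by
      have := (dvd_pow_self (X - C (z i)) (Nat.succ_ne_zero (lam i))).trans
        ((factor_dvd_exponentProd lam z i).trans h1)
      exact dvd_iff_isRoot.mp this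
    rw [eval_finsetSum, Finset.sum_eq_single i] at h2
    · rw [eval_smul, smul_eq_mul] at h2
      exact (mul_eq_zero.mp h2).resolve_right ((hGe i i).mpr rfl)
    · intro j _ hji
      rw [eval_smul, not_ne_iff.mp (mt (hGe j i).mp hji.symm), smul_zero]
    · simp
  obtain ⟨Φ, hΦ⟩ : ∃ Φ : degreeLT ℂ (d + 2) →ₗ[ℂ] degreeLT ℂ d,
      ∀ p, Φ p = ρ (operD lam z μ p) :=
    ⟨ρ ∘ₗ operD lam z μ ∘ₗ (degreeLT ℂ (d + 2)).subtype, fun p => rfl⟩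
  -- The image of Φ lies in the image of E, which has dimension at most d − N, so the kernel of Φ
  -- has dimension at least (d + 2) − (d − N) = N + 2.
  have hΦr := finrank_add_card_le E hli (fun i => by rw [hE, hρ]; exact hGD i) Φ (by
    rintro _ ⟨p, rfl⟩
    exact ⟨ρ p, by rw [hE, hΦ]⟩)
  rw [finrank_degreeLT, finrank_degreeLT, Fintype.card_fin] at hΦr
  -- For deg p ≤ d + 1 one has deg D_μ p ≤ d + N − 1. Annihilating the coefficients d, …, d + N − 1
  -- costs N conditions and leaves a space of dimension at least 2.
  obtain ⟨K, hK⟩ : ∃ K : LinearMap.ker Φ →ₗ[ℂ] (Fin N → ℂ),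
      ∀ p k, K p k = (operD lam z μ p).coeff (d + k) :=
    ⟨LinearMap.pi fun k => (lcoeff ℂ (d + k)) ∘ₗ operD lam z μ ∘ₗ
      (degreeLT ℂ (d + 2)).subtype ∘ₗ (LinearMap.ker Φ).subtype, fun p k => rfl⟩
  have hK1 := finrank_le_add_finrank_ker (V := LinearMap.ker Φ) (W := Fin N → ℂ) K
  rw [Module.finrank_fin_fun] at hK1
  obtain ⟨y, hy⟩ := exists_linearIndependent_of_le_finrank
    (show 2 ≤ Module.finrank ℂ (LinearMap.ker K) by omega)
  obtain ⟨ι, hι⟩ : ∃ ι : LinearMap.ker K →ₗ[ℂ] ℂ[X], ∀ x, ι x = x.1.1.1 :=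
    ⟨(degreeLT ℂ (d + 2)).subtype ∘ₗ (LinearMap.ker Φ).subtype ∘ₗ (LinearMap.ker K).subtype,
      fun x => rfl⟩
  have hιk : Function.Injective ι := fun x x' hx => by
    rw [hι, hι] at hx
    exact Subtype.ext (Subtype.ext (Subtype.ext hx))
  refine ⟨ι ∘ y, hy.map_injOn ι hιk.injOn, fun k => ?_⟩
  rw [Function.comp_apply, hι]
  set p : ℂ[X] := (y k).1.1.1 with hp
  have hpd : p ∈ degreeLT ℂ (d + 2) := (y k).1.1.2
  have hpQ : Q ∣ operD lam z μ p := (hρ _).mp ((hΦ _).symm.trans (y k).1.2)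
  have hpK : ∀ j : Fin N, (operD lam z μ p).coeff (d + j) = 0 := fun j =>
    (hK _ _).symm.trans (congrFun (y k).2 j)
  -- A nonzero multiple of Q has degree at least d, but the top coefficients of D_μ p have all been
  -- annihilated.
  by_contra hne
  have h1 := natDegree_X_sq_mul_operD_le (sum_vacuumValue_sub lam z hμ) p
  rw [natDegree_mul (pow_ne_zero _ X_ne_zero) hne, natDegree_pow, natDegree_X] at h1
  have h2 : p.natDegree < d + 2 := by
    rw [mem_degreeLT] at hpd
    by_cases hp0 : p = 0
    · rw [hp0, natDegree_zero]; omega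
    · exact (natDegree_lt_iff_degree_lt hp0).mpr hpd
  have h3 : d ≤ (operD lam z μ p).natDegree := natDegree_le_of_dvd hpQ hne
  have h4 := hpK ⟨(operD lam z μ p).natDegree - d, by omega⟩
  rw [show d + ((operD lam z μ p).natDegree - d) = (operD lam z μ p).natDegree by omega] at h4
  exact hne (leadingCoeff_eq_zero.mp h4)

/-- If both vanished at z_i, both would do so to order exactly λ_i + 1, and some nonzero combination
would vanish to higher order, which is not an exponent. -/
lemma exists_eval_ne_zero_of_two_solutions {lam : Fin N → ℕ} {z : Fin N → ℂ}
    (hz : Function.Injective z) {μ : Fin N → ℂ} {y : Fin 2 → ℂ[X]} (hy : LinearIndependent ℂ y)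
    (hD : ∀ k, operD lam z μ (y k) = 0) (i : Fin N) :
    (y 0).eval (z i) ≠ 0 ∨ (y 1).eval (z i) ≠ 0 := by
  by_contra! hcon
  obtain ⟨h0, h1⟩ := hcon
  have hm : ∀ k, (y k).rootMultiplicity (z i) = lam i + 1 := fun k =>
    rootMultiplicity_eq_of_operD_eq_zero hz (hy.ne_zero k) (hD k) (by fin_cases k <;> assumption)
  have hg : ∀ k, ∃ g : ℂ[X], y k = (X - C (z i)) ^ (lam i + 1) * g ∧ g.eval (z i) ≠ 0 := by
    intro k
    obtain ⟨g, hg, hg'⟩ := exists_eq_pow_rootMultiplicity_mul_and_not_dvd (y k) (hy.ne_zero k) (z i)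
    rw [hm k] at hg
    exact ⟨g, hg, fun h => hg' (dvd_iff_isRoot.mpr h)⟩
  obtain ⟨g0, hg0, hg0'⟩ := hg 0
  obtain ⟨g1, hg1, hg1'⟩ := hg 1
  set p := g1.eval (z i) • y 0 + (-(g0.eval (z i))) • y 1 with hp
  have hp0 : p ≠ 0 := by
    intro hp0
    have hli := LinearIndependent.pair_iff.mp
      (show LinearIndependent ℂ ![y 0, y 1] by convert hy using 1; ext k; fin_cases k <;> rfl)
    exact hg1' (hli _ _ hp0).1
  have hpD : operD lam z μ p = 0 := by
    rw [hp, map_add, map_smul, map_smul, hD, hD, smul_zero, smul_zero, add_zero]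
  have hpe : p = (X - C (z i)) ^ (lam i + 1) * (C (g1.eval (z i)) * g0 - C (g0.eval (z i)) * g1) := by
    rw [hp, hg0, hg1, smul_eq_C_mul, smul_eq_C_mul, C_neg]; ring
  have hroot : X - C (z i) ∣ C (g1.eval (z i)) * g0 - C (g0.eval (z i)) * g1 := by
    rw [dvd_iff_isRoot]; simp [mul_comm]
  have hdvd : (X - C (z i)) ^ (lam i + 1 + 1) ∣ p := by
    rw [hpe, pow_succ]; exact mul_dvd_mul_left _ hroot
  have h2 := (le_rootMultiplicity_iff hp0).mpr hdvd
  have h3 := rootMultiplicity_eq_of_operD_eq_zero (i := i) hz hp0 hpD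
    (by rw [hpe, eval_mul]; simp)
  omega

/-- `∏_j (X - w_j)`. -/
def bethePoly {m : ℕ} (w : Fin m → ℂ) : ℂ[X] := ∏ j, (X - C (w j))

lemma eval_bethePoly {m : ℕ} (w : Fin m → ℂ) (t : ℂ) :
    (bethePoly w).eval t = ∏ j, (t - w j) := by simp [bethePoly, eval_prod]

lemma bethePoly_monic {m : ℕ} (w : Fin m → ℂ) : (bethePoly w).Monic := monic_prod_X_sub_C _ _

lemma natDegree_bethePoly {m : ℕ} (w : Fin m → ℂ) : (bethePoly w).natDegree = m := by
  rw [bethePoly, natDegree_finsetProd_X_sub_C_eq_card, Finset.card_univ, Fintype.card_fin]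

lemma eval_bethePoly_ne_zero {m : ℕ} {w : Fin m → ℂ} {t : ℂ} (h : ∀ j, t ≠ w j) :
    (bethePoly w).eval t ≠ 0 := by
  rw [eval_bethePoly]; exact Finset.prod_ne_zero_iff.mpr fun j _ => sub_ne_zero.mpr (h j)

lemma rootSet_bethePoly {m : ℕ} (w : Fin m → ℂ) (t : ℂ) :
    (bethePoly w).eval t = 0 ↔ t ∈ Set.range w := by
  rw [eval_bethePoly, Finset.prod_eq_zero_iff]
  simp only [Finset.mem_univ, true_and, sub_eq_zero, Set.mem_range, eq_comm]

/-- The w_j are ordinary points of the equation, where a nonzero solution has simple zeros. -/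
lemma injective_of_operD_bethePoly {lam : Fin N → ℕ} {z μ : Fin N → ℂ} {m : ℕ} {w : Fin m → ℂ}
    (hw : ∀ j i, w j ≠ z i) (hD : operD lam z μ (bethePoly w) = 0) : Function.Injective w := by
  intro j k hjk
  by_contra hne
  refine (bethePoly_monic w).ne_zero (eq_zero_of_operD_eq_zero_of_double_root (hw j) hD
    ((rootSet_bethePoly w _).mpr ⟨j, rfl⟩) ?_)
  have h : (X - C (w j)) ^ 2 ∣ bethePoly w := by
    rw [bethePoly, ← Finset.mul_prod_erase _ _ (Finset.mem_univ j),
      ← Finset.mul_prod_erase _ _ (Finset.mem_erase.mpr ⟨Ne.symm hne, Finset.mem_univ k⟩), ← hjk,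
      ← mul_assoc, ← sq]
    exact dvd_mul_right _ _
  obtain ⟨g, hg⟩ := h
  rw [hg, derivative_X_sub_C_pow_mul (w j) 1 g]
  simp

/-- A polynomial solution that does not vanish at the `z_i` comes from an admissible `w`. -/
lemma exists_admissible_of_solution {lam : Fin N → ℕ} {z μ : Fin N → ℂ} {y : ℂ[X]}
    (hy : operD lam z μ y = 0) (hyz : ∀ i, y.eval (z i) ≠ 0) (hy0 : y ≠ 0) :
    ∃ w : Fin y.natDegree → ℂ, IsAdmissible z w ∧ operD lam z μ (bethePoly w) = 0 ∧
      y = C y.leadingCoeff * bethePoly w := by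
  have hs := (IsAlgClosed.splits y).eq_prod_roots
  have hcard : y.roots.toList.length = y.natDegree := by
    rw [Multiset.length_toList]; exact (splits_iff_card_roots.mp (IsAlgClosed.splits y))
  obtain ⟨w, hw⟩ : ∃ w : Fin y.natDegree → ℂ, y.roots.toList = List.ofFn w := by
    rw [← hcard]; exact ⟨y.roots.toList.get, (List.ofFn_get _).symm⟩
  have hyw : y = C y.leadingCoeff * bethePoly w := by
    conv_lhs => rw [hs]
    rw [← Multiset.coe_toList y.roots, hw, Multiset.map_coe, Multiset.prod_coe, List.map_ofFn,
      List.prod_ofFn]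
    rfl
  have hl : y.leadingCoeff ≠ 0 := leadingCoeff_ne_zero.mpr hy0
  have hD : operD lam z μ (bethePoly w) = 0 := by
    rw [hyw, ← smul_eq_C_mul, map_smul] at hy
    exact (smul_eq_zero.mp hy).resolve_left hl
  have hwz : ∀ j i, w j ≠ z i := by
    intro j i hji
    refine hyz i ?_
    rw [hyw, eval_mul, (rootSet_bethePoly w _).mpr ⟨j, hji⟩, mul_zero]
  exact ⟨w, ⟨injective_of_operD_bethePoly hwz hD, hwz⟩, hD, hyw⟩

theorem exists_admissible_of_two_solutions {lam : Fin N → ℕ} {z : Fin N → ℂ}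
    (hz : Function.Injective z) {μ : Fin N → ℂ} {y : Fin 2 → ℂ[X]} (hy : LinearIndependent ℂ y)
    (hD : ∀ k, operD lam z μ (y k) = 0) :
    ∃ (m : ℕ) (w : Fin m → ℂ), IsAdmissible z w ∧ operD lam z μ (bethePoly w) = 0 := by
  -- The excluded values are those for which y_0 + c y_1 could vanish at some z_i. If y_1(z_i) = 0,
  -- then y_0(z_i) ≠ 0 and every c will do.
  obtain ⟨c, hc⟩ := (Set.finite_range fun i => -((y 0).eval (z i) / (y 1).eval (z i))).exists_notMem
  have hli := LinearIndependent.pair_iff.mp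
    (show LinearIndependent ℂ ![y 0, y 1] by convert hy using 1; ext k; fin_cases k <;> rfl)
  have hne : y 0 + c • y 1 ≠ 0 := fun h => one_ne_zero (hli 1 c (by rwa [one_smul])).1
  obtain ⟨w, hw, hwD, -⟩ := exists_admissible_of_solution (lam := lam) (z := z) (μ := μ)
    (y := y 0 + c • y 1) (by rw [map_add, map_smul, hD, hD, smul_zero, add_zero]) (fun i h => by
      rw [eval_add, eval_smul, smul_eq_mul] at h
      by_cases h1 : (y 1).eval (z i) = 0
      · rw [h1, mul_zero, add_zero] at h
        exact (exists_eval_ne_zero_of_two_solutions hz hy hD i).elim (fun h' => h' h) fun h' => h' h1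
      · refine hc ⟨i, ?_⟩
        field_simp
        linear_combination -h) hne
  exact ⟨_, w, hw, hwD⟩

lemma noLogarithm_of_bethePoly {lam : Fin N → ℕ} {z μ : Fin N → ℂ} {m : ℕ} {w : Fin m → ℂ}
    (hw : ∀ j i, w j ≠ z i) (hD : operD lam z μ (bethePoly w) = 0) (i : Fin N) :
    NoLogarithm lam z μ i :=
  ⟨bethePoly w, eval_bethePoly_ne_zero fun j => (hw j i).symm, hD ▸ dvd_zero _⟩

end

section
open Polynomial
variable {N : ℕ}

/-! ### The Miura form and the Bethe equations -/

/-- Partial fractions of the square of a sum of simple poles. The diagonal terms of the inner sum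
vanish, as `1 / 0 = 0`. -/
lemma sq_sum_div {ι : Type*} [Fintype ι] [DecidableEq ι] (a : ι → ℂ) {p : ι → ℂ}
    (hp : Function.Injective p) {t : ℂ} (ht : ∀ i, t ≠ p i) :
    (∑ i, a i / (t - p i)) ^ 2 = ∑ i, a i ^ 2 / (t - p i) ^ 2
      + 2 * ∑ i, a i / (t - p i) * ∑ j, a j / (p i - p j) := by
  have key : ∀ i j, a i / (t - p i) * (a j / (t - p j)) =
      (if i = j then a i ^ 2 / (t - p i) ^ 2 else 0) + a i / (t - p i) * (a j / (p i - p j))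
        + a j / (t - p j) * (a i / (p j - p i)) := by
    intro i j
    have hi := sub_ne_zero.mpr (ht i)
    have hj := sub_ne_zero.mpr (ht j)
    by_cases hij : i = j
    · subst hij
      rw [if_pos rfl, sub_self, div_zero, mul_zero, add_zero, add_zero, div_mul_div_comm, sq, sq]
    · have h1 := sub_ne_zero.mpr (hp.ne hij)
      have h2 := sub_ne_zero.mpr (hp.ne (Ne.symm hij))
      rw [if_neg hij, zero_add, ← neg_sub (p i) (p j), div_neg]
      field_simp
      ring
  rw [sq, Finset.sum_mul_sum]
  simp only [key, Finset.sum_add_distrib, Finset.sum_ite_eq, Finset.mem_univ, if_true]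
  have hc := Finset.sum_comm (s := Finset.univ) (t := Finset.univ)
    (f := fun i j : ι => a j / (t - p j) * (a i / (p j - p i)))
  rw [hc]
  simp only [← Finset.mul_sum]
  ring

lemma sum_mul_sum_div_antisymm {ι : Type*} [Fintype ι] (a p : ι → ℂ) :
    ∑ i, a i * ∑ j, a j / (p i - p j) = 0 := by
  have h : ∑ i, a i * ∑ j, a j / (p i - p j) = -∑ i, a i * ∑ j, a j / (p i - p j) := by
    conv_lhs => simp only [Finset.mul_sum]
    rw [Finset.sum_comm, ← Finset.sum_neg_distrib]
    refine Finset.sum_congr rfl fun i _ => ?_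
    rw [Finset.mul_sum, ← Finset.sum_neg_distrib]
    refine Finset.sum_congr rfl fun j _ => ?_
    rw [← neg_sub (p i) (p j), div_neg]
    ring
  linear_combination (1 / 2 : ℂ) * h

lemma sum_erase_div {ι : Type*} [Fintype ι] [DecidableEq ι] (a p : ι → ℂ) (i : ι) :
    ∑ j ∈ Finset.univ.erase i, a j / (p i - p j) = ∑ j, a j / (p i - p j) :=
  Finset.sum_erase _ (by rw [sub_self, div_zero])

lemma vacuumValue_eq (lam : Fin N → ℕ) (z : Fin N → ℂ) (i : Fin N) :
    vacuumValue lam z i = (lam i : ℂ) / 2 * ∑ j, (lam j : ℂ) / (z i - z j) := by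
  rw [← sum_erase_div (fun j => (lam j : ℂ)) z i, vacuumValue, Finset.mul_sum]
  refine Finset.sum_congr rfl fun j _ => ?_
  rw [div_eq_mul_inv, div_eq_mul_inv, div_eq_mul_inv]; ring

/-- `∑_i λ_i / (t - z_i)`. -/
def logDer (lam : Fin N → ℕ) (z : Fin N → ℂ) (t : ℂ) : ℂ := ∑ i, (lam i : ℂ) / (t - z i)

lemma potential_eq (lam : Fin N → ℕ) {z : Fin N → ℂ} (hz : Function.Injective z) (μ : Fin N → ℂ)
    {t : ℂ} (ht : ∀ i, t ≠ z i) :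
    potential lam z μ t = logDer lam z t ^ 2 / 4 + (∑ i, (lam i : ℂ) / (t - z i) ^ 2) / 2
      - ∑ i, (vacuumValue lam z i - μ i) / (t - z i) := by
  rw [potential, logDer, sq_sum_div _ hz ht]
  have h : ∑ i, (lam i : ℂ) / (t - z i) * ∑ j, (lam j : ℂ) / (z i - z j) =
      2 * ∑ i, vacuumValue lam z i / (t - z i) := by
    rw [Finset.mul_sum]
    refine Finset.sum_congr rfl fun i _ => ?_
    rw [vacuumValue_eq]; ring
  rw [h]
  simp only [sub_div, Finset.sum_sub_distrib]
  have h2 : ∑ i, ((lam i : ℂ) * ((lam i : ℂ) + 2) / 4) / (t - z i) ^ 2 =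
      (∑ i, (lam i : ℂ) ^ 2 / (t - z i) ^ 2) / 4 + (∑ i, (lam i : ℂ) / (t - z i) ^ 2) / 2 := by
    rw [Finset.sum_div, Finset.sum_div, ← Finset.sum_add_distrib]
    refine Finset.sum_congr rfl fun i _ => ?_
    ring
  rw [h2]; ring

lemma hasDerivAt_sum_div {ι : Type*} [Fintype ι] (a : ι → ℂ) {p : ι → ℂ} {t : ℂ}
    (ht : ∀ i, t ≠ p i) :
    HasDerivAt (fun t => ∑ i, a i / (t - p i)) (-∑ i, a i / (t - p i) ^ 2) t := by
  rw [← Finset.sum_neg_distrib]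
  refine HasDerivAt.fun_sum fun i _ => ?_
  have h := ((hasDerivAt_const t (a i)).div ((hasDerivAt_id t).sub_const (p i))
    (sub_ne_zero.mpr (ht i)))
  refine HasDerivAt.congr_deriv h ?_
  simp only [id]
  ring

lemma hasDerivAt_chi (lam : Fin N → ℕ) {z : Fin N → ℂ} {m : ℕ} {w : Fin m → ℂ} {t : ℂ}
    (ht : ∀ i, t ≠ z i) (htw : ∀ j, t ≠ w j) :
    HasDerivAt (chi lam z w) (-∑ i, (lam i : ℂ) / (t - z i) ^ 2 + ∑ j, 2 / (t - w j) ^ 2) t := by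
  have h := (hasDerivAt_sum_div (fun i => (lam i : ℂ)) ht).sub
    (hasDerivAt_sum_div (fun _ => (2 : ℂ)) htw)
  rw [sub_neg_eq_add] at h
  exact h

/-- The residue of `χ_w² / 4 - χ_w' / 2` at `z_i`. -/
def betheValue (lam : Fin N → ℕ) (z : Fin N → ℂ) {m : ℕ} (w : Fin m → ℂ) (i : Fin N) : ℂ :=
  vacuumValue lam z i + lam i * ∑ s, 1 / (w s - z i)

/-- The left hand side of the Bethe equations. -/
def betheDefect (lam : Fin N → ℕ) (z : Fin N → ℂ) {m : ℕ} (w : Fin m → ℂ) (j : Fin m) : ℂ :=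
  ∑ i, (lam i : ℂ) / (w j - z i) - ∑ s ∈ Finset.univ.erase j, 2 / (w j - w s)

/-- χ_w is treated as a single sum of simple poles over z and w together, with residues λ_i at z_i
and −2 at w_j. -/
lemma append_injective {z : Fin N → ℂ} (hz : Function.Injective z) {m : ℕ} {w : Fin m → ℂ}
    (hw : IsAdmissible z w) : Function.Injective (Fin.append z w) :=
  Fin.append_injective_iff.mpr ⟨hz, hw.1, fun i j => (hw.2 j i).symm⟩

/-- The inner sums of `sq_sum_div` for `χ_w`. -/
lemma sum_append_div_left (lam : Fin N → ℕ) (z : Fin N → ℂ) {m : ℕ} (w : Fin m → ℂ) (i : Fin N) :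
    (lam i : ℂ) / 2 * ∑ l, Fin.append (fun i => (lam i : ℂ)) (fun _ => (-2 : ℂ)) l
      / (z i - Fin.append z w l) = betheValue lam z w i := by
  rw [Fin.sum_univ_add]
  simp only [Fin.append_left, Fin.append_right]
  rw [betheValue, vacuumValue_eq, mul_add]
  congr 1
  rw [Finset.mul_sum, Finset.mul_sum]
  refine Finset.sum_congr rfl fun s _ => ?_
  rw [← neg_sub (w s), neg_div_neg_eq]
  ring

lemma sum_append_div_right (lam : Fin N → ℕ) (z : Fin N → ℂ) {m : ℕ} (w : Fin m → ℂ) (j : Fin m) :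
    ∑ l, Fin.append (fun i => (lam i : ℂ)) (fun _ => (-2 : ℂ)) l
      / (w j - Fin.append z w l) = betheDefect lam z w j := by
  rw [Fin.sum_univ_add]
  simp only [Fin.append_left, Fin.append_right]
  rw [betheDefect, sum_erase_div (fun _ => (2 : ℂ)) w j, sub_eq_add_neg, ← Finset.sum_neg_distrib]
  simp only [neg_div]

/-- The double sum of a_k a_l / (p_k − p_l) over all poles is zero by antisymmetry; half of it is
the difference of the two sides. It is the reason why the Bethe equations imply ∑ μ_i = 0. -/
lemma sum_betheValue (lam : Fin N → ℕ) (z : Fin N → ℂ) {m : ℕ} (w : Fin m → ℂ) :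
    ∑ i, betheValue lam z w i = ∑ j, betheDefect lam z w j := by
  have h := sum_mul_sum_div_antisymm (Fin.append (fun i => (lam i : ℂ)) (fun _ : Fin m => (-2 : ℂ)))
    (Fin.append z w)
  rw [Fin.sum_univ_add] at h
  simp only [Fin.append_left, Fin.append_right, sum_append_div_right] at h
  simp only [← sum_append_div_left]
  rw [← Finset.mul_sum] at h
  simp only [div_mul_eq_mul_div, ← Finset.sum_div]
  linear_combination (1 / 2 : ℂ) * h

/-- Partial fractions of the Miura transform of `χ_w`. -/
lemma miura_eq (lam : Fin N → ℕ) {z : Fin N → ℂ} (hz : Function.Injective z) {m : ℕ}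
    {w : Fin m → ℂ} (hw : IsAdmissible z w) {t : ℂ} (ht : ∀ i, t ≠ z i) (htw : ∀ j, t ≠ w j) :
    chi lam z w t ^ 2 / 4 - deriv (chi lam z w) t / 2 =
      ∑ i, ((lam i : ℂ) * ((lam i : ℂ) + 2) / 4) / (t - z i) ^ 2
        + ∑ i, betheValue lam z w i / (t - z i) - ∑ j, betheDefect lam z w j / (t - w j) := by
  have hchi : chi lam z w t = ∑ l, Fin.append (fun i => (lam i : ℂ)) (fun _ => (-2 : ℂ)) l
      / (t - Fin.append z w l) := by
    rw [Fin.sum_univ_add]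
    simp only [Fin.append_left, Fin.append_right, chi, sub_eq_add_neg, neg_div,
      Finset.sum_neg_distrib]
  have htp : ∀ l, t ≠ Fin.append z w l := fun l => by
    refine Fin.addCases (fun i => ?_) (fun j => ?_) l
    · rw [Fin.append_left]; exact ht i
    · rw [Fin.append_right]; exact htw j
  rw [(hasDerivAt_chi lam ht htw).deriv, hchi, sq_sum_div _ (append_injective hz hw) htp,
    Fin.sum_univ_add, Fin.sum_univ_add]
  simp only [Fin.append_left, Fin.append_right, sum_append_div_right]
  simp only [← sum_append_div_left]
  have h1 : ∑ i, (lam i : ℂ) / 2 * (∑ l, Fin.append (fun i => (lam i : ℂ))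
      (fun _ => (-2 : ℂ)) l / (z i - Fin.append z w l)) / (t - z i) =
      (∑ i, (lam i : ℂ) / (t - z i) * (∑ l, Fin.append (fun i => (lam i : ℂ))
      (fun _ => (-2 : ℂ)) l / (z i - Fin.append z w l))) / 2 := by
    rw [Finset.sum_div]
    exact Finset.sum_congr rfl fun i _ => by ring
  have h2 : ∑ i, ((lam i : ℂ) * ((lam i : ℂ) + 2) / 4) / (t - z i) ^ 2 =
      (∑ i, (lam i : ℂ) ^ 2 / (t - z i) ^ 2) / 4 + (∑ i, (lam i : ℂ) / (t - z i) ^ 2) / 2 := by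
    rw [Finset.sum_div, Finset.sum_div, ← Finset.sum_add_distrib]
    refine Finset.sum_congr rfl fun i _ => ?_
    ring
  have h3 : ∑ j, -2 / (t - w j) * betheDefect lam z w j =
      -2 * ∑ j, betheDefect lam z w j / (t - w j) := by
    rw [Finset.mul_sum]
    exact Finset.sum_congr rfl fun i _ => by ring
  have h4 : ∑ j, (-2 : ℂ) ^ 2 / (t - w j) ^ 2 = 2 * ∑ j, 2 / (t - w j) ^ 2 := by
    rw [Finset.mul_sum]
    exact Finset.sum_congr rfl fun i _ => by ring
  rw [h1, h2, h3, h4]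
  ring

lemma eq_zero_of_sum_div_eq_zero {c p : Fin N → ℂ} (hp : Function.Injective p)
    (h : ∀ t, (∀ i, t ≠ p i) → ∑ i, c i / (t - p i) = 0) (i : Fin N) : c i = 0 := by
  have h0 : operC p c = 0 := polynomial_ext_of_forall_ne (z := p) fun t ht => by
    rw [eval_operC ht, h t ht, mul_zero, eval_zero]
  have h1 := congrArg (eval (p i)) h0
  rw [operC, eval_finsetSum, eval_zero, Finset.sum_eq_single i, eval_mul, eval_C] at h1
  · exact (mul_eq_zero.mp h1).resolve_right (eval_nodalErase_self_ne_zero hp i)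
  · intro j _ hji
    rw [eval_mul, eval_nodalErase_of_ne p hji, mul_zero]
  · simp

/-- Uniqueness of partial fractions. The double poles at the w_j cancel by themselves, as (−2)²/4 −
2/2 = 0, and the residues there are the defects of the Bethe equations up to sign. -/
theorem miuraForm_iff (lam : Fin N → ℕ) {z : Fin N → ℂ} (hz : Function.Injective z)
    (μ : Fin N → ℂ) {m : ℕ} {w : Fin m → ℂ} (hw : IsAdmissible z w) :
    MiuraForm lam z μ w ↔ BetheEquations lam z w ∧ μ = betheValue lam z w := by
  constructor
  · intro h
    have key : ∀ t, (∀ l, t ≠ Fin.append z w l) → ∑ l, Fin.append (μ - betheValue lam z w)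
        (betheDefect lam z w) l / (t - Fin.append z w l) = 0 := by
      intro t ht
      have ht1 : ∀ i, t ≠ z i := fun i => by simpa using ht (Fin.castAdd m i)
      have ht2 : ∀ j, t ≠ w j := fun j => by simpa using ht (Fin.natAdd N j)
      have h1 := (h t ht1 ht2).trans (miura_eq lam hz hw ht1 ht2)
      rw [potential] at h1
      rw [Fin.sum_univ_add]
      simp only [Fin.append_left, Fin.append_right, Pi.sub_apply, sub_div, Finset.sum_sub_distrib]
      linear_combination h1
    have h0 := eq_zero_of_sum_div_eq_zero (append_injective hz hw) key
    refine ⟨fun j => ?_, funext fun i => ?_⟩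
    · have := h0 (Fin.natAdd N j)
      rwa [Fin.append_right] at this
    · have := h0 (Fin.castAdd m i)
      rw [Fin.append_left] at this
      exact sub_eq_zero.mp this
  · rintro ⟨hB, rfl⟩ t ht htw
    rw [miura_eq lam hz hw ht htw, potential, Finset.sum_eq_zero (s := Finset.univ)
      (f := fun j => betheDefect lam z w j / (t - w j)), sub_zero]
    intro j _
    rw [show betheDefect lam z w j = 0 from hB j, zero_div]

theorem betheEquations_iff (lam : Fin N → ℕ) {z : Fin N → ℂ} (hz : Function.Injective z)
    {m : ℕ} {w : Fin m → ℂ} (hw : IsAdmissible z w) :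
    BetheEquations lam z w ↔ ∃ μ : Fin N → ℂ, ∑ i, μ i = 0 ∧ MiuraForm lam z μ w := by
  constructor
  · intro h
    refine ⟨_, ?_, (miuraForm_iff lam hz _ hw).mpr ⟨h, rfl⟩⟩
    rw [sum_betheValue]
    exact Finset.sum_eq_zero fun j _ => h j
  · rintro ⟨μ, -, h⟩
    exact ((miuraForm_iff lam hz _ hw).mp h).1

/-! ### The Bethe polynomial -/

lemma eval_derivative_bethePoly {m : ℕ} {w : Fin m → ℂ} {t : ℂ} (ht : ∀ j, t ≠ w j) :
    (derivative (bethePoly w)).eval t = (bethePoly w).eval t * ∑ j, 1 / (t - w j) := by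
  rw [bethePoly, derivative_prod_finset, eval_finsetSum, Finset.mul_sum]
  refine Finset.sum_congr rfl fun j _ => ?_
  rw [← Finset.mul_prod_erase _ _ (Finset.mem_univ j), derivative_X_sub_C, mul_one, eval_mul,
    eval_sub, eval_X, eval_C]
  field_simp [sub_ne_zero.mpr (ht j)]

lemma eval_derivative_derivative_bethePoly {m : ℕ} {w : Fin m → ℂ} {t : ℂ} (ht : ∀ j, t ≠ w j) :
    (derivative (derivative (bethePoly w))).eval t =
      (bethePoly w).eval t * ((∑ j, 1 / (t - w j)) ^ 2 - ∑ j, 1 / (t - w j) ^ 2) := by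
  have h1 := (derivative (bethePoly w)).hasDerivAt t
  have h2 := ((bethePoly w).hasDerivAt t).mul (hasDerivAt_sum_div (fun _ => (1 : ℂ)) ht)
  have h3 : ∀ᶠ s in 𝓝 t, ∀ j, s ≠ w j :=
    Filter.eventually_all.mpr fun j => isOpen_ne.mem_nhds (ht j)
  have h4 := h2.congr_of_eventuallyEq (f₁ := fun s => (derivative (bethePoly w)).eval s)
    (h3.mono fun s hs => eval_derivative_bethePoly hs)
  rw [h1.unique h4, eval_derivative_bethePoly ht]
  ring

/-- With y = ∏ (t − w_j), at points different from all z_i and w_j one has D_μ y = ∏ (t − z_i) · y ·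
(χ_w²/4 − χ_w'/2 − q_μ). The w_j may coincide here. -/
theorem miuraForm_iff_operD (lam : Fin N → ℕ) {z : Fin N → ℂ} (hz : Function.Injective z)
    (μ : Fin N → ℂ) {m : ℕ} (w : Fin m → ℂ) :
    MiuraForm lam z μ w ↔ operD lam z μ (bethePoly w) = 0 := by
  have key : ∀ t, (∀ i, t ≠ z i) → (∀ j, t ≠ w j) →
      ((potential lam z μ t = chi lam z w t ^ 2 / 4 - deriv (chi lam z w) t / 2) ↔
        (operD lam z μ (bethePoly w)).eval t = 0) := by
    intro t ht htw
    have e : (operD lam z μ (bethePoly w)).eval t = (nodal z).eval t * (bethePoly w).eval t *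
        ((chi lam z w t ^ 2 / 4 - deriv (chi lam z w) t / 2) - potential lam z μ t) := by
      rw [eval_operD ht, eval_derivative_bethePoly htw, eval_derivative_derivative_bethePoly htw,
        potential_eq lam hz μ ht, (hasDerivAt_chi lam ht htw).deriv, chi]
      have e1 : ∑ j, 2 / (t - w j) = 2 * ∑ j, 1 / (t - w j) := by
        rw [Finset.mul_sum]; simp only [mul_one_div]
      have e2 : ∑ j, 2 / (t - w j) ^ 2 = 2 * ∑ j, 1 / (t - w j) ^ 2 := by
        rw [Finset.mul_sum]; simp only [mul_one_div]
      rw [e1, e2, logDer]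
      ring
    rw [e, mul_eq_zero, sub_eq_zero, eq_comm, or_iff_right]
    exact mul_ne_zero (eval_nodal_ne_zero ht) (eval_bethePoly_ne_zero htw)
  constructor
  · intro h
    refine polynomial_ext_of_forall_ne (z := Fin.append z w) fun t ht => ?_
    have ht1 : ∀ i, t ≠ z i := fun i => by simpa using ht (Fin.castAdd m i)
    have ht2 : ∀ j, t ≠ w j := fun j => by simpa using ht (Fin.natAdd N j)
    rw [(key t ht1 ht2).mp (h t ht1 ht2), eval_zero]
  · intro h t ht htw
    rw [key t ht htw, h, eval_zero]

/-! ### Multivalued solutions -/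

/-- A general index type is allowed because later the factor at one point z_i is left out. -/
lemma exists_analytic_sqrt {ι : Type*} [Fintype ι] (lam : ι → ℕ) {z : ι → ℂ} {t₀ : ℂ} (ht : ∀ i, t₀ ≠ z i) :
    ∃ r : ℂ → ℂ, AnalyticAt ℂ r t₀ ∧ ∀ᶠ t in 𝓝 t₀, r t ^ 2 = ∏ i, (t - z i) ^ lam i := by
  have hR : AnalyticAt ℂ (fun t => ∏ i, (t - z i) ^ lam i) t₀ :=
    Finset.analyticAt_fun_prod _ fun i _ => (analyticAt_id.sub analyticAt_const).pow _
  have hne : ∏ i, (t₀ - z i) ^ lam i ≠ 0 :=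
    Finset.prod_ne_zero_iff.mpr fun i _ => pow_ne_zero _ (sub_ne_zero.mpr (ht i))
  set R₀ := ∏ i, (t₀ - z i) ^ lam i with hR₀
  -- The radicand is divided by its value at t₀, so that the principal branch is applied near 1,
  -- away from its cut.
  refine ⟨fun t => R₀ ^ (((2 : ℕ) : ℂ)⁻¹) * ((∏ i, (t - z i) ^ lam i) / R₀) ^ (((2 : ℕ) : ℂ)⁻¹),
    analyticAt_const.mul ((hR.div analyticAt_const hne).cpow analyticAt_const ?_), ?_⟩
  · change R₀ / R₀ ∈ Complex.slitPlane
    rw [div_self hne]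
    exact Complex.one_mem_slitPlane
  · refine Filter.Eventually.of_forall fun t => ?_
    rw [mul_pow, Complex.cpow_nat_inv_pow _ two_ne_zero, Complex.cpow_nat_inv_pow _ two_ne_zero,
      mul_div_cancel₀ _ hne]

lemma hasDerivAt_prod_pow (lam : Fin N → ℕ) {z : Fin N → ℂ} {t : ℂ} (ht : ∀ i, t ≠ z i) :
    HasDerivAt (fun t => ∏ i, (t - z i) ^ lam i)
      ((∏ i, (t - z i) ^ lam i) * logDer lam z t) t := by
  have h : ∀ i ∈ (Finset.univ : Finset (Fin N)),
      HasDerivAt (fun t => (t - z i) ^ lam i) ((t - z i) ^ lam i * (lam i / (t - z i))) t := by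
    intro i _
    refine (((hasDerivAt_id t).sub_const (z i)).pow (lam i)).congr_deriv ?_
    have hne := sub_ne_zero.mpr (ht i)
    rcases lam i with _ | k
    · simp
    · simp only [id, Nat.add_sub_cancel, pow_succ]
      push_cast
      field_simp
  refine (HasDerivAt.fun_finsetProd h).congr_deriv ?_
  symm
  rw [logDer, Finset.mul_sum]
  refine Finset.sum_congr rfl fun i _ => ?_
  rw [← Finset.mul_prod_erase _ _ (Finset.mem_univ i), smul_eq_mul]
  ring

/-- Conjugation of `∂² - q_μ` by the square root `r` of `∏ (t - z_i) ^ λ_i`. -/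
lemma eventually_conjugate (lam : Fin N → ℕ) {z : Fin N → ℂ} (hz : Function.Injective z)
    (μ : Fin N → ℂ) {t₀ : ℂ} (ht₀ : ∀ i, t₀ ≠ z i) {r Y : ℂ → ℂ} (hr : AnalyticAt ℂ r t₀)
    (hr2 : ∀ᶠ t in 𝓝 t₀, r t ^ 2 = ∏ i, (t - z i) ^ lam i) (hY : AnalyticAt ℂ Y t₀) :
    ∀ᶠ t in 𝓝 t₀, r t ≠ 0 ∧ deriv (deriv fun t => Y t / r t) t
      - potential lam z μ t * (Y t / r t) =
      (deriv (deriv Y) t - logDer lam z t * deriv Y t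
        + (∑ i, (vacuumValue lam z i - μ i) / (t - z i)) * Y t) / r t := by
  have hz' : ∀ᶠ t in 𝓝 t₀, ∀ i, t ≠ z i :=
    Filter.eventually_all.mpr fun i => isOpen_ne.mem_nhds (ht₀ i)
  have hne : ∀ᶠ t in 𝓝 t₀, r t ≠ 0 := by
    filter_upwards [hz', hr2] with t ht h h0
    rw [h0, zero_pow two_ne_zero] at h
    exact Finset.prod_ne_zero_iff.mpr (fun i _ => pow_ne_zero (lam i) (sub_ne_zero.mpr (ht i)))
      h.symm
  have hr' : ∀ᶠ t in 𝓝 t₀, HasDerivAt r (r t * logDer lam z t / 2) t := by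
    filter_upwards [hz', hr2.eventually_nhds, hne, hr.eventually_analyticAt] with t ht h2 hn ha
    have h1 := ha.differentiableAt.hasDerivAt
    have h3 := (h1.pow 2).congr_of_eventuallyEq (f₁ := fun t => ∏ i, (t - z i) ^ lam i)
      (h2.mono fun s hs => hs.symm)
    have h4 := h3.unique (hasDerivAt_prod_pow lam ht)
    rw [← h2.self_of_nhds] at h4
    have h5 : deriv r t = r t * logDer lam z t / 2 := by
      have h6 : r t * (2 * deriv r t) = r t * (r t * logDer lam z t) := by
        rw [sq] at h4
        norm_num at h4
        linear_combination h4
      have h7 := mul_left_cancel₀ hn h6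
      linear_combination h7 / 2
    rwa [h5] at h1
  have hd1 : ∀ᶠ t in 𝓝 t₀, HasDerivAt (fun t => Y t / r t)
      ((deriv Y t - Y t * logDer lam z t / 2) / r t) t := by
    filter_upwards [hr', hne, hY.eventually_analyticAt] with t h1 hn hYa
    refine (hYa.differentiableAt.hasDerivAt.div h1 hn).congr_deriv ?_
    field_simp
  filter_upwards [hz', hr', hne, hY.eventually_analyticAt, hd1.eventually_nhds] with t ht h1 hn hYa
    hd
  refine ⟨hn, ?_⟩
  have h2 : deriv (fun t => Y t / r t) =ᶠ[𝓝 t]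
      fun t => (deriv Y t - Y t * logDer lam z t / 2) / r t := hd.mono fun s hs => hs.deriv
  have h3 := ((hYa.deriv.differentiableAt.hasDerivAt.sub
    ((hYa.differentiableAt.hasDerivAt.mul
      (hasDerivAt_sum_div (fun i => (lam i : ℂ)) ht)).div_const 2)).div h1 hn)
  rw [h2.deriv_eq, show deriv (fun t => (deriv Y t - Y t * logDer lam z t / 2) / r t) t = _ from
    h3.deriv, potential_eq lam hz μ ht]
  simp only [Pi.sub_apply, Pi.mul_apply, ← show logDer lam z t = ∑ i, (lam i : ℂ) / (t - z i) from rfl]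
  field_simp
  ring

lemma deriv_eval (y : ℂ[X]) : deriv (fun t => y.eval t) = fun t => (derivative y).eval t :=
  funext fun _ => y.deriv

lemma analyticAt_eval (y : ℂ[X]) (t : ℂ) : AnalyticAt ℂ (fun t => y.eval t) t :=
  y.differentiable.analyticAt t

/-- Polynomial solutions and solutions of the oper. -/
theorem isSolutionAt_eval_div (lam : Fin N → ℕ) {z : Fin N → ℂ} (hz : Function.Injective z)
    {μ : Fin N → ℂ} {y : ℂ[X]} (hy : operD lam z μ y = 0) {t₀ : ℂ} (ht₀ : ∀ i, t₀ ≠ z i)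
    {r : ℂ → ℂ} (hr : AnalyticAt ℂ r t₀)
    (hr2 : ∀ᶠ t in 𝓝 t₀, r t ^ 2 = ∏ i, (t - z i) ^ lam i) :
    IsSolutionAt (potential lam z μ) (fun t => y.eval t / r t) t₀ := by
  have h := eventually_conjugate lam hz μ ht₀ hr hr2 (analyticAt_eval y t₀)
  refine ⟨(analyticAt_eval y t₀).div hr h.self_of_nhds.1, ?_⟩
  have hz' : ∀ᶠ t in 𝓝 t₀, ∀ i, t ≠ z i :=
    Filter.eventually_all.mpr fun i => isOpen_ne.mem_nhds (ht₀ i)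
  filter_upwards [h, hz'] with t ht htz
  have h1 := congrArg (eval t) hy
  rw [eval_operD htz, eval_zero] at h1
  have h2 := (mul_eq_zero.mp h1).resolve_left (eval_nodal_ne_zero htz)
  rw [deriv_eval, deriv_eval, logDer, h2, zero_div] at ht
  exact sub_eq_zero.mp ht.2

theorem operD_eq_zero_iff_betheFunctionSolves (lam : Fin N → ℕ) {z : Fin N → ℂ}
    (hz : Function.Injective z) (μ : Fin N → ℂ) {m : ℕ} (w : Fin m → ℂ) :
    operD lam z μ (bethePoly w) = 0 ↔ BetheFunctionSolves lam z μ w := by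
  constructor
  · intro h t₀ ht₀ r hr hr2
    have := isSolutionAt_eval_div lam hz h ht₀ hr hr2
    simpa only [eval_bethePoly] using this
  · intro h
    refine polynomial_ext_of_forall_ne (z := z) fun t₀ ht₀ => ?_
    obtain ⟨r, hr, hr2⟩ := exists_analytic_sqrt lam ht₀
    have h1 := (h t₀ ht₀ r hr hr2).2.self_of_nhds
    obtain ⟨hn, h2⟩ := (eventually_conjugate lam hz μ ht₀ hr hr2
      (analyticAt_eval (bethePoly w) t₀)).self_of_nhds
    simp only [← eval_bethePoly] at h1
    rw [h1, sub_self, deriv_eval, deriv_eval, eq_comm, div_eq_zero_iff, or_iff_left hn] at h2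
    rw [eval_operD ht₀, ← logDer, h2, mul_zero, eval_zero]

theorem miuraForm_iff_betheFunctionSolves (lam : Fin N → ℕ) {z : Fin N → ℂ}
    (hz : Function.Injective z) (μ : Fin N → ℂ) {m : ℕ} (w : Fin m → ℂ) :
    MiuraForm lam z μ w ↔ BetheFunctionSolves lam z μ w :=
  (miuraForm_iff_operD lam hz μ w).trans (operD_eq_zero_iff_betheFunctionSolves lam hz μ w)

end

section
open Polynomial
variable {N : ℕ}

/-! ### Monodromy of opers with polynomial solutions -/

lemma exists_wronskian_eq_const {q φ ψ : ℂ → ℂ} {t₀ : ℂ} (hφ : IsSolutionAt q φ t₀)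
    (hψ : IsSolutionAt q ψ t₀) : ∀ᶠ t in 𝓝 t₀,
      φ t * deriv ψ t - deriv φ t * ψ t = φ t₀ * deriv ψ t₀ - deriv φ t₀ * ψ t₀ := by
  have h : ∀ᶠ t in 𝓝 t₀, HasDerivAt (fun t => φ t * deriv ψ t - deriv φ t * ψ t) 0 t := by
    filter_upwards [hφ.1.eventually_analyticAt, hψ.1.eventually_analyticAt, hφ.2, hψ.2]
      with t h1 h2 h3 h4
    refine ((h1.differentiableAt.hasDerivAt.mul h2.deriv.differentiableAt.hasDerivAt).sub
      (h1.deriv.differentiableAt.hasDerivAt.mul h2.differentiableAt.hasDerivAt)).congr_deriv ?_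
    rw [h3, h4]; ring
  obtain ⟨ε, hε, hball⟩ := Metric.eventually_nhds_iff_ball.mp h
  filter_upwards [Metric.ball_mem_nhds t₀ hε] with t ht
  exact Metric.isOpen_ball.is_const_of_deriv_eq_zero (convex_ball t₀ ε).isPreconnected
    (fun s hs => (hball s hs).differentiableAt.differentiableWithinAt)
    (fun s hs => (hball s hs).deriv) ht (Metric.mem_ball_self hε)

/-- A zero of the Wronskian would give a nontrivial combination of y_0, y_1 with a double root at an
ordinary point, or else a double root of y_1. -/
lemma eval_wronskian_ne_zero {lam : Fin N → ℕ} {z μ : Fin N → ℂ} {y : Fin 2 → ℂ[X]}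
    (hy : LinearIndependent ℂ y) (hD : ∀ k, operD lam z μ (y k) = 0) {t : ℂ}
    (ht : ∀ i, t ≠ z i) :
    (y 0).eval t * (derivative (y 1)).eval t - (derivative (y 0)).eval t * (y 1).eval t ≠ 0 := by
  intro hW
  have hli := LinearIndependent.pair_iff.mp
    (show LinearIndependent ℂ ![y 0, y 1] by convert hy using 1; ext k; fin_cases k <;> rfl)
  have key : ∀ a b : ℂ, a * (y 0).eval t + b * (y 1).eval t = 0 →
      a * (derivative (y 0)).eval t + b * (derivative (y 1)).eval t = 0 → a = 0 := by
    intro a b h1 h2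
    refine (hli a b (eq_zero_of_operD_eq_zero_of_double_root ht (lam := lam) (μ := μ) ?_ ?_ ?_)).1
    · rw [map_add, map_smul, map_smul, hD, hD, smul_zero, smul_zero, add_zero]
    · rw [eval_add, eval_smul, eval_smul]; exact h1
    · rw [derivative_add, derivative_smul, derivative_smul, eval_add, eval_smul, eval_smul]
      exact h2
  have h1 := key ((y 1).eval t) (-(y 0).eval t) (by ring) (by linear_combination -hW)
  have h2 := key ((derivative (y 1)).eval t) (-(derivative (y 0)).eval t)
    (by linear_combination hW) (by ring)
  exact hy.ne_zero 1 (eq_zero_of_operD_eq_zero_of_double_root ht (hD 1) h1 h2)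

/-- Cramer's rule: φ is a combination of y_0/r and y_1/r whose coefficients are quotients of
Wronskians, and these are constant because the equation has no first order term. -/
lemma exists_combination_of_solution {lam : Fin N → ℕ} {z μ : Fin N → ℂ}
    (hz : Function.Injective z) {y : Fin 2 → ℂ[X]} (hy : LinearIndependent ℂ y)
    (hD : ∀ k, operD lam z μ (y k) = 0) {t₀ : ℂ} (ht₀ : ∀ i, t₀ ≠ z i) {r : ℂ → ℂ}
    (hr : AnalyticAt ℂ r t₀) (hr2 : ∀ᶠ t in 𝓝 t₀, r t ^ 2 = ∏ i, (t - z i) ^ lam i) {φ : ℂ → ℂ}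
    (hφ : IsSolutionAt (potential lam z μ) φ t₀) :
    ∃ p : ℂ[X], ∀ᶠ t in 𝓝 t₀, φ t * r t = p.eval t := by
  have hs := fun k => isSolutionAt_eval_div lam hz (hD k) ht₀ hr hr2
  have hr0 : ∀ᶠ t in 𝓝 t₀, r t ≠ 0 :=
    (eventually_conjugate lam hz μ ht₀ hr hr2 (analyticAt_const (v := 0))).mono fun t h => h.1
  set f : Fin 2 → ℂ → ℂ := fun k t => (y k).eval t / r t with hf
  have hd : ∀ k, deriv (f k) t₀ =
      ((derivative (y k)).eval t₀ * r t₀ - (y k).eval t₀ * deriv r t₀) / r t₀ ^ 2 := fun k =>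
    (((y k).hasDerivAt t₀).div hr.differentiableAt.hasDerivAt hr0.self_of_nhds).deriv
  set W := f 0 t₀ * deriv (f 1) t₀ - deriv (f 0) t₀ * f 1 t₀ with hW
  have hW0 : W ≠ 0 := by
    have e : W = ((y 0).eval t₀ * (derivative (y 1)).eval t₀
        - (derivative (y 0)).eval t₀ * (y 1).eval t₀) / r t₀ ^ 2 := by
      rw [hW, hd, hd, hf]
      field_simp [hr0.self_of_nhds]
      ring
    rw [e]
    exact div_ne_zero (eval_wronskian_ne_zero hy hD ht₀) (pow_ne_zero _ hr0.self_of_nhds)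
  set A := φ t₀ * deriv (f 1) t₀ - deriv φ t₀ * f 1 t₀ with hA
  set B := φ t₀ * deriv (f 0) t₀ - deriv φ t₀ * f 0 t₀ with hB
  refine ⟨C (A / W) * y 0 - C (B / W) * y 1, ?_⟩
  filter_upwards [exists_wronskian_eq_const (hs 0) (hs 1), exists_wronskian_eq_const hφ (hs 1),
    exists_wronskian_eq_const hφ (hs 0), hr0] with t h1 h2 h3 h4
  change f 0 t * deriv (f 1) t - deriv (f 0) t * f 1 t = W at h1
  change φ t * deriv (f 1) t - deriv φ t * f 1 t = A at h2
  change φ t * deriv (f 0) t - deriv φ t * f 0 t = B at h3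
  have e : W * φ t = A * f 0 t - B * f 1 t := by
    rw [← h1, ← h2, ← h3]; ring
  rw [eval_sub, eval_mul, eval_mul, eval_C, eval_C]
  simp only [hf] at e
  field_simp at e ⊢
  exact e

/-- In a product of two solutions the square root r appears squared, so its sign ambiguity
disappears. -/
lemma exists_product_eq_eval {lam : Fin N → ℕ} {z μ : Fin N → ℂ}
    (hz : Function.Injective z) {y : Fin 2 → ℂ[X]} (hy : LinearIndependent ℂ y)
    (hD : ∀ k, operD lam z μ (y k) = 0) {t₀ : ℂ} (ht₀ : ∀ i, t₀ ≠ z i) {φ ψ : ℂ → ℂ}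
    (hφ : IsSolutionAt (potential lam z μ) φ t₀) (hψ : IsSolutionAt (potential lam z μ) ψ t₀) :
    ∃ p : ℂ[X], ∀ᶠ t in 𝓝 t₀, φ t * ψ t * ∏ i, (t - z i) ^ lam i = p.eval t := by
  obtain ⟨r, hr, hr2⟩ := exists_analytic_sqrt lam ht₀
  obtain ⟨p, hp⟩ := exists_combination_of_solution hz hy hD ht₀ hr hr2 hφ
  obtain ⟨p', hp'⟩ := exists_combination_of_solution hz hy hD ht₀ hr hr2 hψ
  refine ⟨p * p', ?_⟩
  filter_upwards [hr2, hp, hp'] with t h1 h2 h3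
  rw [eval_mul, ← h1, ← h2, ← h3]; ring

lemma polynomial_eq_of_eventually_eq {p p' : ℂ[X]} {t₀ : ℂ}
    (h : ∀ᶠ t in 𝓝 t₀, p.eval t = p'.eval t) : p = p' :=
  Polynomial.eq_of_infinite_eval_eq p p' (infinite_of_mem_nhds t₀ h)

lemma germ_mul_eq_zero {f g : ℂ → ℂ} {x : ℂ} (hf : AnalyticAt ℂ f x) (hg : AnalyticAt ℂ g x)
    (h : ∀ᶠ t in 𝓝 x, f t * g t = 0) : (∀ᶠ t in 𝓝 x, f t = 0) ∨ ∀ᶠ t in 𝓝 x, g t = 0 := by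
  rcases hf.eventually_eq_zero_or_eventually_ne_zero with h1 | h1
  · exact Or.inl h1
  · right
    refine hg.frequently_zero_iff_eventually_zero.mp (Filter.Eventually.frequently ?_)
    filter_upwards [h1, h.filter_mono nhdsWithin_le_nhds] with t h2 h3
    exact (mul_eq_zero.mp h3).resolve_left h2

/-- The polynomial attached to the product F G is locally constant along the path, because
overlapping germs determine the same polynomial; hence it is the same at both ends. -/
lemma product_monodromy {lam : Fin N → ℕ} {z μ : Fin N → ℂ}
    (hz : Function.Injective z) {y : Fin 2 → ℂ[X]} (hy : LinearIndependent ℂ y)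
    (hD : ∀ k, operD lam z μ (y k) = 0) {x : ℂ} {γ : Path x x} (hγ : ∀ s i, γ s ≠ z i)
    {F G : unitInterval → ℂ → ℂ} (hF : IsContinuation (potential lam z μ) γ F)
    (hG : IsContinuation (potential lam z μ) γ G) :
    ∀ᶠ t in 𝓝 x, F 1 t * G 1 t = F 0 t * G 0 t := by
  choose P hP using fun s => exists_product_eq_eval hz hy hD (hγ s) (hF.solution s) (hG.solution s)
  have hloc : IsLocallyConstant P := by
    rw [IsLocallyConstant.iff_eventually_eq]
    intro s
    have hev : ∀ᶠ s' in 𝓝 s, ∀ᶠ t in 𝓝 (γ s'),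
        F s t * G s t * ∏ i, (t - z i) ^ lam i = (P s).eval t :=
      γ.continuous.continuousAt.eventually (hP s).eventually_nhds
    filter_upwards [hF.coherent s, hG.coherent s, hev] with s' h1 h2 h3
    refine polynomial_eq_of_eventually_eq (t₀ := γ s') ?_
    filter_upwards [h1, h2, h3, hP s'] with t e1 e2 e3 e4
    rw [← e3, ← e4, e1, e2]
  have hc := hloc.apply_eq_of_isPreconnected isPreconnected_univ (Set.mem_univ 1) (Set.mem_univ 0)
  have h0 := hP 0
  have h1 := hP 1
  rw [γ.source] at h0
  rw [γ.target, hc] at h1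
  have hx : ∀ i, x ≠ z i := fun i => by simpa using hγ 0 i
  have hz' : ∀ᶠ t in 𝓝 x, ∀ i, t ≠ z i :=
    Filter.eventually_all.mpr fun i => isOpen_ne.mem_nhds (hx i)
  filter_upwards [h0, h1, hz'] with t e0 e1 e2
  have hne : ∏ i, (t - z i) ^ lam i ≠ 0 :=
    Finset.prod_ne_zero_iff.mpr fun i _ => pow_ne_zero _ (sub_ne_zero.mpr (e2 i))
  exact mul_right_cancel₀ hne (e1.trans e0.symm)

/-- From F_1² = F_0² follows F_1 = ±F_0, as germs of analytic functions form a domain. If some F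
changes sign and is not zero, then F_1 G_1 = F_0 G_0 makes every other G change sign, so the sign is
common to all solutions. -/
theorem plusMinusOneMonodromy_of_two_solutions {lam : Fin N → ℕ} {z μ : Fin N → ℂ}
    (hz : Function.Injective z) {y : Fin 2 → ℂ[X]} (hy : LinearIndependent ℂ y)
    (hD : ∀ k, operD lam z μ (y k) = 0) : PlusMinusOneMonodromy z (potential lam z μ) := by
  intro x γ hγ
  have han : ∀ F : unitInterval → ℂ → ℂ, IsContinuation (potential lam z μ) γ F →
      AnalyticAt ℂ (F 0) x ∧ AnalyticAt ℂ (F 1) x := fun F hF =>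
    ⟨by simpa using (hF.solution 0).1, by simpa using (hF.solution 1).1⟩
  by_cases hall : HasScalarMonodromy (potential lam z μ) γ 1
  · exact Or.inl hall
  right
  simp only [HasScalarMonodromy, not_forall] at hall
  obtain ⟨F, hF, hne⟩ := hall
  have hneg : ∀ᶠ t in 𝓝 x, F 1 t + F 0 t = 0 := by
    refine (germ_mul_eq_zero ((han F hF).2.sub (han F hF).1) ((han F hF).2.add (han F hF).1)
      ?_).resolve_left fun h => hne ?_
    · filter_upwards [product_monodromy hz hy hD hγ hF hF] with t h
      simp only [Pi.sub_apply, Pi.add_apply]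
      linear_combination h
    · filter_upwards [h] with t h
      rw [one_mul]; exact sub_eq_zero.mp h
  intro G hG
  have hGn : ∀ᶠ t in 𝓝 x, G 1 t + G 0 t = 0 := by
    refine (germ_mul_eq_zero (han F hF).1 ((han G hG).2.add (han G hG).1)
      ?_).resolve_left fun h => hne ?_
    · filter_upwards [product_monodromy hz hy hD hγ hF hG, hneg] with t h h'
      simp only [Pi.add_apply]
      linear_combination -h + G 1 t * h'
    · filter_upwards [h, hneg] with t h h'
      rw [h, add_zero] at h'
      rw [h, h', mul_zero]
  filter_upwards [hGn] with t h
  linear_combination h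

lemma trivialPGL2Monodromy_of_plusMinusOne {z : Fin N → ℂ} {q : ℂ → ℂ}
    (h : PlusMinusOneMonodromy z q) : TrivialPGL2Monodromy z q := fun x γ hγ =>
  (h x γ hγ).elim (fun h => ⟨1, one_ne_zero, h⟩) fun h => ⟨-1, neg_ne_zero.mpr one_ne_zero, h⟩

end

section

/-! ### Convergent power series -/

open PowerSeries in
/-- The coefficients of `f` grow at most geometrically. -/
def HasGeometricGrowth (f : PowerSeries ℂ) : Prop :=
  ∃ M R : ℝ, 0 ≤ M ∧ 1 ≤ R ∧ ∀ n, ‖coeff n f‖ ≤ M * R ^ n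

/-- The sum of a power series. -/
def seriesSum (f : PowerSeries ℂ) (s : ℂ) : ℂ := ∑' n, PowerSeries.coeff n f * s ^ n

namespace HasGeometricGrowth
open PowerSeries

variable {f g : PowerSeries ℂ}

lemma add (hf : HasGeometricGrowth f) (hg : HasGeometricGrowth g) : HasGeometricGrowth (f + g) := by
  obtain ⟨M, R, hM, hR, h⟩ := hf
  obtain ⟨M', R', hM', hR', h'⟩ := hg
  refine ⟨M + M', max R R', by positivity, hR.trans (le_max_left _ _), fun n => ?_⟩
  rw [map_add, add_mul]
  refine (norm_add_le _ _).trans (add_le_add ((h n).trans ?_) ((h' n).trans ?_))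
  · gcongr; exact le_max_left _ _
  · gcongr; exact le_max_right _ _

/-- The doubled rate absorbs the n + 1 terms of the convolution. -/
lemma mul (hf : HasGeometricGrowth f) (hg : HasGeometricGrowth g) : HasGeometricGrowth (f * g) := by
  obtain ⟨M, R, hM, hR, h⟩ := hf
  obtain ⟨M', R', hM', hR', h'⟩ := hg
  have hS : 1 ≤ max R R' := hR.trans (le_max_left _ _)
  refine ⟨M * M', 2 * max R R', by positivity, by linarith, fun n => ?_⟩
  rw [coeff_mul]
  calc ‖∑ p ∈ Finset.HasAntidiagonal.antidiagonal n, coeff p.1 f * coeff p.2 g‖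
      ≤ ∑ p ∈ Finset.HasAntidiagonal.antidiagonal n, M * M' * max R R' ^ n := by
        refine norm_sum_le_of_le _ fun p hp => ?_
        rw [norm_mul]
        calc ‖coeff p.1 f‖ * ‖coeff p.2 g‖ ≤ (M * max R R' ^ p.1) * (M' * max R R' ^ p.2) := by
              gcongr
              · exact (h _).trans (by gcongr; exact le_max_left _ _)
              · exact (h' _).trans (by gcongr; exact le_max_right _ _)
          _ = M * M' * max R R' ^ n := by
              rw [← Finset.HasAntidiagonal.mem_antidiagonal.mp hp, pow_add]; ring
    _ = (n + 1) * (M * M' * max R R' ^ n) := by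
        rw [Finset.sum_const, Finset.Nat.card_antidiagonal, nsmul_eq_mul]; push_cast; ring
    _ ≤ 2 ^ n * (M * M' * max R R' ^ n) := by
        gcongr
        exact_mod_cast Nat.lt_two_pow_self
    _ = M * M' * (2 * max R R') ^ n := by rw [mul_pow]; ring

lemma derivative (hf : HasGeometricGrowth f) : HasGeometricGrowth (d⁄dX ℂ f) := by
  obtain ⟨M, R, hM, hR, h⟩ := hf
  refine ⟨M * R, 2 * R, by positivity, by linarith, fun n => ?_⟩
  rw [coeff_derivative, norm_mul]
  have h1 : ‖((n : ℂ) + 1)‖ ≤ 2 ^ n := by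
    have : ((n : ℂ) + 1) = ((n + 1 : ℕ) : ℂ) := by push_cast; ring
    rw [this, Complex.norm_natCast]
    exact_mod_cast Nat.lt_two_pow_self
  calc ‖coeff (n + 1) f‖ * ‖((n : ℂ) + 1)‖ ≤ (M * R ^ (n + 1)) * 2 ^ n := by
        gcongr; exact h _
    _ = M * R * (2 * R) ^ n := by rw [mul_pow, pow_succ]; ring

lemma of_polynomial (p : Polynomial ℂ) : HasGeometricGrowth (p : PowerSeries ℂ) := by
  refine ⟨∑ i ∈ p.support, ‖p.coeff i‖, 1, Finset.sum_nonneg fun _ _ => norm_nonneg _, le_rfl,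
    fun n => ?_⟩
  rw [one_pow, mul_one, Polynomial.coeff_coe]
  by_cases hn : n ∈ p.support
  · exact Finset.single_le_sum (f := fun i => ‖p.coeff i‖) (fun _ _ => norm_nonneg _) hn
  · rw [Polynomial.notMem_support_iff.mp hn, norm_zero]
    exact Finset.sum_nonneg fun _ _ => norm_nonneg _

lemma eventually_summable (hf : HasGeometricGrowth f) :
    ∀ᶠ s in 𝓝 (0 : ℂ), Summable fun n => ‖coeff n f * s ^ n‖ := by
  obtain ⟨M, R, hM, hR, h⟩ := hf
  have hR0 : 0 < R := by linarith
  filter_upwards [Metric.ball_mem_nhds (0 : ℂ) (show 0 < 1 / (2 * R) by positivity)] with s hs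
  rw [mem_ball_zero_iff] at hs
  refine Summable.of_nonneg_of_le (fun _ => norm_nonneg _) (fun n => ?_)
    ((summable_geometric_of_lt_one (by norm_num) (show (1 / 2 : ℝ) < 1 by norm_num)).mul_left M)
  rw [norm_mul, norm_pow]
  calc ‖coeff n f‖ * ‖s‖ ^ n ≤ M * R ^ n * (1 / (2 * R)) ^ n := by
        gcongr; exact h n
    _ = M * (1 / 2) ^ n := by
        rw [mul_assoc, ← mul_pow]; congr 2; field_simp

lemma eventually_seriesSum_add (hf : HasGeometricGrowth f) (hg : HasGeometricGrowth g) :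
    ∀ᶠ s in 𝓝 (0 : ℂ), seriesSum (f + g) s = seriesSum f s + seriesSum g s := by
  filter_upwards [hf.eventually_summable, hg.eventually_summable] with s h1 h2
  rw [seriesSum, seriesSum, seriesSum, ← h1.of_norm.tsum_add h2.of_norm]
  exact tsum_congr fun n => by rw [map_add, add_mul]

lemma eventually_seriesSum_mul (hf : HasGeometricGrowth f) (hg : HasGeometricGrowth g) :
    ∀ᶠ s in 𝓝 (0 : ℂ), seriesSum (f * g) s = seriesSum f s * seriesSum g s := by
  filter_upwards [hf.eventually_summable, hg.eventually_summable] with s h1 h2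
  rw [seriesSum, seriesSum, seriesSum,
    tsum_mul_tsum_eq_tsum_sum_antidiagonal_of_summable_norm h1 h2]
  refine tsum_congr fun n => ?_
  rw [coeff_mul, Finset.sum_mul]
  refine Finset.sum_congr rfl fun p hp => ?_
  rw [← Finset.HasAntidiagonal.mem_antidiagonal.mp hp, pow_add]; ring

lemma eventually_hasDerivAt (hf : HasGeometricGrowth f) :
    ∀ᶠ s in 𝓝 (0 : ℂ), HasDerivAt (seriesSum f) (seriesSum (d⁄dX ℂ f) s) s := by
  obtain ⟨M, R, hM, hR, h⟩ := hf
  have hR0 : 0 < R := by linarith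
  have hsum : Summable fun n => M * R * 2 * (1 / 2 : ℝ) ^ n :=
    (summable_geometric_of_lt_one (by norm_num) (by norm_num)).mul_left _
  filter_upwards [Metric.ball_mem_nhds (0 : ℂ) (show 0 < 1 / (4 * R) by positivity)] with s hs
  have hb : ∀ n, ∀ y ∈ Metric.ball (0 : ℂ) (1 / (4 * R)),
      ‖coeff n f * (n * y ^ (n - 1))‖ ≤ M * R * 2 * (1 / 2 : ℝ) ^ n := by
    intro n y hy
    rw [mem_ball_zero_iff] at hy
    cases n with
    | zero => simp; positivity
    | succ m =>
      rw [Nat.add_sub_cancel, norm_mul, norm_mul, norm_pow, Complex.norm_natCast]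
      calc ‖coeff (m + 1) f‖ * (((m + 1 : ℕ) : ℝ) * ‖y‖ ^ m)
          ≤ M * R ^ (m + 1) * (2 ^ m * (1 / (4 * R)) ^ m) := by
            gcongr
            · exact h _
            · exact_mod_cast Nat.lt_two_pow_self
        _ = M * R * 2 * (1 / 2 : ℝ) ^ (m + 1) := by
            rw [pow_succ, pow_succ, ← mul_pow,
              show M * (R ^ m * R) * (2 * (1 / (4 * R))) ^ m =
                M * R * (R * (2 * (1 / (4 * R)))) ^ m by rw [mul_pow R]; ring,
              show R * (2 * (1 / (4 * R))) = 1 / 2 by field_simp; norm_num]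
            ring
  have key := hasDerivAt_tsum_of_isPreconnected hsum Metric.isOpen_ball
    (convex_ball (0 : ℂ) (1 / (4 * R))).isPreconnected
    (g := fun n y => coeff n f * y ^ n) (g' := fun n y => coeff n f * (n * y ^ (n - 1)))
    (fun n y _ => (hasDerivAt_pow n y).const_mul _) hb
    (Metric.mem_ball_self (by positivity)) (summable_of_ne_finset_zero (s := {0}) fun n hn => by
      rw [zero_pow (by simpa using hn), mul_zero]) hs
  refine key.congr_deriv ?_
  rw [(Summable.of_norm_bounded hsum fun n => hb n s hs).tsum_eq_zero_add, seriesSum]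
  simp only [Nat.cast_zero, zero_mul, mul_zero, zero_add, Nat.add_sub_cancel]
  refine tsum_congr fun n => ?_
  rw [coeff_derivative]; push_cast; ring

lemma analyticAt (hf : HasGeometricGrowth f) : AnalyticAt ℂ (seriesSum f) 0 :=
  Complex.analyticAt_iff_eventually_differentiableAt.mpr
    (hf.eventually_hasDerivAt.mono fun _ h => h.differentiableAt)

end HasGeometricGrowth

lemma seriesSum_coe (p : Polynomial ℂ) (s : ℂ) : seriesSum (p : PowerSeries ℂ) s = p.eval s := by
  rw [seriesSum, Polynomial.eval_eq_sum_range, tsum_eq_sum (s := Finset.range (p.natDegree + 1))]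
  · simp only [Polynomial.coeff_coe]
  · intro n hn
    rw [Polynomial.coeff_coe, Polynomial.coeff_eq_zero_of_natDegree_lt, zero_mul]
    simpa [Nat.lt_succ_iff] using hn

lemma seriesSum_zero (f : PowerSeries ℂ) : seriesSum f 0 = PowerSeries.coeff 0 f := by
  rw [seriesSum, tsum_eq_single 0 fun n hn => by rw [zero_pow hn, mul_zero], pow_zero, mul_one]

/-! ### Frobenius series -/

lemma exists_recursive {Φ : ℕ → (ℕ → ℂ) → ℂ}
    (hΦ : ∀ n f g, (∀ k ≤ n, f k = g k) → Φ n f = Φ n g) (x₀ : ℂ) :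
    ∃ f : ℕ → ℂ, f 0 = x₀ ∧ ∀ n, f (n + 1) = Φ n f := by
  -- The n-th function has the correct values up to index n; later updates do not touch them.
  let G : ℕ → ℕ → ℂ := fun n => Nat.rec (fun _ => x₀) (fun k g => Function.update g (k + 1) (Φ k g)) n
  have hG : ∀ n, G (n + 1) = Function.update (G n) (n + 1) (Φ n (G n)) := fun n => rfl
  have hst : ∀ k d, G (k + d) k = G k k := by
    intro k d
    induction d with
    | zero => rfl
    | succ d ih => rw [← add_assoc, hG, Function.update_of_ne (by omega), ih]
  refine ⟨fun n => G n n, rfl, fun n => ?_⟩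
  change G (n + 1) (n + 1) = _
  rw [hG, Function.update_self]
  refine hΦ n _ _ fun k hk => ?_
  have := hst k (n - k)
  rwa [Nat.add_sub_cancel' hk] at this

lemma exists_geometric_bound {f h : ℕ → ℝ} {K M R : ℝ} (hf : ∀ n, 0 ≤ f n) (hK : 0 ≤ K)
    (hM : 0 ≤ M) (hR : 1 ≤ R) (hh : ∀ n, h n ≤ M * R ^ n)
    (hrec : ∀ n, f (n + 1) ≤ h n + K * ∑ l ∈ Finset.range (n + 1), f l) :
    ∃ M' R' : ℝ, 0 ≤ M' ∧ 1 ≤ R' ∧ ∀ n, f n ≤ M' * R' ^ n := by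
  -- S makes each of the two contributions at most half: 2K ≤ S − 1 bounds the geometric sum, and R
  -- ≤ S, 2 ≤ S bound the inhomogeneous term.
  set S := 2 * K + R + 1 with hS
  have hS1 : 2 ≤ S := by linarith
  refine ⟨M + f 0, S, add_nonneg hM (hf 0), by linarith, fun n => ?_⟩
  induction n using Nat.strong_induction_on with
  | _ n ih =>
    cases n with
    | zero => rw [pow_zero, mul_one]; linarith
    | succ n =>
      have hsum : ∑ l ∈ Finset.range (n + 1), f l ≤
          (M + f 0) * ∑ l ∈ Finset.range (n + 1), S ^ l := by
        rw [Finset.mul_sum]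
        exact Finset.sum_le_sum fun l hl => ih l (Finset.mem_range.mp hl)
      have hgeo : (∑ l ∈ Finset.range (n + 1), S ^ l) * (S - 1) = S ^ (n + 1) - 1 :=
        geom_sum_mul S (n + 1)
      have hKg : K * (∑ l ∈ Finset.range (n + 1), S ^ l) ≤ S ^ (n + 1) / 2 := by
        have h0 : 0 ≤ ∑ l ∈ Finset.range (n + 1), S ^ l := Finset.sum_nonneg fun _ _ => by positivity
        have h1 : (2 * K) * (∑ l ∈ Finset.range (n + 1), S ^ l) ≤
            (S - 1) * (∑ l ∈ Finset.range (n + 1), S ^ l) := by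
          gcongr; linarith
        linarith
      have hhn : h n ≤ (M + f 0) * (S ^ (n + 1) / 2) := by
        refine (hh n).trans ?_
        have h1 : R ^ n ≤ S ^ n := by gcongr; linarith
        have h2 : S ^ n ≤ S ^ (n + 1) / 2 := by
          rw [pow_succ]
          have : 0 ≤ S ^ n := by positivity
          nlinarith
        calc M * R ^ n ≤ (M + f 0) * R ^ n := by gcongr; linarith [hf 0]
          _ ≤ (M + f 0) * (S ^ (n + 1) / 2) := by
            gcongr
            · exact add_nonneg hM (hf 0)
            · exact h1.trans h2
      calc f (n + 1) ≤ h n + K * ∑ l ∈ Finset.range (n + 1), f l := hrec n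
        _ ≤ (M + f 0) * (S ^ (n + 1) / 2) +
            K * ((M + f 0) * ∑ l ∈ Finset.range (n + 1), S ^ l) := by gcongr
        _ = (M + f 0) * (S ^ (n + 1) / 2) +
            (M + f 0) * (K * ∑ l ∈ Finset.range (n + 1), S ^ l) := by ring
        _ ≤ (M + f 0) * (S ^ (n + 1) / 2) + (M + f 0) * (S ^ (n + 1) / 2) := by
            gcongr
            exact add_nonneg hM (hf 0)
        _ = (M + f 0) * S ^ (n + 1) := by ring

open PowerSeries in
/-- The operator `f ↦ s a f'' - b f' + c f` on power series in `s`. -/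
def frobeniusOp (a b c f : PowerSeries ℂ) : PowerSeries ℂ :=
  X * a * d⁄dX ℂ (d⁄dX ℂ f) - b * d⁄dX ℂ f + c * f

open PowerSeries in
lemma coeff_frobeniusOp (a b c f : PowerSeries ℂ) (n : ℕ) :
    coeff n (frobeniusOp a b c f) = ∑ j ∈ Finset.range (n + 1),
      ((coeff (n - j) a * j - coeff (n - j) b) * (j + 1) * coeff (j + 1) f
        + coeff (n - j) c * coeff j f) := by
  have hX : ∀ j, coeff j (X * d⁄dX ℂ (d⁄dX ℂ f)) = j * (j + 1) * coeff (j + 1) f := by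
    intro j
    cases j with
    | zero => simp
    | succ j => rw [coeff_succ_X_mul, coeff_derivative, coeff_derivative]; push_cast; ring
  rw [frobeniusOp, show X * a * d⁄dX ℂ (d⁄dX ℂ f) = X * d⁄dX ℂ (d⁄dX ℂ f) * a by ring,
    mul_comm b, mul_comm c, map_add, map_sub, coeff_mul, coeff_mul, coeff_mul,
    Finset.Nat.sum_antidiagonal_eq_sum_range_succ_mk, Finset.Nat.sum_antidiagonal_eq_sum_range_succ_mk,
    Finset.Nat.sum_antidiagonal_eq_sum_range_succ_mk, ← Finset.sum_sub_distrib,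
    ← Finset.sum_add_distrib]
  refine Finset.sum_congr rfl fun j _ => ?_
  rw [hX, coeff_derivative]
  ring

/-- The indicial polynomial is quadratic in n with nonzero leading coefficient, so the quotient
converges. At a resonance the inverse of zero is 0, which does no harm to the bound. The weight (n +
1)² matches the growth of the coefficients in the recursion. -/
lemma exists_indicial_bound {a b : ℂ} (ha : a ≠ 0) :
    ∃ K : ℝ, 0 ≤ K ∧ ∀ n : ℕ, ((n : ℝ) + 1) ^ 2 * ‖(((n : ℂ) + 1) * (a * n - b))⁻¹‖ ≤ K := by
  have h : Filter.Tendsto (fun n : ℕ => (a - (a + b) * ((n : ℂ) + 1)⁻¹)⁻¹) Filter.atTop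
      (𝓝 (a - (a + b) * 0)⁻¹) := by
    refine Filter.Tendsto.inv₀ ?_ (by simpa using ha)
    refine tendsto_const_nhds.sub (tendsto_const_nhds.mul ?_)
    have := (tendsto_one_div_add_atTop_nhds_zero_nat (𝕜 := ℂ))
    simpa only [one_div] using this
  obtain ⟨K, hK⟩ := (Metric.isBounded_range_of_tendsto _ h).exists_norm_le
  refine ⟨K, (norm_nonneg _).trans (hK _ ⟨0, rfl⟩), fun n => ?_⟩
  refine le_trans (le_of_eq ?_) (hK _ ⟨n, rfl⟩)
  have hn : ((n : ℂ) + 1) ≠ 0 := Nat.cast_add_one_ne_zero n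
  have hn' : ‖(n : ℂ) + 1‖ = (n : ℝ) + 1 := by
    have : ((n : ℂ) + 1) = ((n + 1 : ℕ) : ℂ) := by push_cast; ring
    rw [this, Complex.norm_natCast]; push_cast; ring
  have e : a - (a + b) * ((n : ℂ) + 1)⁻¹ = ((n : ℂ) + 1)⁻¹ * (a * n - b) := by
    field_simp; ring
  change _ = ‖(a - (a + b) * ((n : ℂ) + 1)⁻¹)⁻¹‖
  rw [e, mul_inv, mul_inv, inv_inv, norm_mul, norm_mul, norm_inv, hn']
  field_simp

lemma exists_coeff_bound (p : Polynomial ℂ) : ∃ K : ℝ, 0 ≤ K ∧ ∀ n, ‖p.coeff n‖ ≤ K := by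
  refine ⟨∑ i ∈ p.support, ‖p.coeff i‖, Finset.sum_nonneg fun _ _ => norm_nonneg _, fun n => ?_⟩
  by_cases hn : n ∈ p.support
  · exact Finset.single_le_sum (f := fun i => ‖p.coeff i‖) (fun _ _ => norm_nonneg _) hn
  · rw [Polynomial.notMem_support_iff.mp hn, norm_zero]
    exact Finset.sum_nonneg fun _ _ => norm_nonneg _

open PowerSeries in
/-- Frobenius' method: a convergent formal solution exists up to the resonant coefficient. -/
theorem exists_frobenius_solution {a b c : Polynomial ℂ} (ha : a.coeff 0 ≠ 0)
    {h : PowerSeries ℂ} (hh : HasGeometricGrowth h) (x₀ : ℂ) :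
    ∃ f : PowerSeries ℂ, HasGeometricGrowth f ∧ coeff 0 f = x₀ ∧
      ∀ n : ℕ, a.coeff 0 * n ≠ b.coeff 0 → coeff n (frobeniusOp a b c f) = coeff n h := by
  -- The equation in degree n solved for the coefficient n + 1. At a resonant n the value is 0, by
  -- the convention for the inverse of zero, and the equation is not claimed there.
  let Φ : ℕ → (ℕ → ℂ) → ℂ := fun n f => (((n : ℂ) + 1) * (a.coeff 0 * n - b.coeff 0))⁻¹ *
    (coeff n h - c.coeff 0 * f n - ∑ j ∈ Finset.range n,
      ((a.coeff (n - j) * j - b.coeff (n - j)) * (j + 1) * f (j + 1) + c.coeff (n - j) * f j))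
  obtain ⟨f, hf0, hf⟩ := exists_recursive (Φ := Φ) (fun n f g hfg => by
    simp only [Φ]
    rw [hfg n le_rfl]
    congr 2
    refine Finset.sum_congr rfl fun j hj => ?_
    have := Finset.mem_range.mp hj
    rw [hfg j this.le, hfg (j + 1) this]) x₀
  obtain ⟨K₀, hK₀, hb₀⟩ := exists_indicial_bound (b := b.coeff 0) ha
  obtain ⟨Ka, hKa, hba⟩ := exists_coeff_bound a
  obtain ⟨Kb, hKb, hbb⟩ := exists_coeff_bound b
  obtain ⟨Kc, hKc, hbc⟩ := exists_coeff_bound c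
  obtain ⟨M, R, hM, hR, hbh⟩ := hh
  refine ⟨PowerSeries.mk f, ?_, by rw [coeff_mk, hf0], fun n hn => ?_⟩
  · simp only [HasGeometricGrowth, coeff_mk]
    refine exists_geometric_bound (K := K₀ * (2 * (Ka + Kb + Kc))) (M := K₀ * M) (R := R)
      (h := fun n => K₀ * (M * R ^ n)) (fun _ => norm_nonneg _) (by positivity) (by positivity) hR
      (fun n => (by rw [mul_assoc])) fun n => ?_
    set D := (((n : ℂ) + 1) * (a.coeff 0 * n - b.coeff 0))⁻¹ with hD
    set L := Ka + Kb + Kc with hL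
    have hn1 : (1 : ℝ) ≤ ((n : ℝ) + 1) ^ 2 := by
      have : (0 : ℝ) ≤ n := Nat.cast_nonneg n
      nlinarith
    have hterm : ∀ j ∈ Finset.range n, ‖(a.coeff (n - j) * j - b.coeff (n - j)) * (j + 1) * f (j + 1)
        + c.coeff (n - j) * f j‖ ≤ L * ((n : ℝ) + 1) ^ 2 * (‖f (j + 1)‖ + ‖f j‖) := by
      intro j hj
      have hjn : (j : ℝ) ≤ n := by exact_mod_cast (Finset.mem_range.mp hj).le
      have hj1 : ‖(j : ℂ) + 1‖ ≤ (n : ℝ) + 1 := by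
        refine (norm_add_le _ _).trans ?_
        rw [Complex.norm_natCast, norm_one]; linarith
      have h1 : ‖(a.coeff (n - j) * j - b.coeff (n - j)) * (j + 1)‖ ≤ L * ((n : ℝ) + 1) ^ 2 := by
        rw [norm_mul]
        have h2 : ‖a.coeff (n - j) * j - b.coeff (n - j)‖ ≤ L * ((n : ℝ) + 1) := by
          refine (norm_sub_le _ _).trans ?_
          rw [norm_mul, Complex.norm_natCast]
          have e1 : ‖a.coeff (n - j)‖ * j ≤ Ka * n := by gcongr; exact hba _
          have e2 := hbb (n - j)
          have : 0 ≤ (Kb + Kc) * (n : ℝ) := by positivity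
          rw [hL]; nlinarith
        calc _ ≤ L * ((n : ℝ) + 1) * ((n : ℝ) + 1) := by gcongr
          _ = _ := by ring
      have h3 : ‖c.coeff (n - j)‖ ≤ L * ((n : ℝ) + 1) ^ 2 := by
        have : Kc ≤ L := by rw [hL]; linarith
        have h4 : 0 ≤ L := by positivity
        nlinarith [hbc (n - j)]
      refine (norm_add_le _ _).trans ?_
      have h5 := mul_le_mul_of_nonneg_right h1 (norm_nonneg (f (j + 1)))
      have h6 := mul_le_mul_of_nonneg_right h3 (norm_nonneg (f j))
      rw [← norm_mul] at h5 h6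
      linarith
    have hsum : ‖c.coeff 0 * f n‖ + ∑ j ∈ Finset.range n, L * ((n : ℝ) + 1) ^ 2 *
        (‖f (j + 1)‖ + ‖f j‖) ≤
        ((n : ℝ) + 1) ^ 2 * (2 * L * ∑ l ∈ Finset.range (n + 1), ‖f l‖) := by
      rw [← Finset.mul_sum, Finset.sum_add_distrib, norm_mul]
      have e1 := Finset.sum_range_succ' (fun l => ‖f l‖) n
      have e2 := Finset.sum_range_succ (fun l => ‖f l‖) n
      have e3 : ‖c.coeff 0‖ * ‖f n‖ ≤ L * ((n : ℝ) + 1) ^ 2 * ‖f n‖ := by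
        gcongr
        have : Kc ≤ L := by rw [hL]; linarith
        have h4 : 0 ≤ L := by positivity
        nlinarith [hbc 0]
      have e4 : 0 ≤ L * ((n : ℝ) + 1) ^ 2 * ‖f 0‖ := by positivity
      calc _ ≤ L * ((n : ℝ) + 1) ^ 2 * ‖f n‖ + L * ((n : ℝ) + 1) ^ 2 *
            (∑ j ∈ Finset.range n, ‖f (j + 1)‖ + ∑ j ∈ Finset.range n, ‖f j‖)
            + L * ((n : ℝ) + 1) ^ 2 * ‖f 0‖ := by linarith
        _ = L * ((n : ℝ) + 1) ^ 2 * ((∑ j ∈ Finset.range n, ‖f (j + 1)‖ + ‖f 0‖) +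
            (∑ j ∈ Finset.range n, ‖f j‖ + ‖f n‖)) := by ring
        _ = _ := by rw [← e1, ← e2]; ring
    have hD1 : ‖D‖ ≤ K₀ := by
      refine le_trans ?_ (hb₀ n)
      exact le_mul_of_one_le_left (norm_nonneg _) hn1
    rw [hf n]
    calc ‖Φ n f‖ ≤ ‖D‖ * (M * R ^ n + (‖c.coeff 0 * f n‖ + ∑ j ∈ Finset.range n,
          L * ((n : ℝ) + 1) ^ 2 * (‖f (j + 1)‖ + ‖f j‖))) := by
          simp only [Φ, ← hD]
          rw [norm_mul]
          gcongr
          refine (norm_sub_le _ _).trans ?_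
          rw [← add_assoc]
          refine add_le_add ((norm_sub_le _ _).trans ?_) (norm_sum_le_of_le _ hterm)
          gcongr
          exact hbh n
      _ ≤ ‖D‖ * (M * R ^ n + ((n : ℝ) + 1) ^ 2 *
          (2 * L * ∑ l ∈ Finset.range (n + 1), ‖f l‖)) := by gcongr
      _ = ‖D‖ * (M * R ^ n) + (((n : ℝ) + 1) ^ 2 * ‖D‖) *
          (2 * L * ∑ l ∈ Finset.range (n + 1), ‖f l‖) := by ring
      _ ≤ K₀ * (M * R ^ n) + K₀ * (2 * L * ∑ l ∈ Finset.range (n + 1), ‖f l‖) := by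
          gcongr
          exact hb₀ n
      _ = _ := by ring
  · rw [coeff_frobeniusOp, Finset.sum_range_succ]
    simp only [coeff_mk, Nat.sub_self, Polynomial.coeff_coe]
    rw [hf n]
    simp only [Φ]
    have hne : ((n : ℂ) + 1) * (a.coeff 0 * n - b.coeff 0) ≠ 0 :=
      mul_ne_zero (Nat.cast_add_one_ne_zero n) (sub_ne_zero.mpr hn)
    field_simp
    ring

end

section

/-! ### Formal solutions with a logarithm. -/

section FormalLog
open PowerSeries

lemma HasGeometricGrowth.of_X_mul {f : PowerSeries ℂ} (h : HasGeometricGrowth (X * f)) :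
    HasGeometricGrowth f := by
  obtain ⟨M, R, hM, hR, h⟩ := h
  refine ⟨M * R, R, by positivity, hR, fun n => ?_⟩
  have := h (n + 1)
  rw [coeff_succ_X_mul] at this
  refine this.trans (le_of_eq ?_)
  rw [pow_succ]; ring

lemma X_mul_derivative_X_pow (n : ℕ) :
    (X : PowerSeries ℂ) * d⁄dX ℂ (X ^ n) = (n : PowerSeries ℂ) * X ^ n := by
  cases n with
  | zero => simp
  | succ n =>
    rw [Derivation.leibniz_pow, Nat.add_sub_cancel, derivative_X, smul_eq_mul, mul_one,
      nsmul_eq_mul, pow_succ]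
    push_cast; ring

lemma derivative_X_pow_succ_mul (n : ℕ) (u : PowerSeries ℂ) :
    d⁄dX ℂ (X ^ (n + 1) * u) =
      ((n : PowerSeries ℂ) + 1) * X ^ n * u + X ^ (n + 1) * d⁄dX ℂ u := by
  have h := X_mul_derivative_X_pow (n + 1)
  have h2 : d⁄dX ℂ ((X : PowerSeries ℂ) ^ (n + 1)) = ((n : PowerSeries ℂ) + 1) * X ^ n := by
    refine X_mul_cancel ?_
    rw [h, pow_succ]; push_cast; ring
  rw [Derivation.leibniz, h2, smul_eq_mul, smul_eq_mul]; ring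

lemma frobeniusOp_add (a b c f g : PowerSeries ℂ) :
    frobeniusOp a b c (f + g) = frobeniusOp a b c f + frobeniusOp a b c g := by
  simp only [frobeniusOp, map_add]; ring

/-- Conjugation of `frobeniusOp` by a power of the variable. -/
lemma frobeniusOp_X_pow_mul (n : ℕ) {a b c q : PowerSeries ℂ}
    (hq : (n : PowerSeries ℂ) * a - b = X * q) (u : PowerSeries ℂ) :
    frobeniusOp a b c (X ^ (n + 1) * u) =
      X ^ (n + 1) * frobeniusOp a (b - 2 * (n + 1) * a) (c + (n + 1) * q) u := by
  have h1 := derivative_X_pow_succ_mul n u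
  have h2 := derivative_X_pow_succ_mul n (d⁄dX ℂ u)
  have h3 : X * d⁄dX ℂ (d⁄dX ℂ (X ^ (n + 1) * u)) = X ^ n * (((n : PowerSeries ℂ) + 1) * (n : PowerSeries ℂ) * u
      + 2 * ((n : PowerSeries ℂ) + 1) * X * d⁄dX ℂ u + X ^ 2 * d⁄dX ℂ (d⁄dX ℂ u)) := by
    have h4 : d⁄dX ℂ (((n : PowerSeries ℂ) + 1) * X ^ n * u) =
        ((n : PowerSeries ℂ) + 1) * (d⁄dX ℂ (X ^ n) * u + X ^ n * d⁄dX ℂ u) := by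
      have : ((n : PowerSeries ℂ) + 1) = ((n + 1 : ℕ) : PowerSeries ℂ) := by push_cast; ring
      rw [this, mul_assoc, Derivation.leibniz, Derivation.map_natCast, smul_zero, add_zero,
        Derivation.leibniz, smul_eq_mul, smul_eq_mul, smul_eq_mul]; ring
    rw [h1, map_add, h2, h4]
    linear_combination ((n : PowerSeries ℂ) + 1) * u * X_mul_derivative_X_pow n
  rw [frobeniusOp, frobeniusOp]
  linear_combination a * h3 - b * h1 + ((n : PowerSeries ℂ) + 1) * X ^ n * u * hq

/-- Either the resonance of the Frobenius equation is harmless, or there is a solution with a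
logarithm. -/
theorem exists_solution_or_log {a b c : Polynomial ℂ} {n : ℕ} (ha : a.coeff 0 ≠ 0)
    (hb : b.coeff 0 = n * a.coeff 0) :
    (∃ g : Polynomial ℂ, g.coeff 0 ≠ 0 ∧ Polynomial.X ^ (n + 1) ∣
      Polynomial.X * a * Polynomial.derivative (Polynomial.derivative g)
        - b * Polynomial.derivative g + c * g) ∨
    ∃ (κ : ℂ) (u p : PowerSeries ℂ), κ ≠ 0 ∧ HasGeometricGrowth u ∧ HasGeometricGrowth p ∧
      coeff 0 u = 1 ∧ frobeniusOp a b c (X ^ (n + 1) * u) = 0 ∧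
      frobeniusOp a b c p + PowerSeries.C κ * ((a : PowerSeries ℂ) *
        (2 * d⁄dX ℂ (X ^ (n + 1) * u) - X ^ n * u) - (b : PowerSeries ℂ) * (X ^ n * u)) = 0 := by
  have hres : ∀ k : ℕ, k ≠ n → a.coeff 0 * k ≠ b.coeff 0 := fun k hk h => by
    rw [hb, mul_comm] at h
    exact hk (Nat.cast_injective (mul_right_cancel₀ ha h))
  obtain ⟨f, hf, hf0, hfL⟩ := exists_frobenius_solution (b := b) (c := c) ha
    (HasGeometricGrowth.of_polynomial 0) 1
  -- The obstruction: n is the only resonant degree, so the operator maps f to o X^n.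
  set o := coeff n (frobeniusOp a b c f) with ho
  have hfL' : ∀ k, k ≠ n → coeff k (frobeniusOp a b c f) = 0 := fun k hk => by
    rw [hfL k (hres k hk), Polynomial.coeff_coe, Polynomial.coeff_zero]
  by_cases ho0 : o = 0
  · left
    -- The coefficients 0, …, n of the operator only involve the coefficients 0, …, n + 1 of the
    -- series.
    refine ⟨trunc (n + 2) f, ?_, ?_⟩
    · rw [coeff_trunc, if_pos (by omega), hf0]; exact one_ne_zero
    · rw [Polynomial.X_pow_dvd_iff]
      intro k hk
      have e : ((Polynomial.X * a * Polynomial.derivative (Polynomial.derivative (trunc (n + 2) f))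
          - b * Polynomial.derivative (trunc (n + 2) f) + c * trunc (n + 2) f : Polynomial ℂ) :
          PowerSeries ℂ) = frobeniusOp a b c (trunc (n + 2) f : Polynomial ℂ) := by
        rw [frobeniusOp, derivative_coe, derivative_coe]
        push_cast
        rfl
      have e2 : coeff k (frobeniusOp a b c (trunc (n + 2) f : Polynomial ℂ)) =
          coeff k (frobeniusOp a b c f) := by
        rw [coeff_frobeniusOp, coeff_frobeniusOp]
        refine Finset.sum_congr rfl fun j hj => ?_
        have := Finset.mem_range.mp hj
        rw [Polynomial.coeff_coe (trunc (n + 2) f), Polynomial.coeff_coe (trunc (n + 2) f),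
          coeff_trunc, coeff_trunc, if_pos (by omega), if_pos (by omega)]
      rw [← Polynomial.coeff_coe, e, e2]
      by_cases hkn : k = n
      · rw [hkn]; exact ho0
      · exact hfL' k hkn
  · right
    have hncast : ((n : Polynomial ℂ) : PowerSeries ℂ) = (n : PowerSeries ℂ) :=
      map_natCast Polynomial.coeToPowerSeries.ringHom n
    obtain ⟨q, hq⟩ : ∃ q : Polynomial ℂ, (n : Polynomial ℂ) * a - b = Polynomial.X * q := by
      have : Polynomial.X ∣ (n : Polynomial ℂ) * a - b := by
        rw [Polynomial.X_dvd_iff, Polynomial.coeff_sub, ← Polynomial.C_eq_natCast,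
          Polynomial.coeff_C_mul, hb]
        simp
      exact this
    have hq' : (n : PowerSeries ℂ) * (a : PowerSeries ℂ) - (b : PowerSeries ℂ) = X * (q : PowerSeries ℂ) := by
      have := congrArg (fun p : Polynomial ℂ => (p : PowerSeries ℂ)) hq
      rw [← hncast, ← Polynomial.coe_mul, ← Polynomial.coe_sub, this, Polynomial.coe_mul,
        Polynomial.coe_X]
    -- Conjugation by X^(n+1) shifts the exponents to −(n + 1) and 0: the new b' has constant term
    -- −(n + 2) a(0), so no resonance is left.
    set b' : Polynomial ℂ := b - 2 * (n + 1) * a with hb'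
    set c' : Polynomial ℂ := c + (n + 1) * q with hc'
    have hb'c : (b' : PowerSeries ℂ) = (b : PowerSeries ℂ) - 2 * ((n : PowerSeries ℂ) + 1) * (a : PowerSeries ℂ) := by
      rw [hb']
      have h2 : ((2 : Polynomial ℂ) : PowerSeries ℂ) = 2 := by
        rw [← one_add_one_eq_two]; push_cast; rw [one_add_one_eq_two]
      push_cast
      rw [h2, hncast]
    have hc'c : (c' : PowerSeries ℂ) = (c : PowerSeries ℂ) + ((n : PowerSeries ℂ) + 1) * (q : PowerSeries ℂ) := by
      rw [hc']; push_cast; rw [hncast]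
    have hb'0 : b'.coeff 0 = -((n : ℂ) + 2) * a.coeff 0 := by
      have h2 : (2 * ((n : Polynomial ℂ) + 1)) = Polynomial.C (2 * ((n : ℂ) + 1)) := by
        rw [Polynomial.C_mul, Polynomial.C_add, Polynomial.C_1, Polynomial.C_eq_natCast]; rfl
      rw [hb', Polynomial.coeff_sub, h2, Polynomial.coeff_C_mul, hb]
      ring
    have hres' : ∀ k : ℕ, a.coeff 0 * k ≠ b'.coeff 0 := fun k h => by
      rw [hb'0, mul_comm] at h
      have h1 := mul_right_cancel₀ ha h
      have h2 : ((k + n + 2 : ℕ) : ℂ) = 0 := by push_cast; linear_combination h1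
      rw [Nat.cast_eq_zero] at h2
      omega
    have hconj : ∀ v, frobeniusOp a b c (X ^ (n + 1) * v) = X ^ (n + 1) * frobeniusOp a b' c' v :=
      fun v => by rw [hb'c, hc'c]; exact frobeniusOp_X_pow_mul n hq' v
    obtain ⟨u, hu, hu0, huL⟩ := exists_frobenius_solution (b := b') (c := c') ha
      (HasGeometricGrowth.of_polynomial 0) 1
    have huL' : frobeniusOp a b' c' u = 0 := by
      ext k; rw [huL k (hres' k)]; simp
    -- For the solution y = s^(n+1) u, applying the operator to y log s leaves exactly s^n G. The
    -- constant term of G is (2n + 1) a(0) − n a(0) = (n + 1) a(0), which is not zero.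
    set G : PowerSeries ℂ := (a : PowerSeries ℂ) * ((2 * (n : PowerSeries ℂ) + 1) * u
      + 2 * (X * d⁄dX ℂ u)) - (b : PowerSeries ℂ) * u
      with hG
    have hcast : (2 * (n : PowerSeries ℂ) + 1) =
        ((Polynomial.C (2 * (n : ℂ) + 1) : Polynomial ℂ) : PowerSeries ℂ) := by
      rw [Polynomial.coe_C, map_add, map_mul, map_natCast, map_one, map_ofNat]
    have h2cast : (2 : PowerSeries ℂ) = ((Polynomial.C 2 : Polynomial ℂ) : PowerSeries ℂ) := by
      rw [Polynomial.coe_C, map_ofNat]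
    have hGg : HasGeometricGrowth G := by
      have e : G = (a : PowerSeries ℂ) * (((Polynomial.C (2 * (n : ℂ) + 1) : Polynomial ℂ) :
          PowerSeries ℂ) * u + ((Polynomial.C 2 * Polynomial.X : Polynomial ℂ) : PowerSeries ℂ) *
          d⁄dX ℂ u) + ((-b : Polynomial ℂ) : PowerSeries ℂ) * u := by
        rw [Polynomial.coe_mul, ← h2cast, ← hcast, Polynomial.coe_X, hG,
          show ((-b : Polynomial ℂ) : PowerSeries ℂ) = -(b : PowerSeries ℂ) by
            exact map_neg Polynomial.coeToPowerSeries.ringHom b]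
        ring
      rw [e]
      exact ((HasGeometricGrowth.of_polynomial a).mul
        (((HasGeometricGrowth.of_polynomial _).mul hu).add
          ((HasGeometricGrowth.of_polynomial _).mul hu.derivative))).add
        ((HasGeometricGrowth.of_polynomial _).mul hu)
    have hcc : ∀ p : Polynomial ℂ, constantCoeff (p : PowerSeries ℂ) = p.coeff 0 := fun p => by
      rw [← coeff_zero_eq_constantCoeff_apply, Polynomial.coeff_coe]
    have hG0 : coeff 0 G = (n + 1) * a.coeff 0 := by
      rw [coeff_zero_eq_constantCoeff_apply] at hu0
      rw [coeff_zero_eq_constantCoeff_apply, hG, map_sub, map_mul, map_mul, map_add, map_mul,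
        map_mul, map_mul, constantCoeff_X, hu0, zero_mul, mul_zero, add_zero, mul_one, mul_one,
        hcc, hcc, hb, map_add, map_mul, map_natCast, map_one,
        map_ofNat]
      ring
    have hG0' : coeff 0 G ≠ 0 := by
      rw [hG0]; exact mul_ne_zero (Nat.cast_add_one_ne_zero n) ha
    -- Chosen so that the lowest term of κ X^n G cancels the obstruction o X^n.
    set κ := -o / coeff 0 G with hκ
    obtain ⟨H, hH⟩ : ∃ H, G = PowerSeries.C (coeff 0 G) + X * H := by
      have : X ∣ G - PowerSeries.C (coeff 0 G) := by
        rw [X_dvd_iff, map_sub, ← coeff_zero_eq_constantCoeff_apply]; simp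
      obtain ⟨H, hH⟩ := this
      exact ⟨H, by rw [← hH]; ring⟩
    have hHg : HasGeometricGrowth H := by
      refine HasGeometricGrowth.of_X_mul ?_
      have e : X * H = G + ((Polynomial.C (-coeff 0 G) : Polynomial ℂ) : PowerSeries ℂ) := by
        rw [Polynomial.coe_C, map_neg]; linear_combination -hH
      rw [e]
      exact hGg.add (HasGeometricGrowth.of_polynomial _)
    -- The rest κ X^(n+1) H is divisible by X^(n+1), and is removed by a correction X^(n+1) v in the
    -- nonresonant range.
    obtain ⟨v, hv, -, hvL⟩ := exists_frobenius_solution (b := b') (c := c') ha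
      ((HasGeometricGrowth.of_polynomial (Polynomial.C (-κ))).mul hHg) 0
    have hvL' : frobeniusOp a b' c' v = PowerSeries.C (-κ) * H := by
      ext k; rw [hvL k (hres' k), Polynomial.coe_C]
    have hfo : frobeniusOp a b c f = PowerSeries.C o * X ^ n := by
      ext k
      rw [coeff_C_mul, coeff_X_pow]
      by_cases hk : k = n
      · rw [hk, if_pos rfl, mul_one]
      · rw [hfL' k hk, if_neg hk, mul_zero]
    refine ⟨κ, u, f + X ^ (n + 1) * v, div_ne_zero (neg_ne_zero.mpr ho0) hG0', hu, ?_, hu0, ?_, ?_⟩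
    · have : HasGeometricGrowth ((Polynomial.X ^ (n + 1) : Polynomial ℂ) * v) :=
        (HasGeometricGrowth.of_polynomial _).mul hv
      rw [Polynomial.coe_pow, Polynomial.coe_X] at this
      exact hf.add this
    · rw [hconj, huL', mul_zero]
    · rw [frobeniusOp_add, hconj, hvL', hfo, derivative_X_pow_succ_mul]
      have e1 : PowerSeries.C o + PowerSeries.C κ * PowerSeries.C (coeff 0 G) = 0 := by
        rw [← map_mul, ← map_add, hκ, div_mul_cancel₀ _ hG0', add_neg_cancel, map_zero]
      have e2 : (a : PowerSeries ℂ) * (2 * (((n : PowerSeries ℂ) + 1) * X ^ n * u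
          + X ^ (n + 1) * d⁄dX ℂ u) - X ^ n * u) - (b : PowerSeries ℂ) * (X ^ n * u) = X ^ n * G := by
        rw [hG]; ring
      rw [e2, map_neg]
      linear_combination (PowerSeries.C κ * X ^ n) * hH + X ^ n * e1

end FormalLog

lemma HasGeometricGrowth.eventually_frobeniusOp {f : PowerSeries ℂ} (hf : HasGeometricGrowth f)
    (a b c : Polynomial ℂ) : ∀ᶠ s in 𝓝 (0 : ℂ), seriesSum (frobeniusOp a b c f) s =
      s * a.eval s * deriv (deriv (seriesSum f)) s - b.eval s * deriv (seriesSum f) s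
        + c.eval s * seriesSum f s := by
  have h1 := hf.eventually_hasDerivAt
  have h2 := hf.derivative.eventually_hasDerivAt
  have e : frobeniusOp a b c f = ((Polynomial.X * a : Polynomial ℂ) : PowerSeries ℂ) *
      PowerSeries.derivative ℂ (PowerSeries.derivative ℂ f) +
      ((-b : Polynomial ℂ) : PowerSeries ℂ) * PowerSeries.derivative ℂ f + (c : PowerSeries ℂ) * f := by
    rw [frobeniusOp, Polynomial.coe_mul, Polynomial.coe_X,
      show ((-b : Polynomial ℂ) : PowerSeries ℂ) = -(b : PowerSeries ℂ) by
        exact map_neg Polynomial.coeToPowerSeries.ringHom b]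
    ring
  have ga := HasGeometricGrowth.of_polynomial (Polynomial.X * a)
  have gb := HasGeometricGrowth.of_polynomial (-b)
  have gc := HasGeometricGrowth.of_polynomial c
  rw [e]
  filter_upwards [h1, h1.eventually_nhds, h2, ga.eventually_seriesSum_mul hf.derivative.derivative,
    gb.eventually_seriesSum_mul hf.derivative, gc.eventually_seriesSum_mul hf,
    (ga.mul hf.derivative.derivative).eventually_seriesSum_add (gb.mul hf.derivative),
    ((ga.mul hf.derivative.derivative).add (gb.mul hf.derivative)).eventually_seriesSum_add
      (gc.mul hf)] with s k1 k1' k2 k3 k4 k5 k6 k7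
  have k8 : deriv (seriesSum f) =ᶠ[𝓝 s] seriesSum (PowerSeries.derivative ℂ f) :=
    k1'.mono fun _ h => h.deriv
  rw [k7, k6, k5, k4, k3, seriesSum_coe, seriesSum_coe, seriesSum_coe, k8.deriv_eq, k2.deriv,
    k1.deriv, Polynomial.eval_mul, Polynomial.eval_X, Polynomial.eval_neg]
  ring

end

section
open Polynomial
variable {N : ℕ}

/-! ### Trivial monodromy excludes logarithms -/

lemma derivative_taylor (r : ℂ) (p : ℂ[X]) :
    derivative (taylor r p) = taylor r (derivative p) := by
  rw [taylor_apply, taylor_apply, derivative_comp]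
  simp

lemma X_pow_dvd_taylor_iff {r : ℂ} {p : ℂ[X]} {n : ℕ} :
    X ^ n ∣ taylor r p ↔ (X - C r) ^ n ∣ p := by
  have h : (X : ℂ[X]) ^ n = taylorEquiv r ((X - C r) ^ n) := by
    rw [map_pow, map_sub]
    change X ^ n = (taylor r X - taylor r (C r)) ^ n
    rw [taylor_X, taylor_C, add_sub_cancel_right]
  rw [h]
  exact map_dvd_iff (taylorEquiv r)

lemma taylor_operD (lam : Fin N → ℕ) (z μ : Fin N → ℂ) (i : Fin N) (y : ℂ[X]) :
    taylor (z i) (operD lam z μ y) =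
      X * taylor (z i) (nodalErase z i) * derivative (derivative (taylor (z i) y))
      - taylor (z i) (operB lam z) * derivative (taylor (z i) y)
      + taylor (z i) (operC z fun i => vacuumValue lam z i - μ i) * taylor (z i) y := by
  rw [operD_apply, map_add, map_sub, taylor_mul, taylor_mul, taylor_mul, nodal_eq z i, taylor_mul,
    map_sub, taylor_X, taylor_C, add_sub_cancel_right, derivative_taylor, derivative_taylor]

lemma eval_operB_self (lam : Fin N → ℕ) (z : Fin N → ℂ) (i : Fin N) :
    (operB lam z).eval (z i) = lam i * (nodalErase z i).eval (z i) := by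
  obtain ⟨B', hB'⟩ := exists_operB_eq lam z i
  rw [hB']; simp

/-- If `z_i` carries a logarithm, then there is a solution `P + κ Y log (t - z_i)` near `z_i`. -/
lemma exists_log_solution {lam : Fin N → ℕ} {z : Fin N → ℂ} (hz : Function.Injective z)
    {μ : Fin N → ℂ} {i : Fin N} (h : ¬ NoLogarithm lam z μ i) :
    ∃ (κ : ℂ) (Y P : ℂ → ℂ), κ ≠ 0 ∧ ∀ᶠ t in 𝓝 (z i), AnalyticAt ℂ Y t ∧ AnalyticAt ℂ P t ∧
      (t ≠ z i → Y t ≠ 0 ∧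
        (nodal z).eval t * deriv (deriv Y) t - (operB lam z).eval t * deriv Y t
          + (operC z fun i => vacuumValue lam z i - μ i).eval t * Y t = 0 ∧
        (nodal z).eval t * deriv (deriv P) t - (operB lam z).eval t * deriv P t
          + (operC z fun i => vacuumValue lam z i - μ i).eval t * P t
          + κ * ((nodalErase z i).eval t * (2 * deriv Y t - Y t / (t - z i))
            - (operB lam z).eval t * (Y t / (t - z i))) = 0) := by
  set a := taylor (z i) (nodalErase z i) with ha
  set b := taylor (z i) (operB lam z) with hb
  set c := taylor (z i) (operC z fun i => vacuumValue lam z i - μ i) with hc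
  have ha0 : a.coeff 0 ≠ 0 := by
    rw [ha, taylor_coeff_zero]; exact eval_nodalErase_self_ne_zero hz i
  have hb0 : b.coeff 0 = lam i * a.coeff 0 := by
    rw [ha, hb, taylor_coeff_zero, taylor_coeff_zero, eval_operB_self]
  rcases exists_solution_or_log (c := c) ha0 hb0 with ⟨g, hg0, hg⟩ | hlog
  · refine absurd ⟨taylor (-z i) g, ?_, ?_⟩ h
    · have : taylor (z i) (taylor (-z i) g) = g := by
        rw [taylor_taylor, add_neg_cancel, taylor_zero]
      rwa [← taylor_coeff_zero, this]
    · rw [← X_pow_dvd_taylor_iff, taylor_operD, taylor_taylor, add_neg_cancel, taylor_zero]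
      exact hg
  · obtain ⟨κ, u, p, hκ, hu, hp, hu0, hy, hpl⟩ := hlog
    set n := lam i with hn
    have gX : ∀ k : ℕ, HasGeometricGrowth ((PowerSeries.X : PowerSeries ℂ) ^ k) := fun k => by
      have := HasGeometricGrowth.of_polynomial (X ^ k)
      rwa [coe_pow, coe_X] at this
    have gy : HasGeometricGrowth (PowerSeries.X ^ (n + 1) * u) := (gX _).mul hu
    set y : PowerSeries ℂ := PowerSeries.X ^ (n + 1) * u with hyd
    have evX : ∀ (k : ℕ) (s : ℂ), seriesSum ((PowerSeries.X : PowerSeries ℂ) ^ k) s = s ^ k := by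
      intro k s
      have := seriesSum_coe (X ^ k) s
      rwa [coe_pow, coe_X, eval_pow, eval_X] at this
    have hune : ∀ᶠ s in 𝓝 (0 : ℂ), seriesSum u s ≠ 0 :=
      hu.analyticAt.continuousAt.eventually_ne (by rw [seriesSum_zero, hu0]; exact one_ne_zero)
    set G : PowerSeries ℂ := (a : PowerSeries ℂ) * (2 * PowerSeries.derivative ℂ y
      - PowerSeries.X ^ n * u) - (b : PowerSeries ℂ) * (PowerSeries.X ^ n * u) with hG
    have hG' : PowerSeries.C κ * G = ((C (2 * κ) * a : ℂ[X]) : PowerSeries ℂ) *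
        PowerSeries.derivative ℂ y
        + ((-(C κ * (a + b)) : ℂ[X]) : PowerSeries ℂ) * (PowerSeries.X ^ n * u) := by
      have hneg : ((-(C κ * (a + b)) : ℂ[X]) : PowerSeries ℂ) =
          -((C κ * (a + b) : ℂ[X]) : PowerSeries ℂ) :=
        map_neg Polynomial.coeToPowerSeries.ringHom _
      rw [hneg, coe_mul, coe_mul, coe_C, coe_C, coe_add, hG, map_mul PowerSeries.C 2 κ, map_ofNat]
      ring
    have g1 := HasGeometricGrowth.of_polynomial (C (2 * κ) * a)
    have g2 := HasGeometricGrowth.of_polynomial (-(C κ * (a + b)))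
    have g3 := (gX n).mul hu
    have gG : HasGeometricGrowth (PowerSeries.C κ * G) := by
      rw [hG']; exact (g1.mul gy.derivative).add (g2.mul g3)
    have gfp : HasGeometricGrowth (frobeniusOp a b c p) := by
      rw [eq_neg_of_add_eq_zero_left hpl]
      have e : -(PowerSeries.C κ * G) = ((C (-1) : ℂ[X]) : PowerSeries ℂ) * (PowerSeries.C κ * G) := by
        rw [coe_C, map_neg, map_one]; ring
      rw [e]
      exact (HasGeometricGrowth.of_polynomial _).mul gG
    have key : ∀ᶠ s in 𝓝 (0 : ℂ), AnalyticAt ℂ (seriesSum y) s ∧ AnalyticAt ℂ (seriesSum p) s ∧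
        (s ≠ 0 → seriesSum y s ≠ 0 ∧
          s * a.eval s * deriv (deriv (seriesSum y)) s - b.eval s * deriv (seriesSum y) s
            + c.eval s * seriesSum y s = 0 ∧
          s * a.eval s * deriv (deriv (seriesSum p)) s - b.eval s * deriv (seriesSum p) s
            + c.eval s * seriesSum p s + κ * (a.eval s * (2 * deriv (seriesSum y) s
              - seriesSum y s / s) - b.eval s * (seriesSum y s / s)) = 0) := by
      filter_upwards [gy.analyticAt.eventually_analyticAt, hp.analyticAt.eventually_analyticAt,
        hune, gy.eventually_frobeniusOp a b c, hp.eventually_frobeniusOp a b c,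
        (gX (n + 1)).eventually_seriesSum_mul hu, (gX n).eventually_seriesSum_mul hu,
        gy.eventually_hasDerivAt, gfp.eventually_seriesSum_add gG,
        (g1.mul gy.derivative).eventually_seriesSum_add (g2.mul g3),
        g1.eventually_seriesSum_mul gy.derivative, g2.eventually_seriesSum_mul g3]
        with s k1 k2 k3 k4 k5 k6 k7 k8 k9 k10 k11 k12
      refine ⟨k1, k2, fun hs => ?_⟩
      rw [← hyd, evX] at k6
      rw [evX] at k7
      have hz0 : seriesSum (0 : PowerSeries ℂ) s = 0 := by simp [seriesSum]
      refine ⟨?_, ?_, ?_⟩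
      · rw [k6]; exact mul_ne_zero (pow_ne_zero _ hs) k3
      · rw [← k4, hy, hz0]
      · rw [hpl, hz0, k5, hG', k10, k11, k12, seriesSum_coe, seriesSum_coe, k7, ← k8.deriv] at k9
        have e : seriesSum y s / s = s ^ n * seriesSum u s := by
          rw [k6, pow_succ]; field_simp
        rw [e, k9]
        simp only [eval_mul, eval_neg, eval_add, eval_C]
        ring
    refine ⟨κ, fun t => seriesSum y (t - z i), fun t => seriesSum p (t - z i), hκ, ?_⟩
    have htend : Filter.Tendsto (fun t : ℂ => t - z i) (𝓝 (z i)) (𝓝 0) := by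
      have : ContinuousAt (fun t : ℂ => t - z i) (z i) := by fun_prop
      rwa [ContinuousAt, sub_self] at this
    filter_upwards [htend.eventually key] with t ht
    have hsub : AnalyticAt ℂ (fun t : ℂ => t - z i) t := analyticAt_id.sub analyticAt_const
    refine ⟨ht.1.comp_of_eq hsub rfl, ht.2.1.comp_of_eq hsub rfl, fun hne => ?_⟩
    obtain ⟨e1, e2, e3⟩ := ht.2.2 (sub_ne_zero.mpr hne)
    have hd : ∀ F : ℂ → ℂ, deriv (fun t => F (t - z i)) = fun t => deriv F (t - z i) := fun F =>
      funext fun t => deriv_comp_sub_const F (z i) t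
    have hev : ∀ q : ℂ[X], (taylor (z i) q).eval (t - z i) = q.eval t := fun q => by
      rw [taylor_eval, sub_add_cancel]
    rw [ha, hb, hc, hev, hev, hev] at e2 e3
    refine ⟨e1, ?_, ?_⟩
    · rw [hd, hd, nodal_eq z i]
      simpa using e2
    · rw [hd, hd, hd, nodal_eq z i]
      simpa using e3

lemma isSolutionAt_div_of_ode {lam : Fin N → ℕ} {z : Fin N → ℂ} (hz : Function.Injective z)
    {μ : Fin N → ℂ} {t₀ : ℂ} (ht₀ : ∀ i, t₀ ≠ z i) {r Y : ℂ → ℂ} (hr : AnalyticAt ℂ r t₀)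
    (hr2 : ∀ᶠ t in 𝓝 t₀, r t ^ 2 = ∏ i, (t - z i) ^ lam i) (hY : AnalyticAt ℂ Y t₀)
    (h : ∀ᶠ t in 𝓝 t₀, (nodal z).eval t * deriv (deriv Y) t - (operB lam z).eval t * deriv Y t
          + (operC z fun i => vacuumValue lam z i - μ i).eval t * Y t = 0) :
    IsSolutionAt (potential lam z μ) (fun t => Y t / r t) t₀ := by
  have hc := eventually_conjugate lam hz μ ht₀ hr hr2 hY
  refine ⟨hY.div hr hc.self_of_nhds.1, ?_⟩
  have hz' : ∀ᶠ t in 𝓝 t₀, ∀ i, t ≠ z i :=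
    Filter.eventually_all.mpr fun i => isOpen_ne.mem_nhds (ht₀ i)
  filter_upwards [hc, hz', h] with t ht htz h0
  have hB : (operB lam z).eval t = (nodal z).eval t * logDer lam z t :=
    eval_operC htz fun i => (lam i : ℂ)
  rw [hB, eval_operC htz] at h0
  have h2 : (nodal z).eval t * (deriv (deriv Y) t - logDer lam z t * deriv Y t
        + (∑ i, (vacuumValue lam z i - μ i) / (t - z i)) * Y t) = 0 := by
    linear_combination h0
  rw [(mul_eq_zero.mp h2).resolve_left (eval_nodal_ne_zero htz), zero_div] at ht
  exact sub_eq_zero.mp ht.2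

/-! ### Circles and branches of the logarithm along them. -/

/-- The point at angle `2πθ` on the circle of radius `ε` around `z₀`. -/
def circlePoint (z₀ : ℂ) (ε : ℝ) (θ : ℝ) : ℂ :=
  z₀ + ε * Complex.exp (2 * Real.pi * Complex.I * θ)

/-- The branch of `log (t - z₀)` near `circlePoint z₀ ε θ` continued from `θ = 0`. -/
def logBranch (z₀ : ℂ) (ε : ℝ) (θ : ℝ) (t : ℂ) : ℂ :=
  Complex.log ε + 2 * Real.pi * Complex.I * θ
    + Complex.log ((t - z₀) / (ε * Complex.exp (2 * Real.pi * Complex.I * θ)))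

lemma circlePoint_sub (z₀ : ℂ) (ε θ : ℝ) : circlePoint z₀ ε θ - z₀ =
    ε * Complex.exp (2 * Real.pi * Complex.I * θ) := by rw [circlePoint]; ring

lemma circle_ne_zero {ε : ℝ} (hε : 0 < ε) (θ : ℝ) :
    (ε : ℂ) * Complex.exp (2 * Real.pi * Complex.I * θ) ≠ 0 :=
  mul_ne_zero (by exact_mod_cast hε.ne') (Complex.exp_ne_zero _)

lemma continuous_circlePoint (z₀ : ℂ) (ε : ℝ) : Continuous (circlePoint z₀ ε) := by
  unfold circlePoint; fun_prop

lemma dist_circlePoint (z₀ : ℂ) {ε : ℝ} (hε : 0 < ε) (θ : ℝ) : dist (circlePoint z₀ ε θ) z₀ = ε := by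
  rw [dist_eq_norm, circlePoint_sub, norm_mul, Complex.norm_real, Real.norm_of_nonneg hε.le,
    show 2 * (Real.pi : ℂ) * Complex.I * θ = ((2 * Real.pi * θ : ℝ) : ℂ) * Complex.I by
      push_cast; ring, Complex.norm_exp_ofReal_mul_I, mul_one]

lemma eventually_re_pos (z₀ : ℂ) {ε : ℝ} (hε : 0 < ε) (θ : ℝ) :
    ∀ᶠ t in 𝓝 (circlePoint z₀ ε θ),
      0 < ((t - z₀) / (ε * Complex.exp (2 * Real.pi * Complex.I * θ))).re := by
  have hc : ContinuousAt (fun t : ℂ =>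
      ((t - z₀) / (ε * Complex.exp (2 * Real.pi * Complex.I * θ))).re) (circlePoint z₀ ε θ) := by
    fun_prop
  refine hc.eventually (lt_mem_nhds ?_)
  simp only [circlePoint_sub, div_self (circle_ne_zero hε θ)]
  exact one_pos

lemma eventually_hasDerivAt_logBranch (z₀ : ℂ) {ε : ℝ} (hε : 0 < ε) (θ : ℝ) :
    ∀ᶠ t in 𝓝 (circlePoint z₀ ε θ), HasDerivAt (logBranch z₀ ε θ) (1 / (t - z₀)) t := by
  filter_upwards [eventually_re_pos z₀ hε θ] with t ht
  have hne := circle_ne_zero hε θ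
  have h := (((hasDerivAt_id t).sub_const z₀).div_const
    (ε * Complex.exp (2 * Real.pi * Complex.I * θ))).clog (Or.inl ht)
  refine (h.const_add (Complex.log ε + 2 * Real.pi * Complex.I * θ)).congr_deriv ?_
  simp only [id]
  have : t - z₀ ≠ 0 := fun h0 => by rw [h0, zero_div, Complex.zero_re] at ht; exact lt_irrefl _ ht
  rw [div_div_eq_mul_div, one_div_mul_cancel hne]

lemma exp_logBranch {z₀ : ℂ} {ε : ℝ} (hε : 0 < ε) (θ : ℝ) {t : ℂ} (ht : t ≠ z₀) :
    Complex.exp (logBranch z₀ ε θ t) = t - z₀ := by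
  have hne := circle_ne_zero hε θ
  have hε' : (ε : ℂ) ≠ 0 := by exact_mod_cast hε.ne'
  rw [logBranch, Complex.exp_add, Complex.exp_add, Complex.exp_log hε',
    Complex.exp_log (div_ne_zero (sub_ne_zero.mpr ht) hne), mul_div_cancel₀ _ hne]

/-- For |θ' − θ| < 1/4 the rotation angle is less than π/2, and so is the argument of a number with
positive real part. Their sum stays within (−π, π), where the principal logarithm is additive. -/
lemma eventually_logBranch_eq (z₀ : ℂ) {ε : ℝ} (hε : 0 < ε) (θ : ℝ) :
    ∀ᶠ θ' in 𝓝 θ, logBranch z₀ ε θ' =ᶠ[𝓝 (circlePoint z₀ ε θ')] logBranch z₀ ε θ := by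
  filter_upwards [Metric.ball_mem_nhds θ (show (0 : ℝ) < 1 / 4 by norm_num)] with θ' hθ'
  rw [Metric.mem_ball, Real.dist_eq, abs_lt] at hθ'
  filter_upwards [eventually_re_pos z₀ hε θ'] with t ht
  set q := (t - z₀) / (ε * Complex.exp (2 * Real.pi * Complex.I * θ')) with hq
  have hq0 : q ≠ 0 := fun h0 => by rw [h0, Complex.zero_re] at ht; exact lt_irrefl _ ht
  have harg := abs_lt.mp (Complex.abs_arg_lt_pi_div_two_iff.mpr (Or.inl ht))
  set w := Complex.log q + 2 * Real.pi * Complex.I * ((θ' - θ : ℝ) : ℂ) with hw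
  have him : w.im = q.arg + 2 * Real.pi * (θ' - θ) := by
    rw [hw, Complex.add_im, Complex.log_im,
      show 2 * (Real.pi : ℂ) * Complex.I * ((θ' - θ : ℝ) : ℂ) =
        ((2 * Real.pi * (θ' - θ) : ℝ) : ℂ) * Complex.I by push_cast; ring, Complex.im_ofReal_mul,
      Complex.I_im, mul_one]
  have hpi := Real.pi_pos
  have hexp : (t - z₀) / (ε * Complex.exp (2 * Real.pi * Complex.I * θ)) = Complex.exp w := by
    rw [hw, Complex.exp_add, Complex.exp_log hq0, hq,
      show 2 * (Real.pi : ℂ) * Complex.I * ((θ' - θ : ℝ) : ℂ) =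
        2 * Real.pi * Complex.I * θ' - 2 * Real.pi * Complex.I * θ by push_cast; ring,
      Complex.exp_sub]
    have h1 := Complex.exp_ne_zero (2 * Real.pi * Complex.I * θ)
    have h2 := Complex.exp_ne_zero (2 * Real.pi * Complex.I * θ')
    have hε' : (ε : ℂ) ≠ 0 := by exact_mod_cast hε.ne'
    field_simp
  rw [logBranch, logBranch, ← hq, hexp, Complex.log_exp (by rw [him]; nlinarith)
    (by rw [him]; nlinarith), hw]
  push_cast; ring

lemma logBranch_one (z₀ : ℂ) (ε : ℝ) (t : ℂ) :
    logBranch z₀ ε 1 t = logBranch z₀ ε 0 t + 2 * Real.pi * Complex.I := by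
  simp only [logBranch, Complex.ofReal_one, Complex.ofReal_zero, mul_one, mul_zero, Complex.exp_zero,
    Complex.exp_two_pi_mul_I]
  ring

/-- The circle as a loop. -/
def circleLoop (z₀ : ℂ) (ε : ℝ) : Path (circlePoint z₀ ε 0) (circlePoint z₀ ε 0) where
  toFun θ := circlePoint z₀ ε θ
  continuous_toFun := (continuous_circlePoint z₀ ε).comp continuous_subtype_val
  source' := rfl
  target' := by
    change circlePoint z₀ ε 1 = circlePoint z₀ ε 0
    simp [circlePoint, Complex.exp_two_pi_mul_I]

/-- Trivial projective monodromy around `z_i` excludes logarithms at `z_i`. -/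
theorem noLogarithm_of_trivialPGL2Monodromy {lam : Fin N → ℕ} {z : Fin N → ℂ}
    (hz : Function.Injective z) {μ : Fin N → ℂ}
    (h : TrivialPGL2Monodromy z (potential lam z μ)) (i : Fin N) : NoLogarithm lam z μ i := by
  by_contra hlog
  obtain ⟨κ, Y, P, hκ, hYP⟩ := exists_log_solution hz hlog
  -- The part of the square root coming from the other points is single-valued near z_i.
  obtain ⟨r, hr, hr2⟩ := exists_analytic_sqrt (fun k : {k // k ≠ i} => lam k)
    (z := fun k : {k // k ≠ i} => z k) (t₀ := z i) fun k => hz.ne k.2.symm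
  have hzi : ∀ᶠ t in 𝓝 (z i), ∀ k, k ≠ i → t ≠ z k := Filter.eventually_all.mpr fun k => by
    by_cases hk : k = i
    · simp [hk]
    · filter_upwards [isOpen_ne.mem_nhds (hz.ne (Ne.symm hk))] with t ht _
      exact ht
  obtain ⟨ρ, hρ, hball⟩ := Metric.eventually_nhds_iff_ball.mp
    ((hYP.and hr.eventually_analyticAt).and (hr2.and hzi))
  set ε := ρ / 2 with hε
  have hε0 : 0 < ε := by positivity
  set γ := circleLoop (z i) ε with hγ
  have hmem : ∀ θ : ℝ, ∀ᶠ t in 𝓝 (circlePoint (z i) ε θ), t ∈ Metric.ball (z i) ρ ∧ t ≠ z i := by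
    intro θ
    have h1 : circlePoint (z i) ε θ ∈ Metric.ball (z i) ρ := by
      rw [Metric.mem_ball, dist_circlePoint _ hε0, hε]; linarith
    have h2 : circlePoint (z i) ε θ ≠ z i := by
      rw [← dist_pos, dist_circlePoint _ hε0]; exact hε0
    exact Filter.inter_mem (Metric.isOpen_ball.mem_nhds h1) (isOpen_ne.mem_nhds h2)
  have hzk : ∀ (θ : ℝ) k, circlePoint (z i) ε θ ≠ z k := by
    intro θ k
    by_cases hk : k = i
    · rw [hk]; exact (hmem θ).self_of_nhds.2
    · exact (hball _ (hmem θ).self_of_nhds.1).2.2 k hk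
  obtain ⟨c, -, hc⟩ := h _ γ fun s k => hzk s k
  -- The square root of ∏ (t − z_k)^λ_k continued along the circle; the factor at z_i comes from the
  -- continued logarithm.
  set R : ℝ → ℂ → ℂ := fun θ t => Complex.exp ((lam i : ℂ) / 2 * logBranch (z i) ε θ t) * r t with hR
  have hLan : ∀ θ : ℝ, AnalyticAt ℂ (logBranch (z i) ε θ) (circlePoint (z i) ε θ) := fun θ =>
    Complex.analyticAt_iff_eventually_differentiableAt.mpr
      ((eventually_hasDerivAt_logBranch (z i) hε0 θ).mono fun _ h => h.differentiableAt)
  have hRan : ∀ θ : ℝ, AnalyticAt ℂ (R θ) (circlePoint (z i) ε θ) := fun θ =>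
    ((analyticAt_const.mul (hLan θ)).cexp).mul (hball _ (hmem θ).self_of_nhds.1).1.2
  have hR2 : ∀ θ : ℝ, ∀ᶠ t in 𝓝 (circlePoint (z i) ε θ), R θ t ^ 2 = ∏ k, (t - z k) ^ lam k := by
    intro θ
    filter_upwards [hmem θ] with t ht
    have h1 : Complex.exp ((lam i : ℂ) / 2 * logBranch (z i) ε θ t) ^ 2 = (t - z i) ^ lam i := by
      rw [← exp_logBranch hε0 θ ht.2, ← Complex.exp_nat_mul, ← Complex.exp_nat_mul]
      congr 1; push_cast; ring
    rw [hR]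
    simp only
    rw [mul_pow, h1, (hball t ht.1).2.1, ← Finset.mul_prod_erase _ _ (Finset.mem_univ i)]
    congr 1
    rw [Finset.prod_subtype (Finset.univ.erase i) (p := fun k => k ≠ i) (by simp)]
  have hRne : ∀ (θ : ℝ) (t : ℂ), t ∈ Metric.ball (z i) ρ → R θ t = 0 → False := by
    intro θ t ht h0
    have h1 := (mul_eq_zero.mp h0).resolve_left (Complex.exp_ne_zero _)
    have h2 := (hball t ht).2.1
    rw [h1, zero_pow two_ne_zero, eq_comm, Finset.prod_eq_zero_iff] at h2
    obtain ⟨k, -, hk⟩ := h2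
    exact (hball t ht).2.2 k k.2 (sub_eq_zero.mp (eq_zero_of_pow_eq_zero hk))
  -- The pure solution Y / R and the logarithmic solution (P + κ Y log) / R, both continued along
  -- the circle.
  set F₁ : unitInterval → ℂ → ℂ := fun s t => Y t / R s t with hF₁
  set F₂ : unitInterval → ℂ → ℂ := fun s t => (P t + κ * (Y t * logBranch (z i) ε s t)) / R s t
    with hF₂
  have hcoh : ∀ s : unitInterval, ∀ᶠ s' : unitInterval in 𝓝 s,
      logBranch (z i) ε s' =ᶠ[𝓝 (circlePoint (z i) ε s')] logBranch (z i) ε s := fun s =>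
    continuous_subtype_val.continuousAt.eventually (eventually_logBranch_eq (z i) hε0 s)
  have hC₁ : IsContinuation (potential lam z μ) γ F₁ := by
    refine ⟨fun s => ?_, fun s => ?_⟩
    · refine isSolutionAt_div_of_ode hz (hzk s) (hRan s) (hR2 s)
        (hball _ (hmem s).self_of_nhds.1).1.1.1 ?_
      filter_upwards [hmem s] with t ht
      exact ((hball t ht.1).1.1.2.2 ht.2).2.1
    · filter_upwards [hcoh s] with s' hs'
      filter_upwards [hs'] with t ht
      simp only [hF₁, hR, ht]
  have hC₂ : IsContinuation (potential lam z μ) γ F₂ := by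
    refine ⟨fun s => ?_, fun s => ?_⟩
    · have hYa := (hball _ (hmem s).self_of_nhds.1).1.1.1
      have hPa := (hball _ (hmem s).self_of_nhds.1).1.1.2.1
      refine isSolutionAt_div_of_ode hz (hzk s) (hRan s) (hR2 s)
        (Y := fun t => P t + κ * (Y t * logBranch (z i) ε s t))
        (hPa.add (analyticAt_const.mul (hYa.mul (hLan s)))) ?_
      have hd1 : ∀ᶠ t in 𝓝 (circlePoint (z i) ε s),
          HasDerivAt (fun t => P t + κ * (Y t * logBranch (z i) ε s t))
            (deriv P t + κ * (deriv Y t * logBranch (z i) ε s t + Y t * (1 / (t - z i)))) t := by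
        filter_upwards [hmem s, eventually_hasDerivAt_logBranch (z i) hε0 s] with t ht hl
        have hY := (hball t ht.1).1.1.1.differentiableAt.hasDerivAt
        have hP := (hball t ht.1).1.1.2.1.differentiableAt.hasDerivAt
        exact hP.add ((hY.mul hl).const_mul κ)
      filter_upwards [hmem s, eventually_hasDerivAt_logBranch (z i) hε0 s, hd1,
        hd1.eventually_nhds] with t ht hl hd hdn
      have hne := sub_ne_zero.mpr ht.2
      have hY := (hball t ht.1).1.1.1
      have hP := (hball t ht.1).1.1.2.1
      have hinv : HasDerivAt (fun t => 1 / (t - z i)) (-1 / (t - z i) ^ 2) t := by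
        refine ((hasDerivAt_const t (1 : ℂ)).div ((hasDerivAt_id t).sub_const (z i))
          hne).congr_deriv ?_
        simp
      have hdd := hP.deriv.differentiableAt.hasDerivAt.add
        (((hY.deriv.differentiableAt.hasDerivAt.mul hl).add
          (hY.differentiableAt.hasDerivAt.mul hinv)).const_mul κ)
      have e2 : deriv (deriv fun t => P t + κ * (Y t * logBranch (z i) ε s t)) t = _ :=
        (Filter.EventuallyEq.deriv_eq (hdn.mono fun _ h => h.deriv)).trans hdd.deriv
      obtain ⟨-, o1, o2⟩ := (hball t ht.1).1.1.2.2 ht.2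
      rw [e2, hd.deriv]
      rw [nodal_eq z i, eval_mul, eval_sub, eval_X, eval_C] at o1 o2 ⊢
      have hs1 : (t - z i) * (1 / (t - z i)) = 1 := by field_simp
      have hs2 : (t - z i) * (-1 / (t - z i) ^ 2) = -(1 / (t - z i)) := by field_simp
      rw [div_eq_mul_one_div (Y t)] at o2
      linear_combination o2 + κ * logBranch (z i) ε s t * o1
        + 2 * κ * (nodalErase z i).eval t * deriv Y t * hs1 + κ * (nodalErase z i).eval t * Y t * hs2
    · filter_upwards [hcoh s] with s' hs'
      filter_upwards [hs'] with t ht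
      simp only [hF₂, hR, ht]
  -- The first solution gives R_0 = c R_1. The second one, multiplied by the same c, still gains 2πi
  -- κ Y, so this product would have to vanish.
  have h1 := (hc F₁ hC₁).self_of_nhds
  have h2 := (hc F₂ hC₂).self_of_nhds
  set x := circlePoint (z i) ε 0 with hx
  have hxm := (hmem 0).self_of_nhds
  have hYx : Y x ≠ 0 := ((hball x hxm.1).1.1.2.2 hxm.2).1
  have hR0 : R 0 x ≠ 0 := hRne 0 x hxm.1
  have hR1 : R 1 x ≠ 0 := hRne 1 x hxm.1
  simp only [hF₁, hF₂, Set.Icc.coe_one, Set.Icc.coe_zero] at h1 h2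
  rw [logBranch_one] at h2
  have h3 : Y x * R 0 x = c * Y x * R 1 x := by
    rwa [← mul_div_assoc, div_eq_div_iff hR1 hR0] at h1
  have h4 : R 0 x = c * R 1 x := mul_left_cancel₀ hYx (by linear_combination h3)
  have h5 : (P x + κ * (Y x * (logBranch (z i) ε 0 x + 2 * Real.pi * Complex.I))) * R 0 x =
      c * (P x + κ * (Y x * logBranch (z i) ε 0 x)) * R 1 x := by
    rwa [← mul_div_assoc, div_eq_div_iff hR1 hR0] at h2
  have h6 : κ * Y x * (2 * Real.pi * Complex.I) * R 0 x = 0 := by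
    linear_combination h5 - (P x + κ * (Y x * logBranch (z i) ε 0 x)) * h4
  exact mul_ne_zero (mul_ne_zero (mul_ne_zero hκ hYx) Complex.two_pi_I_ne_zero) hR0 h6

end

section
open MvPolynomial
variable {N : ℕ}

/-! ### Bethe vectors -/

lemma derivation_prod {ι σ : Type*} [DecidableEq ι]
    (D : Derivation ℂ (MvPolynomial σ ℂ) (MvPolynomial σ ℂ)) (S : Finset ι)
    (ξ : ι → MvPolynomial σ ℂ) :
    D (∏ s ∈ S, ξ s) = ∑ s ∈ S, (∏ t ∈ S.erase s, ξ t) * D (ξ s) := by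
  induction S using Finset.induction_on with
  | empty => simp
  | insert a S ha ih =>
    rw [Finset.prod_insert ha, Derivation.leibniz, ih, Finset.sum_insert ha,
      Finset.erase_insert ha, smul_eq_mul, smul_eq_mul, Finset.mul_sum, add_comm]
    congr 1
    refine Finset.sum_congr rfl fun s hs => ?_
    have hsa : s ≠ a := fun h => ha (h ▸ hs)
    rw [Finset.erase_insert_of_ne hsa.symm, Finset.prod_insert (fun h => ha (Finset.mem_of_mem_erase h))]
    ring

lemma derivation_derivation_prod {ι σ : Type*} [DecidableEq ι]
    (D : Derivation ℂ (MvPolynomial σ ℂ) (MvPolynomial σ ℂ)) (S : Finset ι)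
    {ξ : ι → MvPolynomial σ ℂ} {d : ι → ℂ} (hd : ∀ s, D (ξ s) = C (d s)) :
    D (D (∏ s ∈ S, ξ s)) =
      ∑ s ∈ S, ∑ t ∈ S.erase s, (∏ r ∈ (S.erase s).erase t, ξ r) * C (d s * d t) := by
  rw [derivation_prod, map_sum]
  refine Finset.sum_congr rfl fun s _ => ?_
  have hC : D (C (d s)) = 0 := by
    rw [← algebraMap_eq]; exact D.map_algebraMap _
  rw [hd, Derivation.leibniz, hC, smul_zero, zero_add, derivation_prod, smul_eq_mul, Finset.mul_sum]
  refine Finset.sum_congr rfl fun t _ => ?_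
  rw [hd, C_mul]; ring

variable {m : ℕ}

/-- The linear form `∑_i x_i / (w_s - z_i)`. -/
def betheForm (z : Fin N → ℂ) (w : ℂ) : MvPolynomial (Fin N) ℂ := ∑ i, C (w - z i)⁻¹ * X i

/-- The Bethe vector in the polynomial model. -/
def bethePsi (z : Fin N → ℂ) (w : Fin m → ℂ) : MvPolynomial (Fin N) ℂ := ∏ s, betheForm z (w s)

lemma fOp_toStates (lam : Fin N → ℕ) (z : Fin N → ℂ) (w : ℂ) (p : MvPolynomial (Fin N) ℂ) :
    fOp lam z w (toStates lam p) = toStates lam (betheForm z w * p) := by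
  simp only [fOp, betheForm, LinearMap.sum_apply, Finset.sum_mul, map_sum, LinearMap.smul_apply,
    ← toStates_polyF, polyF_apply]
  refine Finset.sum_congr rfl fun i _ => ?_
  rw [mul_assoc, ← smul_eq_C_mul, map_smul]

lemma betheVector_eq (lam : Fin N → ℕ) (z : Fin N → ℂ) (w : Fin m → ℂ) :
    betheVector lam z w = toStates lam (bethePsi z w) := by
  induction m with
  | zero => simp [betheVector, bethePsi, toStates_one]
  | succ m ih =>
    have h := ih (fun s => w s.succ)
    rw [betheVector] at h ⊢
    rw [List.ofFn_succ, List.prod_cons, Module.End.mul_apply, h, fOp_toStates, bethePsi, bethePsi,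
      Fin.prod_univ_succ]

lemma pderiv_betheForm (z : Fin N → ℂ) (w : ℂ) (i : Fin N) :
    pderiv i (betheForm z w) = C (w - z i)⁻¹ := by
  simp [betheForm, pderiv_X, Pi.single_apply]

lemma isHomogeneous_bethePsi (z : Fin N → ℂ) (w : Fin m → ℂ) : (bethePsi z w).IsHomogeneous m := by
  have h := IsHomogeneous.prod (Finset.univ : Finset (Fin m)) (fun s => betheForm z (w s))
    (fun _ => 1) fun s _ => IsHomogeneous.sum _ _ _ fun i _ => by
      simpa using (isHomogeneous_C (Fin N) ((w s - z i)⁻¹)).mul (isHomogeneous_X ℂ i)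
  simpa [bethePsi] using h

/-- The product of the linear forms without the factor `s`. -/
def bethePsiErase (z : Fin N → ℂ) (w : Fin m → ℂ) (s : Fin m) : MvPolynomial (Fin N) ℂ :=
  ∏ t ∈ Finset.univ.erase s, betheForm z (w t)

/-- The product of the linear forms without the factors `s` and `t`. -/
def bethePsiErase₂ (z : Fin N → ℂ) (w : Fin m → ℂ) (s t : Fin m) : MvPolynomial (Fin N) ℂ :=
  ∏ r ∈ (Finset.univ.erase s).erase t, betheForm z (w r)

lemma betheForm_mul_erase (z : Fin N → ℂ) (w : Fin m → ℂ) (s : Fin m) :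
    betheForm z (w s) * bethePsiErase z w s = bethePsi z w :=
  Finset.mul_prod_erase _ (fun t => betheForm z (w t)) (Finset.mem_univ s)

lemma betheForm_mul_erase₂ (z : Fin N → ℂ) (w : Fin m → ℂ) {s t : Fin m} (h : t ≠ s) :
    betheForm z (w t) * bethePsiErase₂ z w s t = bethePsiErase z w s :=
  Finset.mul_prod_erase _ (fun t => betheForm z (w t))
    (Finset.mem_erase.mpr ⟨h, Finset.mem_univ t⟩)

lemma bethePsiErase₂_comm (z : Fin N → ℂ) (w : Fin m → ℂ) (s t : Fin m) :
    bethePsiErase₂ z w s t = bethePsiErase₂ z w t s := by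
  rw [bethePsiErase₂, bethePsiErase₂, Finset.erase_right_comm]

/-- The unwanted terms coming from pairs of linear forms. -/
lemma sum_pairs_erase (z : Fin N → ℂ) (w : Fin m → ℂ) (c : Fin m → ℂ) :
    ∑ s, ∑ t ∈ Finset.univ.erase s, bethePsiErase₂ z w s t * (C (w t - w s)⁻¹ *
      (C (c s) * betheForm z (w t) - C (c t) * betheForm z (w s))) =
    -∑ s, C (c s * ∑ t ∈ Finset.univ.erase s, 2 / (w s - w t)) * bethePsiErase z w s := by
  -- Multiplying the product without s and t by the form of t gives the product without s, so each
  -- pair contributes to two single-deletion terms.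
  set g : Fin m → Fin m → MvPolynomial (Fin N) ℂ := fun s t =>
    C (c s / (w t - w s)) * bethePsiErase z w s with hg
  have h1 : ∀ s, ∀ t ∈ Finset.univ.erase s, bethePsiErase₂ z w s t * (C (w t - w s)⁻¹ *
      (C (c s) * betheForm z (w t) - C (c t) * betheForm z (w s))) = g s t + g t s := by
    intro s t ht
    have hts := Finset.ne_of_mem_erase ht
    have e1 := betheForm_mul_erase₂ z w hts
    have e2 := betheForm_mul_erase₂ z w (Ne.symm hts)
    rw [← bethePsiErase₂_comm] at e2
    simp only [hg]
    rw [← e1, ← e2, ← neg_sub (w t) (w s), div_neg, C_neg, div_eq_mul_inv, div_eq_mul_inv, C_mul,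
      C_mul]
    ring
  have hg0 : ∀ s, g s s = 0 := fun s => by simp [hg]
  rw [Finset.sum_congr rfl fun s _ => Finset.sum_congr rfl (h1 s)]
  have h2 : ∀ s, ∑ t ∈ Finset.univ.erase s, (g s t + g t s) = ∑ t, (g s t + g t s) := fun s =>
    Finset.sum_erase _ (by rw [hg0, add_zero])
  rw [Finset.sum_congr rfl fun s _ => h2 s]
  simp only [Finset.sum_add_distrib]
  rw [Finset.sum_comm (f := fun s t => g t s), ← Finset.sum_add_distrib, ← Finset.sum_neg_distrib]
  refine Finset.sum_congr rfl fun s _ => ?_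
  rw [sum_erase_div (fun _ => (2 : ℂ)) w s, ← Finset.sum_add_distrib, Finset.mul_sum, map_sum,
    Finset.sum_mul, ← Finset.sum_neg_distrib]
  refine Finset.sum_congr rfl fun t _ => ?_
  simp only [hg]
  rw [← add_mul, ← C_add, ← neg_mul, ← C_neg]
  congr 2
  rw [← neg_sub (w t) (w s), div_neg]
  ring

/-- The highest weight condition for Bethe vectors. -/
lemma sum_polyE_bethePsi {lam : Fin N → ℕ} {z : Fin N → ℂ} {w : Fin m → ℂ}
    (hw : IsAdmissible z w) (hB : BetheEquations lam z w) :
    (∑ i, polyE lam i) (bethePsi z w) = 0 := by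
  have hterm : ∀ i, polyE lam i (bethePsi z w) =
      ∑ s, bethePsiErase z w s * C ((lam i : ℂ) / (w s - z i)) + ∑ s, ∑ t ∈ Finset.univ.erase s,
        bethePsiErase₂ z w s t * (C (w t - w s)⁻¹ * (C (w t - z i)⁻¹ * X i - C (w s - z i)⁻¹ * X i)) := by
    intro i
    rw [polyE_apply, bethePsi, derivation_derivation_prod (pderiv i) Finset.univ
      (fun s => pderiv_betheForm z (w s) i), derivation_prod, Finset.mul_sum, Finset.mul_sum,
      sub_eq_add_neg, ← Finset.sum_neg_distrib]
    refine congrArg₂ (· + ·) (Finset.sum_congr rfl fun s _ => ?_)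
      (Finset.sum_congr rfl fun s _ => ?_)
    · rw [pderiv_betheForm, bethePsiErase, div_eq_mul_inv, C_mul]; ring
    · rw [Finset.mul_sum, ← Finset.sum_neg_distrib]
      refine Finset.sum_congr rfl fun t ht => ?_
      have hts := sub_ne_zero.mpr (hw.1.ne (Finset.ne_of_mem_erase ht))
      have h1 := sub_ne_zero.mpr (hw.2 s i)
      have h2 := sub_ne_zero.mpr (hw.2 t i)
      -- Partial fractions in z_i separate the poles at w_s and w_t, so that the sum over i
      -- reassembles the linear forms.
      have e : C ((w s - z i)⁻¹ * (w t - z i)⁻¹) =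
          (C (w t - w s)⁻¹ * (C (w s - z i)⁻¹ - C (w t - z i)⁻¹) : MvPolynomial (Fin N) ℂ) := by
        rw [← C_sub, ← C_mul]
        congr 1
        field_simp
        ring
      rw [e, bethePsiErase₂]; ring
  rw [LinearMap.sum_apply, Finset.sum_congr rfl fun i _ => hterm i, Finset.sum_add_distrib,
    Finset.sum_comm, Finset.sum_comm (s := Finset.univ (α := Fin N)) (t := Finset.univ (α := Fin m))
      (f := fun i s => ∑ t ∈ Finset.univ.erase s, bethePsiErase₂ z w s t *
        (C (w t - w s)⁻¹ * (C (w t - z i)⁻¹ * X i - C (w s - z i)⁻¹ * X i)))]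
  have h2 : ∀ s, ∑ i, ∑ t ∈ Finset.univ.erase s, bethePsiErase₂ z w s t *
        (C (w t - w s)⁻¹ * (C (w t - z i)⁻¹ * X i - C (w s - z i)⁻¹ * X i)) =
      ∑ t ∈ Finset.univ.erase s, bethePsiErase₂ z w s t *
        (C (w t - w s)⁻¹ * (C 1 * betheForm z (w t) - C 1 * betheForm z (w s))) := by
    intro s
    rw [Finset.sum_comm]
    refine Finset.sum_congr rfl fun t _ => ?_
    rw [← Finset.mul_sum, ← Finset.mul_sum, Finset.sum_sub_distrib, C_1, one_mul, one_mul,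
      betheForm, betheForm]
  rw [Finset.sum_congr rfl fun s _ => h2 s, sum_pairs_erase z w fun _ => 1, ← sub_eq_add_neg,
    ← Finset.sum_sub_distrib]
  refine Finset.sum_eq_zero fun s _ => ?_
  rw [← Finset.mul_sum, ← map_sum, one_mul, mul_comm, ← sub_mul, ← C_sub, hB s, C_0, zero_mul]

/-- The eigenvalue equations for Bethe vectors. -/
lemma ham_bethePsi {lam : Fin N → ℕ} {z : Fin N → ℂ} (hz : Function.Injective z) {w : Fin m → ℂ}
    (hw : IsAdmissible z w) (hB : BetheEquations lam z w) (i : Fin N) :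
    ham (polyE lam) polyF (polyH lam) (fun i j => (z i - z j)⁻¹) i (bethePsi z w) =
      betheValue lam z w i • bethePsi z w := by
  have hterm : ∀ j ∈ Finset.univ.erase i, C (z i - z j)⁻¹ * polyW lam i j (bethePsi z w) =
      ∑ s, bethePsiErase z w s * (C (lam i / (w s - z i)) * (C (w s - z j)⁻¹ * X j)
        - X i * C (w s - z i)⁻¹ * C (lam j / (w s - z j)))
      - X i * ∑ s, ∑ t ∈ Finset.univ.erase s, bethePsiErase₂ z w s t * (C (w t - w s)⁻¹ *
        (C (w s - z i)⁻¹ * (C (w t - z j)⁻¹ * X j) - C (w t - z i)⁻¹ * (C (w s - z j)⁻¹ * X j))) := by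
    intro j hj
    have hij := sub_ne_zero.mpr (hz.ne (Finset.ne_of_mem_erase hj).symm)
    -- The operator `polyW` only involves the derivation ∂_i − ∂_j and its square, which act on a
    -- product of linear forms by deleting one or two factors.
    set D : Derivation ℂ (MvPolynomial (Fin N) ℂ) (MvPolynomial (Fin N) ℂ) := pderiv i - pderiv j
      with hD
    have hd : ∀ s, D (betheForm z (w s)) = C ((w s - z i)⁻¹ - (w s - z j)⁻¹) := fun s => by
      rw [hD, Derivation.sub_apply, pderiv_betheForm, pderiv_betheForm, C_sub]
    have h1 : pderiv i (bethePsi z w) - pderiv j (bethePsi z w) = D (bethePsi z w) := rfl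
    have h2 : pderiv i (pderiv i (bethePsi z w)) - 2 * pderiv i (pderiv j (bethePsi z w))
        + pderiv j (pderiv j (bethePsi z w)) = D (D (bethePsi z w)) := by
      rw [hD]
      simp only [Derivation.sub_apply, map_sub]
      rw [pderiv_comm j i]; ring
    rw [polyW, h1, h2, bethePsi, derivation_derivation_prod D Finset.univ hd, derivation_prod, mul_sub,
      Finset.mul_sum, Finset.mul_sum]
    refine congrArg₂ (· - ·) (Finset.sum_congr rfl fun s _ => ?_) ?_
    · have h3 := sub_ne_zero.mpr (hw.2 s i)
      have h4 := sub_ne_zero.mpr (hw.2 s j)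
      -- Partial fractions absorb the denominator z_i − z_j of the Hamiltonian.
      have e : C (z i - z j)⁻¹ * C ((w s - z i)⁻¹ - (w s - z j)⁻¹) =
          (C (w s - z i)⁻¹ * C (w s - z j)⁻¹ : MvPolynomial (Fin N) ℂ) := by
        rw [← C_mul, ← C_mul]
        congr 1
        field_simp
        ring
      rw [hd, div_eq_mul_inv, div_eq_mul_inv, C_mul, C_mul, bethePsiErase]
      linear_combination (C (lam i : ℂ) * X j - C (lam j : ℂ) * X i) *
        (∏ t ∈ Finset.univ.erase s, betheForm z (w t)) * e
    · rw [mul_assoc (X i), mul_left_comm, Finset.mul_sum, Finset.mul_sum]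
      congr 1
      refine Finset.sum_congr rfl fun s _ => ?_
      rw [Finset.mul_sum, Finset.mul_sum]
      refine Finset.sum_congr rfl fun t ht => ?_
      have hts := sub_ne_zero.mpr (hw.1.ne (Finset.ne_of_mem_erase ht))
      have h3 := sub_ne_zero.mpr (hw.2 s i)
      have h4 := sub_ne_zero.mpr (hw.2 s j)
      have h5 := sub_ne_zero.mpr (hw.2 t i)
      have h6 := sub_ne_zero.mpr (hw.2 t j)
      have e : C (z i - z j)⁻¹ * C (((w s - z i)⁻¹ - (w s - z j)⁻¹) *
          ((w t - z i)⁻¹ - (w t - z j)⁻¹)) = (C (w t - w s)⁻¹ * (C (w s - z i)⁻¹ * C (w t - z j)⁻¹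
          - C (w t - z i)⁻¹ * C (w s - z j)⁻¹) : MvPolynomial (Fin N) ℂ) := by
        rw [← C_mul, ← C_mul, ← C_mul, ← C_sub, ← C_mul]
        congr 1
        field_simp
        ring
      rw [bethePsiErase₂]
      linear_combination (X j * ∏ r ∈ (Finset.univ.erase s).erase t, betheForm z (w r)) * e
  -- After the rewriting the summand for j = i is zero, so the sum may run over all j, which
  -- restores complete linear forms.
  rw [ham_poly, Finset.sum_congr rfl hterm, Finset.sum_erase]
  · rw [Finset.sum_sub_distrib, Finset.sum_comm, ← Finset.mul_sum,
      Finset.sum_comm (s := Finset.univ (α := Fin N)) (t := Finset.univ (α := Fin m))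
      (f := fun j s => ∑ t ∈ Finset.univ.erase s, bethePsiErase₂ z w s t * (C (w t - w s)⁻¹ *
        (C (w s - z i)⁻¹ * (C (w t - z j)⁻¹ * X j) - C (w t - z i)⁻¹ * (C (w s - z j)⁻¹ * X j))))]
    have h1 : ∀ s, ∑ j, bethePsiErase z w s * (C (lam i / (w s - z i)) * (C (w s - z j)⁻¹ * X j)
        - X i * C (w s - z i)⁻¹ * C (lam j / (w s - z j))) =
        C (lam i / (w s - z i)) * bethePsi z w - X i * (C ((w s - z i)⁻¹ *
          ∑ j, (lam j : ℂ) / (w s - z j)) * bethePsiErase z w s) := by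
      intro s
      rw [← Finset.mul_sum, Finset.sum_sub_distrib, ← Finset.mul_sum, ← Finset.mul_sum,
        ← betheForm_mul_erase z w s, C_mul, map_sum, betheForm]
      ring
    have h2 : ∀ s, ∑ j, ∑ t ∈ Finset.univ.erase s, bethePsiErase₂ z w s t * (C (w t - w s)⁻¹ *
        (C (w s - z i)⁻¹ * (C (w t - z j)⁻¹ * X j) - C (w t - z i)⁻¹ * (C (w s - z j)⁻¹ * X j))) =
        ∑ t ∈ Finset.univ.erase s, bethePsiErase₂ z w s t * (C (w t - w s)⁻¹ *
          (C (w s - z i)⁻¹ * betheForm z (w t) - C (w t - z i)⁻¹ * betheForm z (w s))) := by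
      intro s
      rw [Finset.sum_comm]
      refine Finset.sum_congr rfl fun t _ => ?_
      rw [← Finset.mul_sum, ← Finset.mul_sum, Finset.sum_sub_distrib, ← Finset.mul_sum,
        ← Finset.mul_sum, betheForm, betheForm]
    rw [Finset.sum_congr rfl fun s _ => h1 s, Finset.sum_congr rfl fun s _ => h2 s,
      sum_pairs_erase z w fun s => (w s - z i)⁻¹, Finset.sum_sub_distrib, ← Finset.sum_mul,
      ← map_sum, ← Finset.mul_sum]
    -- The unwanted terms have the two parts of the Bethe equations as coefficients.
    have h3 : ∑ s, C ((w s - z i)⁻¹ * ∑ j, (lam j : ℂ) / (w s - z j)) * bethePsiErase z w s =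
        ∑ s, C ((w s - z i)⁻¹ * ∑ t ∈ Finset.univ.erase s, 2 / (w s - w t))
          * bethePsiErase z w s := by
      refine Finset.sum_congr rfl fun s _ => ?_
      rw [sub_eq_zero.mp (hB s)]
    have h4 : ∑ s, (lam i : ℂ) / (w s - z i) = lam i * ∑ s, 1 / (w s - z i) := by
      rw [Finset.mul_sum]; simp only [mul_one_div]
    rw [h3, h4, smul_eq_C_mul, betheValue, C_add]
    ring
  · have h1 : ∀ s : Fin m, (C ((lam i : ℂ) / (w s - z i)) * (C (w s - z i)⁻¹ * X i)
        - X i * C (w s - z i)⁻¹ * C ((lam i : ℂ) / (w s - z i)) : MvPolynomial (Fin N) ℂ) = 0 :=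
      fun s => by ring
    have h2 : ∀ s t : Fin m, (C (w s - z i)⁻¹ * (C (w t - z i)⁻¹ * X i)
        - C (w t - z i)⁻¹ * (C (w s - z i)⁻¹ * X i) : MvPolynomial (Fin N) ℂ) = 0 :=
      fun s t => by ring
    simp only [h1, h2, mul_zero, Finset.sum_const_zero, sub_zero]

lemma sum_polyH_of_isHomogeneous (lam : Fin N → ℕ) {p : MvPolynomial (Fin N) ℂ} {m : ℕ}
    (hp : p.IsHomogeneous m) :
    (∑ i, polyH lam i) p = (∑ i, (lam i : ℂ) - 2 * (m : ℂ)) • p := by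
  have h := hp.sum_X_mul_pderiv
  simp only [LinearMap.sum_apply, polyH_apply]
  rw [Finset.sum_sub_distrib, ← Finset.sum_mul, ← map_sum, ← Finset.mul_sum, h, sub_smul,
    smul_eq_C_mul, nsmul_eq_mul, smul_eq_C_mul, C_mul, map_natCast, map_ofNat, mul_assoc]

theorem betheVector_properties {lam : Fin N → ℕ} {z : Fin N → ℂ} (hz : Function.Injective z)
    {w : Fin m → ℂ} (hw : IsAdmissible z w) (hB : BetheEquations lam z w) :
    (∀ i, hamiltonian lam z i (betheVector lam z w) = betheValue lam z w i • betheVector lam z w) ∧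
      diagonalAction lam repE (betheVector lam z w) = 0 ∧
      diagonalAction lam repH (betheVector lam z w) =
        (∑ i, (lam i : ℂ) - 2 * (m : ℂ)) • betheVector lam z w := by
  refine ⟨fun i => ?_, ?_, ?_⟩
  · rw [hamiltonian_eq, betheVector_eq, ← toStates_ham, ham_bethePsi hz hw hB, map_smul]
  · rw [betheVector_eq, ← toStates_sum_polyE, sum_polyE_bethePsi hw hB, map_zero]
  · rw [betheVector_eq, ← toStates_sum_polyH,
      sum_polyH_of_isHomogeneous lam (isHomogeneous_bethePsi z w), map_smul]

end

section

/-! ### Monodromy, Bethe equations and eigenvectors for arbitrary distinct points -/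

variable {N : ℕ}

/-- All implications pass through the absence of logarithms and the two polynomial solutions it
provides. From (4) the polynomial ∏ (t − w_j) itself witnesses this absence, as it does not vanish
at the z_i; this already yields monodromy ±1. -/
theorem monodromy_tfae (lam : Fin N → ℕ) {z : Fin N → ℂ} (hz : Function.Injective z)
    {μ : Fin N → ℂ} (hμ : ∑ i, μ i = 0) :
    List.TFAE [
      TrivialPGL2Monodromy z (potential lam z μ),
      PlusMinusOneMonodromy z (potential lam z μ),
      ∃ (m : ℕ) (w : Fin m → ℂ), IsAdmissible z w ∧
        BetheEquations lam z w ∧ MiuraForm lam z μ w,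
      ∃ (m : ℕ) (w : Fin m → ℂ), (∀ j i, w j ≠ z i) ∧
        BetheFunctionSolves lam z μ w] := by
  tfae_have 1 → 3 := by
    intro h
    obtain ⟨y, hy, hD⟩ := exists_two_polynomial_solutions hz hμ
      (noLogarithm_of_trivialPGL2Monodromy hz h)
    obtain ⟨m, w, hw, hw'⟩ := exists_admissible_of_two_solutions hz hy hD
    have h3 := (miuraForm_iff_operD lam hz μ w).2 hw'
    exact ⟨m, w, hw, ((miuraForm_iff lam hz μ hw).1 h3).1, h3⟩
  tfae_have 3 → 4 := by
    rintro ⟨m, w, hw, -, h⟩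
    exact ⟨m, w, hw.2, (miuraForm_iff_betheFunctionSolves lam hz μ w).1 h⟩
  tfae_have 4 → 2 := by
    rintro ⟨m, w, hw, h⟩
    have h1 := (miuraForm_iff_operD lam hz μ w).1
      ((miuraForm_iff_betheFunctionSolves lam hz μ w).2 h)
    obtain ⟨y, hy, hD⟩ := exists_two_polynomial_solutions hz hμ (noLogarithm_of_bethePoly hw h1)
    exact plusMinusOneMonodromy_of_two_solutions hz hy hD
  tfae_have 2 → 1 := trivialPGL2Monodromy_of_plusMinusOne
  tfae_finish

theorem trivialPGL2Monodromy_of_eigenvector {lam : Fin N → ℕ} {z : Fin N → ℂ}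
    (hz : Function.Injective z) {μ : Fin N → ℂ} {v : States lam}
    (hv : IsGaudinEigenvector lam z μ v) : TrivialPGL2Monodromy z (potential lam z μ) := by
  obtain ⟨y, hy, hD⟩ := exists_two_polynomial_solutions hz (sum_eq_zero_of_eigenvector hv)
    (noLogarithm_of_eigenvector hz hv)
  exact trivialPGL2Monodromy_of_plusMinusOne (plusMinusOneMonodromy_of_two_solutions hz hy hD)

theorem betheVector_eigen {lam : Fin N → ℕ} {z : Fin N → ℂ}
    (hz : Function.Injective z) {μ : Fin N → ℂ} {m : ℕ} {w : Fin m → ℂ} (hw : IsAdmissible z w)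
    (hB : BetheEquations lam z w) (hM : MiuraForm lam z μ w) :
    (∀ i, hamiltonian lam z i (betheVector lam z w) = μ i • betheVector lam z w) ∧
      diagonalAction lam repE (betheVector lam z w) = 0 ∧
      diagonalAction lam repH (betheVector lam z w) =
        (∑ i, (lam i : ℂ) - 2 * (m : ℂ)) • betheVector lam z w := by
  obtain rfl := ((miuraForm_iff lam hz μ hw).1 hM).2
  exact betheVector_properties hz hw hB

/-! ### Bethe vectors do not vanish -/

/-- The polynomial Gaudin Hamiltonians. -/
abbrev polyHam (lam : Fin N → ℕ) (r : Fin N → Fin N → ℂ) (i : Fin N) :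
    Module.End ℂ (MvPolynomial (Fin N) ℂ) :=
  ham (polyE lam) polyF (polyH lam) r i

/-- The eigenvector is the image of an element of the product of the F_k under summation. It lifts
to an eigenvector in that product, any nonzero component of which will do. -/
theorem exists_joint_eigenvector_of_sum {ι κ A : Type*} [Finite ι] [Fintype κ] [AddCommGroup A]
    [Module ℂ A] {X : ι → Module.End ℂ A} (hX : ∀ i j, Commute (X i) (X j))
    {F : κ → Submodule ℂ A} [∀ k, FiniteDimensional ℂ (F k)]
    (hF : ∀ k i, ∀ u ∈ F k, X i u ∈ F k) {μ : ι → ℂ} {g : κ → A} (hg : ∀ k, g k ∈ F k)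
    (h : IsJointEigenvector X μ (∑ k, g k)) :
    ∃ k, ∃ u ∈ F k, IsJointEigenvector X μ u := by
  classical
  let X' : ι → Module.End ℂ (∀ k, F k) := fun i =>
    LinearMap.pi fun k => ((X i).restrict (hF k i)) ∘ₗ LinearMap.proj k
  have hX'a : ∀ i (u : ∀ k, F k) k, ((X' i u k : F k) : A) = X i (u k) := fun i u k => rfl
  let π : (∀ k, F k) →ₗ[ℂ] A := ∑ k, (F k).subtype ∘ₗ LinearMap.proj k
  have hπ : ∀ u, π u = ∑ k, (u k : A) := fun u => by simp [π]
  obtain ⟨u, hu0, hu⟩ := exists_joint_eigenvector (X := X') (Y := X) (π := π) (μ := μ)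
    (u := fun k => ⟨g k, hg k⟩) (by
      intro i j
      refine LinearMap.ext fun u => funext fun k => Subtype.ext ?_
      change X i (X j (u k)) = X j (X i (u k))
      exact LinearMap.congr_fun (hX i j) _) (by
      intro i u
      rw [hπ, hπ, map_sum]
      exact Finset.sum_congr rfl fun k _ => hX'a i u k) (by rw [hπ]; exact h)
  obtain ⟨k, hk⟩ := Function.ne_iff.1 hu0
  refine ⟨k, u k, (u k).2, fun h0 => hk (Subtype.ext h0), fun i => ?_⟩
  rw [← hX'a, hu i]
  rfl

/-- Each monomial in the kernel has some exponent exceeding λ_i; the monomials are grouped by a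
choice of such an i. -/
theorem exists_sum_of_toStates_eq_zero {lam : Fin N → ℕ} {d : ℕ} {p : MvPolynomial (Fin N) ℂ}
    (hp : p ∈ MvPolynomial.restrictTotalDegree (Fin N) ℂ d) (h : toStates lam p = 0) :
    ∃ g : Fin N → MvPolynomial (Fin N) ℂ,
      (∀ i, g i ∈ singularMultiples lam i ⊓ MvPolynomial.restrictTotalDegree (Fin N) ℂ d) ∧
      p = ∑ i, g i := by
  classical
  rw [toStates_eq_zero_iff] at h
  have hsel : ∀ a : p.support, ∃ i, lam i < a.1 i := by
    rintro ⟨a, ha⟩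
    by_contra hcon
    push Not at hcon
    exact MvPolynomial.mem_support_iff.1 ha (h a hcon)
  choose σ hσ using hsel
  refine ⟨fun i => ∑ a ∈ p.support.attach.filter (fun a => σ a = i),
    MvPolynomial.monomial a.1 (p.coeff a.1), fun i => ?_, ?_⟩
  · refine Submodule.sum_mem _ fun a ha => ⟨?_, ?_⟩
    · rw [SetLike.mem_coe, mem_singularMultiples, MvPolynomial.X_pow_eq_monomial,
        MvPolynomial.monomial_dvd_monomial]
      obtain rfl := (Finset.mem_filter.1 ha).2
      exact ⟨Or.inr (Finsupp.single_le_iff.2 (hσ a)), one_dvd _⟩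
    · rw [SetLike.mem_coe, MvPolynomial.mem_restrictTotalDegree] at *
      refine (MvPolynomial.totalDegree_monomial_le _ _).trans ?_
      exact (MvPolynomial.le_totalDegree a.2).trans hp
  · rw [Finset.sum_fiberwise, Finset.sum_attach p.support
      (fun a => MvPolynomial.monomial a (p.coeff a))]
    exact p.as_sum

/-- Two polynomial solutions of degree at most half of the critical one are proportional. -/
theorem eq_C_mul_of_operD_eq_zero {lam : Fin N → ℕ} {z μ : Fin N → ℂ}
    (hμ : ∑ i, (vacuumValue lam z i - μ i) = 0) {y q : Polynomial ℂ}
    (hy : y.Monic) (hyD : operD lam z μ y = 0) (hyn : 2 * y.natDegree ≤ ∑ i, lam i)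
    (hqD : operD lam z μ q = 0) (hqn : 2 * q.natDegree ≤ ∑ i, lam i) :
    q = Polynomial.C q.leadingCoeff * y := by
  have key : ∀ q₁ q₂ : Polynomial ℂ, q₁ ≠ 0 → q₂ ≠ 0 → operD lam z μ q₁ = 0 →
      operD lam z μ q₂ = 0 → 2 * q₁.natDegree ≤ ∑ i, lam i → 2 * q₂.natDegree ≤ ∑ i, lam i →
      q₁.natDegree = q₂.natDegree := by
    intro q₁ q₂ h1 h2 h3 h4 h5 h6
    have e1 := natDegree_of_operD_eq_zero hμ h1 h3
    rw [← natDegree_of_operD_eq_zero hμ h2 h4] at e1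
    have e2 : ((q₁.natDegree : ℂ) - q₂.natDegree) *
        (∑ i, (lam i : ℂ) + 1 - q₁.natDegree - q₂.natDegree) = 0 := by linear_combination e1
    rcases mul_eq_zero.1 e2 with h | h
    · exact_mod_cast sub_eq_zero.1 h
    -- The other root of the indicial equation at infinity: the two degrees add up to Λ + 1, which
    -- the bounds exclude.
    · have : (∑ i, lam i) + 1 = q₁.natDegree + q₂.natDegree := by
        have : ((∑ i, lam i : ℕ) : ℂ) + 1 = q₁.natDegree + q₂.natDegree := by
          push_cast; linear_combination h
        exact_mod_cast this
      omega
  by_cases hq0 : q = 0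
  · simp [hq0]
  have hdeg := key q y hq0 hy.ne_zero hqD hyD hqn hyn
  by_contra hne
  have hsub : q - Polynomial.C q.leadingCoeff * y ≠ 0 := sub_ne_zero.2 hne
  have hlt : (q - Polynomial.C q.leadingCoeff * y).degree < q.degree := by
    have hl0 : q.leadingCoeff ≠ 0 := Polynomial.leadingCoeff_ne_zero.2 hq0
    refine Polynomial.degree_sub_lt_left ?_ hq0 ?_
    · rw [Polynomial.degree_C_mul hl0, Polynomial.degree_eq_natDegree hq0,
        Polynomial.degree_eq_natDegree hy.ne_zero, hdeg]
    · simp [hy.leadingCoeff]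
  have hlt' := Polynomial.natDegree_lt_natDegree hsub hlt
  have hD' : operD lam z μ (q - Polynomial.C q.leadingCoeff * y) = 0 := by
    rw [← Polynomial.smul_eq_C_mul, map_sub, map_smul, hqD, hyD, smul_zero, sub_zero]
  have := key _ q hsub hq0 hD' hqD (by omega) hqn
  omega

theorem lineHom_operD_eq_zero {lam : Fin N → ℕ} {z : Fin N → ℂ} (hz : Function.Injective z)
    {μ b : Fin N → ℂ} (hb : ∑ i, b i = 0) {g : MvPolynomial (Fin N) ℂ}
    (hg : ∀ i, polyHam lam (fun i j => (z i - z j)⁻¹) i g = μ i • g) :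
    operD lam z μ (lineHom z b g) = 0 := by
  rw [operD_lineHom lam hz μ hb]
  refine Finset.sum_eq_zero fun i _ => ?_
  rw [hg i, MvPolynomial.smul_eq_C_mul, sub_self, map_zero, mul_zero]

/-- A polynomial that vanishes on all the curves `t ↦ (b_i (t - z_i))_i` with `∑ b_i = 0`
vanishes identically, if there are at least two points. -/
theorem eq_zero_of_lineHom_eq_zero {z : Fin N → ℂ} (hz : Function.Injective z) (hN : 2 ≤ N)
    {g : MvPolynomial (Fin N) ℂ}
    (h : ∀ b : Fin N → ℂ, ∑ i, b i = 0 → lineHom z b g = 0) : g = 0 := by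
  classical
  -- The extra factor reduces the claim to points x with all x_i ≠ 0 and ∑ x_i ≠ 0.
  have hprod : g * ((∏ i, MvPolynomial.X i) * ∑ i, MvPolynomial.X i) = 0 := by
    refine MvPolynomial.funext fun x => ?_
    rw [map_mul, map_mul, map_prod, map_sum, map_zero]
    simp only [MvPolynomial.eval_X]
    by_cases hx : ∀ i, x i ≠ 0
    swap
    · push Not at hx
      obtain ⟨i, hi⟩ := hx
      rw [Finset.prod_eq_zero (Finset.mem_univ i) hi]; ring
    by_cases hs : ∑ i, x i = 0
    · rw [hs]; ring
    have hcoeff : (∑ i, Polynomial.C (x i) * nodalErase z i).coeff (N - 1) = ∑ i, x i := by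
      rw [Polynomial.finsetSum_coeff]
      refine Finset.sum_congr rfl fun i _ => ?_
      have h1 : (nodalErase z i).Monic := Polynomial.monic_prod_of_monic _ _
        fun j _ => Polynomial.monic_X_sub_C _
      have h2 : (nodalErase z i).natDegree = N - 1 := by
        rw [nodalErase, Polynomial.natDegree_finsetProd_X_sub_C_eq_card]
        simp
      rw [Polynomial.coeff_C_mul, ← h2, h1.coeff_natDegree, mul_one]
    have hdeg : (∑ i, Polynomial.C (x i) * nodalErase z i).degree ≠ 0 := by
      intro h0
      have := Polynomial.coeff_eq_zero_of_degree_lt (p := ∑ i, Polynomial.C (x i) * nodalErase z i)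
        (n := N - 1) (by rw [h0]; exact_mod_cast (by omega : 0 < N - 1))
      exact hs (hcoeff ▸ this)
    -- The root solves ∑ x_i / (t − z_i) = 0, so that b_i = x_i / (t − z_i) defines a curve through
    -- x. The coefficient ∑ x_i in degree N − 1 ≥ 1 keeps the polynomial from being constant.
    obtain ⟨t, ht⟩ := IsAlgClosed.exists_root _ hdeg
    rw [Polynomial.IsRoot.def, Polynomial.eval_finsetSum] at ht
    simp only [Polynomial.eval_mul, Polynomial.eval_C] at ht
    have htz : ∀ i, t ≠ z i := by
      rintro i rfl
      rw [Finset.sum_eq_single i] at ht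
      · exact mul_ne_zero (hx i) (by
          rw [nodalErase, Polynomial.eval_prod]
          refine Finset.prod_ne_zero_iff.2 fun j hj => ?_
          simpa [sub_eq_zero] using fun hh => (Finset.mem_erase.1 hj).1 (hz hh).symm) ht
      · intro j _ hji
        rw [nodalErase, Polynomial.eval_prod, Finset.prod_eq_zero
          (Finset.mem_erase.2 ⟨hji.symm, Finset.mem_univ i⟩) (by simp), mul_zero]
      · simp
    have hpr : ∏ i, (t - z i) ≠ 0 := Finset.prod_ne_zero_iff.2 fun i _ => sub_ne_zero.2 (htz i)
    have hb : ∑ i, x i / (t - z i) = 0 := by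
      have : (∑ i, x i / (t - z i)) * ∏ i, (t - z i) = 0 := by
        rw [Finset.sum_mul, ← ht]
        refine Finset.sum_congr rfl fun i _ => ?_
        rw [nodalErase, Polynomial.eval_prod, ← Finset.mul_prod_erase _ _ (Finset.mem_univ i),
          ← mul_assoc, div_mul_cancel₀ _ (sub_ne_zero.2 (htz i))]
        simp
      exact (mul_eq_zero.1 this).resolve_right hpr
    have h0 := congrArg (Polynomial.eval t) (h _ hb)
    rw [eval_lineHom, Polynomial.eval_zero] at h0
    have : (fun j => x j / (t - z j) * (t - z j)) = x := by
      funext j; rw [div_mul_cancel₀ _ (sub_ne_zero.2 (htz j))]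
    rw [this] at h0
    rw [h0, zero_mul]
  refine (mul_eq_zero.1 hprod).resolve_right (mul_ne_zero ?_ ?_)
  · exact Finset.prod_ne_zero_iff.2 fun i _ => MvPolynomial.X_ne_zero i
  · intro h0
    have := congrArg (MvPolynomial.eval (fun _ => (1 : ℂ))) h0
    simp at this
    omega

theorem sum_betheValue_eq_zero {lam : Fin N → ℕ} {z : Fin N → ℂ} (hz : Function.Injective z)
    {m : ℕ} {w : Fin m → ℂ} (hw : IsAdmissible z w) (hB : BetheEquations lam z w) :
    ∑ i, betheValue lam z w i = 0 ∧ operD lam z (betheValue lam z w) (bethePoly w) = 0 := by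
  obtain ⟨μ, h0, hM⟩ := (betheEquations_iff lam hz hw).1 hB
  obtain rfl := ((miuraForm_iff lam hz μ hw).1 hM).2
  exact ⟨h0, (miuraForm_iff_operD lam hz _ w).1 hM⟩

theorem bethePsi_ne_zero {z : Fin N → ℂ} (hN : N ≠ 0) {m : ℕ} {w : Fin m → ℂ}
    (hw : IsAdmissible z w) : bethePsi z w ≠ 0 := by
  classical
  refine Finset.prod_ne_zero_iff.2 fun s _ h0 => ?_
  have := congrArg (MvPolynomial.eval (Pi.single ⟨0, Nat.pos_of_ne_zero hN⟩ (1 : ℂ))) h0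
  simp only [betheForm, map_sum, map_mul, MvPolynomial.eval_C, MvPolynomial.eval_X, map_zero,
    Pi.single_apply, mul_ite, mul_one, mul_zero, Finset.sum_ite_eq', Finset.mem_univ, if_true,
    inv_eq_zero] at this
  exact hw.2 s _ (sub_eq_zero.1 this)

instance (lam : Fin N → ℕ) (i : Fin N) (d : ℕ) : FiniteDimensional ℂ
    ↥(singularMultiples lam i ⊓ MvPolynomial.restrictTotalDegree (Fin N) ℂ d) :=
  Submodule.finiteDimensional_of_le (inf_le_right)

/-- If the image vanishes, the polynomial Bethe vector is a sum of multiples of the x_i^(λ_i+1), and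
some such multiple u ≠ 0 of degree at most m has the same eigenvalues. Its restrictions to lines are
proportional to ∏ (t − w_j) by the degree bound, and vanish at z_i, where that product does not; so
they vanish identically, and then u = 0. -/
theorem betheVector_ne_zero {lam : Fin N → ℕ} {z : Fin N → ℂ} (hz : Function.Injective z)
    {m : ℕ} (hm : 2 * m ≤ ∑ i, lam i) {w : Fin m → ℂ} (hw : IsAdmissible z w)
    (hB : BetheEquations lam z w) : betheVector lam z w ≠ 0 := by
  obtain ⟨hμ, hD⟩ := sum_betheValue_eq_zero hz hw hB
  intro h0
  rw [betheVector_eq] at h0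
  have hdeg : bethePsi z w ∈ MvPolynomial.restrictTotalDegree (Fin N) ℂ m := by
    rw [MvPolynomial.mem_restrictTotalDegree]
    exact (isHomogeneous_bethePsi z w).totalDegree_le
  rcases Nat.eq_zero_or_pos N with rfl | hN
  · have : m = 0 := by simpa using hm
    subst this
    have h1 : bethePsi z w = 1 := by simp [bethePsi]
    rw [h1, toStates_eq_zero_iff] at h0
    have := h0 0 (fun i => i.elim0)
    simp at this
  obtain ⟨g, hg, hsum⟩ := exists_sum_of_toStates_eq_zero hdeg h0
  obtain ⟨i, u, hu, hu0, hue⟩ := exists_joint_eigenvector_of_sum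
    (X := fun i => polyHam lam (fun i j => (z i - z j)⁻¹) i)
    (fun i j => (poly_sites lam).ham_commute (isRMatrix_inv_sub hz) i j)
    (F := fun i => singularMultiples lam i ⊓ MvPolynomial.restrictTotalDegree (Fin N) ℂ m)
    (fun k i u hu => ⟨ham_mem_singularMultiples lam k i hu.1 _, ham_mem lam hu.2 _ i⟩)
    (μ := betheValue lam z w) (g := g) hg
    ⟨hsum ▸ bethePsi_ne_zero hN.ne' hw, fun i => hsum ▸ ham_bethePsi hz hw hB i⟩
  rcases Nat.lt_or_ge N 2 with hN2 | hN2
  -- With one point the only line is constant, but x^(λ+1) already has larger degree than m ≤ λ/2.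
  · obtain rfl : N = 1 := by omega
    obtain ⟨q, rfl⟩ := hu.1
    have hq : q ≠ 0 := by rintro rfl; exact hu0 (mul_zero _)
    have h1 := (MvPolynomial.mem_restrictTotalDegree _ _ _ ).1 hu.2
    rw [MvPolynomial.totalDegree_mul_of_isDomain (pow_ne_zero _ (MvPolynomial.X_ne_zero i)) hq,
      MvPolynomial.totalDegree_X_pow] at h1
    obtain rfl : i = 0 := Subsingleton.elim _ _
    simp at hm
    omega
  · refine hu0 (eq_zero_of_lineHom_eq_zero hz hN2 fun b hb => ?_)
    have hDl := lineHom_operD_eq_zero hz hb hue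
    have hle := (natDegree_lineHom_le z b u).trans
      ((MvPolynomial.mem_restrictTotalDegree _ _ _).1 hu.2)
    have hpr := eq_C_mul_of_operD_eq_zero (sum_vacuumValue_sub lam z hμ) (bethePoly_monic w) hD
      (by rw [natDegree_bethePoly]; exact hm) hDl (by omega)
    have hev : (lineHom z b u).eval (z i) = 0 := by
      obtain ⟨q, rfl⟩ := hu.1
      rw [map_mul, map_pow, lineHom_X]
      simp
    rw [hpr, Polynomial.eval_mul, Polynomial.eval_C] at hev
    have := (mul_eq_zero.1 hev).resolve_right
      (eval_bethePoly_ne_zero fun j => (hw.2 j i).symm)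
    rw [hpr, this]
    simp

/-- Equal eigenvalues mean the same D_μ, whose monic solution of degree at most Λ/2 is unique; its
roots are the w_j. -/
theorem range_eq_of_betheValue_eq {lam : Fin N → ℕ} {z : Fin N → ℂ} (hz : Function.Injective z)
    {m m' : ℕ} (hm : 2 * m ≤ ∑ i, lam i) (hm' : 2 * m' ≤ ∑ i, lam i) {w : Fin m → ℂ}
    {w' : Fin m' → ℂ} (hw : IsAdmissible z w) (hw' : IsAdmissible z w')
    (hB : BetheEquations lam z w) (hB' : BetheEquations lam z w')
    (h : betheValue lam z w = betheValue lam z w') : Set.range w = Set.range w' := by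
  obtain ⟨hμ, hD⟩ := sum_betheValue_eq_zero hz hw hB
  obtain ⟨-, hD'⟩ := sum_betheValue_eq_zero hz hw' hB'
  rw [← h] at hD'
  have hpr := eq_C_mul_of_operD_eq_zero (sum_vacuumValue_sub lam z hμ) (bethePoly_monic w) hD
      (by rw [natDegree_bethePoly]; exact hm) hD' (by rw [natDegree_bethePoly]; exact hm')
  rw [(bethePoly_monic w').leadingCoeff, map_one, one_mul] at hpr
  ext t
  rw [← rootSet_bethePoly, ← rootSet_bethePoly, hpr]

/-- Joint eigenvectors with different tuples of eigenvalues are linearly independent. -/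
theorem linearIndependent_of_joint_eigenvectors {ι κ A : Type*} [AddCommGroup A]
    [Module ℂ A] {X : ι → Module.End ℂ A} (hX : ∀ i j, Commute (X i) (X j)) {μ : κ → ι → ℂ}
    (hμ : Function.Injective μ) {v : κ → A} (hv : ∀ k, IsJointEigenvector X (μ k) (v k)) : LinearIndependent ℂ v := by
  have h1 : iSupIndep fun χ : ι → ℂ => ⨅ i, (X i).maxGenEigenspace (χ i) :=
    Module.End.independent_iInf_maxGenEigenspace_of_forall_mapsTo X fun i j φ =>
      Module.End.mapsTo_maxGenEigenspace_of_comm (hX j i) φ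
  have h3 : ∀ k, v k ∈ ⨅ i, (X i).maxGenEigenspace (μ k i) := fun k =>
    (Submodule.mem_iInf _).2 fun i => (Module.End.genEigenspace (X i) (μ k i)).monotone le_top
      (Module.End.mem_eigenspace_iff.2 ((hv k).2 i))
  exact (h1.comp hμ).linearIndependent _ h3 fun k => (hv k).1

theorem linearIndependent_betheVector {lam : Fin N → ℕ} {z : Fin N → ℂ}
    (hz : Function.Injective z) {ι : Type} {m : ι → ℕ} {w : (k : ι) → Fin (m k) → ℂ}
    (h : ∀ k, 2 * m k ≤ ∑ i, lam i ∧ IsAdmissible z (w k) ∧ BetheEquations lam z (w k))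
    (hinj : Function.Injective (fun k => Set.range (w k))) :
    LinearIndependent ℂ (fun k => betheVector lam z (w k)) := by
  refine linearIndependent_of_joint_eigenvectors (X := hamiltonian lam z)
    (fun i j => (states_sites lam).ham_commute (isRMatrix_inv_sub hz) i j)
    (μ := fun k => betheValue lam z (w k)) (fun k k' hk => hinj ?_) fun k =>
    ⟨betheVector_ne_zero hz (h k).1 (h k).2.1 (h k).2.2,
      (betheVector_properties hz (h k).2.1 (h k).2.2).1⟩
  exact range_eq_of_betheValue_eq hz (h k).1 (h k').1 (h k).2.1 (h k').2.1 (h k).2.2 (h k').2.2 hk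

end

section

/-! ### Simple joint spectra -/

section JointSpectra

open Module Module.End

variable {ι U V' : Type*} [AddCommGroup U] [Module ℂ U] [AddCommGroup V'] [Module ℂ V']

/-- The commuting operators `X j` have simple joint spectrum: their generalized joint eigenspaces
have dimension at most one. -/
def HasSimpleSpectrum (X : ι → Module.End ℂ U) : Prop :=
  ∀ (ξ : ι → ℂ) (v u : U), IsJointEigenvector X ξ v →
    (∀ j, X j u - ξ j • u ∈ Submodule.span ℂ {v}) → u ∈ Submodule.span ℂ {v}

/-- The families `X` and `Y` have no joint eigenvalue in common. -/
def HaveDisjointSpectra (X : ι → Module.End ℂ U) (Y : ι → Module.End ℂ V') : Prop :=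
  ∀ (ξ : ι → ℂ) (v : U) (u : V'), IsJointEigenvector X ξ v → ¬ IsJointEigenvector Y ξ u

theorem exists_isJointEigenvector [Finite ι] [FiniteDimensional ℂ U] [Nontrivial U]
    {X : ι → Module.End ℂ U} (hX : ∀ i j, Commute (X i) (X j)) :
    ∃ ξ v, IsJointEigenvector X ξ v := by
  have h := iSup_iInf_maxGenEigenspace_eq_top_of_iSup_maxGenEigenspace_eq_top_of_commute X
    (fun i j _ => hX i j) fun i => iSup_maxGenEigenspace_eq_top (X i)
  obtain ⟨ξ, hξ⟩ : ∃ ξ : ι → ℂ, ⨅ i, (X i).maxGenEigenspace (ξ i) ≠ ⊥ := by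
    by_contra hcon
    push Not at hcon
    rw [iSup_congr hcon, iSup_bot] at h
    exact bot_ne_top h
  obtain ⟨u, hu, hu0⟩ := Submodule.exists_mem_ne_zero_of_ne_bot hξ
  refine ⟨ξ, exists_joint_eigenvector_of_pow hX ξ hu0 fun i => ?_⟩
  obtain ⟨k, hk⟩ := mem_maxGenEigenspace _ _ _ |>.1 ((Submodule.mem_iInf _).1 hu i)
  refine ⟨k, ?_⟩
  rwa [Module.algebraMap_end_eq_smul_id]

theorem finite_joint_eigenvalues [FiniteDimensional ℂ U]
    {X : ι → Module.End ℂ U} (hX : ∀ i j, Commute (X i) (X j)) :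
    {ξ | ∃ v, IsJointEigenvector X ξ v}.Finite := by
  have h : ∀ ξ : {ξ | ∃ v, IsJointEigenvector X ξ v}, ∃ v, IsJointEigenvector X ξ.1 v :=
    fun ξ => ξ.2
  choose v hv using h
  have hli := linearIndependent_of_joint_eigenvectors hX Subtype.val_injective hv
  exact Set.finite_coe_iff.1 hli.finite

/-- Finitely many points are separated by some linear form. -/
theorem exists_separating [Fintype ι] {S : Set (ι → ℂ)} (hS : S.Finite) :
    ∃ c : ι → ℂ, ∀ ξ ∈ S, ∀ η ∈ S, ∑ j, c j * ξ j = ∑ j, c j * η j → ξ = η := by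
  classical
  let p : (ι → ℂ) × (ι → ℂ) → MvPolynomial ι ℂ := fun x =>
    if x.1 = x.2 then 1 else ∑ j, MvPolynomial.C (x.1 j - x.2 j) * MvPolynomial.X j
  have hp : ∏ x ∈ hS.toFinset ×ˢ hS.toFinset, p x ≠ 0 := by
    refine Finset.prod_ne_zero_iff.2 fun x _ => ?_
    by_cases h : x.1 = x.2
    · simp [p, h]
    · obtain ⟨j, hj⟩ := Function.ne_iff.1 h
      simp only [p, h, if_false]
      intro h0
      have := congrArg (MvPolynomial.eval (Pi.single j (1 : ℂ))) h0
      simp only [map_sum, map_mul, MvPolynomial.eval_C, MvPolynomial.eval_X, map_zero,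
        Pi.single_apply, mul_ite, mul_one, mul_zero, Finset.sum_ite_eq', Finset.mem_univ,
        if_true] at this
      exact hj (sub_eq_zero.1 this)
  obtain ⟨c, hc⟩ : ∃ c, MvPolynomial.eval c (∏ x ∈ hS.toFinset ×ˢ hS.toFinset, p x) ≠ 0 := by
    by_contra hcon
    push Not at hcon
    exact hp (MvPolynomial.funext fun c => by rw [hcon, map_zero])
  refine ⟨c, fun ξ hξ η hη h => ?_⟩
  by_contra hne
  rw [map_prod] at hc
  refine Finset.prod_ne_zero_iff.1 hc (ξ, η) (by simp [hξ, hη]) ?_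
  simp only [p, hne, if_false, map_sum, map_mul, MvPolynomial.eval_C, MvPolynomial.eval_X,
    sub_mul, Finset.sum_sub_distrib]
  rw [sub_eq_zero]
  simpa [mul_comm] using h

theorem sum_smul_apply_of_isJointEigenvector [Fintype ι] {X : ι → Module.End ℂ U} {ξ : ι → ℂ}
    {v : U} (h : IsJointEigenvector X ξ v) (c : ι → ℂ) :
    (∑ j, c j • X j) v = (∑ j, c j * ξ j) • v := by
  rw [LinearMap.sum_apply, Finset.sum_smul]
  exact Finset.sum_congr rfl fun j _ => by rw [LinearMap.smul_apply, h.2 j, smul_smul]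

theorem commute_sum_smul [Fintype ι] {X : ι → Module.End ℂ U} (hX : ∀ i j, Commute (X i) (X j))
    (c : ι → ℂ) (i : ι) : Commute (∑ j, c j • X j) (X i) :=
  Commute.sum_left _ _ _ fun j _ => (hX j i).smul_left _

theorem eq_of_mem_maxGenEigenspace {K : Module.End ℂ U} {κ κ' : ℂ} {v : U} (hv : v ≠ 0)
    (h : v ∈ K.maxGenEigenspace κ) (h' : K v = κ' • v) : κ' = κ := by
  by_contra hne
  have h1 : v ∈ K.maxGenEigenspace κ' :=
    (genEigenspace K κ').monotone le_top (mem_eigenspace_iff.2 h')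
  exact hv ((Submodule.disjoint_def.1 (disjoint_genEigenspace K hne ⊤ ⊤)) v h1 h)

/-- Inside a generalized eigenspace of dimension at least two of a combination of the operators
there is a joint eigenvector, and a second one modulo the first. -/
theorem separable_charpoly_of_separating [Fintype ι] [FiniteDimensional ℂ U]
    {X : ι → Module.End ℂ U} (hX : ∀ i j, Commute (X i) (X j)) (hs : HasSimpleSpectrum X)
    {c : ι → ℂ} (hc : ∀ ξ η : ι → ℂ, (∃ v, IsJointEigenvector X ξ v) →
      (∃ v, IsJointEigenvector X η v) → ∑ j, c j * ξ j = ∑ j, c j * η j → ξ = η) :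
    (∑ j, c j • X j).charpoly.Separable := by
  set K := ∑ j, c j • X j with hK
  rw [← Polynomial.nodup_roots_iff_of_splits (LinearMap.charpoly_monic K).ne_zero
    (IsAlgClosed.splits _), Multiset.nodup_iff_count_le_one]
  intro κ
  -- The multiplicity of a root is the dimension of the generalized eigenspace G, which is assumed
  -- to be at least 2 from here on.
  rw [Polynomial.count_roots, ← LinearMap.finrank_maxGenEigenspace_eq]
  by_contra! hrank
  set G := K.maxGenEigenspace κ with hG
  have hmaps : ∀ j, ∀ u ∈ G, X j u ∈ G := fun j =>
    mapsTo_maxGenEigenspace_of_comm (commute_sum_smul hX c j) κ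
  let X' : ι → Module.End ℂ G := fun j => (X j).restrict (hmaps j)
  have hX'a : ∀ j (u : G), ((X' j u : G) : U) = X j u := fun j u => rfl
  have hX' : ∀ i j, Commute (X' i) (X' j) := fun i j => LinearMap.ext fun u => Subtype.ext
    (LinearMap.congr_fun (hX i j) (u : U))
  have hlift : ∀ {ξ : ι → ℂ} {u : G}, IsJointEigenvector X' ξ u →
      IsJointEigenvector X ξ (u : U) := fun {ξ u} h =>
    ⟨fun h0 => h.1 (Subtype.ext h0), fun j => by rw [← hX'a, h.2 j]; rfl⟩
  have hval : ∀ {ξ : ι → ℂ} {u : G}, IsJointEigenvector X' ξ u → ∑ j, c j * ξ j = κ :=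
    fun {ξ u} h => eq_of_mem_maxGenEigenspace (hlift h).1 u.2
      (sum_smul_apply_of_isJointEigenvector (hlift h) c)
  have : Nontrivial G := Module.nontrivial_of_finrank_pos (R := ℂ) (by omega)
  obtain ⟨ξ, v, hv⟩ := exists_isJointEigenvector hX'
  set L : Submodule ℂ G := Submodule.span ℂ {v} with hL
  have hLs : ∀ j, L ≤ L.comap (X' j) := fun j => by
    rw [hL, Submodule.span_le, Set.singleton_subset_iff]
    change X' j v ∈ Submodule.span ℂ {v}
    rw [hv.2 j]
    exact Submodule.smul_mem _ _ (Submodule.mem_span_singleton_self v)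
  let Y : ι → Module.End ℂ (G ⧸ L) := fun j => L.mapQ L (X' j) (hLs j)
  have hY : ∀ i j, Commute (Y i) (Y j) := fun i j => by
    refine LinearMap.ext fun q => ?_
    obtain ⟨u, rfl⟩ := L.mkQ_surjective q
    change L.mkQ (X' i (X' j u)) = L.mkQ (X' j (X' i u))
    exact congrArg _ (LinearMap.congr_fun (hX' i j) u)
  have : Nontrivial (G ⧸ L) := by
    refine Module.nontrivial_of_finrank_pos (R := ℂ) ?_
    have h1 := Submodule.finrank_quotient_add_finrank L
    have h2 : finrank ℂ L = 1 := finrank_span_singleton hv.1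
    omega
  obtain ⟨η, q, hq⟩ := exists_isJointEigenvector hY
  obtain ⟨u, rfl⟩ := L.mkQ_surjective q
  obtain ⟨u', hu'⟩ := exists_joint_eigenvector hX' (π := L.mkQ) (fun i u => rfl) hq
  -- On G the combination has the single eigenvalue κ, so the separating property leaves only one
  -- tuple of joint eigenvalues. The vector u is then an eigenvector modulo v, which simplicity
  -- forbids.
  obtain rfl : η = ξ := hc η ξ ⟨_, hlift hu'⟩ ⟨_, hlift hv⟩ (by rw [hval hu', hval hv])
  have hmem : ∀ x : ↥G, x ∈ L ↔ (x : U) ∈ Submodule.span ℂ {(v : U)} := fun x => by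
    simp only [hL, Submodule.mem_span_singleton, Subtype.ext_iff, Submodule.coe_smul]
  refine hq.1 ((Submodule.Quotient.mk_eq_zero L).2 ((hmem u).2 (hs η v u (hlift hv) fun j => ?_)))
  have h1 : L.mkQ (X' j u) - η j • L.mkQ u = 0 := sub_eq_zero.2 (hq.2 j)
  rw [← map_smul, ← map_sub] at h1
  exact (hmem _).1 ((Submodule.Quotient.mk_eq_zero L).1 h1)

theorem hasSimpleSpectrum_iff_separable [FiniteDimensional ℂ U] (K : Module.End ℂ U) :
    HasSimpleSpectrum (fun _ : Unit => K) ↔ K.charpoly.Separable := by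
  constructor
  · intro h
    have := separable_charpoly_of_separating (c := fun _ : Unit => 1) (fun _ _ => Commute.refl K) h
      (fun ξ η _ _ h => funext fun j => by simpa using h)
    simpa using this
  · intro h ξ v u hv hu
    have h1 := (Polynomial.nodup_roots h)
    rw [Multiset.nodup_iff_count_le_one] at h1
    have h2 := h1 (ξ ())
    rw [Polynomial.count_roots, ← LinearMap.finrank_maxGenEigenspace_eq] at h2
    have hv0 : (K - ξ () • 1) v = 0 := by
      have := hv.2 ()
      simp [this]
    have hvG : v ∈ K.maxGenEigenspace (ξ ()) := (mem_maxGenEigenspace _ _ _).2 ⟨1, by simpa using hv0⟩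
    have huG : u ∈ K.maxGenEigenspace (ξ ()) := by
      refine (mem_maxGenEigenspace _ _ _).2 ⟨2, ?_⟩
      obtain ⟨a, ha⟩ := Submodule.mem_span_singleton.1 (hu ())
      rw [pow_two, Module.End.mul_apply]
      have : (K - ξ () • 1) u = a • v := by rw [ha]; simp
      rw [this, map_smul, hv0, smul_zero]
    have h3 := finrank_le_one_iff.1 h2
    obtain ⟨g, hg⟩ := h3
    obtain ⟨a, ha⟩ := hg ⟨v, hvG⟩
    obtain ⟨b, hb⟩ := hg ⟨u, huG⟩
    have ha' : a • (g : U) = v := congrArg Subtype.val ha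
    have hb' : b • (g : U) = u := congrArg Subtype.val hb
    have ha0 : a ≠ 0 := by
      rintro rfl
      exact hv.1 (by rw [← ha', zero_smul])
    refine Submodule.mem_span_singleton.2 ⟨b / a, ?_⟩
    rw [← ha', ← hb', smul_smul, div_mul_cancel₀ _ ha0]

theorem isRoot_charpoly_iff [FiniteDimensional ℂ U] (T : Module.End ℂ U) (ξ : Unit → ℂ) :
    (∃ v, IsJointEigenvector (fun _ : Unit => T) ξ v) ↔ T.charpoly.IsRoot (ξ ()) := by
  rw [← hasEigenvalue_iff_isRoot_charpoly]
  constructor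
  · rintro ⟨v, hv⟩
    exact hasEigenvalue_of_hasEigenvector ⟨mem_eigenspace_iff.2 (hv.2 ()), hv.1⟩
  · intro h
    obtain ⟨v, hv⟩ := h.exists_hasEigenvector
    exact ⟨v, hv.2, fun _ => mem_eigenspace_iff.1 hv.1⟩

theorem haveDisjointSpectra_iff_isCoprime [FiniteDimensional ℂ U] [FiniteDimensional ℂ V']
    (K : Module.End ℂ U) (K' : Module.End ℂ V') :
    HaveDisjointSpectra (fun _ : Unit => K) (fun _ : Unit => K') ↔
      IsCoprime K.charpoly K'.charpoly := by
  constructor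
  · intro h
    refine (Polynomial.isCoprime_iff_aeval_ne_zero_of_isAlgClosed ℂ ℂ _ _).2 fun a => ?_
    by_contra! hcon
    obtain ⟨v, hv⟩ := (isRoot_charpoly_iff K fun _ => a).2 (by simpa using hcon.1)
    obtain ⟨u, hu⟩ := (isRoot_charpoly_iff K' fun _ => a).2 (by simpa using hcon.2)
    exact h _ v u hv hu
  · intro h ξ v u hv hu
    have h1 := (isRoot_charpoly_iff K ξ).1 ⟨v, hv⟩
    have h2 := (isRoot_charpoly_iff K' ξ).1 ⟨u, hu⟩
    obtain ⟨a, b, hab⟩ := h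
    have := congrArg (Polynomial.eval (ξ ())) hab
    simp [h1.eq_zero, h2.eq_zero] at this

theorem exists_joint_eigenvalue_of_combination [Fintype ι] [FiniteDimensional ℂ U]
    {X : ι → Module.End ℂ U} (hX : ∀ i j, Commute (X i) (X j)) {c : ι → ℂ} {κ : ℂ} {v : U}
    (hv : v ≠ 0) (h : (∑ j, c j • X j) v = κ • v) :
    ∃ ξ : ι → ℂ, (∃ v, IsJointEigenvector X ξ v) ∧ ∑ j, c j * ξ j = κ := by
  set G := (∑ j, c j • X j).eigenspace κ with hG
  have hmaps : ∀ j, ∀ u ∈ G, X j u ∈ G := fun j u hu => by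
    have := mem_eigenspace_iff.1 hu
    refine mem_eigenspace_iff.2 ?_
    rw [← Module.End.mul_apply, (commute_sum_smul hX c j).eq, Module.End.mul_apply, this, map_smul]
  have : Nontrivial G := ⟨⟨v, mem_eigenspace_iff.2 h⟩, 0, fun h0 => hv (congrArg Subtype.val h0)⟩
  obtain ⟨ξ, u, hu⟩ := exists_isJointEigenvector (X := fun j => (X j).restrict (hmaps j))
    fun i j => LinearMap.ext fun u => Subtype.ext (LinearMap.congr_fun (hX i j) (u : U))
  have hu' : IsJointEigenvector X ξ (u : U) :=
    ⟨fun h0 => hu.1 (Subtype.ext h0), fun j => congrArg Subtype.val (hu.2 j)⟩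
  refine ⟨ξ, ⟨u, hu'⟩, ?_⟩
  have h1 := sum_smul_apply_of_isJointEigenvector hu' c
  rw [mem_eigenspace_iff.1 u.2] at h1
  exact (smul_left_injective ℂ hu'.1 h1).symm

theorem haveDisjointSpectra_of_separating [Fintype ι] [FiniteDimensional ℂ U]
    [FiniteDimensional ℂ V'] {X : ι → Module.End ℂ U} (hX : ∀ i j, Commute (X i) (X j))
    {Y : ι → Module.End ℂ V'} (hY : ∀ i j, Commute (Y i) (Y j)) (hd : HaveDisjointSpectra X Y)
    {c : ι → ℂ} (hc : ∀ ξ η : ι → ℂ, (∃ v, IsJointEigenvector X ξ v) →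
      (∃ v, IsJointEigenvector Y η v) → ∑ j, c j * ξ j = ∑ j, c j * η j → ξ = η) :
    HaveDisjointSpectra (fun _ : Unit => ∑ j, c j • X j) (fun _ : Unit => ∑ j, c j • Y j) := by
  intro ξ v u hv hu
  obtain ⟨η, hη, h1⟩ := exists_joint_eigenvalue_of_combination hX hv.1 (hv.2 ())
  obtain ⟨η', hη', h2⟩ := exists_joint_eigenvalue_of_combination hY hu.1 (hu.2 ())
  obtain rfl := hc η η' hη hη' (h1.trans h2.symm)
  obtain ⟨⟨v', hv'⟩, ⟨u', hu'⟩⟩ := hη, hη'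
  exact hd η v' u' hv' hu'

/-- A linear form separating the finitely many joint eigenvalues of all the families reduces the
conditions to single operators, where they become conditions on characteristic polynomials. -/
theorem exists_good_combination {κ : Type*} [Finite κ] {F : κ → Type*} [∀ k, AddCommGroup (F k)]
    [∀ k, Module ℂ (F k)] [Fintype ι] [FiniteDimensional ℂ U] [∀ k, FiniteDimensional ℂ (F k)]
    {X : ι → Module.End ℂ U} (hX : ∀ i j, Commute (X i) (X j))
    {Y : ∀ k, ι → Module.End ℂ (F k)} (hY : ∀ k i j, Commute (Y k i) (Y k j))
    (hs : HasSimpleSpectrum X) (hd : ∀ k, HaveDisjointSpectra X (Y k)) :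
    ∃ c : ι → ℂ, HasSimpleSpectrum (fun _ : Unit => ∑ j, c j • X j) ∧
      ∀ k, HaveDisjointSpectra (fun _ : Unit => ∑ j, c j • X j)
        (fun _ : Unit => ∑ j, c j • Y k j) := by
  obtain ⟨c, hc⟩ := exists_separating ((finite_joint_eigenvalues hX).union
    (Set.finite_iUnion fun k => finite_joint_eigenvalues (hY k)))
  refine ⟨c, (hasSimpleSpectrum_iff_separable _).2 (separable_charpoly_of_separating hX hs ?_),
    fun k => haveDisjointSpectra_of_separating hX (hY k) (hd k) ?_⟩
  · exact fun ξ η hξ hη => hc ξ (Or.inl hξ) η (Or.inl hη)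
  · exact fun ξ η hξ hη => hc ξ (Or.inl hξ) η (Or.inr (Set.mem_iUnion.2 ⟨k, hη⟩))

/-- The characteristic polynomial of a linear combination of operators, with indeterminate
coefficients. -/
theorem exists_generic_charpoly {T : Type*} [Fintype T] [FiniteDimensional ℂ U]
    (D : T → Module.End ℂ U) :
    ∃ χ : Polynomial (MvPolynomial T ℂ), χ.Monic ∧
      ∀ ρ : T → ℂ, χ.map (MvPolynomial.eval ρ) = (∑ t, ρ t • D t).charpoly := by
  classical
  let b := Module.finBasis ℂ U
  let M : Matrix _ _ (MvPolynomial T ℂ) :=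
    ∑ t, (MvPolynomial.X t : MvPolynomial T ℂ) •
      (LinearMap.toMatrix b b (D t)).map (MvPolynomial.C (σ := T))
  refine ⟨M.charpoly, Matrix.charpoly_monic M, fun ρ => ?_⟩
  rw [← Matrix.charpoly_map, ← LinearMap.charpoly_toMatrix _ b]
  congr 1
  ext i j
  simp [M, Matrix.sum_apply]

/-- Simplicity and disjointness of spectra are open in the Zariski topology. -/
theorem exists_discriminant {κ : Type*} [Fintype κ] {F : κ → Type*} [∀ k, AddCommGroup (F k)]
    [∀ k, Module ℂ (F k)] {T : Type*} [Fintype T] [FiniteDimensional ℂ U]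
    [∀ k, FiniteDimensional ℂ (F k)] (D : T → Module.End ℂ U)
    (D' : ∀ k, T → Module.End ℂ (F k)) :
    ∃ Θ : MvPolynomial T ℂ, ∀ ρ : T → ℂ, MvPolynomial.eval ρ Θ ≠ 0 ↔
      HasSimpleSpectrum (fun _ : Unit => ∑ t, ρ t • D t) ∧
      ∀ k, HaveDisjointSpectra (fun _ : Unit => ∑ t, ρ t • D t)
        (fun _ : Unit => ∑ t, ρ t • D' k t) := by
  obtain ⟨χ, hχ, hχρ⟩ := exists_generic_charpoly D
  choose χ' hχ' hχρ' using fun k => exists_generic_charpoly (D' k)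
  -- Specialisation may lower the degree of g. Since f is monic, the resultant taken with the larger
  -- formal degree differs only by a power of the leading coefficient 1.
  have hres : ∀ (f g : Polynomial (MvPolynomial T ℂ)), f.Monic → ∀ ρ : T → ℂ,
      MvPolynomial.eval ρ (f.resultant g) ≠ 0 ↔
        IsCoprime (f.map (MvPolynomial.eval ρ)) (g.map (MvPolynomial.eval ρ)) := by
    intro f g hf ρ
    have hfd : (f.map (MvPolynomial.eval ρ)).natDegree = f.natDegree := hf.natDegree_map _
    obtain ⟨k, hk⟩ := Nat.exists_eq_add_of_le
      (Polynomial.natDegree_map_le (f := MvPolynomial.eval ρ) (p := g))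
    have hfm := hf.map (MvPolynomial.eval ρ)
    rw [← Polynomial.resultant_map_map, hk, Polynomial.resultant_add_right_deg _ _ _ _ _ le_rfl,
      ← hfd, hfm.coeff_natDegree, one_pow, one_mul,
      ← Polynomial.isUnit_resultant_iff_isCoprime hfm, isUnit_iff_ne_zero]
  refine ⟨χ.resultant χ.derivative * ∏ k, χ.resultant (χ' k), fun ρ => ?_⟩
  rw [map_mul, map_prod, mul_ne_zero_iff, Finset.prod_ne_zero_iff, hres _ _ hχ,
    hasSimpleSpectrum_iff_separable, Polynomial.separable_def, ← Polynomial.derivative_map, hχρ]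
  refine and_congr Iff.rfl ⟨fun h k => ?_, fun h k _ => ?_⟩
  · rw [haveDisjointSpectra_iff_isCoprime, ← hχρ', ← hχρ]
    exact (hres _ _ hχ ρ).1 (h k (Finset.mem_univ k))
  · rw [hres _ _ hχ, hχρ, hχρ', ← haveDisjointSpectra_iff_isCoprime]
    exact h k

variable {κ : Type*} {W : Submodule ℂ U} {F : κ → Submodule ℂ V'}

/-- The operators `X j` on the invariant subspace `W` have simple joint spectrum. -/
def SimpleSpectrumOn (W : Submodule ℂ U) (X : ι → Module.End ℂ U) : Prop :=
  ∀ (ξ : ι → ℂ) (v u : U), v ∈ W → u ∈ W → IsJointEigenvector X ξ v →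
    (∀ j, X j u - ξ j • u ∈ Submodule.span ℂ {v}) → u ∈ Submodule.span ℂ {v}

/-- The operators `X j` on `W` and `Y j` on `F` have no joint eigenvalue in common. -/
def DisjointSpectraOn (W : Submodule ℂ U) (X : ι → Module.End ℂ U) (F : Submodule ℂ V')
    (Y : ι → Module.End ℂ V') : Prop :=
  ∀ (ξ : ι → ℂ) (v : U) (u : V'), v ∈ W → u ∈ F → IsJointEigenvector X ξ v →
    ¬ IsJointEigenvector Y ξ u

theorem isJointEigenvector_restrict_iff {X : ι → Module.End ℂ U} (hW : ∀ j, ∀ u ∈ W, X j u ∈ W)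
    {ξ : ι → ℂ} {v : W} :
    IsJointEigenvector (fun j => (X j).restrict (hW j)) ξ v ↔ IsJointEigenvector X ξ (v : U) :=
  and_congr (not_congr Subtype.ext_iff) (forall_congr' fun _ => Subtype.ext_iff)

theorem simpleSpectrumOn_iff {X : ι → Module.End ℂ U} (hW : ∀ j, ∀ u ∈ W, X j u ∈ W) :
    SimpleSpectrumOn W X ↔ HasSimpleSpectrum (fun j => (X j).restrict (hW j)) := by
  have hmem : ∀ x v : ↥W, x ∈ Submodule.span ℂ {v} ↔ (x : U) ∈ Submodule.span ℂ {(v : U)} :=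
    fun x v => by simp only [Submodule.mem_span_singleton, Subtype.ext_iff, Submodule.coe_smul]
  constructor
  · intro h ξ v u hv hu
    exact (hmem u v).2 (h ξ v u v.2 u.2 ((isJointEigenvector_restrict_iff hW).1 hv)
      fun j => (hmem _ v).1 (hu j))
  · intro h ξ v u hv hu hve hue
    exact (hmem ⟨u, hu⟩ ⟨v, hv⟩).1 (h ξ ⟨v, hv⟩ ⟨u, hu⟩
      ((isJointEigenvector_restrict_iff hW).2 hve) fun j => (hmem _ ⟨v, hv⟩).2 (hue j))

theorem disjointSpectraOn_iff {X : ι → Module.End ℂ U} (hW : ∀ j, ∀ u ∈ W, X j u ∈ W)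
    {F : Submodule ℂ V'} {Y : ι → Module.End ℂ V'} (hF : ∀ j, ∀ u ∈ F, Y j u ∈ F) :
    DisjointSpectraOn W X F Y ↔ HaveDisjointSpectra (fun j => (X j).restrict (hW j))
      (fun j => (Y j).restrict (hF j)) := by
  constructor
  · intro h ξ v u hv hu
    exact h ξ v u v.2 u.2 ((isJointEigenvector_restrict_iff hW).1 hv)
      ((isJointEigenvector_restrict_iff hF).1 hu)
  · intro h ξ v u hv hu hve hue
    exact h ξ ⟨v, hv⟩ ⟨u, hu⟩ ((isJointEigenvector_restrict_iff hW).2 hve)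
      ((isJointEigenvector_restrict_iff hF).2 hue)

theorem sum_smul_mem [Fintype ι] {X : ι → Module.End ℂ U} (hW : ∀ j, ∀ u ∈ W, X j u ∈ W)
    (c : ι → ℂ) : ∀ u ∈ W, (∑ j, c j • X j) u ∈ W := fun u hu => by
  rw [LinearMap.sum_apply]
  exact Submodule.sum_mem _ fun j _ => W.smul_mem _ (hW j u hu)

theorem restrict_sum_smul [Fintype ι] {X : ι → Module.End ℂ U} (hW : ∀ j, ∀ u ∈ W, X j u ∈ W)
    (c : ι → ℂ) : (∑ j, c j • X j).restrict (sum_smul_mem hW c) =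
      ∑ j, c j • (X j).restrict (hW j) := by
  refine LinearMap.ext fun u => Subtype.ext ?_
  rw [LinearMap.coe_restrict_apply, LinearMap.sum_apply, LinearMap.sum_apply,
    AddSubmonoidClass.coe_finsetSum]
  rfl

/-- `K` on `W` has simple spectrum, disjoint from the spectra of `K'` on the `F k`. -/
def HasGoodSpectrum (W : Submodule ℂ U) (F : κ → Submodule ℂ V') (K : Module.End ℂ U)
    (K' : Module.End ℂ V') : Prop :=
  SimpleSpectrumOn W (fun _ : Unit => K) ∧
    ∀ k, DisjointSpectraOn W (fun _ : Unit => K) (F k) (fun _ : Unit => K')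

theorem exists_combination_hasGoodSpectrum [Finite κ] [Fintype ι] [FiniteDimensional ℂ W]
    [∀ k, FiniteDimensional ℂ (F k)] {X : ι → Module.End ℂ U} (hX : ∀ i j, Commute (X i) (X j))
    (hW : ∀ j, ∀ u ∈ W, X j u ∈ W) {Y : ι → Module.End ℂ V'} (hY : ∀ i j, Commute (Y i) (Y j))
    (hF : ∀ k j, ∀ u ∈ F k, Y j u ∈ F k) (hs : SimpleSpectrumOn W X)
    (hd : ∀ k, DisjointSpectraOn W X (F k) Y) :
    ∃ c : ι → ℂ, HasGoodSpectrum W F (∑ j, c j • X j) (∑ j, c j • Y j) := by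
  obtain ⟨c, h1, h2⟩ := exists_good_combination
    (X := fun j => (X j).restrict (hW j)) (Y := fun k j => (Y j).restrict (hF k j))
    (fun i j => LinearMap.ext fun u => Subtype.ext (LinearMap.congr_fun (hX i j) (u : U)))
    (fun k i j => LinearMap.ext fun u => Subtype.ext (LinearMap.congr_fun (hY i j) (u : V')))
    ((simpleSpectrumOn_iff hW).1 hs) (fun k => (disjointSpectraOn_iff hW (hF k)).1 (hd k))
  refine ⟨c, (simpleSpectrumOn_iff fun _ => sum_smul_mem hW c).2 ?_, fun k =>
    (disjointSpectraOn_iff (fun _ => sum_smul_mem hW c) fun _ => sum_smul_mem (hF k) c).2 ?_⟩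
  · simpa only [restrict_sum_smul hW] using h1
  · simpa only [restrict_sum_smul hW, restrict_sum_smul (hF k)] using h2 k

theorem exists_discriminant_hasGoodSpectrum [Fintype κ] {T : Type*} [Fintype T]
    [FiniteDimensional ℂ W] [∀ k, FiniteDimensional ℂ (F k)] {D : T → Module.End ℂ U}
    (hW : ∀ j, ∀ u ∈ W, D j u ∈ W) {D' : T → Module.End ℂ V'}
    (hF : ∀ k j, ∀ u ∈ F k, D' j u ∈ F k) :
    ∃ Θ : MvPolynomial T ℂ, ∀ ρ : T → ℂ, MvPolynomial.eval ρ Θ ≠ 0 ↔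
      HasGoodSpectrum W F (∑ t, ρ t • D t) (∑ t, ρ t • D' t) := by
  obtain ⟨Θ, hΘ⟩ := exists_discriminant (fun t => (D t).restrict (hW t))
    (fun k t => (D' t).restrict (hF k t))
  refine ⟨Θ, fun ρ => (hΘ ρ).trans (and_congr ?_ (forall_congr' fun k => ?_))⟩
  · rw [simpleSpectrumOn_iff fun _ => sum_smul_mem hW ρ]
    simp only [restrict_sum_smul hW]
  · rw [disjointSpectraOn_iff (fun _ => sum_smul_mem hW ρ) fun _ => sum_smul_mem (hF k) ρ]
    simp only [restrict_sum_smul hW, restrict_sum_smul (hF k)]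

/-- Goodness of a combination gives goodness of the family. -/
theorem HasGoodSpectrum.of_combination [Fintype ι] {X : ι → Module.End ℂ U}
    {Y : ι → Module.End ℂ V'} {c : ι → ℂ}
    (h : HasGoodSpectrum W F (∑ j, c j • X j) (∑ j, c j • Y j)) :
    SimpleSpectrumOn W X ∧ ∀ k, DisjointSpectraOn W X (F k) Y := by
  refine ⟨fun ξ v u hv hu hve hue => ?_, fun k ξ v u hv hu hve hue => ?_⟩
  · refine h.1 (fun _ => ∑ j, c j * ξ j) v u hv hu
      ⟨hve.1, fun _ => sum_smul_apply_of_isJointEigenvector hve c⟩ fun _ => ?_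
    rw [LinearMap.sum_apply, Finset.sum_smul, ← Finset.sum_sub_distrib]
    refine Submodule.sum_mem _ fun j _ => ?_
    rw [LinearMap.smul_apply, mul_smul, ← smul_sub]
    exact Submodule.smul_mem _ _ (hue j)
  · exact h.2 k (fun _ => ∑ j, c j * ξ j) v u hv hu
      ⟨hve.1, fun _ => sum_smul_apply_of_isJointEigenvector hve c⟩
      ⟨hue.1, fun _ => sum_smul_apply_of_isJointEigenvector hue c⟩

/-- A subspace on which a combination of commuting operators has simple spectrum is spanned by
joint eigenvectors. -/
theorem le_span_of_simpleSpectrumOn [Fintype ι] [FiniteDimensional ℂ W] {X : ι → Module.End ℂ U}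
    (hX : ∀ i j, Commute (X i) (X j)) (hW : ∀ j, ∀ u ∈ W, X j u ∈ W) {c : ι → ℂ}
    (hs : SimpleSpectrumOn W (fun _ : Unit => ∑ j, c j • X j)) :
    W ≤ Submodule.span ℂ {v | v ∈ W ∧ ∃ ξ, IsJointEigenvector X ξ v} := by
  set S := Submodule.span ℂ {v | v ∈ W ∧ ∃ ξ, IsJointEigenvector X ξ v} with hS
  set K := ∑ j, c j • X j with hK
  set K' : Module.End ℂ W := K.restrict (sum_smul_mem hW c) with hK'
  have hs' := (simpleSpectrumOn_iff fun _ => sum_smul_mem hW c).1 hs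
  have htop : ⨆ κ, K'.maxGenEigenspace κ = ⊤ := iSup_maxGenEigenspace_eq_top K'
  have hle : ∀ κ, K'.maxGenEigenspace κ ≤ S.comap W.subtype := by
    intro κ u hu
    by_cases hu0 : u = 0
    · rw [hu0]; exact Submodule.zero_mem _
    have hrank := (Polynomial.nodup_roots ((hasSimpleSpectrum_iff_separable K').1 hs'))
    rw [Multiset.nodup_iff_count_le_one] at hrank
    have h2 := hrank κ
    rw [Polynomial.count_roots, ← LinearMap.finrank_maxGenEigenspace_eq] at h2
    have hcomm : ∀ j, Commute K' ((X j).restrict (hW j)) := fun j =>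
      LinearMap.ext fun u => Subtype.ext (LinearMap.congr_fun (commute_sum_smul hX c j) (u : U))
    obtain ⟨g, hg⟩ := finrank_le_one_iff.1 h2
    obtain ⟨a, ha⟩ := hg ⟨u, hu⟩
    have ha0 : a ≠ 0 := by
      rintro rfl
      exact hu0 (by simpa using (congrArg Subtype.val ha).symm)
    -- The generalized eigenspace is a line stable under every X_j, so its vectors are joint
    -- eigenvectors.
    have hex : ∀ j, ∃ b : ℂ, (X j).restrict (hW j) u = b • u := fun j => by
      obtain ⟨b, hb⟩ := hg ⟨_, mapsTo_maxGenEigenspace_of_comm (hcomm j) κ hu⟩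
      refine ⟨b / a, ?_⟩
      have h3 := congrArg Subtype.val hb
      have h4 := congrArg Subtype.val ha
      simp only [Submodule.coe_smul] at h3 h4
      rw [← h4, smul_smul, div_mul_cancel₀ _ ha0, h3, h4]
    choose ξ hξ using hex
    exact Submodule.subset_span ⟨u.2, ξ, fun h0 => hu0 (Subtype.ext h0),
      fun j => congrArg Subtype.val (hξ j)⟩
  intro u hu
  have : (⟨u, hu⟩ : W) ∈ S.comap W.subtype := by
    have h5 : (⊤ : Submodule ℂ W) ≤ S.comap W.subtype := htop ▸ iSup_le hle
    exact h5 Submodule.mem_top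
  exact this

end JointSpectra
end

section

/-! ### Weights of finite dimensional `sl₂`-modules -/

section Weights

variable {M : Type*} [AddCommGroup M] [Module ℂ M] {E F H : Module.End ℂ M}

theorem weight_apply_pow {c : ℂ} (hE : H * E = E * H + c • E) {ω : ℂ} {x : M} (hx : H x = ω • x)
    (n : ℕ) : H ((E ^ n) x) = (ω + n * c) • (E ^ n) x := by
  induction n with
  | zero => simpa using hx
  | succ n ih =>
    have h1 := LinearMap.congr_fun hE ((E ^ n) x)
    simp only [Module.End.mul_apply, LinearMap.add_apply, LinearMap.smul_apply, ih, map_smul] at h1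
    rw [pow_succ', Module.End.mul_apply, h1, ← add_smul]
    congr 1
    push_cast
    ring

/-- The vectors E^n x have the distinct weights ω + n c, of which there are only finitely many. It
is used with c = 2 for raising and c = −2 for lowering. -/
theorem exists_pow_ne_zero [FiniteDimensional ℂ M] {c : ℂ} (hc : c ≠ 0)
    (hE : H * E = E * H + c • E) {ω : ℂ} {x : M} (hx : H x = ω • x) (hx0 : x ≠ 0) :
    ∃ n, (E ^ n) x ≠ 0 ∧ (E ^ (n + 1)) x = 0 := by
  classical
  have hex : ∃ n, (E ^ n) x = 0 := by
    by_contra! hcon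
    have h1 : ∀ n : ℕ, H.HasEigenvalue (ω + n * c) := fun n =>
      Module.End.hasEigenvalue_of_hasEigenvector
        ⟨Module.End.mem_eigenspace_iff.2 (weight_apply_pow hE hx n), hcon n⟩
    refine Set.infinite_of_injective_forall_mem (s := {κ | H.HasEigenvalue κ})
      (f := fun n : ℕ => ω + n * c) (fun a b hab => ?_) h1 (Module.End.finite_hasEigenvalue H)
    simpa [hc] using hab
  obtain ⟨n, hn⟩ : ∃ n, Nat.find hex = n + 1 := by
    refine Nat.exists_eq_succ_of_ne_zero fun h3 => hx0 ?_
    have := Nat.find_spec hex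
    rwa [h3, pow_zero, Module.End.one_apply] at this
  exact ⟨n, Nat.find_min hex (by omega), hn ▸ Nat.find_spec hex⟩

/-- Weights of highest weight vectors of finite dimensional modules are dominant. -/
theorem exists_nat_of_highest_weight [FiniteDimensional ℂ M] (hE : H * E = E * H + (2 : ℂ) • E)
    (hF : H * F = F * H - (2 : ℂ) • F) (hEF : E * F = F * E + H) {κ : ℂ} {x : M} (hx0 : x ≠ 0)
    (hx : H x = κ • x) (hEx : E x = 0) : ∃ k : ℕ, κ = k := by
  by_cases hH : H = 0
  · refine ⟨0, ?_⟩
    rw [hH, LinearMap.zero_apply, eq_comm, smul_eq_zero] at hx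
    simpa using hx.resolve_right hx0
  let _ : LieRing (Module.End ℂ M) := LieRing.ofAssociativeRing
  have t : IsSl2Triple H E F :=
    { h_ne_zero := hH
      lie_e_f := by rw [LieRing.of_associative_ring_bracket, hEF]; abel
      lie_h_e_nsmul := by rw [LieRing.of_associative_ring_bracket, hE, two_smul, two_nsmul]; abel
      lie_h_f_nsmul := by rw [LieRing.of_associative_ring_bracket, hF, two_smul, two_nsmul]; abel }
  have P : IsSl2Triple.HasPrimitiveVectorWith t x κ := ⟨hx0, hx, hEx⟩
  exact P.exists_nat

theorem casimir_commute (hE : H * E = E * H + (2 : ℂ) • E) (hEF : E * F = F * E + H) :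
    Commute (F * E + (1 / 4 : ℂ) • (H * H) + (1 / 2 : ℂ) • H) E := by
  have h1 : E * H = H * E - (2 : ℂ) • E := by rw [hE]; abel
  have h2 : E * (F * E) = F * E * E + H * E := by rw [← mul_assoc, hEF, add_mul]
  have h3 : E * (H * H) = H * H * E - (4 : ℂ) • (H * E) + (4 : ℂ) • E := by
    rw [← mul_assoc, h1, sub_mul, mul_assoc, h1, smul_mul_assoc, h1, mul_sub, mul_smul_comm,
      ← mul_assoc]
    module
  rw [Commute, SemiconjBy, add_mul, add_mul, mul_add, mul_add, mul_smul_comm, mul_smul_comm, h1,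
    h2, h3, smul_mul_assoc, smul_mul_assoc]
  module

theorem casimir_apply_pow (hE : H * E = E * H + (2 : ℂ) • E) (hEF : E * F = F * E + H) {γ : ℂ}
    {x : M} (hγ : (F * E + (1 / 4 : ℂ) • (H * H) + (1 / 2 : ℂ) • H) x = γ • x) (n : ℕ) :
    (F * E + (1 / 4 : ℂ) • (H * H) + (1 / 2 : ℂ) • H) ((E ^ n) x) = γ • (E ^ n) x := by
  rw [← Module.End.mul_apply, ((casimir_commute hE hEF).pow_right n).eq, Module.End.mul_apply, hγ,
    map_smul]

theorem casimir_of_highest_weight {κ γ : ℂ} {x : M} (hx0 : x ≠ 0)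
    (hx : H x = κ • x) (hEx : E x = 0)
    (hγ : (F * E + (1 / 4 : ℂ) • (H * H) + (1 / 2 : ℂ) • H) x = γ • x) :
    κ * (κ + 2) / 4 = γ := by
  simp only [LinearMap.add_apply, LinearMap.smul_apply, Module.End.mul_apply, hEx, hx, map_zero,
    map_smul, smul_smul, zero_add, ← add_smul] at hγ
  have := smul_left_injective ℂ hx0 hγ
  rw [← this]
  ring

theorem eq_or_of_casimir_eq {a b : ℂ} (h : a * (a + 2) / 4 = b * (b + 2) / 4) :
    a = b ∨ a = -b - 2 := by
  have : (a - b) * (a + b + 2) = 0 := by linear_combination 4 * h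
  rcases mul_eq_zero.1 this with h | h
  · exact Or.inl (sub_eq_zero.1 h)
  · exact Or.inr (by linear_combination h)

/-- The Casimir value is invariant only under a ↦ −a − 2, which maps dominant weights to negative
numbers. -/
theorem nat_eq_of_casimir_eq {a b : ℕ}
    (h : (a : ℂ) * (a + 2) / 4 = (b : ℂ) * (b + 2) / 4) : a = b := by
  rcases eq_or_of_casimir_eq h with h | h
  · exact_mod_cast h
  · have : ((a + b + 2 : ℕ) : ℂ) = 0 := by push_cast; linear_combination h
    exact absurd this (Nat.cast_ne_zero.2 (by omega))

/-- A weight vector on which the Casimir element is a scalar lies in the isotypic component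
of highest weight `k`; its weight is one of `k, k - 2, …, -k`. -/
theorem exists_string [FiniteDimensional ℂ M] (hE : H * E = E * H + (2 : ℂ) • E)
    (hF : H * F = F * H - (2 : ℂ) • F) (hEF : E * F = F * E + H) {ω γ : ℂ} {x : M} (hx0 : x ≠ 0)
    (hx : H x = ω • x) (hγ : (F * E + (1 / 4 : ℂ) • (H * H) + (1 / 2 : ℂ) • H) x = γ • x) :
    ∃ k b : ℕ, ω = k - 2 * b ∧ b ≤ k ∧ γ = (k : ℂ) * (k + 2) / 4 ∧ (E ^ b) x ≠ 0 ∧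
      (E ^ (b + 1)) x = 0 := by
  obtain ⟨b, hb, hb'⟩ := exists_pow_ne_zero two_ne_zero hE hx hx0
  have hEb : E ((E ^ b) x) = 0 := by rwa [pow_succ', Module.End.mul_apply] at hb'
  have hHb := weight_apply_pow hE hx b
  obtain ⟨k, hk⟩ := exists_nat_of_highest_weight hE hF hEF hb hHb hEb
  have hγk := casimir_of_highest_weight hb hHb hEb (casimir_apply_pow hE hEF hγ b)
  rw [hk] at hγk
  have hF' : H * F = F * H + (-2 : ℂ) • F := by rw [hF, neg_smul, sub_eq_add_neg]
  -- Lowering as far as possible and exchanging the roles of E and F gives a dominant weight l with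
  -- the same Casimir value, so l = k. Then a + b = k, whence b ≤ k.
  obtain ⟨a, ha, ha'⟩ := exists_pow_ne_zero (by norm_num) hF' hx hx0
  have hFa : F ((F ^ a) x) = 0 := by rwa [pow_succ', Module.End.mul_apply] at ha'
  have hHa := weight_apply_pow hF' hx a
  have hE2 : -H * F = F * -H + (2 : ℂ) • F := by rw [neg_mul, hF, mul_neg]; module
  have hF2 : -H * E = E * -H - (2 : ℂ) • E := by rw [neg_mul, hE, mul_neg]; module
  have hEF2 : F * E = E * F + -H := by rw [hEF]; abel
  have hHa' : (-H) ((F ^ a) x) = (-(ω + a * (-2))) • (F ^ a) x := by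
    rw [LinearMap.neg_apply, hHa, neg_smul]
  obtain ⟨l, hl⟩ := exists_nat_of_highest_weight hE2 hF2 hEF2 ha hHa' hFa
  have hγ2 : (E * F + (1 / 4 : ℂ) • (-H * -H) + (1 / 2 : ℂ) • -H) x = γ • x := by
    rw [← hγ, hEF, neg_mul_neg]
    simp only [LinearMap.add_apply, LinearMap.smul_apply, LinearMap.neg_apply]
    module
  have hγl := casimir_of_highest_weight ha hHa' hFa (casimir_apply_pow hE2 hEF2 hγ2 a)
  rw [hl] at hγl
  obtain rfl := nat_eq_of_casimir_eq (hγl.trans hγk.symm)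
  refine ⟨l, b, by linear_combination hk, ?_, hγk.symm, hb, hb'⟩
  have : ((a + b : ℕ) : ℂ) = l := by push_cast; linear_combination (1/2 : ℂ) * (hk + hl)
  have : a + b = l := by exact_mod_cast this
  omega

end Weights
end

section

/-! ### Joint eigenvectors of the Hamiltonians and of the weight operator -/

section Totals

variable {ι R : Type*} [Ring R] [Fintype ι] [DecidableEq ι]

theorem sum_mul_sum_eq_of_commute {a b d : ι → R} (hne : ∀ i j, i ≠ j → a i * b j = b j * a i)
    (heq : ∀ i, a i * b i = b i * a i + d i) :
    (∑ i, a i) * ∑ i, b i = (∑ i, b i) * (∑ i, a i) + ∑ i, d i := by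
  have h1 : ∀ i j, a i * b j = b j * a i + if i = j then d i else 0 := fun i j => by
    split_ifs with hij
    · subst hij; exact heq i
    · rw [hne i j hij, add_zero]
  rw [Finset.sum_mul_sum, Finset.sum_mul_sum, Finset.sum_comm (s := Finset.univ) (t := Finset.univ)
    (f := fun i j => b i * a j), ← Finset.sum_add_distrib]
  refine Finset.sum_congr rfl fun i _ => ?_
  simp only [h1, Finset.sum_add_distrib, Finset.sum_ite_eq, Finset.mem_univ, if_true]

variable [Algebra ℂ R] {c : ι → ℂ} {e f h : ι → R}

theorem Sl2Sites.total_he (S : Sl2Sites c e f h) :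
    (∑ i, h i) * ∑ i, e i = (∑ i, e i) * (∑ i, h i) + (2 : ℂ) • ∑ i, e i := by
  rw [sum_mul_sum_eq_of_commute (d := fun i => (2 : ℂ) • e i)
    (fun i j hij => (S.comm_eh j i hij.symm).symm) (fun i => by rw [S.rel_he, two_mul, two_smul]),
    Finset.smul_sum]

theorem Sl2Sites.total_hf (S : Sl2Sites c e f h) :
    (∑ i, h i) * ∑ i, f i = (∑ i, f i) * (∑ i, h i) - (2 : ℂ) • ∑ i, f i := by
  rw [sum_mul_sum_eq_of_commute (d := fun i => -((2 : ℂ) • f i))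
    (fun i j hij => (S.comm_fh j i hij.symm).symm)
    (fun i => by rw [S.rel_hf, two_mul, two_smul, sub_eq_add_neg]),
    Finset.smul_sum, Finset.sum_neg_distrib, sub_eq_add_neg]

theorem Sl2Sites.total_ef (S : Sl2Sites c e f h) :
    (∑ i, e i) * ∑ i, f i = (∑ i, f i) * (∑ i, e i) + ∑ i, h i :=
  sum_mul_sum_eq_of_commute S.comm_ef S.rel_ef

/-- The Gaudin Hamiltonians, together with the total weight. -/
def totalFamily (e f h : ι → R) (r : ι → ι → ℂ) : Option ι → R
  | none => ∑ k, h k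
  | some i => ham e f h r i

theorem Sl2Sites.totalFamily_commute (S : Sl2Sites c e f h) {r : ι → ι → ℂ} (hr : IsRMatrix r) :
    ∀ i j, Commute (totalFamily e f h r i) (totalFamily e f h r j)
  | none, none => Commute.refl _
  | none, some j => (S.ham_commute_sum r j).2.2.symm
  | some i, none => (S.ham_commute_sum r i).2.2
  | some i, some j => S.ham_commute hr i j

end Totals

/-! ### Joint eigenvectors along sl₂-strings. -/

section Strings

variable {ι M : Type*} [AddCommGroup M] [Module ℂ M] [Fintype ι] [DecidableEq ι] {c : ι → ℂ}
  {e f h : ι → Module.End ℂ M}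

/-- The eigenvalues of the `n`-th power of the raising operator applied to an eigenvector. -/
def raise (ξ : Option ι → ℂ) (n : ℕ) : Option ι → ℂ
  | none => ξ none + n * 2
  | some i => ξ (some i)

theorem totalFamily_raise (S : Sl2Sites c e f h) (r : ι → ι → ℂ) (ξ : Option ι → ℂ) (x : M)
    (n : ℕ) (j : Option ι) :
    totalFamily e f h r j (((∑ i, e i) ^ n) x) - raise ξ n j • ((∑ i, e i) ^ n) x =
      ((∑ i, e i) ^ n) (totalFamily e f h r j x - ξ j • x) := by
  cases j with
  | some i =>
    rw [map_sub, map_smul, ← Module.End.mul_apply, ← Module.End.mul_apply]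
    rw [show totalFamily e f h r (some i) = ham e f h r i from rfl,
      (((S.ham_commute_sum r i).1).pow_right n).eq]
    rfl
  | none =>
    rw [show totalFamily e f h r none = ∑ i, h i from rfl, raise]
    induction n with
    | zero => simp
    | succ n ih =>
      have h1 := LinearMap.congr_fun S.total_he (((∑ i, e i) ^ n) x)
      simp only [Module.End.mul_apply, LinearMap.add_apply, LinearMap.smul_apply] at h1
      simp only [pow_succ', Module.End.mul_apply]
      rw [← ih, map_sub, map_smul, h1]
      push_cast
      module

theorem isJointEigenvector_raise (S : Sl2Sites c e f h) {r : ι → ι → ℂ} {ξ : Option ι → ℂ} {x : M}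
    (hx : IsJointEigenvector (totalFamily e f h r) ξ x) {n : ℕ} (hn : ((∑ i, e i) ^ n) x ≠ 0) :
    IsJointEigenvector (totalFamily e f h r) (raise ξ n) (((∑ i, e i) ^ n) x) :=
  ⟨hn, fun j => sub_eq_zero.1 (by
    rw [totalFamily_raise S, sub_eq_zero.2 (hx.2 j), map_zero])⟩

/-- The value of the Casimir element on a joint eigenvector. -/
def casimirOf (c z : ι → ℂ) (ξ : Option ι → ℂ) : ℂ := ∑ i, c i + ∑ i, z i * ξ (some i)

/-- The total Casimir element is the sum of the local ones and of ∑ z_i H_i. -/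
theorem casimir_apply_of_isJointEigenvector (S : Sl2Sites c e f h) {z : ι → ℂ}
    (hz : Function.Injective z) {ξ : Option ι → ℂ} {x : M}
    (hx : IsJointEigenvector (totalFamily e f h fun i j => (z i - z j)⁻¹) ξ x) :
    ((∑ i, f i) * (∑ i, e i) + (1 / 4 : ℂ) • ((∑ i, h i) * ∑ i, h i) + (1 / 2 : ℂ) • ∑ i, h i) x =
      casimirOf c z ξ • x := by
  rw [S.casimir_total, ← S.sum_smul_ham hz, LinearMap.add_apply, Module.algebraMap_end_apply,
    casimirOf, add_smul, LinearMap.sum_apply, Finset.sum_smul, Finset.sum_smul]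
  refine congrArg _ (Finset.sum_congr rfl fun i _ => ?_)
  rw [LinearMap.smul_apply, mul_smul]
  exact congrArg _ (hx.2 (some i))

theorem casimir_of_highest (S : Sl2Sites c e f h) {z : ι → ℂ}
    (hz : Function.Injective z) {ξ : Option ι → ℂ} {x : M}
    (hx : IsJointEigenvector (totalFamily e f h fun i j => (z i - z j)⁻¹) ξ x)
    (hex : (∑ i, e i) x = 0) : ξ none * (ξ none + 2) / 4 = casimirOf c z ξ :=
  casimir_of_highest_weight hx.1 (hx.2 none) hex (casimir_apply_of_isJointEigenvector S hz hx)

theorem exists_string_of_isJointEigenvector [FiniteDimensional ℂ M] (S : Sl2Sites c e f h)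
    {z : ι → ℂ} (hz : Function.Injective z) {ξ : Option ι → ℂ} {x : M}
    (hx : IsJointEigenvector (totalFamily e f h fun i j => (z i - z j)⁻¹) ξ x) :
    ∃ k b : ℕ, ξ none = k - 2 * b ∧ b ≤ k ∧ casimirOf c z ξ = (k : ℂ) * (k + 2) / 4 ∧
      ((∑ i, e i) ^ b) x ≠ 0 ∧ ((∑ i, e i) ^ (b + 1)) x = 0 :=
  exists_string S.total_he S.total_hf S.total_ef hx.1 (hx.2 none)
    (casimir_apply_of_isJointEigenvector S hz hx)

/-- If the joint spectrum on the space of highest weight vectors is simple, then so is the joint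
spectrum on the whole space. -/
theorem simpleSpectrumOn_top [FiniteDimensional ℂ M] (S : Sl2Sites c e f h)
    {z : ι → ℂ} (hz : Function.Injective z)
    (hs : SimpleSpectrumOn (LinearMap.ker (∑ i, e i)) (totalFamily e f h fun i j => (z i - z j)⁻¹)) :
    SimpleSpectrumOn ⊤ (totalFamily e f h fun i j => (z i - z j)⁻¹) := by
  intro ξ v u _ _ hv hu
  obtain ⟨k, b, hξ, -, hγ, hb, hb'⟩ := exists_string_of_isJointEigenvector S hz hv
  have hEE : ∀ x : M, (∑ i, e i) (((∑ i, e i) ^ b) x) = ((∑ i, e i) ^ (b + 1)) x := fun x => by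
    rw [pow_succ', Module.End.mul_apply]
  -- Otherwise this is a joint eigenvector of weight k + 2 in the isotypic component of highest
  -- weight k.
  have hu1 : ((∑ i, e i) ^ (b + 1)) u = 0 := by
    by_contra hne
    have h1 : IsJointEigenvector (totalFamily e f h fun i j => (z i - z j)⁻¹) (raise ξ (b + 1))
        (((∑ i, e i) ^ (b + 1)) u) := by
      refine ⟨hne, fun j => sub_eq_zero.1 ?_⟩
      rw [totalFamily_raise S]
      obtain ⟨a, ha⟩ := Submodule.mem_span_singleton.1 (hu j)
      rw [← ha, map_smul, hb', smul_zero]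
    obtain ⟨k', b', hξ', -, hγ', -⟩ := exists_string_of_isJointEigenvector S hz h1
    obtain rfl : k = k' := nat_eq_of_casimir_eq (hγ.symm.trans hγ')
    have h2 : ((b' + 1 : ℕ) : ℂ) = 0 := by
      simp only [raise] at hξ'
      push_cast at hξ' ⊢
      linear_combination (1 / 2 : ℂ) * (hξ' - hξ)
    exact Nat.cast_ne_zero.2 (Nat.succ_ne_zero b') h2
  have hmem := hs (raise ξ b) _ (((∑ i, e i) ^ b) u) (by rw [LinearMap.mem_ker, hEE, hb'])
    (by rw [LinearMap.mem_ker, hEE, hu1]) (isJointEigenvector_raise S hv hb) fun j => by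
      rw [totalFamily_raise S]
      obtain ⟨a, ha⟩ := Submodule.mem_span_singleton.1 (hu j)
      rw [← ha, map_smul]
      exact Submodule.smul_mem _ _ (Submodule.mem_span_singleton_self _)
  obtain ⟨t, ht⟩ := Submodule.mem_span_singleton.1 hmem
  have hu' : ((∑ i, e i) ^ b) (u - t • v) = 0 := by rw [map_sub, map_smul, ht, sub_self]
  -- The error of u − t v is a multiple a v. Applying E^b, which kills u − t v but not v, gives a =
  -- 0.
  have heig : ∀ j, totalFamily e f h (fun i j => (z i - z j)⁻¹) j (u - t • v) =
      ξ j • (u - t • v) := by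
    intro j
    obtain ⟨a, ha⟩ := Submodule.mem_span_singleton.1 (hu j)
    have h3 : totalFamily e f h (fun i j => (z i - z j)⁻¹) j (u - t • v) - ξ j • (u - t • v) =
        a • v := by
      rw [ha, map_sub, map_smul, hv.2 j]
      module
    have h4 := totalFamily_raise S (fun i j => (z i - z j)⁻¹) ξ (u - t • v) b j
    rw [h3, hu', map_zero, smul_zero, sub_zero, map_smul, eq_comm, smul_eq_zero] at h4
    rw [h4.resolve_right hb, zero_smul] at h3
    exact sub_eq_zero.1 h3
  by_cases h0 : u - t • v = 0
  · rw [sub_eq_zero.1 h0]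
    exact Submodule.smul_mem _ _ (Submodule.mem_span_singleton_self _)
  -- A nonzero eigenvector with these eigenvalues sits at depth b in its string, so E^b could not
  -- kill it.
  · obtain ⟨k', b', hξ', -, hγ', hne, -⟩ := exists_string_of_isJointEigenvector S hz ⟨h0, heig⟩
    obtain rfl : k = k' := nat_eq_of_casimir_eq (hγ.symm.trans hγ')
    have h2 : (b' : ℂ) = b := by linear_combination (1 / 2 : ℂ) * (hξ' - hξ)
    obtain rfl : b' = b := by exact_mod_cast h2
    exact absurd hu' hne

end Strings
end

section

/-! ### Separating the first site -/

section Slices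

open MvPolynomial

variable {N : ℕ}

/-- The coefficient of `x_0 ^ b`, a polynomial in the other variables. -/
def slice (b : ℕ) : MvPolynomial (Fin (N + 1)) ℂ →ₗ[ℂ] MvPolynomial (Fin N) ℂ :=
  (Polynomial.lcoeff (MvPolynomial (Fin N) ℂ) b).restrictScalars ℂ ∘ₗ
    (finSuccEquiv ℂ N).toLinearMap

theorem slice_apply (b : ℕ) (p : MvPolynomial (Fin (N + 1)) ℂ) :
    slice b p = (finSuccEquiv ℂ N p).coeff b := rfl

theorem coeff_slice (b : ℕ) (m : Fin N →₀ ℕ) (p : MvPolynomial (Fin (N + 1)) ℂ) :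
    coeff m (slice b p) = coeff (m.cons b) p :=
  finSuccEquiv_coeff_coeff m p b

theorem exists_slice_ne_zero {p : MvPolynomial (Fin (N + 1)) ℂ} (hp : p ≠ 0) :
    ∃ b, slice b p ≠ 0 := by
  by_contra! hcon
  refine hp ((finSuccEquiv ℂ N).injective (Polynomial.ext fun b => ?_))
  rw [← slice_apply, hcon, map_zero, Polynomial.coeff_zero]

theorem slice_pderiv_zero (b : ℕ) (p : MvPolynomial (Fin (N + 1)) ℂ) :
    slice b (pderiv 0 p) = ((b : ℂ) + 1) • slice (b + 1) p := by
  ext m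
  rw [coeff_smul, coeff_slice, coeff_slice, coeff_pderiv, Finsupp.cons_zero, smul_eq_mul, mul_comm]
  congr 2
  ext i
  refine Fin.cases ?_ (fun j => ?_) i <;> simp [Fin.succ_ne_zero]

theorem slice_pderiv_succ (b : ℕ) (j : Fin N) (p : MvPolynomial (Fin (N + 1)) ℂ) :
    slice b (pderiv j.succ p) = pderiv j (slice b p) := by
  ext m
  rw [coeff_slice, coeff_pderiv, coeff_pderiv, coeff_slice, Finsupp.cons_succ]
  congr 2
  ext i
  refine Fin.cases ?_ (fun j => ?_) i <;> simp [Finsupp.single_apply, (Fin.succ_ne_zero _)]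

theorem slice_X_succ_mul (b : ℕ) (j : Fin N) (p : MvPolynomial (Fin (N + 1)) ℂ) :
    slice b (X j.succ * p) = X j * slice b p := by
  rw [slice_apply, map_mul, finSuccEquiv_X_succ, Polynomial.coeff_C_mul, slice_apply]

theorem slice_succ_X_zero_mul (b : ℕ) (p : MvPolynomial (Fin (N + 1)) ℂ) :
    slice (b + 1) (X 0 * p) = slice b p := by
  rw [slice_apply, map_mul, finSuccEquiv_X_zero, Polynomial.coeff_X_mul, slice_apply]

theorem slice_zero_X_zero_mul (p : MvPolynomial (Fin (N + 1)) ℂ) : slice 0 (X 0 * p) = 0 := by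
  rw [slice_apply, map_mul, finSuccEquiv_X_zero, Polynomial.mul_coeff_zero]
  simp

theorem slice_polyE_zero (lam : Fin (N + 1) → ℕ) (b : ℕ) (p : MvPolynomial (Fin (N + 1)) ℂ) :
    slice b (polyE lam 0 p) = (((b : ℂ) + 1) * (lam 0 - b)) • slice (b + 1) p := by
  rw [polyE_apply, map_sub, ← smul_eq_C_mul, map_smul, slice_pderiv_zero]
  cases b with
  | zero => rw [slice_zero_X_zero_mul]; simp
  | succ b =>
    rw [slice_succ_X_zero_mul, slice_pderiv_zero, slice_pderiv_zero]
    push_cast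
    module

theorem slice_polyH_zero (lam : Fin (N + 1) → ℕ) (b : ℕ) (p : MvPolynomial (Fin (N + 1)) ℂ) :
    slice b (polyH lam 0 p) = ((lam 0 : ℂ) - 2 * b) • slice b p := by
  rw [polyH_apply, map_sub, ← smul_eq_C_mul, map_smul, two_mul, map_add]
  cases b with
  | zero => rw [slice_zero_X_zero_mul]; simp
  | succ b =>
    rw [slice_succ_X_zero_mul, slice_pderiv_zero]
    push_cast
    module

theorem slice_polyE_succ (lam : Fin (N + 1) → ℕ) (b : ℕ) (j : Fin N)
    (p : MvPolynomial (Fin (N + 1)) ℂ) :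
    slice b (polyE lam j.succ p) = polyE (Fin.tail lam) j (slice b p) := by
  rw [polyE_apply, polyE_apply, map_sub, ← smul_eq_C_mul, ← smul_eq_C_mul, map_smul,
    slice_pderiv_succ, slice_X_succ_mul, slice_pderiv_succ, slice_pderiv_succ]
  rfl

theorem slice_polyH_succ (lam : Fin (N + 1) → ℕ) (b : ℕ) (j : Fin N)
    (p : MvPolynomial (Fin (N + 1)) ℂ) :
    slice b (polyH lam j.succ p) = polyH (Fin.tail lam) j (slice b p) := by
  rw [polyH_apply, polyH_apply, map_sub, ← smul_eq_C_mul, ← smul_eq_C_mul, map_smul, two_mul,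
    two_mul, map_add, slice_X_succ_mul, slice_pderiv_succ]
  rfl

theorem slice_polyF_succ (b : ℕ) (j : Fin N) (p : MvPolynomial (Fin (N + 1)) ℂ) :
    slice b (polyF j.succ p) = polyF j (slice b p) := by
  rw [polyF_apply, polyF_apply, slice_X_succ_mul]

theorem slice_sum_polyE (lam : Fin (N + 1) → ℕ) (b : ℕ) (p : MvPolynomial (Fin (N + 1)) ℂ) :
    slice b ((∑ i, polyE lam i) p) = (((b : ℂ) + 1) * (lam 0 - b)) • slice (b + 1) p +
      (∑ j, polyE (Fin.tail lam) j) (slice b p) := by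
  rw [Fin.sum_univ_succ, LinearMap.add_apply, map_add, slice_polyE_zero, LinearMap.sum_apply,
    LinearMap.sum_apply, map_sum]
  simp only [slice_polyE_succ]

theorem slice_sum_polyH (lam : Fin (N + 1) → ℕ) (b : ℕ) (p : MvPolynomial (Fin (N + 1)) ℂ) :
    slice b ((∑ i, polyH lam i) p) = ((lam 0 : ℂ) - 2 * b) • slice b p +
      (∑ j, polyH (Fin.tail lam) j) (slice b p) := by
  rw [Fin.sum_univ_succ, LinearMap.add_apply, map_add, slice_polyH_zero, LinearMap.sum_apply,
    LinearMap.sum_apply, map_sum]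
  simp only [slice_polyH_succ]

/-- The limit of the coefficients `1 / (z_i - z_j)` when the first point tends to infinity. -/
def limitMatrix (r : Fin N → Fin N → ℂ) (i j : Fin (N + 1)) : ℂ :=
  Fin.cases 0 (fun i' => Fin.cases 0 (fun j' => r i' j') j) i

theorem isRMatrix_limitMatrix {r : Fin N → Fin N → ℂ} (hr : IsRMatrix r) :
    IsRMatrix (limitMatrix r) where
  skew i j := by
    refine Fin.cases ?_ (fun i => ?_) i <;> refine Fin.cases ?_ (fun j => ?_) j <;>
      simp [limitMatrix]
    exact hr.skew i j
  yang_baxter i j k := by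
    refine Fin.cases ?_ (fun i => ?_) i <;> refine Fin.cases ?_ (fun j => ?_) j <;>
      refine Fin.cases ?_ (fun k => ?_) k <;> intro h1 h2 h3 <;> simp [limitMatrix]
    exact hr.yang_baxter i j k (fun h => h1 (congrArg _ h)) (fun h => h2 (congrArg _ h))
      (fun h => h3 (congrArg _ h))

theorem IsRMatrix.self_eq_zero {ι : Type*} {r : ι → ι → ℂ} (hr : IsRMatrix r) (i : ι) :
    r i i = 0 := by
  have h := hr.skew i i
  exact self_eq_neg.1 h

theorem ham_eq_sum {ι R : Type*} [Ring R] [Algebra ℂ R] [Fintype ι] [DecidableEq ι]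
    {e f h : ι → R} {r : ι → ι → ℂ} (hr : IsRMatrix r) (i : ι) :
    ham e f h r i = ∑ j, r i j • omega e f h i j :=
  Finset.sum_erase _ (by rw [hr.self_eq_zero, zero_smul])

theorem slice_omega_succ (lam : Fin (N + 1) → ℕ) (b : ℕ) (j k : Fin N)
    (p : MvPolynomial (Fin (N + 1)) ℂ) :
    slice b (omega (polyE lam) polyF (polyH lam) j.succ k.succ p) =
      omega (polyE (Fin.tail lam)) polyF (polyH (Fin.tail lam)) j k (slice b p) := by
  simp only [omega, LinearMap.add_apply, LinearMap.smul_apply, Module.End.mul_apply, map_add,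
    map_smul, slice_polyE_succ, slice_polyF_succ, slice_polyH_succ]

/-- In the limit the first site decouples, so the remaining Hamiltonians act on the coefficients of
the powers of x_0. -/
theorem slice_ham (lam : Fin (N + 1) → ℕ) {r : Fin N → Fin N → ℂ} (hr : IsRMatrix r) (b : ℕ)
    (j : Fin N) (p : MvPolynomial (Fin (N + 1)) ℂ) :
    slice b (polyHam lam (limitMatrix r) j.succ p) = polyHam (Fin.tail lam) r j (slice b p) := by
  rw [polyHam, polyHam, ham_eq_sum hr, ham_eq_sum (isRMatrix_limitMatrix hr), Fin.sum_univ_succ]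
  simp only [limitMatrix, Fin.cases_succ, Fin.cases_zero, zero_smul, zero_add, LinearMap.sum_apply,
    map_sum, LinearMap.smul_apply, map_smul, slice_omega_succ]

theorem toStates_slice_eq_zero {lam : Fin (N + 1) → ℕ} {p : MvPolynomial (Fin (N + 1)) ℂ}
    (hp : toStates lam p = 0) {b : ℕ} (hb : b ≤ lam 0) :
    toStates (Fin.tail lam) (slice b p) = 0 := by
  rw [toStates_eq_zero_iff] at hp ⊢
  intro a ha
  rw [coeff_slice]
  exact hp _ fun i => Fin.cases (by simpa using hb) (fun j => by rw [Finsupp.cons_succ]; exact ha j) i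

theorem toStates_eq_zero_of_slice {lam : Fin (N + 1) → ℕ} {p : MvPolynomial (Fin (N + 1)) ℂ}
    (h : ∀ b ≤ lam 0, toStates (Fin.tail lam) (slice b p) = 0) : toStates lam p = 0 := by
  rw [toStates_eq_zero_iff]
  intro a ha
  have := (toStates_eq_zero_iff _ _).1 (h (a 0) (ha 0)) a.tail fun j => ha j.succ
  rwa [coeff_slice, Finsupp.cons_tail] at this

theorem toStates_surjective (lam : Fin N → ℕ) : Function.Surjective (toStates lam) := fun v =>
  let ⟨p, _, hp⟩ := exists_toStates_eq lam v
  ⟨p, hp⟩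

/-- The component along the highest weight vector of the first factor; it descends from polynomials
since extracting the coefficient of x_0^0 respects the kernels of `toStates`. -/
theorem exists_component (lam : Fin (N + 1) → ℕ) :
    ∃ φ : States lam →ₗ[ℂ] States (Fin.tail lam),
      ∀ p, φ (toStates lam p) = toStates (Fin.tail lam) (slice 0 p) := by
  obtain ⟨g, hg⟩ := (toStates lam).exists_rightInverse_of_surjective
    (LinearMap.range_eq_top.2 (toStates_surjective lam))
  refine ⟨toStates (Fin.tail lam) ∘ₗ slice 0 ∘ₗ g, fun p => ?_⟩
  rw [LinearMap.comp_apply, LinearMap.comp_apply, ← sub_eq_zero, ← map_sub, ← map_sub]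
  refine toStates_slice_eq_zero ?_ (Nat.zero_le _)
  rw [map_sub, sub_eq_zero]
  exact LinearMap.congr_fun hg _

/-- Comparing the coefficients of x_0^n in e p = 0 expresses E' of the n-th component by the next
one, with factor −(n + 1)(λ_0 − n), where E' acts on the other sites. -/
theorem pow_sum_polyE_slice {lam : Fin (N + 1) → ℕ} {p : MvPolynomial (Fin (N + 1)) ℂ}
    (hp : toStates lam ((∑ i, polyE lam i) p) = 0) {n : ℕ} (hn : n ≤ lam 0 + 1) :
    (diagonalAction (Fin.tail lam) repE ^ n) (toStates (Fin.tail lam) (slice 0 p)) =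
      (∏ i ∈ Finset.range n, (-(((i : ℂ) + 1) * (lam 0 - i)))) •
        toStates (Fin.tail lam) (slice n p) := by
  induction n with
  | zero => simp
  | succ n ih =>
    have h1 := toStates_slice_eq_zero hp (b := n) (by omega)
    rw [slice_sum_polyE, map_add, map_smul, toStates_sum_polyE] at h1
    rw [pow_succ', Module.End.mul_apply, ih (by omega), map_smul, Finset.prod_range_succ, mul_smul,
      eq_neg_of_add_eq_zero_right h1, neg_smul]

/-- The last factor of the product is λ_0 − λ_0. -/
theorem component_pow {lam : Fin (N + 1) → ℕ} {φ : States lam →ₗ[ℂ] States (Fin.tail lam)}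
    (hφ : ∀ p, φ (toStates lam p) = toStates (Fin.tail lam) (slice 0 p)) {v : States lam}
    (hv : diagonalAction lam repE v = 0) :
    (diagonalAction (Fin.tail lam) repE ^ (lam 0 + 1)) (φ v) = 0 := by
  obtain ⟨p, rfl⟩ := toStates_surjective lam v
  rw [hφ, pow_sum_polyE_slice (by rw [toStates_sum_polyE, hv]) le_rfl, Finset.prod_range_succ]
  simp

/-- Up to exponent λ_0 the factors do not vanish, so the component at x_0^0 determines all the
others. -/
theorem component_injective {lam : Fin (N + 1) → ℕ} {φ : States lam →ₗ[ℂ] States (Fin.tail lam)}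
    (hφ : ∀ p, φ (toStates lam p) = toStates (Fin.tail lam) (slice 0 p)) {v : States lam}
    (hv : diagonalAction lam repE v = 0) (h0 : φ v = 0) : v = 0 := by
  obtain ⟨p, rfl⟩ := toStates_surjective lam v
  refine toStates_eq_zero_of_slice fun b hb => ?_
  have h1 := pow_sum_polyE_slice (n := b) (by rw [toStates_sum_polyE, hv]) (by omega)
  rw [← hφ, h0, map_zero, eq_comm, smul_eq_zero] at h1
  refine h1.resolve_left (Finset.prod_ne_zero_iff.2 fun i hi => ?_)
  have hi' : i < lam 0 := (Finset.mem_range.1 hi).trans_le hb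
  refine neg_ne_zero.2 (mul_ne_zero (Nat.cast_add_one_ne_zero i) (sub_ne_zero.2 ?_))
  exact_mod_cast hi'.ne'

end Slices

section Families

variable {N : ℕ}

/-- The Hamiltonians and the weight operator on the space of states. -/
abbrev stateFamily (lam : Fin N → ℕ) (r : Fin N → Fin N → ℂ) :
    Option (Fin N) → Module.End ℂ (States lam) :=
  totalFamily (site lam repE) (site lam repF) (site lam repH) r

/-- The Hamiltonians and the weight operator on polynomials. -/
abbrev polyFamily (lam : Fin N → ℕ) (r : Fin N → Fin N → ℂ) :
    Option (Fin N) → Module.End ℂ (MvPolynomial (Fin N) ℂ) :=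
  totalFamily (polyE lam) polyF (polyH lam) r

theorem toStates_polyFamily (lam : Fin N → ℕ) (r : Fin N → Fin N → ℂ)
    (p : MvPolynomial (Fin N) ℂ) :
    ∀ j, toStates lam (polyFamily lam r j p) = stateFamily lam r j (toStates lam p)
  | none => toStates_sum_polyH lam p
  | some i => toStates_ham lam r i p

/-- The eigenvalues after removing the first site from a vector with `x_0`-exponent `b`. -/
def dropFirst (lam : Fin (N + 1) → ℕ) (b : ℕ) (ξ : Option (Fin (N + 1)) → ℂ) :
    Option (Fin N) → ℂ
  | none => ξ none - lam 0 + 2 * b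
  | some j => ξ (some j.succ)

theorem polyFamily_slice (lam : Fin (N + 1) → ℕ) {r : Fin N → Fin N → ℂ} (hr : IsRMatrix r)
    (b : ℕ) (p : MvPolynomial (Fin (N + 1)) ℂ) (ξ : Option (Fin (N + 1)) → ℂ) :
    ∀ j, polyFamily (Fin.tail lam) r j (slice b p) - dropFirst lam b ξ j • slice b p =
      slice b (polyFamily lam (limitMatrix r) (j.map Fin.succ) p - ξ (j.map Fin.succ) • p)
  | none => by
    rw [map_sub, map_smul]
    change _ = slice b ((∑ i, polyH lam i) p) - _
    rw [slice_sum_polyH]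
    change (∑ j, polyH (Fin.tail lam) j) (slice b p) - (ξ none - lam 0 + 2 * b) • slice b p =
      _ - ξ none • slice b p
    module
  | some j => by
    rw [map_sub, map_smul]
    exact congrArg (· - _) (slice_ham lam hr b j p).symm

theorem stateFamily_component {lam : Fin (N + 1) → ℕ}
    {φ : States lam →ₗ[ℂ] States (Fin.tail lam)}
    (hφ : ∀ p, φ (toStates lam p) = toStates (Fin.tail lam) (slice 0 p))
    {r : Fin N → Fin N → ℂ} (hr : IsRMatrix r) (v : States lam) (ξ : Option (Fin (N + 1)) → ℂ)
    (j : Option (Fin N)) :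
    stateFamily (Fin.tail lam) r j (φ v) - dropFirst lam 0 ξ j • φ v =
      φ (stateFamily lam (limitMatrix r) (j.map Fin.succ) v - ξ (j.map Fin.succ) • v) := by
  obtain ⟨p, rfl⟩ := toStates_surjective lam v
  rw [hφ, ← toStates_polyFamily, ← map_smul, ← map_sub, polyFamily_slice lam hr, ← hφ, map_sub,
    map_smul, toStates_polyFamily]

end Families
end

section

/-! ### Generic points -/

section Generic

open MvPolynomial

variable {N : ℕ}

/-- The highest weight vectors of the space of states. -/
abbrev highestSpace (lam : Fin N → ℕ) : Submodule ℂ (States lam) :=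
  LinearMap.ker (diagonalAction lam repE)

/-- The joint spectrum on the highest weight vectors is simple, and does not meet the spectrum on
the polynomials divisible by `x_i ^ (λ_i + 1)`. -/
structure IsGeneric (lam : Fin N → ℕ) (r : Fin N → Fin N → ℂ) : Prop where
  simple : SimpleSpectrumOn (highestSpace lam) (stateFamily lam r)
  disjoint : ∀ i, DisjointSpectraOn (highestSpace lam) (stateFamily lam r)
    (singularMultiples lam i) (polyFamily lam r)

theorem slice_mem_singularMultiples {lam : Fin (N + 1) → ℕ} {j : Fin N}
    {p : MvPolynomial (Fin (N + 1)) ℂ} (hp : p ∈ singularMultiples lam j.succ) (b : ℕ) :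
    slice b p ∈ singularMultiples (Fin.tail lam) j := by
  obtain ⟨q, rfl⟩ := hp
  refine ⟨slice b q, ?_⟩
  change slice b (X j.succ ^ (lam j.succ + 1) * q) = X j ^ (lam j.succ + 1) * slice b q
  induction lam j.succ + 1 with
  | zero => simp
  | succ n ih => rw [pow_succ', mul_assoc, slice_X_succ_mul, ih, pow_succ', mul_assoc]

theorem slice_eq_zero_of_mem {lam : Fin (N + 1) → ℕ} {p : MvPolynomial (Fin (N + 1)) ℂ}
    (hp : p ∈ singularMultiples lam 0) {b : ℕ} (hb : b ≤ lam 0) : slice b p = 0 := by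
  obtain ⟨q, rfl⟩ := hp
  rw [slice_apply, map_mul, map_pow, finSuccEquiv_X_zero, Polynomial.coeff_X_pow_mul',
    if_neg (by omega)]

theorem pow_sum_polyE_mem {lam : Fin N → ℕ} {i : Fin N} {p : MvPolynomial (Fin N) ℂ}
    (hp : p ∈ singularMultiples lam i) (n : ℕ) :
    ((∑ j, polyE lam j) ^ n) p ∈ singularMultiples lam i := by
  induction n with
  | zero => exact hp
  | succ n ih =>
    rw [pow_succ', Module.End.mul_apply]
    exact sum_polyE_mem_singularMultiples lam i ih

theorem exists_pow_sum_polyE (lam : Fin N → ℕ) {p : MvPolynomial (Fin N) ℂ} (hp : p ≠ 0) :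
    ∃ a, ((∑ j, polyE lam j) ^ a) p ≠ 0 ∧ (∑ j, polyE lam j) (((∑ j, polyE lam j) ^ a) p) = 0 := by
  have := exists_pow_apply_mem_of_not_mem (K := ⊥) (E := ∑ j, polyE lam j) (u := p) (by simpa using hp)
    ⟨p.totalDegree + 1, by
      rw [Submodule.mem_bot]
      exact sum_polyE_pow_eq_zero lam _ ((mem_restrictTotalDegree _ _ _).2 le_rfl)⟩
  simpa using this

/-- Genericity in the limit when the first point tends to infinity. -/
theorem isGeneric_limitMatrix {lam : Fin (N + 1) → ℕ} {z : Fin N → ℂ} (hz : Function.Injective z)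
    (h : IsGeneric (Fin.tail lam) fun i j => (z i - z j)⁻¹) :
    IsGeneric lam (limitMatrix fun i j => (z i - z j)⁻¹) := by
  obtain ⟨φ, hφ⟩ := exists_component lam
  have hr := isRMatrix_inv_sub hz
  have hcomp : ∀ {ξ v}, v ∈ highestSpace lam →
      IsJointEigenvector (stateFamily lam (limitMatrix fun i j => (z i - z j)⁻¹)) ξ v →
      IsJointEigenvector (stateFamily (Fin.tail lam) fun i j => (z i - z j)⁻¹)
        (dropFirst lam 0 ξ) (φ v) := fun {ξ v} hv hve =>
    ⟨fun h0 => hve.1 (component_injective hφ hv h0), fun j => sub_eq_zero.1 (by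
      rw [stateFamily_component hφ hr, sub_eq_zero.2 (hve.2 _), map_zero])⟩
  constructor
  · intro ξ v u hv hu hve hue
    have h1 := simpleSpectrumOn_top (states_sites (Fin.tail lam)) hz h.simple (dropFirst lam 0 ξ)
      (φ v) (φ u) trivial trivial (hcomp hv hve) fun j => by
        rw [stateFamily_component hφ hr]
        obtain ⟨a, ha⟩ := Submodule.mem_span_singleton.1 (hue (j.map Fin.succ))
        rw [← ha, map_smul]
        exact Submodule.smul_mem _ _ (Submodule.mem_span_singleton_self _)
    obtain ⟨t, ht⟩ := Submodule.mem_span_singleton.1 h1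
    refine Submodule.mem_span_singleton.2 ⟨t, sub_eq_zero.1 (component_injective hφ
      (Submodule.sub_mem _ (Submodule.smul_mem _ t hv) hu) ?_)⟩
    rw [map_sub, map_smul, ht, sub_self]
  · intro i ξ v g hv hg hve hge
    have hφv := hcomp hv hve
    obtain ⟨k, b, hξ, hbk, hγ, hb, hb'⟩ :=
      exists_string_of_isJointEigenvector (states_sites (Fin.tail lam)) hz hφv
    -- The depth b of the component in its string is bounded, because E' to the power λ_0 + 1
    -- annihilates it.
    have hbl : b ≤ lam 0 := by
      by_contra! hlt
      obtain ⟨d, rfl⟩ := Nat.exists_eq_add_of_le (Nat.succ_le_of_lt hlt)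
      refine hb ?_
      rw [add_comm (lam 0).succ d, pow_add, Module.End.mul_apply]
      exact (congrArg _ (component_pow hφ hv)).trans (map_zero _)
    -- A nonzero coefficient of x_0^s in g, raised a times, becomes singular. It has the same
    -- Hamiltonian eigenvalues as the component of v, hence the same Casimir value, so its weight is
    -- k or −k − 2.
    obtain ⟨s, hs⟩ := exists_slice_ne_zero hge.1
    obtain ⟨a, ha, ha'⟩ := exists_pow_sum_polyE (Fin.tail lam) hs
    have hgs : IsJointEigenvector (polyFamily (Fin.tail lam) fun i j => (z i - z j)⁻¹)
        (dropFirst lam s ξ) (slice s g) := ⟨hs, fun j => sub_eq_zero.1 (by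
      rw [polyFamily_slice lam hr, sub_eq_zero.2 (hge.2 _), map_zero])⟩
    have hga := isJointEigenvector_raise (poly_sites (Fin.tail lam)) hgs ha
    have hγ' := casimir_of_highest (poly_sites (Fin.tail lam)) hz hga ha'
    have hγγ : casimirOf (fun i => casimirValue (Fin.tail lam i)) z (raise (dropFirst lam s ξ) a) =
      casimirOf (fun i => casimirValue (Fin.tail lam i)) z (dropFirst lam 0 ξ) := rfl
    rw [hγγ, hγ] at hγ'
    have hw0 : raise (dropFirst lam s ξ) a none = k - 2 * b + 2 * s + 2 * a := by
      have : dropFirst lam 0 ξ none = ξ none - lam 0 + 2 * (0 : ℕ) := rfl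
      change ξ none - lam 0 + 2 * s + a * 2 = _
      rw [this] at hξ
      push_cast at hξ
      linear_combination hξ
    rcases eq_or_of_casimir_eq hγ' with h1 | h1
    · have hsab : s + a = b := by
        have : ((s + a : ℕ) : ℂ) = b := by
          push_cast
          linear_combination (1 / 2 : ℂ) * (h1 - hw0)
        exact_mod_cast this
      revert hg
      refine Fin.cases (fun hg => ?_) (fun j hg => ?_) i
      -- For weight k one gets s ≤ b ≤ λ_0, but a multiple of x_0^(λ_0+1) has no such coefficient.
      -- For the other indices the disjointness of the spectra for N points applies.
      · exact hs (slice_eq_zero_of_mem hg (by omega))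
      · have hw := isJointEigenvector_raise (states_sites (Fin.tail lam)) hφv hb
        have heq : raise (dropFirst lam 0 ξ) b = raise (dropFirst lam s ξ) a := by
          funext o
          cases o with
          | none =>
            rw [h1]
            change dropFirst lam 0 ξ none + b * 2 = k
            rw [hξ]
            ring
          | some j => rfl
        rw [heq] at hw
        refine h.disjoint j _ _ _ ?_ (pow_sum_polyE_mem (slice_mem_singularMultiples hg s) a) hw hga
        rw [pow_succ', Module.End.mul_apply] at hb'
        exact hb'
    -- Weight −k − 2 would need b = k + s + a + 1 > k, outside the string.
    · have : ((k + s + a + 1 : ℕ) : ℂ) = b := by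
        push_cast
        linear_combination (1 / 2 : ℂ) * (h1 - hw0)
      have : k + s + a + 1 = b := by exact_mod_cast this
      omega

end Generic
end

section

/-! ### Existence of generic points, and genericity as an algebraic condition. -/

section GenericExistence

open MvPolynomial

variable {N : ℕ}

/-- The operators of which all the families are built: the total weight and the `Ω_ij`. -/
def pairOperators {ι R : Type*} [Ring R] [Algebra ℂ R] [Fintype ι] [DecidableEq ι]
    (e f h : ι → R) : Option (ι × ι) → R
  | none => ∑ k, h k
  | some (i, j) => if i = j then 0 else omega e f h i j

/-- The coefficients of a combination of the Hamiltonians and the total weight in terms of the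
operators `pairOperators`. -/
def pairCoefficients {ι : Type*} (c : Option ι → ℂ) (r : ι → ι → ℂ) : Option (ι × ι) → ℂ
  | none => c none
  | some (i, j) => c (some i) * r i j

theorem sum_smul_totalFamily {ι R : Type*} [Ring R] [Algebra ℂ R] [Fintype ι] [DecidableEq ι]
    (e f h : ι → R) (r : ι → ι → ℂ) (c : Option ι → ℂ) :
    ∑ j, c j • totalFamily e f h r j =
      ∑ t, pairCoefficients c r t • pairOperators e f h t := by
  rw [Fintype.sum_option, Fintype.sum_option, Fintype.sum_prod_type]
  congr 1
  refine Finset.sum_congr rfl fun i _ => ?_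
  simp only [totalFamily, pairCoefficients, pairOperators, ham, Finset.smul_sum, smul_smul]
  rw [← Finset.filter_ne, Finset.sum_filter]
  exact Finset.sum_congr rfl fun j _ => by split_ifs <;> simp_all

theorem sum_h_mem_ker {ι M : Type*} [AddCommGroup M] [Module ℂ M] [Fintype ι] [DecidableEq ι]
    {c : ι → ℂ} {e f h : ι → Module.End ℂ M} (S : Sl2Sites c e f h) {u : M}
    (hu : (∑ i, e i) u = 0) : (∑ i, e i) ((∑ i, h i) u) = 0 := by
  have h1 := LinearMap.congr_fun S.total_he u
  simp only [Module.End.mul_apply, LinearMap.add_apply, LinearMap.smul_apply, hu, map_zero,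
    smul_zero, add_zero] at h1
  exact h1.symm

theorem pairOperators_mem_highestSpace (lam : Fin N → ℕ) :
    ∀ t, ∀ u ∈ highestSpace lam,
      pairOperators (site lam repE) (site lam repF) (site lam repH) t u ∈ highestSpace lam
  | none, u, hu => sum_h_mem_ker (states_sites lam) hu
  | some (i, j), u, hu => by
    rw [pairOperators]
    split_ifs with hij
    · exact Submodule.zero_mem _
    · rw [LinearMap.mem_ker] at hu ⊢
      have h1 := ((states_sites lam).omega_commute_sum hij).1
      have h2 := LinearMap.congr_fun h1.eq u
      rw [Module.End.mul_apply, Module.End.mul_apply] at h2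
      exact h2.symm.trans ((congrArg _ hu).trans (map_zero _))

theorem stateFamily_mem_highestSpace (lam : Fin N → ℕ) (r : Fin N → Fin N → ℂ) :
    ∀ j, ∀ u ∈ highestSpace lam, stateFamily lam r j u ∈ highestSpace lam
  | none, u, hu => sum_h_mem_ker (states_sites lam) hu
  | some i, u, hu => by
    rw [LinearMap.mem_ker] at hu ⊢
    have h2 := LinearMap.congr_fun ((states_sites lam).ham_commute_sum r i).1.eq u
    rw [Module.End.mul_apply, Module.End.mul_apply] at h2
    exact h2.symm.trans ((congrArg _ hu).trans (map_zero _))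

/-- The polynomials of bounded degree divisible by `x_i ^ (λ_i + 1)`. -/
abbrev singularSpace (lam : Fin N → ℕ) (i : Fin N) : Submodule ℂ (MvPolynomial (Fin N) ℂ) :=
  singularMultiples lam i ⊓ restrictTotalDegree (Fin N) ℂ (∑ i, lam i)

theorem sum_polyH_mem_singularSpace (lam : Fin N → ℕ) (k : Fin N) {u : MvPolynomial (Fin N) ℂ}
    (hu : u ∈ singularSpace lam k) : (∑ i, polyH lam i) u ∈ singularSpace lam k := by
  rw [LinearMap.sum_apply]
  exact Submodule.sum_mem _ fun i _ => ⟨polyH_mem_singularMultiples lam k i hu.1,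
    polyH_mem lam hu.2 i⟩

theorem pairOperators_mem_singularSpace (lam : Fin N → ℕ) (k : Fin N) :
    ∀ t, ∀ u ∈ singularSpace lam k,
      pairOperators (polyE lam) polyF (polyH lam) t u ∈ singularSpace lam k
  | none, _, hu => sum_polyH_mem_singularSpace lam k hu
  | some (i, j), u, hu => by
    rw [pairOperators]
    split_ifs with hij
    · exact Submodule.zero_mem _
    · exact ⟨omega_mem_singularMultiples lam k i j hu.1, omega_mem lam hu.2 hij⟩

theorem polyFamily_mem_singularSpace (lam : Fin N → ℕ) (r : Fin N → Fin N → ℂ) (k : Fin N) :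
    ∀ j, ∀ u ∈ singularSpace lam k, polyFamily lam r j u ∈ singularSpace lam k
  | none, _, hu => sum_polyH_mem_singularSpace lam k hu
  | some i, _, hu => ⟨ham_mem_singularMultiples lam k i hu.1 r, ham_mem lam hu.2 r i⟩

/-- The combination of the families with coefficients `c` has good spectrum. -/
def IsGoodCombination (lam : Fin N → ℕ) (r : Fin N → Fin N → ℂ) (c : Option (Fin N) → ℂ) : Prop :=
  HasGoodSpectrum (highestSpace lam) (singularSpace lam) (∑ j, c j • stateFamily lam r j)
    (∑ j, c j • polyFamily lam r j)

theorem coeff_sum_polyH (lam : Fin N → ℕ) (p : MvPolynomial (Fin N) ℂ) (a : Fin N →₀ ℕ) :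
    coeff a ((∑ i, polyH lam i) p) = (∑ i, (lam i : ℂ) - 2 * (a.degree : ℂ)) * coeff a p := by
  induction p using MvPolynomial.induction_on' with
  | monomial b t =>
    rw [sum_polyH_of_isHomogeneous lam (isHomogeneous_monomial t rfl), coeff_smul, smul_eq_mul,
      coeff_monomial]
    split_ifs with hab
    · rw [hab]
    · simp
  | add p q hp hq => rw [map_add, coeff_add, hp, hq, coeff_add, mul_add]

theorem isHomogeneous_of_weight {lam : Fin N → ℕ} {p : MvPolynomial (Fin N) ℂ} (hp : p ≠ 0) {κ : ℂ}
    (h : (∑ i, polyH lam i) p = κ • p) :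
    ∃ m : ℕ, p.IsHomogeneous m ∧ κ = ∑ i, (lam i : ℂ) - 2 * (m : ℂ) := by
  have hd : ∀ a, coeff a p ≠ 0 → κ = ∑ i, (lam i : ℂ) - 2 * (a.degree : ℂ) := fun a ha => by
    have := congrArg (coeff a) h
    rw [coeff_sum_polyH, coeff_smul, smul_eq_mul] at this
    exact (mul_right_cancel₀ ha this).symm
  obtain ⟨a, ha⟩ := exists_coeff_ne_zero hp
  refine ⟨a.degree, fun {b} hb => ?_, hd a ha⟩
  have h1 : (b.degree : ℂ) = a.degree := by
    linear_combination (1 / 2 : ℂ) * (hd b hb - hd a ha)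
  have h2 : b.degree = a.degree := by exact_mod_cast h1
  rw [← h2, Finsupp.degree_eq_weight_one]
  rfl

theorem exists_nat_of_highestSpace {lam : Fin N → ℕ} {κ : ℂ} {v : States lam} (hv0 : v ≠ 0)
    (hv : v ∈ highestSpace lam) (h : (∑ i, site lam repH i) v = κ • v) : ∃ k : ℕ, κ = k :=
  exists_nat_of_highest_weight (states_sites lam).total_he (states_sites lam).total_hf
    (states_sites lam).total_ef hv0 h hv

/-- It suffices to test polynomials of degree at most Λ: a polynomial eigenvector sharing the
eigenvalues of a highest weight vector has dominant weight k, so it is homogeneous of degree m with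
k + 2m = Λ. -/
theorem IsGoodCombination.isGeneric {lam : Fin N → ℕ} {r : Fin N → Fin N → ℂ}
    {c : Option (Fin N) → ℂ} (h : IsGoodCombination lam r c) : IsGeneric lam r := by
  obtain ⟨h1, h2⟩ := h.of_combination
  refine ⟨h1, fun i ξ v u hv hu hve hue => h2 i ξ v u hv ⟨hu, ?_⟩ hve hue⟩
  obtain ⟨k, hk⟩ := exists_nat_of_highestSpace hve.1 hv (hve.2 none)
  obtain ⟨m, hm, hκ⟩ := isHomogeneous_of_weight hue.1 (hue.2 none)
  refine (mem_restrictTotalDegree _ _ _).2 (hm.totalDegree_le.trans ?_)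
  have : ((k + 2 * m : ℕ) : ℂ) = ((∑ i, lam i : ℕ) : ℂ) := by
    push_cast
    linear_combination hκ - hk
  have : k + 2 * m = ∑ i, lam i := by exact_mod_cast this
  omega

theorem IsGeneric.exists_isGoodCombination {lam : Fin N → ℕ} {r : Fin N → Fin N → ℂ}
    (hr : IsRMatrix r) (h : IsGeneric lam r) : ∃ c, IsGoodCombination lam r c :=
  exists_combination_hasGoodSpectrum ((states_sites lam).totalFamily_commute hr)
    (stateFamily_mem_highestSpace lam r) ((poly_sites lam).totalFamily_commute hr)
    (polyFamily_mem_singularSpace lam r) h.simple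
    fun k ξ v u hv hu => h.disjoint k ξ v u hv hu.1

theorem exists_discriminant_isGoodCombination (lam : Fin N → ℕ) :
    ∃ Θ : MvPolynomial (Option (Fin N × Fin N)) ℂ, ∀ r c,
      eval (pairCoefficients c r) Θ ≠ 0 ↔ IsGoodCombination lam r c := by
  obtain ⟨Θ, hΘ⟩ := exists_discriminant_hasGoodSpectrum (F := singularSpace lam)
    (pairOperators_mem_highestSpace lam) (pairOperators_mem_singularSpace lam)
  refine ⟨Θ, fun r c => ?_⟩
  rw [hΘ, IsGoodCombination, sum_smul_totalFamily, sum_smul_totalFamily]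

theorem tendsto_inv_cons_sub (z : Fin N → ℂ) (i j : Fin (N + 1)) :
    Filter.Tendsto (fun s : ℂ => ((Fin.cons s z : Fin (N + 1) → ℂ) i -
      (Fin.cons s z : Fin (N + 1) → ℂ) j)⁻¹) (Bornology.cobounded ℂ)
      (𝓝 (limitMatrix (fun i j => (z i - z j)⁻¹) i j)) := by
  refine Fin.cases ?_ (fun i => ?_) i <;> refine Fin.cases ?_ (fun j => ?_) j
  · simp [limitMatrix]
  · simp only [Fin.cons_zero, Fin.cons_succ]
    exact Filter.tendsto_inv₀_cobounded.comp (tendsto_sub_const_cobounded (z j))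
  · simp only [Fin.cons_zero, Fin.cons_succ]
    exact Filter.tendsto_inv₀_cobounded.comp (tendsto_const_sub_cobounded (z i))
  · simp [limitMatrix]

/-- Induction on N, placing the new point s far away. As s tends to infinity the coefficients 1 /
(z_i − z_j) converge to the decoupled limit, which is generic by induction, and the discriminant,
being continuous, stays nonzero for large s. -/
theorem exists_isGeneric : ∀ (N : ℕ) (lam : Fin N → ℕ),
    ∃ z : Fin N → ℂ, Function.Injective z ∧ IsGeneric lam fun i j => (z i - z j)⁻¹
  | 0, lam => by
    refine ⟨fun i => i.elim0, fun i => i.elim0, fun ξ v u _ _ hv _ => ?_, fun i => i.elim0⟩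
    have h1 : Module.finrank ℂ (States lam) = 1 := by
      rw [Module.finrank_eq_card_basis (statesBasis lam)]
      simp
    obtain ⟨t, ht⟩ := exists_smul_eq_of_finrank_eq_one h1 hv.1 u
    exact Submodule.mem_span_singleton.2 ⟨t, ht⟩
  | N + 1, lam => by
    obtain ⟨z, hz, hgen⟩ := exists_isGeneric N (Fin.tail lam)
    obtain ⟨c, hc⟩ := (isGeneric_limitMatrix hz hgen).exists_isGoodCombination
      (isRMatrix_limitMatrix (isRMatrix_inv_sub hz))
    obtain ⟨Θ, hΘ⟩ := exists_discriminant_isGoodCombination lam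
    have hlim : Filter.Tendsto (fun s : ℂ => eval (pairCoefficients c fun i j =>
        ((Fin.cons s z : Fin (N + 1) → ℂ) i - (Fin.cons s z : Fin (N + 1) → ℂ) j)⁻¹) Θ)
        (Bornology.cobounded ℂ)
        (𝓝 (eval (pairCoefficients c (limitMatrix fun i j => (z i - z j)⁻¹)) Θ)) := by
      refine ((MvPolynomial.continuous_eval Θ).tendsto _).comp (tendsto_pi_nhds.2 fun t => ?_)
      match t with
      | none => exact tendsto_const_nhds
      | some (i, j) => exact (tendsto_inv_cons_sub z i j).const_mul _
    have hev := hlim.eventually_ne ((hΘ _ _).2 hc)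
    have hne : ∀ᶠ s in Bornology.cobounded ℂ, s ∉ Set.range z :=
      (Set.finite_range z).isBounded
    obtain ⟨s, hs, hsz⟩ := (hev.and hne).exists
    exact ⟨Fin.cons s z, Fin.cons_injective_iff.2 ⟨hsz, hz⟩, ((hΘ _ _).1 hs).isGeneric⟩

/-- The good spectrum condition holds outside of a hypersurface. -/
theorem exists_polynomial_isGoodCombination (lam : Fin N → ℕ) :
    ∃ P : MvPolynomial (Fin N) ℂ, P ≠ 0 ∧ ∀ z : Fin N → ℂ, Function.Injective z → eval z P ≠ 0 →
      ∃ c, IsGoodCombination lam (fun i j => (z i - z j)⁻¹) c := by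
  classical
  obtain ⟨z₀, hz₀, hgen⟩ := exists_isGeneric N lam
  obtain ⟨c₀, hc₀⟩ := hgen.exists_isGoodCombination (isRMatrix_inv_sub hz₀)
  obtain ⟨Θ, hΘ⟩ := exists_discriminant_isGoodCombination lam
  let S : Finset (Fin N × Fin N) := Finset.univ.filter fun x => x.1 ≠ x.2
  -- Scaling the combination by Δ clears the denominators z_i − z_j, so that the discriminant
  -- becomes a polynomial in z. The normalisation of `c` below recovers the good combination c₀ at
  -- z₀.
  let Δ : (Fin N → ℂ) → ℂ := fun z => ∏ x ∈ S, (z x.1 - z x.2)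
  have hΔ : ∀ z : Fin N → ℂ, Function.Injective z → Δ z ≠ 0 := fun z hz =>
    Finset.prod_ne_zero_iff.2 fun x hx => sub_ne_zero.2 fun h => (Finset.mem_filter.1 hx).2 (hz h)
  let c : Option (Fin N) → ℂ := fun j => (Δ z₀)⁻¹ * c₀ j
  let q : Option (Fin N × Fin N) → MvPolynomial (Fin N) ℂ := fun t => t.elim
    (C (c none) * ∏ x ∈ S, (X x.1 - X x.2))
    fun x => if x.1 = x.2 then 0 else C (c (some x.1)) * ∏ y ∈ S.erase x, (X y.1 - X y.2)
  have hq : ∀ z : Fin N → ℂ, Function.Injective z → eval z (aeval q Θ) =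
      eval (pairCoefficients (fun j => Δ z * c j) fun i j => (z i - z j)⁻¹) Θ := by
    intro z hz
    rw [← MvPolynomial.coe_aeval_eq_eval, RingHom.coe_coe, ← MvPolynomial.bind₁,
      MvPolynomial.aeval_bind₁]
    rw [← MvPolynomial.coe_aeval_eq_eval, RingHom.coe_coe]
    congr 2
    funext t
    match t with
    | none =>
      simp [q, pairCoefficients, Δ, mul_comm]
    | some (i, j) =>
      by_cases hij : i = j
      · simp [q, pairCoefficients, hij]
      · have hmem : (i, j) ∈ S := by simp [S, hij]
        have hne : z i - z j ≠ 0 := sub_ne_zero.2 fun h => hij (hz h)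
        have h1 : Δ z = (z i - z j) * ∏ y ∈ S.erase (i, j), (z y.1 - z y.2) :=
          (Finset.mul_prod_erase S (fun y => z y.1 - z y.2) hmem).symm
        simp only [q, pairCoefficients, hij, Option.elim, if_false, h1, map_mul, map_prod, map_sub,
          aeval_X, aeval_C, Algebra.algebraMap_self, RingHom.id_apply]
        field_simp
  refine ⟨aeval q Θ, fun h0 => ?_, fun z hz hP => ⟨_, (hΘ _ _).1 (hq z hz ▸ hP)⟩⟩
  have h1 := hq z₀ hz₀
  rw [h0, map_zero] at h1
  refine (hΘ (fun i j => (z₀ i - z₀ j)⁻¹) c₀).2 hc₀ ?_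
  have h2 : (fun j => Δ z₀ * c j) = c₀ := funext fun j => mul_inv_cancel_left₀ (hΔ z₀ hz₀) _
  rw [h1, h2]

end GenericExistence
end

section

/-! ### Completeness of the Bethe ansatz at generic points -/

section Completeness

variable {N : ℕ}

/-- A polynomial solution of degree at most half of the critical one, nonzero at each `z_i`,
obtained from a singular polynomial eigenvector by restriction to lines. -/
theorem exists_solution_of_singular {lam : Fin N → ℕ} {z : Fin N → ℂ} (hz : Function.Injective z)
    {μ : Fin N → ℂ} (hμ : ∑ i, μ i = 0) {m : ℕ} (hm : 2 * m ≤ ∑ i, lam i)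
    {ψ : MvPolynomial (Fin N) ℂ} (hψ0 : ψ ≠ 0) (hψ : ψ.IsHomogeneous m)
    (hψe : ∀ i, polyHam lam (fun i j => (z i - z j)⁻¹) i ψ = μ i • ψ)
    (hX : ∀ i, ¬ MvPolynomial.X i ∣ ψ) :
    ∃ y : Polynomial ℂ, y ≠ 0 ∧ operD lam z μ y = 0 ∧ 2 * y.natDegree ≤ ∑ i, lam i ∧
      ∀ i, y.eval (z i) ≠ 0 := by
  rcases Nat.eq_zero_or_pos N with rfl | hN
  · refine ⟨1, one_ne_zero, ?_, by simp, fun i => i.elim0⟩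
    simp [operD_apply, operC]
  have hline : ∀ i, ∃ y : Polynomial ℂ, operD lam z μ y = 0 ∧ 2 * y.natDegree ≤ ∑ i, lam i ∧
      y.eval (z i) ≠ 0 := fun i => by
    obtain ⟨x, hxi, hx⟩ := exists_eval_ne_zero_of_not_X_dvd (hX i)
    obtain ⟨b, hb, hbx⟩ := exists_line_through z hz hxi
    refine ⟨lineHom z b ψ, lineHom_operD_eq_zero hz hb hψe, ?_, ?_⟩
    · have := (natDegree_lineHom_le z b ψ).trans hψ.totalDegree_le
      omega
    · rwa [eval_lineHom, hbx]
  obtain ⟨y, hyD, hyn, hy⟩ := hline ⟨0, hN⟩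
  have hy0 : y ≠ 0 := by rintro rfl; simp at hy
  refine ⟨y, hy0, hyD, hyn, fun i hi => ?_⟩
  obtain ⟨q, hqD, hqn, hq⟩ := hline i
  have hl0 : y.leadingCoeff ≠ 0 := Polynomial.leadingCoeff_ne_zero.2 hy0
  have hmon : (Polynomial.C y.leadingCoeff⁻¹ * y).Monic :=
    Polynomial.monic_C_mul_of_mul_leadingCoeff_eq_one (inv_mul_cancel₀ hl0)
  -- The solutions found for different points z_i are proportional, being of small degree, so y is
  -- nonzero at every z_i.
  have h1 := eq_C_mul_of_operD_eq_zero (sum_vacuumValue_sub lam z hμ) hmon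
    (by rw [← Polynomial.smul_eq_C_mul, map_smul, hyD, smul_zero])
    (by rwa [Polynomial.natDegree_C_mul (inv_ne_zero hl0)]) hqD hqn
  refine hq ?_
  rw [h1, Polynomial.eval_mul, Polynomial.eval_mul, hi, mul_zero, mul_zero]

theorem polyFamily_mem (lam : Fin N → ℕ) (r : Fin N → Fin N → ℂ) {d : ℕ}
    {p : MvPolynomial (Fin N) ℂ} (hp : p ∈ MvPolynomial.restrictTotalDegree (Fin N) ℂ d) :
    ∀ j, polyFamily lam r j p ∈ MvPolynomial.restrictTotalDegree (Fin N) ℂ d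
  | none => by
    change (∑ i, polyH lam i) p ∈ _
    rw [LinearMap.sum_apply]
    exact Submodule.sum_mem _ fun i _ => polyH_mem lam hp i
  | some i => ham_mem lam hp r i

/-- A highest weight eigenvector lifts to a homogeneous singular polynomial eigenvector. -/
theorem exists_singular_lift {lam : Fin N → ℕ} {z : Fin N → ℂ} (hz : Function.Injective z)
    {ξ : Option (Fin N) → ℂ} {v : States lam} (hv : v ∈ highestSpace lam)
    (hve : IsJointEigenvector (stateFamily lam fun i j => (z i - z j)⁻¹) ξ v) :
    ∃ ψ : MvPolynomial (Fin N) ℂ,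
      IsJointEigenvector (polyFamily lam fun i j => (z i - z j)⁻¹) ξ ψ ∧
      (∑ i, polyE lam i) ψ = 0 ∧ ∃ m : ℕ, ψ.IsHomogeneous m ∧ 2 * m ≤ ∑ i, lam i ∧
        ξ none = ∑ i, (lam i : ℂ) - 2 * (m : ℂ) := by
  obtain ⟨p, hp, rfl⟩ := exists_toStates_eq lam v
  -- With K = 0 the lift is a true eigenvector, though it need not map to v.
  obtain ⟨ψ, -, hψ0, hψe⟩ := exists_joint_eigenvector_mod (K := ⊥)
    (R := MvPolynomial.restrictTotalDegree (Fin N) ℂ (∑ i, lam i))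
    (X := polyFamily lam fun i j => (z i - z j)⁻¹) (Y := stateFamily lam fun i j => (z i - z j)⁻¹)
    (π := toStates lam) ((poly_sites lam).totalFamily_commute (isRMatrix_inv_sub hz))
    (fun j _ hu => polyFamily_mem lam _ hu j)
    (fun j u hu => by rw [Submodule.mem_bot] at hu ⊢; rw [hu, map_zero])
    (fun j u => toStates_polyFamily lam _ u j) (fun u hu => by
      rw [Submodule.mem_bot] at hu; rw [hu, map_zero]) hp hve
  have hψ : IsJointEigenvector (polyFamily lam fun i j => (z i - z j)⁻¹) ξ ψ :=
    ⟨fun h0 => hψ0 ((Submodule.mem_bot ℂ).2 h0),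
      fun j => sub_eq_zero.1 ((Submodule.mem_bot ℂ).1 (hψe j))⟩
  obtain ⟨k, hk⟩ := exists_nat_of_highestSpace hve.1 hv (hve.2 none)
  obtain ⟨m, hm, hκ⟩ := isHomogeneous_of_weight hψ.1 (hψ.2 none)
  -- The topmost raised vector has weight k + 2a and the Casimir value of the dominant weight k;
  -- hence a = 0, and ψ itself is singular.
  obtain ⟨a, ha, ha'⟩ := exists_pow_sum_polyE lam hψ.1
  have h1 := casimir_of_highest (poly_sites lam) hz
    (isJointEigenvector_raise (poly_sites lam) hψ ha) ha'
  have h2 := casimir_of_highest (states_sites lam) hz hve hv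
  have h3 : raise ξ a none = ((k + 2 * a : ℕ) : ℂ) := by
    rw [raise, hk]; push_cast; ring
  have h4 := h1.trans h2.symm
  rw [h3, hk] at h4
  have h5 := nat_eq_of_casimir_eq h4
  obtain rfl : a = 0 := by omega
  refine ⟨ψ, hψ, ha', m, hm, ?_, hκ⟩
  have : ((k + 2 * m : ℕ) : ℂ) = ((∑ i, lam i : ℕ) : ℂ) := by
    push_cast
    linear_combination hκ - hk
  have : k + 2 * m = ∑ i, lam i := by exact_mod_cast this
  omega

/-- Disjointness of the spectra keeps the singular lift ψ out of the multiples of x_i^(λ_i+1), hence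
not divisible by x_i. Its lines give a solution y, nonzero at the z_i, with roots w. The Bethe
vector of w has eigenvalues μ and, by the Casimir element, the weight of v, so simplicity makes v a
multiple of it. -/
theorem exists_betheVector_of_isGeneric {lam : Fin N → ℕ} {z : Fin N → ℂ}
    (hz : Function.Injective z) (hgen : IsGeneric lam fun i j => (z i - z j)⁻¹)
    {μ : Fin N → ℂ} {κ : ℂ} {v : States lam} (hve : IsGaudinEigenvector lam z μ v)
    (hvh : IsHighestWeightVector lam κ v) :
    ∃ (m : ℕ) (w : Fin m → ℂ), 2 * m ≤ ∑ i, lam i ∧ κ = ∑ i, (lam i : ℂ) - 2 * (m : ℂ) ∧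
      IsAdmissible z w ∧ BetheEquations lam z w ∧ MiuraForm lam z μ w ∧
      ∃ a : ℂ, a ≠ 0 ∧ v = a • betheVector lam z w := by
  have hμ := sum_eq_zero_of_eigenvector hve
  let ξ : Option (Fin N) → ℂ := fun j => j.elim κ μ
  have hv : v ∈ highestSpace lam := hvh.2.1
  have hvξ : IsJointEigenvector (stateFamily lam fun i j => (z i - z j)⁻¹) ξ v :=
    ⟨hve.1, fun j => match j with
      | none => hvh.2.2
      | some i => hve.2 i⟩
  obtain ⟨ψ, hψ, hEψ, m, hm, hmΛ, hκ⟩ := exists_singular_lift hz hv hvξ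
  obtain ⟨y, hy0, hyD, hyn, hyz⟩ := exists_solution_of_singular hz hμ hmΛ hψ.1 hm
    (fun i => hψ.2 (some i)) fun i => not_X_dvd_of_singular
      (fun hmem => hgen.disjoint i ξ v ψ hv hmem hvξ hψ) (by rw [hEψ]; exact Submodule.zero_mem _)
  obtain ⟨w, hw, hwD, -⟩ := exists_admissible_of_solution hyD hyz hy0
  have hM := (miuraForm_iff_operD lam hz μ w).2 hwD
  have hB := ((miuraForm_iff lam hz μ hw).1 hM).1
  obtain ⟨hΨe, hΨE, hΨH⟩ := betheVector_eigen hz hw hB hM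
  have hΨ0 := betheVector_ne_zero hz hyn hw hB
  set Ψ := betheVector lam z w with hΨ
  set κ' : ℂ := ∑ i, (lam i : ℂ) - 2 * (y.natDegree : ℂ) with hκ'
  have hΨξ : IsJointEigenvector (stateFamily lam fun i j => (z i - z j)⁻¹)
      (fun j => j.elim κ' μ) Ψ := ⟨hΨ0, fun j => match j with
      | none => hΨH
      | some i => hΨe i⟩
  obtain ⟨k, hk⟩ := exists_nat_of_highestSpace hve.1 hv hvh.2.2
  obtain ⟨k', hk'⟩ := exists_nat_of_highestSpace hΨ0 hΨE hΨH
  have hc := (casimir_of_highest (states_sites lam) hz hvξ hv).trans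
    (casimir_of_highest (states_sites lam) hz hΨξ hΨE).symm
  change κ * (κ + 2) / 4 = κ' * (κ' + 2) / 4 at hc
  rw [hk, hk'] at hc
  have hkk : κ' = κ := by rw [hk, hk', nat_eq_of_casimir_eq hc]
  refine ⟨y.natDegree, w, hyn, hkk.symm, hw, hB, hM, ?_⟩
  rw [hkk] at hΨξ
  have hmem := hgen.simple ξ Ψ v hΨE hv hΨξ fun j => by
    rw [hvξ.2 j, sub_self]; exact Submodule.zero_mem _
  obtain ⟨a, ha⟩ := Submodule.mem_span_singleton.1 hmem
  exact ⟨a, fun h0 => hve.1 (by rw [← ha, h0, zero_smul]), ha.symm⟩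

/-- Simple spectrum makes the space of highest weight vectors a span of joint eigenvectors, and each
of these is a multiple of a Bethe vector. -/
theorem span_betheVector {lam : Fin N → ℕ} {z : Fin N → ℂ} (hz : Function.Injective z)
    {c : Option (Fin N) → ℂ} (hc : IsGoodCombination lam (fun i j => (z i - z j)⁻¹) c) :
    Submodule.span ℂ {v : States lam | ∃ (m : ℕ) (w : Fin m → ℂ),
        2 * m ≤ ∑ i, lam i ∧ IsAdmissible z w ∧ BetheEquations lam z w ∧
        v = betheVector lam z w} = LinearMap.ker (diagonalAction lam repE) := by
  refine le_antisymm (Submodule.span_le.2 ?_) ?_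
  · rintro _ ⟨m, w, -, hw, hB, rfl⟩
    exact (betheVector_properties hz hw hB).2.1
  · refine (le_span_of_simpleSpectrumOn
      ((states_sites lam).totalFamily_commute (isRMatrix_inv_sub hz))
      (stateFamily_mem_highestSpace lam _) hc.1).trans (Submodule.span_le.2 ?_)
    rintro v ⟨hv, ξ, hξ⟩
    obtain ⟨m, w, hm, -, hw, hB, -, a, -, rfl⟩ := exists_betheVector_of_isGeneric hz hc.isGeneric
      (μ := fun i => ξ (some i)) (κ := ξ none) ⟨hξ.1, fun i => hξ.2 (some i)⟩
      ⟨hξ.1, hv, hξ.2 none⟩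
    exact Submodule.smul_mem _ _ (Submodule.subset_span ⟨m, w, hm, hw, hB, rfl⟩)

end Completeness
end

end Gaudin

end

theorem mainTheorem3 (N : ℕ) (lam : Fin N → ℕ) :
    (∀ z : Fin N → ℂ, Function.Injective z →
      -- trivial monodromy, Bethe ansatz equations with the Miura form, and the solution `φ`
      (∀ μ : Fin N → ℂ, ∑ i, μ i = 0 →
        List.TFAE [
          Gaudin.TrivialPGL2Monodromy z (Gaudin.potential lam z μ),
          Gaudin.PlusMinusOneMonodromy z (Gaudin.potential lam z μ),
          ∃ (m : ℕ) (w : Fin m → ℂ), Gaudin.IsAdmissible z w ∧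
            Gaudin.BetheEquations lam z w ∧ Gaudin.MiuraForm lam z μ w,
          ∃ (m : ℕ) (w : Fin m → ℂ), (∀ j i, w j ≠ z i) ∧
            Gaudin.BetheFunctionSolves lam z μ w]) ∧
      -- for given `w`: the Bethe ansatz equations say that the Miura transformation erases the
      -- poles at the `w_j`, and the Miura form says that `φ` is a solution
      (∀ (m : ℕ) (w : Fin m → ℂ), Gaudin.IsAdmissible z w →
        (Gaudin.BetheEquations lam z w ↔
          ∃ μ : Fin N → ℂ, ∑ i, μ i = 0 ∧ Gaudin.MiuraForm lam z μ w) ∧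
        (∀ μ : Fin N → ℂ, Gaudin.MiuraForm lam z μ w ↔ Gaudin.BetheFunctionSolves lam z μ w) ∧
        -- Bethe vectors satisfy the eigenvector and the highest weight equations
        (∀ μ : Fin N → ℂ, Gaudin.BetheEquations lam z w → Gaudin.MiuraForm lam z μ w →
          (∀ i, Gaudin.hamiltonian lam z i (Gaudin.betheVector lam z w) =
            μ i • Gaudin.betheVector lam z w) ∧
          Gaudin.diagonalAction lam Gaudin.repE (Gaudin.betheVector lam z w) = 0 ∧
          Gaudin.diagonalAction lam Gaudin.repH (Gaudin.betheVector lam z w) =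
            (∑ i, (lam i : ℂ) - 2 * (m : ℂ)) • Gaudin.betheVector lam z w)) ∧
      -- eigenvalues of the Gaudin Hamiltonians have trivial monodromy
      (∀ (μ : Fin N → ℂ) (v : Gaudin.States lam), Gaudin.IsGaudinEigenvector lam z μ v →
        ∑ i, μ i = 0 ∧ Gaudin.TrivialPGL2Monodromy z (Gaudin.potential lam z μ))) ∧
    -- completeness for generic `z`
    (∃ P : MvPolynomial (Fin N) ℂ, P ≠ 0 ∧
      ∀ z : Fin N → ℂ, Function.Injective z → MvPolynomial.eval z P ≠ 0 →
        -- every highest weight eigenvector is a Bethe vector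
        (∀ (μ : Fin N → ℂ) (κ : ℂ) (v : Gaudin.States lam),
          Gaudin.IsGaudinEigenvector lam z μ v → Gaudin.IsHighestWeightVector lam κ v →
          ∃ (m : ℕ) (w : Fin m → ℂ), 2 * m ≤ ∑ i, lam i ∧
            κ = ∑ i, (lam i : ℂ) - 2 * (m : ℂ) ∧
            Gaudin.IsAdmissible z w ∧ Gaudin.BetheEquations lam z w ∧
            Gaudin.MiuraForm lam z μ w ∧
            ∃ a : ℂ, a ≠ 0 ∧ v = a • Gaudin.betheVector lam z w) ∧
        -- Bethe vectors of different solutions are linearly independent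
        (∀ (ι : Type) (m : ι → ℕ) (w : (k : ι) → Fin (m k) → ℂ),
          (∀ k, 2 * m k ≤ ∑ i, lam i ∧ Gaudin.IsAdmissible z (w k) ∧
            Gaudin.BetheEquations lam z (w k)) →
          Function.Injective (fun k => Set.range (w k)) →
          LinearIndependent ℂ (fun k => Gaudin.betheVector lam z (w k))) ∧
        -- and they span the space of all highest weight vectors
        Submodule.span ℂ {v : Gaudin.States lam | ∃ (m : ℕ) (w : Fin m → ℂ),
            2 * m ≤ ∑ i, lam i ∧ Gaudin.IsAdmissible z w ∧ Gaudin.BetheEquations lam z w ∧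
            v = Gaudin.betheVector lam z w} =
          LinearMap.ker (Gaudin.diagonalAction lam Gaudin.repE)) := by
  refine ⟨fun z hz => ⟨fun μ hμ => Gaudin.monodromy_tfae lam hz hμ, fun m w hw =>
    ⟨Gaudin.betheEquations_iff lam hz hw,
      fun μ => Gaudin.miuraForm_iff_betheFunctionSolves lam hz μ w,
      fun μ hB hM => Gaudin.betheVector_eigen hz hw hB hM⟩, fun μ v hv =>
    ⟨Gaudin.sum_eq_zero_of_eigenvector hv, Gaudin.trivialPGL2Monodromy_of_eigenvector hz hv⟩⟩, ?_⟩
  obtain ⟨P, hP, h⟩ := Gaudin.exists_polynomial_isGoodCombination lam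
  refine ⟨P, hP, fun z hz hPz => ?_⟩
  obtain ⟨c, hc⟩ := h z hz hPz
  exact ⟨fun μ κ v hv hvh => Gaudin.exists_betheVector_of_isGeneric hz hc.isGeneric hv hvh,
    fun ι m w hw hinj => Gaudin.linearIndependent_betheVector hz hw hinj,
    Gaudin.span_betheVector hz hc⟩
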